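/- Let $0\le d-j\le k\le d$ with $d\ge 1$, and let $Q$ be the star query of dimension $d$ with $j$ output attributes $$Q(x_{d-j+1},\dots,x_d)\leftarrow R_1(x_1,\dots,x_d),\,R_2(x_1),\dots,R_{k+1}(x_k).$$ For a database $D$ let $|D|$ be the total number of tuples in its relations. For a value $v$ let $\deg_i(v)$ be the number of tuples of $R_1$ whose $x_i$-component is $v$, let $$h_i(D)=\max\bigl\{m\in\mathbb N:\ |\{v\in\pi_{x_i}R_1:\deg_i(v)\ge m^{d-1}\}|\ge m\bigr\},$$ and let $h(D)=\max_{1\le i\le d}h_i(D)$ be the generalized H-index. Put $\bar h(D)=\max\{1,h(D)\}$. Then there is a dynamic algorithm on the word RAM (unit-cost arithmetic, bitwise logic and direct memory access on $w$-bit words, memory initially zero), and there are constants $c,C$, all depending only on $Q$, such that the following holds for all $N\ge2$, all word lengths $w\ge c\lceil\log_2N\rceil$, and every sequence of at most $N$ requests that starts from the empty database, where each request is either a single-tuple insertion into or deletion from one of the relations (set semantics, values in $\{0,\dots,N-1\}$) or an enumeration of the current result. Let $D_t$ be the database after the first $t$ requests. 1. (Amortized update time $O(\bar h(D)^{d-1})$.)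 For every $n$, the total time spent on the updates among the first $n$ requests is at most $C\sum_t\bar h(D_t)^{d-1}$, where $t$ ranges over the numbers of these updates. 2. (Enumeration with delay $O(\bar h(D)^{d-j})$.) If request $t$ is an enumeration, the algorithm outputs every tuple of $Q(D_t)$ exactly once and nothing else, and no stretch of consecutive time steps without an output (before the first output, between two consecutive outputs, or after the last one) is longer than $C\,\bar h(D_t)^{d-j}$. 3. (Linear space.) At every moment while request $t$ is being processed, at most $C(|D_t|+1)$ memory cells are in use, that is, have nonzero content. -/

import Mathlib

/-! ### Star queries, databases and updates -/

/-- A star query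
`Q(x_{d-j+1}, …, x_d) ← R_1(x_1, …, x_d), R_2(x_1), …, R_{k+1}(x_k)` with `0 ≤ d - j ≤ k ≤ d`:
`d` is its dimension (the number of attributes of the center relation `R_1`), `j` the number of
output attributes and `k` the number of satellite relations. -/
structure StarQuery where
  d : ℕ
  j : ℕ
  k : ℕ
  j_le : j ≤ d
  sub_le : d - j ≤ k
  k_le : k ≤ d

namespace StarQuery

/-- A database: the center relation `R_1` and the satellites (`satellite i` is the unary relation
on the attribute with 0-based number `i`, that is `R_{i+2}(x_{i+1})`). The domain is `ℕ`. -/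
@[ext]
structure Database (Q : StarQuery) where
  center : Finset (Fin Q.d → ℕ)
  satellite : Fin Q.k → Finset ℕ

/-- A single-tuple update of the center or of a satellite; the flag is `true` for an insertion and
`false` for a deletion. -/
inductive Update (Q : StarQuery) where
  | center (ins : Bool) (t : Fin Q.d → ℕ)
  | satellite (ins : Bool) (i : Fin Q.k) (v : ℕ)

/-- What the user may ask for: a single-tuple update, or an enumeration of the current result. -/
inductive Request (Q : StarQuery) where
  | update (u : Q.Update)
  | enumerate

namespace Database

variable {Q : StarQuery}

/-- The empty database. -/
def empty (Q : StarQuery) : Q.Database := ⟨∅, fun _ => ∅⟩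

/-- The size `|D|`: the number of tuples in all relations. -/
def size (D : Q.Database) : ℕ := D.center.card + ∑ i, (D.satellite i).card

/-- Effect of an update, under set semantics. -/
def apply (D : Q.Database) : Q.Update → Q.Database
  | .center true t => { D with center := insert t D.center }
  | .center false t => { D with center := D.center.erase t }
  | .satellite true i v =>
      { D with satellite := Function.update D.satellite i (insert v (D.satellite i)) }
  | .satellite false i v =>
      { D with satellite := Function.update D.satellite i ((D.satellite i).erase v) }

/-- Effect of a request: an enumeration leaves the database as it is. -/
def serve (D : Q.Database) : Q.Request → Q.Database
  | .update u => D.apply u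
  | .enumerate => D

/-- The query result `Q(D)`: the projections to the last `j` attributes of the tuples of the center
whose first `k` components belong to the respective satellites. -/
def result (D : Q.Database) : Set (Fin Q.j → ℕ) :=
  {o | ∃ t ∈ D.center, (∀ i : Fin Q.k, t (i.castLE Q.k_le) ∈ D.satellite i) ∧
    ∀ a : Fin Q.j, o a = t ⟨Q.d - Q.j + a, by have := Q.j_le; have := a.isLt; omega⟩}

/-- The degree of a value `v` of the attribute `i`: the number of tuples of the center that
carry it. -/
def degree (D : Q.Database) (i : Fin Q.d) (v : ℕ) : ℕ :=
  (D.center.filter fun t => t i = v).card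

/-- The number of values in the projection of the center to the attribute `i` whose degree is at
least `m ^ (d - 1)`. -/
def numDense (D : Q.Database) (i : Fin Q.d) (m : ℕ) : ℕ :=
  ((D.center.image fun t => t i).filter fun v => m ^ (Q.d - 1) ≤ D.degree i v).card

/-- The H-index `h_i(D)` of an attribute: the largest `m` such that at least `m` values have degree
at least `m ^ (d - 1)`. The supremum is a maximum, by `bddAbove_hIndexAt`
(and `m = 0` always qualifies). -/
noncomputable def hIndexAt (D : Q.Database) (i : Fin Q.d) : ℕ :=
  sSup {m : ℕ | m ≤ D.numDense i m}

theorem bddAbove_hIndexAt (D : Q.Database) (i : Fin Q.d) :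
    BddAbove {m : ℕ | m ≤ D.numDense i m} :=
  ⟨D.center.card, fun _ hm => hm.trans ((Finset.card_filter_le _ _).trans Finset.card_image_le)⟩

/-- The generalized H-index `h(D) = max_i h_i(D)`. -/
noncomputable def hIndex (D : Q.Database) : ℕ := Finset.univ.sup fun i => D.hIndexAt i

end Database

/-- The database after the first `n` requests of a list, starting from the empty database. -/
def dbAfter {Q : StarQuery} (reqs : List Q.Request) (n : ℕ) : Q.Database :=
  (reqs.take n).foldl Database.serve (Database.empty Q)

/-- The domain values that occur in a request. -/
def Request.values {Q : StarQuery} : Q.Request → List ℕ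
  | .update (.center _ t) => List.ofFn t
  | .update (.satellite _ _ v) => [v]
  | .enumerate => []

/-- How a request is handed to the machine: for an update, the registers `0, 1, 2, …` receive a flag
(`1` for insert, `0` for delete), the relation (`0` for the center, `i + 1` for satellite `i`) and
the components of the tuple. -/
def Request.encode {Q : StarQuery} : Q.Request → List ℕ
  | .update (.center ins t) => ins.toNat :: 0 :: List.ofFn t
  | .update (.satellite ins i v) => [ins.toNat, (i : ℕ) + 1, v]
  | .enumerate => []

end StarQuery

/-! ### A word RAM -/

namespace WordRAM

/-- Operands of instructions: a register, a constant of the program, or the word length `w`. -/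
inductive Operand where
  | reg (r : ℕ)
  | const (n : ℕ)
  | wordLength

/-- Unit-cost operations on words. -/
inductive BinOp where
  | add | sub | mul | div | mod | and | or | xor | shiftLeft | shiftRight | eq | lt

/-- Result of an operation on `w`-bit words, modulo `2 ^ w` (`a / 0 = 0`, `a mod 0 = a`,
comparisons give `1` or `0`). -/
def BinOp.eval (w : ℕ) (op : BinOp) (a b : ℕ) : ℕ :=
  (match op with
    | .add => a + b
    | .sub => 2 ^ w + a - b
    | .mul => a * b
    | .div => a / b
    | .mod => a % b
    | .and => a &&& b
    | .or => a ||| b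
    | .xor => a ^^^ b
    | .shiftLeft => a * 2 ^ b
    | .shiftRight => a / 2 ^ b
    | .eq => if a = b then 1 else 0
    | .lt => if a < b then 1 else 0) % 2 ^ w

/-- Programs. A program names finitely many registers; the memory is reached only through
`load` and `store`, at an address that is computed in a register. -/
inductive Prog where
  | nop
  | compute (dst : ℕ) (op : BinOp) (a b : Operand)
  | load (dst : ℕ) (addr : Operand)
  | store (addr val : Operand)
  | emit (out : List Operand)
  | seq (p q : Prog)
  | ite (test : Operand) (p q : Prog)
  | loop (test : Operand) (body : Prog)

/-- A machine state: the registers, and the memory cells, all but finitely many of which are `0`. -/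
structure State where
  reg : ℕ → ℕ
  mem : ℕ →₀ ℕ

/-- All registers and memory cells are zero. -/
def State.zero : State := ⟨fun _ => 0, 0⟩

/-- The number of memory cells in use, that is, with nonzero content. -/
def State.space (s : State) : ℕ := s.mem.support.card

def State.setReg (s : State) (r v : ℕ) : State := { s with reg := Function.update s.reg r v }

noncomputable def State.setMem (s : State) (addr v : ℕ) : State :=
  { s with mem := s.mem.update addr v }

/-- Write the words of `l` to the registers `0, 1, …`, and leave the other registers alone. -/
def State.input (w : ℕ) (s : State) (l : List ℕ) : State :=
  { s with reg := fun r => if h : r < l.length then l[r] % 2 ^ w else s.reg r }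

/-- The word denoted by an operand. -/
def Operand.val (w : ℕ) (s : State) : Operand → ℕ
  | .reg r => s.reg r
  | .const n => n % 2 ^ w
  | .wordLength => w

/-- What is recorded about one unit of time: the tuple that was output in it, if any, and the
number of memory cells in use after it. -/
structure Event where
  out : Option (List ℕ)
  space : ℕ

def State.silent (s : State) : Event := ⟨none, s.space⟩

/-- `Exec w p s tr s'`: on words of `w` bits, the program `p` started in state `s` terminates in
state `s'`, and `tr` lists its unit-time steps. Every instruction and every test takes one step. -/
inductive Exec (w : ℕ) : Prog → State → List Event → State → Prop
  | nop (s : State) : Exec w .nop s [s.silent] s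
  | compute (s : State) (dst : ℕ) (op : BinOp) (a b : Operand) :
      Exec w (.compute dst op a b) s
        [(s.setReg dst (op.eval w (a.val w s) (b.val w s))).silent]
        (s.setReg dst (op.eval w (a.val w s) (b.val w s)))
  | load (s : State) (dst : ℕ) (addr : Operand) :
      Exec w (.load dst addr) s
        [(s.setReg dst (s.mem (addr.val w s))).silent]
        (s.setReg dst (s.mem (addr.val w s)))
  | store (s : State) (addr val : Operand) :
      Exec w (.store addr val) s
        [(s.setMem (addr.val w s) (val.val w s)).silent]
        (s.setMem (addr.val w s) (val.val w s))
  | emit (s : State) (out : List Operand) :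
      Exec w (.emit out) s [⟨some (out.map (Operand.val w s)), s.space⟩] s
  | seq {p q : Prog} {s₁ s₂ s₃ : State} {tr₁ tr₂ : List Event} :
      Exec w p s₁ tr₁ s₂ → Exec w q s₂ tr₂ s₃ → Exec w (.seq p q) s₁ (tr₁ ++ tr₂) s₃
  | ite_true {test : Operand} {p q : Prog} {s s' : State} {tr : List Event} :
      test.val w s ≠ 0 → Exec w p s tr s' → Exec w (.ite test p q) s (s.silent :: tr) s'
  | ite_false {test : Operand} {p q : Prog} {s s' : State} {tr : List Event} :
      test.val w s = 0 → Exec w q s tr s' → Exec w (.ite test p q) s (s.silent :: tr) s'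
  | loop_stop {test : Operand} {body : Prog} {s : State} :
      test.val w s = 0 → Exec w (.loop test body) s [s.silent] s
  | loop_step {test : Operand} {body : Prog} {s₁ s₂ s₃ : State} {tr₁ tr₂ : List Event} :
      test.val w s₁ ≠ 0 → Exec w body s₁ tr₁ s₂ → Exec w (.loop test body) s₂ tr₂ s₃ →
      Exec w (.loop test body) s₁ (s₁.silent :: (tr₁ ++ tr₂)) s₃

/-- The tuples that are output during a computation, in order. -/
def outputs (tr : List Event) : List (List ℕ) := tr.filterMap Event.out

/-- Enumeration delay at most `B`: no stretch of consecutive steps without output is longer than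
`B`, whether it lies before the first output, between two outputs, or after the last one. -/
def DelayAtMost (B : ℕ) (tr : List Event) : Prop :=
  ∀ l : List Event, l <:+: tr → (∀ e ∈ l, e.out = none) → l.length ≤ B

end WordRAM

/-! ### Dynamic algorithms -/

/-- A dynamic algorithm: a program that processes an update and a program that enumerates the
result. They share registers and memory, which persist from one request to the next. -/
structure DynamicAlgorithm where
  onUpdate : WordRAM.Prog
  onEnumerate : WordRAM.Prog

namespace DynamicAlgorithm

open WordRAM StarQuery

/-- The program that is run on a request. -/
def code {Q : StarQuery} (A : DynamicAlgorithm) : Q.Request → Prog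
  | .update _ => A.onUpdate
  | .enumerate => A.onEnumerate

/-- `A` serves the requests one after the other, with `w`-bit words, from zeroed memory: `σ i` is the
state before the request with 0-based number `i`, and `tr i` the steps taken for that request. -/
def IsRun {Q : StarQuery} (A : DynamicAlgorithm) (w : ℕ) (reqs : List Q.Request)
    (σ : ℕ → State) (tr : ℕ → List Event) : Prop :=
  σ 0 = State.zero ∧
    ∀ i r, reqs[i]? = some r → Exec w (A.code r) ((σ i).input w r.encode) (tr i) (σ (i + 1))

open Classical in
/-- The numbers of the updates among the first `n` requests. -/
noncomputable def updatesAmong {Q : StarQuery} (reqs : List Q.Request) (n : ℕ) : Finset ℕ :=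
  (Finset.range n).filter fun i => ∃ u, reqs[i]? = some (Request.update u)

end DynamicAlgorithm

/-! ### Structured programs: variables, expressions, assignments, conditionals and loops on the word
RAM. -/

namespace StarMaintenance

open WordRAM

/-! The algorithm separates heavy from light values with a threshold that follows the H-index. At
scale `s` let θ = `theta s` = 2^(s+3) and τ = `tau Q.d s` = θ^(d-1); a value of an attribute is
heavy if its degree is at least τ. The scale is kept `Balanced`: no attribute has more than 4θ heavy
values, and, unless s = 0, some attribute has at least θ/4 values that reach the next lower
threshold (θ/2)^(d-1). The second condition forces θ ≤ 8·max(1, h) (`Balanced.theta_le`), so every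
bound in θ is a bound in h.

Let e = d - j be the number of bound attributes. A tuple is abstracted to its pattern `Sem.P`, which
keeps the heavy values and blanks the light ones, and to its group `Sem.G`, which keeps the heavy
values of bound attributes and all values of output attributes. That a tuple joins with the
satellites splits into three conditions (`Sem.alive_iff`): its light values are alive, the heavy
output values of its pattern are alive, the heavy bound values of its pattern are alive. The first
is maintained per tuple, the second per pattern, and the third is not maintained at all but tested
during enumeration. The sets of `Sem.spec` store this: the tuples of a group, the groups of a
pattern, the patterns over a bound part, and so on.

A satellite update of a light value re-registers fewer than τ tuples (`run_updateSat_light`). For a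
heavy value it revisits the patterns with one prescribed digit, of which there are at most (1 +
4θ)^(d-1) (`Sem.card_patterns_le`, `run_updateSat_heavy`). A center update changes d degrees by one;
only tuples that share with the given tuple a value of degree about τ or less are taken out and put
back (`run_changeCenter`). All this is O(τ).

When balance is lost, the scale moves by one, and exactly the tuples with a component whose degree
lies between the two thresholds are re-registered (`run_rescale`). This costs O(θτ). An update
changes the number of values above a threshold by at most one, so a potential that measures the
distance of these numbers from the middle of the balanced range pays for the change
(`Balanced.amortized`, `sum_updates_le`).

For the enumeration, the result is a union of sets of output tuples, one for each of the at most (1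
+ 4θ)^e bound parts of patterns (`Sem.card_roots_le`). Each set is listed without repetition and
with constant delay by walking through its patterns and their groups (`Lists.nodup_walks`), and
membership is tested by looking up one group (`Lists.mem_parts_iff`). The sets are chained: a stage
that receives an element of its own set replaces it by the next element of its own list, and
otherwise lets the element pass (`InRound.take`, `InRound.skip`). A stage cannot run out of
replacements, because each element of its set arrives at most once (`InRound.eq_zero`). Every round
over all stages thus yields one new tuple until nothing is left, and the delay is O(number of
stages) = O(h^e).

On the machine, a set is an array with inverse positions and a size, addressed directly by a word
that packs the name of the set and an index or element. Each stored pair accounts for at most three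
nonzero cells (`Good.holds`), and the sets have O(|D|) pairs in total (`Sem.card_pairs_le`), which
gives linear space. -/

/-- A bound on the number of steps of loop-free programs. -/
def tm : Prog → ℕ
  | .nop => 1
  | .compute _ _ _ _ => 1
  | .load _ _ => 1
  | .store _ _ => 1
  | .emit _ => 1
  | .seq p q => tm p + tm q
  | .ite _ p q => 1 + tm p + tm q
  | .loop _ p => 1 + tm p

/-- Program variables: the input registers of a request for a query of dimension `d`, and local
variables. -/
inductive Var (d : ℕ) where
  | inp (i : Fin (d + 2))
  | loc (n : ℕ)
  deriving DecidableEq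

variable {d : ℕ}

/-- The register that holds a variable. -/
def Var.idx : Var d → ℕ
  | .inp i => i
  | .loc n => d + 2 + 2 * n

/-- Scratch registers, used for the evaluation of expressions. -/
def scr (d r : ℕ) : ℕ := d + 2 + 2 * r + 1

/-- Inputs occupy the first registers; after them local variables and scratch registers alternate,
so that there are unboundedly many of both without overlap. -/
theorem Var.idx_injective : Function.Injective (Var.idx (d := d)) := by
  rintro (i | n) (i' | n') h
  · simp only [Var.idx] at h
    rw [Fin.ext h]
  · have := i.isLt
    simp only [Var.idx] at h
    omega
  · have := i'.isLt
    simp only [Var.idx] at h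
    omega
  · simp only [Var.idx] at h
    congr 1
    omega

theorem Var.idx_ne_scr (v : Var d) (r : ℕ) : v.idx ≠ scr d r := by
  rcases v with i | n
  · have := i.isLt
    simp only [Var.idx, scr]
    omega
  · simp only [Var.idx, scr]
    omega

theorem scr_inj {r r' : ℕ} : scr d r = scr d r' ↔ r = r' := by
  simp only [scr]
  omega

/-- Side-effect-free expressions. -/
inductive Expr (d : ℕ) where
  | var (v : Var d)
  | const (n : ℕ)
  | wlen
  | bin (op : BinOp) (a b : Expr d)
  | load (a : Expr d)

namespace Expr

/-- The value of an expression. -/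
def eval (w : ℕ) (ρ : Var d → ℕ) (μ : ℕ → ℕ) : Expr d → ℕ
  | var v => ρ v % 2 ^ w
  | const n => n % 2 ^ w
  | wlen => w % 2 ^ w
  | bin op a b => op.eval w (a.eval w ρ μ) (b.eval w ρ μ)
  | load a => μ (a.eval w ρ μ) % 2 ^ w

/-- Every constructor reduces modulo `2 ^ w`, even the plain reads of a variable or a cell;
`compile` realizes the reduction by adding `0`. No bound on the contents is needed here. -/
theorem eval_lt (w : ℕ) (ρ : Var d → ℕ) (μ : ℕ → ℕ) (e : Expr d) : e.eval w ρ μ < 2 ^ w := by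
  have h : 0 < 2 ^ w := by positivity
  cases e <;> exact Nat.mod_lt _ h

/-- Evaluation of an expression into the scratch register `r`, with the help of later ones. -/
def compile : ℕ → Expr d → Prog
  | r, var v => .compute (scr d r) .add (.reg v.idx) (.const 0)
  | r, const n => .compute (scr d r) .add (.const n) (.const 0)
  | r, wlen => .compute (scr d r) .add .wordLength (.const 0)
  | r, bin op a b => .seq (a.compile r) (.seq (b.compile (r + 1))
      (.compute (scr d r) op (.reg (scr d r)) (.reg (scr d (r + 1)))))
  | r, load a => .seq (a.compile r) (.seq (.load (scr d r) (.reg (scr d r)))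
      (.compute (scr d r) .add (.reg (scr d r)) (.const 0)))

end Expr

/-- The registers of a machine state hold the given values of the variables. -/
def Rel (w : ℕ) (s : State) (ρ : Var d → ℕ) : Prop :=
  ∀ v : Var d, s.reg v.idx = ρ v ∧ ρ v < 2 ^ w

/-- No output, and at most `S` memory cells in use. -/
def Quiet (S : ℕ) (tr : List Event) : Prop := ∀ e ∈ tr, e.out = none ∧ e.space ≤ S

theorem Quiet.append {S : ℕ} {a b : List Event} (ha : Quiet S a) (hb : Quiet S b) :
    Quiet S (a ++ b) := by
  intro e he
  rcases List.mem_append.1 he with h | h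
  exacts [ha e h, hb e h]

theorem Quiet.cons {S : ℕ} {s : State} {b : List Event} (ha : s.space ≤ S) (hb : Quiet S b) :
    Quiet S (s.silent :: b) := by
  intro e he
  rcases List.mem_cons.1 he with rfl | h
  exacts [⟨rfl, ha⟩, hb e h]

theorem Quiet.single {S : ℕ} {s : State} (ha : s.space ≤ S) : Quiet S [s.silent] :=
  Quiet.cons ha (by simp [Quiet])

theorem Rel.setScr {w : ℕ} {s : State} {ρ : Var d → ℕ} (h : Rel w s ρ) (r x : ℕ) :
    Rel w (s.setReg (scr d r) x) ρ := by
  intro v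
  refine ⟨?_, (h v).2⟩
  simp only [State.setReg]
  rw [Function.update_of_ne (Var.idx_ne_scr v r)]
  exact (h v).1

/-- The clause about the registers below `r` carries the induction: the second operand is evaluated
into register `r + 1` and upwards, so the first one survives in register `r`. -/
theorem Expr.compile_exec (w S : ℕ) (e : Expr d) : ∀ (r : ℕ) (s : State) (ρ : Var d → ℕ),
    Rel w s ρ → s.space ≤ S →
    ∃ tr s', Exec w (e.compile r) s tr s' ∧ Rel w s' ρ ∧ s'.mem = s.mem ∧
      s'.reg (scr d r) = e.eval w ρ s.mem ∧ (∀ r' < r, s'.reg (scr d r') = s.reg (scr d r')) ∧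
      tr.length ≤ tm (e.compile r) ∧ Quiet S tr := by
  have basic : ∀ (r : ℕ) (s : State) (ρ : Var d → ℕ) (op : BinOp) (a b : Operand),
      Rel w s ρ → s.space ≤ S →
      ∃ tr s', Exec w (.compute (scr d r) op a b) s tr s' ∧ Rel w s' ρ ∧ s'.mem = s.mem ∧
        s'.reg (scr d r) = op.eval w (a.val w s) (b.val w s) ∧
        (∀ r' < r, s'.reg (scr d r') = s.reg (scr d r')) ∧
        tr.length ≤ 1 ∧ Quiet S tr := by
    intro r s ρ op a b h hS
    refine ⟨_, _, Exec.compute _ _ _ _ _, h.setScr _ _, rfl, ?_, ?_, le_rfl, Quiet.single hS⟩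
    · simp [State.setReg]
    · intro r' hr'
      simp only [State.setReg]
      rw [Function.update_of_ne]
      rw [Ne, scr_inj]
      omega
  induction e with
  | var v =>
    intro r s ρ h hS
    obtain ⟨tr, s', h1, h2, h3, h4, h5, h6, h7⟩ :=
      basic r s ρ .add (.reg v.idx) (.const 0) h hS
    refine ⟨tr, s', h1, h2, h3, ?_, h5, h6, h7⟩
    rw [h4]
    simp [BinOp.eval, Operand.val, Expr.eval, (h v).1]
  | const n =>
    intro r s ρ h hS
    obtain ⟨tr, s', h1, h2, h3, h4, h5, h6, h7⟩ :=
      basic r s ρ .add (.const n) (.const 0) h hS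
    refine ⟨tr, s', h1, h2, h3, ?_, h5, h6, h7⟩
    rw [h4]
    simp [BinOp.eval, Operand.val, Expr.eval]
  | wlen =>
    intro r s ρ h hS
    obtain ⟨tr, s', h1, h2, h3, h4, h5, h6, h7⟩ :=
      basic r s ρ .add .wordLength (.const 0) h hS
    refine ⟨tr, s', h1, h2, h3, ?_, h5, h6, h7⟩
    rw [h4]
    simp [BinOp.eval, Operand.val, Expr.eval]
  | bin op a b iha ihb =>
    intro r s ρ h hS
    obtain ⟨tr1, s1, h1, h2, h3, h4, h5, h6, h7⟩ := iha r s ρ h hS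
    obtain ⟨tr2, s2, k1, k2, k3, k4, k5, k6, k7⟩ :=
      ihb (r + 1) s1 ρ h2 (by rw [State.space, h3]; exact hS)
    obtain ⟨tr3, s3, l1, l2, l3, l4, l5, l6, l7⟩ :=
      basic r s2 ρ op (.reg (scr d r)) (.reg (scr d (r + 1))) k2
        (by rw [State.space, k3, h3]; exact hS)
    refine ⟨_, s3, Exec.seq h1 (Exec.seq k1 l1), l2, by rw [l3, k3, h3], ?_, ?_, ?_,
      h7.append (k7.append l7)⟩
    · rw [l4]
      simp only [Operand.val, Expr.eval]
      rw [k4, k5 r (by omega), h4, h3]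
    · intro r' hr'
      rw [l5 r' hr', k5 r' (by omega), h5 r' hr']
    · simp only [List.length_append, Expr.compile, tm]
      omega
  | load a iha =>
    intro r s ρ h hS
    obtain ⟨tr1, s1, h1, h2, h3, h4, h5, h6, h7⟩ := iha r s ρ h hS
    have hS1 : s1.space ≤ S := by rw [State.space, h3]; exact hS
    obtain ⟨tr3, s3, l1, l2, l3, l4, l5, l6, l7⟩ :=
      basic r (s1.setReg (scr d r) (s1.mem (s1.reg (scr d r)))) ρ .add (.reg (scr d r)) (.const 0)
        (h2.setScr _ _) hS1
    refine ⟨_, s3, Exec.seq h1 (Exec.seq (Exec.load _ _ _) l1), l2, by rw [l3]; exact h3, ?_, ?_,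
      ?_, h7.append (Quiet.append (Quiet.single hS1) l7)⟩
    · rw [l4]
      simp only [Operand.val, Expr.eval, BinOp.eval, State.setReg, Function.update_self]
      simp [h3, h4]
    · intro r' hr'
      rw [l5 r' hr', ← h5 r' hr']
      simp only [State.setReg]
      rw [Function.update_of_ne]
      rw [Ne, scr_inj]
      omega
    · simp only [List.length_append, Expr.compile, tm, List.length_singleton]
      omega

/-- From variables `ρ` and memory `m`, the program `p` terminates within `T` steps, without output
and with at most `S` memory cells in use, and its final variables and memory satisfy `Post`. -/
def Does (w S : ℕ) (p : Prog) (ρ : Var d → ℕ) (m : ℕ →₀ ℕ) (T : ℕ)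
    (Post : (Var d → ℕ) → (ℕ →₀ ℕ) → Prop) : Prop :=
  ∀ s : State, Rel w s ρ → s.mem = m → ∃ tr s' ρ', Exec w p s tr s' ∧ Rel w s' ρ' ∧
    Post ρ' s'.mem ∧ tr.length ≤ T ∧ Quiet S tr

section Does

variable {w S T T₁ T₂ : ℕ} {p q : Prog} {ρ : Var d → ℕ} {m : ℕ →₀ ℕ}
  {Post Mid : (Var d → ℕ) → (ℕ →₀ ℕ) → Prop}

theorem Does.mono (h : Does w S p ρ m T₁ Mid) (hT : T₁ ≤ T)
    (hP : ∀ ρ' m', Mid ρ' m' → Post ρ' m') : Does w S p ρ m T Post := by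
  intro s hs hm
  obtain ⟨tr, s', ρ', h1, h2, h3, h4, h5⟩ := h s hs hm
  exact ⟨tr, s', ρ', h1, h2, hP _ _ h3, h4.trans hT, h5⟩

theorem Does.seq (h : Does w S p ρ m T₁ Mid) (h' : ∀ ρ' m', Mid ρ' m' → Does w S q ρ' m' T₂ Post) :
    Does w S (.seq p q) ρ m (T₁ + T₂) Post := by
  intro s hs hm
  obtain ⟨tr, s', ρ', h1, h2, h3, h4, h5⟩ := h s hs hm
  obtain ⟨tr', s'', ρ'', k1, k2, k3, k4, k5⟩ := h' _ _ h3 s' h2 rfl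
  refine ⟨_, s'', ρ'', Exec.seq h1 k1, k2, k3, ?_, h5.append k5⟩
  rw [List.length_append]
  omega

theorem Does.nop (hS : m.support.card ≤ S) (hP : Post ρ m) : Does w S .nop ρ m 1 Post := by
  intro s hs hm
  subst hm
  exact ⟨_, s, ρ, Exec.nop s, hs, hP, le_rfl, Quiet.single hS⟩

/-- Assignment. -/
def asg (v : Var d) (e : Expr d) : Prog :=
  .seq (e.compile 0) (.compute v.idx .add (.reg (scr d 0)) (.const 0))

theorem Does.asg {v : Var d} {e : Expr d} (hS : m.support.card ≤ S)
    (hP : Post (Function.update ρ v (e.eval w ρ m)) m) :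
    Does w S (asg v e) ρ m (tm (asg v e)) Post := by
  intro s hs hm
  subst hm
  obtain ⟨tr, s', h1, h2, h3, h4, h5, h6, h7⟩ := e.compile_exec w S 0 s ρ hs hS
  have hlt := e.eval_lt w ρ s.mem
  have hval : BinOp.add.eval w ((Operand.reg (scr d 0)).val w s') ((Operand.const 0).val w s')
      = e.eval w ρ s.mem := by
    simp only [BinOp.eval, Operand.val, h4]
    simpa using Nat.mod_eq_of_lt hlt
  refine ⟨_, _, Function.update ρ v (e.eval w ρ s.mem), Exec.seq h1 (Exec.compute _ _ _ _ _),
    ?_, ?_, ?_, h7.append (Quiet.single ?_)⟩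
  · intro v'
    rw [hval]
    by_cases hv : v' = v
    · subst hv
      simp [State.setReg, hlt]
    · simp only [State.setReg]
      rw [Function.update_of_ne hv, Function.update_of_ne (fun hh => hv (Var.idx_injective hh))]
      exact h2 v'
  · simpa [State.setReg, h3] using hP
  · simpa [StarMaintenance.asg, tm] using h6
  · simpa [State.setReg, State.space, h3] using hS

/-- Write to memory. -/
def store (a e : Expr d) : Prog :=
  .seq (a.compile 0) (.seq (e.compile 1) (.store (.reg (scr d 0)) (.reg (scr d 1))))

theorem card_support_update_le (m : ℕ →₀ ℕ) (x y : ℕ) :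
    (m.update x y).support.card ≤ m.support.card + 1 := by
  classical
  refine (Finset.card_le_card ?_).trans (Finset.card_insert_le x m.support)
  intro z hz
  rw [Finsupp.mem_support_iff, Finsupp.coe_update] at hz
  rw [Finset.mem_insert, Finsupp.mem_support_iff]
  by_cases h : z = x
  · exact Or.inl h
  · rw [Function.update_of_ne h] at hz
    exact Or.inr hz

theorem Does.store {a e : Expr d} (hS : m.support.card + 1 ≤ S)
    (hP : Post ρ (m.update (a.eval w ρ m) (e.eval w ρ m))) :
    Does w S (store a e) ρ m (tm (store a e)) Post := by
  intro s hs hm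
  subst hm
  have hS' : s.space ≤ S := by rw [State.space]; omega
  obtain ⟨tr, s', h1, h2, h3, h4, h5, h6, h7⟩ := a.compile_exec w S 0 s ρ hs hS'
  obtain ⟨tr', s'', k1, k2, k3, k4, k5, k6, k7⟩ := e.compile_exec w S 1 s' ρ h2
    (by rw [State.space, h3]; exact hS')
  have hmem : (s''.setMem (a.eval w ρ s.mem) (e.eval w ρ s.mem)).mem =
      s.mem.update (a.eval w ρ s.mem) (e.eval w ρ s.mem) := by
    simp [State.setMem, k3, h3]
  have ha : (Operand.reg (scr d 0)).val w s'' = a.eval w ρ s.mem := by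
    simp only [Operand.val]
    rw [k5 0 (by omega), h4]
  have he : (Operand.reg (scr d 1)).val w s'' = e.eval w ρ s.mem := by
    simp only [Operand.val]
    rw [k4, h3]
  have hx := Exec.store (w := w) s'' (.reg (scr d 0)) (.reg (scr d 1))
  rw [ha, he] at hx
  refine ⟨_, _, ρ, Exec.seq h1 (Exec.seq k1 hx), ?_, ?_, ?_, h7.append (k7.append
    (Quiet.single ?_))⟩
  · intro v
    exact k2 v
  · rw [hmem]
    exact hP
  · simp only [StarMaintenance.store, tm, List.length_append, List.length_singleton]
    omega
  · rw [State.space, hmem]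
    exact (card_support_update_le _ _ _).trans hS

/-- Conditional. -/
def cond (e : Expr d) (p q : Prog) : Prog := .seq (e.compile 0) (.ite (.reg (scr d 0)) p q)

theorem Does.cond {e : Expr d} (hS : m.support.card ≤ S)
    (hp : e.eval w ρ m ≠ 0 → Does w S p ρ m T Post)
    (hq : e.eval w ρ m = 0 → Does w S q ρ m T Post) :
    Does w S (cond e p q) ρ m (tm (e.compile 0) + 1 + T) Post := by
  intro s hs hm
  subst hm
  obtain ⟨tr, s', h1, h2, h3, h4, h5, h6, h7⟩ := e.compile_exec w S 0 s ρ hs hS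
  by_cases h : e.eval w ρ s.mem = 0
  · obtain ⟨tr', s'', ρ'', k1, k2, k3, k4, k5⟩ := hq h s' h2 h3
    refine ⟨_, s'', ρ'', Exec.seq h1 (Exec.ite_false (by simp [Operand.val, h4, h]) k1), k2, k3, ?_,
      h7.append (Quiet.cons (by rw [State.space, h3]; exact hS) k5)⟩
    simp only [List.length_append, List.length_cons]
    omega
  · obtain ⟨tr', s'', ρ'', k1, k2, k3, k4, k5⟩ := hp h s' h2 h3
    refine ⟨_, s'', ρ'', Exec.seq h1 (Exec.ite_true (by simp [Operand.val, h4, h]) k1), k2, k3, ?_,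
      h7.append (Quiet.cons (by rw [State.space, h3]; exact hS) k5)⟩
    simp only [List.length_append, List.length_cons]
    omega

/-- While loop. -/
def while_ (e : Expr d) (p : Prog) : Prog :=
  .seq (e.compile 0) (.loop (.reg (scr d 0)) (.seq p (e.compile 0)))

/-- A loop whose test holds as long as `n < L` for a loop counter `n`. -/
theorem Does.while_ {e : Expr d} {L : ℕ} (I : ℕ → (Var d → ℕ) → (ℕ →₀ ℕ) → Prop)
    (hS : ∀ n ρ m, I n ρ m → m.support.card ≤ S)
    (hstep : ∀ n < L, ∀ ρ m, I n ρ m → e.eval w ρ m ≠ 0 ∧ Does w S p ρ m T (I (n + 1)))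
    (hend : ∀ ρ m, I L ρ m → e.eval w ρ m = 0) (h0 : I 0 ρ m) :
    Does w S (while_ e p) ρ m ((L + 1) * (tm (e.compile 0) + 1 + T)) (I L) := by
  -- Induction on the number `r` of remaining iterations. The loop only looks at a register, and the
  -- test is evaluated once before the loop and again at the end of each body; so the invariant has
  -- to tie this register to the current value of the test.
  have main : ∀ r n, n + r = L → ∀ (s : State) (ρ : Var d → ℕ), Rel w s ρ → I n ρ s.mem →
      s.reg (scr d 0) = e.eval w ρ s.mem →
      ∃ tr s' ρ', Exec w (.loop (.reg (scr d 0)) (.seq p (e.compile 0))) s tr s' ∧ Rel w s' ρ' ∧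
        I L ρ' s'.mem ∧ tr.length ≤ r * (tm (e.compile 0) + 1 + T) + 1 ∧ Quiet S tr := by
    intro r
    induction r with
    | zero =>
      intro n hn s ρ hs hI hr
      obtain rfl : n = L := by omega
      exact ⟨_, s, ρ, Exec.loop_stop (by simp [Operand.val, hr, hend _ _ hI]), hs, hI, by simp,
        Quiet.single (hS _ _ _ hI)⟩
    | succ r ih =>
      intro n hn s ρ hs hI hr
      obtain ⟨hne, hd⟩ := hstep n (by omega) ρ s.mem hI
      obtain ⟨tr, s', ρ', h1, h2, h3, h4, h5⟩ := hd s hs rfl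
      obtain ⟨tr', s'', k1, k2, k3, k4, k5, k6, k7⟩ := e.compile_exec w S 0 s' ρ' h2 (hS _ _ _ h3)
      obtain ⟨tr'', s''', ρ''', l1, l2, l3, l4, l5⟩ := ih (n + 1) (by omega) s'' ρ' k2
        (by rw [k3]; exact h3) (by rw [k4, k3])
      refine ⟨_, s''', ρ''', Exec.loop_step (by simp [Operand.val, hr, hne]) (Exec.seq h1 k1) l1,
        l2, l3, ?_, Quiet.cons (hS _ _ _ hI) ((h5.append k7).append l5)⟩
      simp only [List.length_append, List.length_cons]
      rw [add_mul]
      omega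
  intro s hs hm
  subst hm
  obtain ⟨tr', s'', k1, k2, k3, k4, k5, k6, k7⟩ := e.compile_exec w S 0 s ρ hs (hS _ _ _ h0)
  obtain ⟨tr'', s''', ρ''', l1, l2, l3, l4, l5⟩ := main L 0 (by omega) s'' ρ k2
    (by rw [k3]; exact h0) (by rw [k4, k3])
  refine ⟨_, s''', ρ''', Exec.seq k1 l1, l2, l3, ?_, k7.append l5⟩
  rw [List.length_append, add_mul]
  omega

end Does

end StarMaintenance

/-! ### Stored sets: deletion by swapping, the address scheme, and abstract states. -/

namespace StarMaintenance

open WordRAM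

/-- The names of the stored sets: a kind, an attribute and a word. -/
abbrev Key := ℕ × ℕ × ℕ

/-- The position, counted from `1`, of `x` in `L`, and `0` if there is none. -/
def pos (L : List ℕ) (x : ℕ) : ℕ := if x ∈ L then L.idxOf x + 1 else 0

/-- Removal of `x` by moving the last element to its place. -/
def swapErase (L : List ℕ) (x : ℕ) : List ℕ :=
  if x ∈ L then (L.set (L.idxOf x) (L.getD (L.length - 1) 0)).dropLast else L

theorem pos_eq_zero {L : List ℕ} {x : ℕ} : pos L x = 0 ↔ x ∉ L := by
  unfold pos
  split <;> simp_all

theorem pos_of_getElem {L : List ℕ} (hL : L.Nodup) {x j : ℕ} (h : L[j]? = some x) :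
    pos L x = j + 1 := by
  obtain ⟨hj, rfl⟩ := List.getElem?_eq_some_iff.1 h
  simp [pos, hL.idxOf_getElem j hj]

theorem getElem?_idxOf' {L : List ℕ} {x : ℕ} (h : x ∈ L) : L[L.idxOf x]? = some x := by
  have := List.idxOf_lt_length_of_mem h
  rw [List.getElem?_eq_getElem this, List.getElem_idxOf]

theorem length_swapErase {L : List ℕ} {x : ℕ} (h : x ∈ L) :
    (swapErase L x).length = L.length - 1 := by
  simp [swapErase, h]

theorem getElem?_swapErase {L : List ℕ} {x : ℕ} (h : x ∈ L) (j : ℕ) :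
    (swapErase L x)[j]? = if j < L.length - 1 then
      (if j = L.idxOf x then some (L.getD (L.length - 1) 0) else L[j]?) else none := by
  have h1 := List.idxOf_lt_length_of_mem h
  rw [swapErase, if_pos h, List.getElem?_dropLast, List.length_set, List.getElem?_set]
  split_ifs <;> first | rfl | omega

theorem getElem?_last {L : List ℕ} {x : ℕ} (h : x ∈ L) :
    L[L.length - 1]? = some (L.getD (L.length - 1) 0) := by
  have h1 := List.length_pos_of_mem h
  have : L.length - 1 < L.length := by omega
  rw [List.getElem?_eq_getElem this, List.getD_eq_getElem _ _ this]

theorem idx_unique {L : List ℕ} (hL : L.Nodup) {i j x : ℕ} (hi : L[i]? = some x)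
    (hj : L[j]? = some x) : i = j := by
  have h1 := pos_of_getElem hL hi
  have h2 := pos_of_getElem hL hj
  omega

theorem mem_swapErase {L : List ℕ} (hL : L.Nodup) {x y : ℕ} :
    y ∈ swapErase L x ↔ y ∈ L ∧ y ≠ x := by
  by_cases h : x ∈ L
  · have hx := getElem?_idxOf' h
    have hl := getElem?_last h
    have h1 := List.idxOf_lt_length_of_mem h
    constructor
    · intro hy
      obtain ⟨j, hj⟩ := List.mem_iff_getElem?.1 hy
      rw [getElem?_swapErase h] at hj
      split_ifs at hj with h2 h3
      · simp only [Option.some.injEq] at hj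
        rw [hj] at hl
        refine ⟨List.mem_of_getElem? hl, ?_⟩
        rintro rfl
        have := idx_unique hL hl hx
        omega
      · refine ⟨List.mem_of_getElem? hj, ?_⟩
        rintro rfl
        exact h3 (idx_unique hL hj hx)
    · rintro ⟨hy, hne⟩
      have hyj := getElem?_idxOf' hy
      have h2 := List.idxOf_lt_length_of_mem hy
      rw [List.mem_iff_getElem?]
      -- If `y` is the last element, it now sits at the former place of `x`; that place is not the
      -- last one, because `y ≠ x`.
      by_cases h3 : L.idxOf y = L.length - 1
      · refine ⟨L.idxOf x, ?_⟩
        rw [h3, hl] at hyj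
        have : L.idxOf x ≠ L.length - 1 := by
          intro h4
          rw [h4, hl] at hx
          exact hne (Option.some.inj (hyj.symm.trans hx))
        rw [getElem?_swapErase h, if_pos (by omega), if_pos rfl]
        exact hyj
      · refine ⟨L.idxOf y, ?_⟩
        rw [getElem?_swapErase h, if_pos (by omega), if_neg, hyj]
        intro h4
        rw [h4, hx] at hyj
        exact hne (Option.some.inj hyj).symm
  · simp only [swapErase, if_neg h]
    constructor
    · intro hy
      exact ⟨hy, fun hh => h (hh ▸ hy)⟩
    · exact fun hh => hh.1

theorem nodup_swapErase {L : List ℕ} (hL : L.Nodup) (x : ℕ) : (swapErase L x).Nodup := by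
  by_cases h : x ∈ L
  · have hl := getElem?_last h
    have h1 := List.idxOf_lt_length_of_mem h
    rw [List.nodup_iff_getElem?_ne_getElem?]
    intro i j hij hj heq
    rw [length_swapErase h] at hj
    rw [getElem?_swapErase h, getElem?_swapErase h, if_pos (show i < L.length - 1 by omega),
      if_pos hj] at heq
    by_cases h2 : i = L.idxOf x
    · by_cases h3 : j = L.idxOf x
      · omega
      · rw [if_pos h2, if_neg h3] at heq
        have := idx_unique hL hl heq.symm
        omega
    · have hi : i < L.length := by omega
      have e1 : L[i]? = some L[i] := List.getElem?_eq_getElem hi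
      by_cases h3 : j = L.idxOf x
      · rw [if_neg h2, if_pos h3] at heq
        have := idx_unique hL hl heq
        omega
      · rw [if_neg h2, if_neg h3] at heq
        have := idx_unique hL e1 (heq.symm.trans e1)
        omega
  · simpa [swapErase, h] using hL

/-- Only two positions change, that of `x` and that of the last element, so that constantly many
writes suffice for a deletion. The case `y = x` takes precedence because `x` may itself be the last
element. -/
theorem pos_swapErase {L : List ℕ} (hL : L.Nodup) {x : ℕ} (h : x ∈ L) (y : ℕ) :
    pos (swapErase L x) y =
      if y = x then 0 else if y = L.getD (L.length - 1) 0 then L.idxOf x + 1 else pos L y := by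
  have hx := getElem?_idxOf' h
  have hl := getElem?_last h
  have h1 := List.idxOf_lt_length_of_mem h
  have hn := nodup_swapErase hL x
  split_ifs with h2 h3
  · rw [pos_eq_zero, mem_swapErase hL]
    tauto
  · refine pos_of_getElem hn ?_
    rw [getElem?_swapErase h, if_pos, if_pos rfl, h3]
    by_contra hlt
    have : L.idxOf x = L.length - 1 := by omega
    rw [this, hl] at hx
    exact h2 (h3.trans (Option.some.inj hx))
  · by_cases hy : y ∈ L
    · have hyj := getElem?_idxOf' hy
      have h4 := List.idxOf_lt_length_of_mem hy
      rw [pos_of_getElem hL hyj]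
      refine pos_of_getElem hn ?_
      rw [getElem?_swapErase h, if_pos, if_neg, hyj]
      · intro h5
        rw [h5, hx] at hyj
        exact h2 (Option.some.inj hyj).symm
      · by_contra hlt
        have : L.idxOf y = L.length - 1 := by omega
        rw [this, hl] at hyj
        exact h3 (Option.some.inj hyj).symm
    · rw [pos_eq_zero.2 hy, pos_eq_zero, mem_swapErase hL]
      tauto

/-- Numerical parameters of a run: the word length `w`, the number `b` of bits per digit, and
the limit `S` for the number of memory cells. -/
structure Cfg (d : ℕ) where
  w : ℕ
  b : ℕ
  S : ℕ
  b_eq : b = w / (4 * d + 16)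
  le_b : 64 * (d + 4) ≤ b

namespace Cfg

variable {d : ℕ} (c : Cfg d)

/-- The base of the digits. -/
def B : ℕ := 2 ^ c.b

/-- A word holds `4 * d + 16` digits. An address needs the `d + 3` digits of a name, the `d + 1`
digits of an element and a little more, so address computations never overflow. -/
theorem pow_le : c.B ^ (4 * d + 16) ≤ 2 ^ c.w := by
  rw [B, ← pow_mul]
  refine Nat.pow_le_pow_right (by norm_num) ?_
  rw [c.b_eq]
  exact Nat.div_mul_le_self _ _

/-- Already the number `b` of bits per digit exceeds all constants that are linear in `d`, a
fortiori `2 ^ b` does. -/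
theorem small {n : ℕ} (h : n ≤ 64 * (d + 4)) : n < c.B :=
  (h.trans c.le_b).trans_lt Nat.lt_two_pow_self

theorem B_pos : 0 < c.B := by
  unfold B
  positivity

theorem one_lt_B : 1 < c.B := c.small (by omega)

theorem lt_word {n k : ℕ} (h : n ≤ c.B ^ k) (hk : k < 4 * d + 16) : n < 2 ^ c.w :=
  h.trans_lt ((Nat.pow_lt_pow_right c.one_lt_B hk).trans_le c.pow_le)

theorem small_lt_word {n : ℕ} (h : n ≤ 64 * (d + 4)) : n < 2 ^ c.w :=
  c.lt_word (k := 1) (by rw [pow_one]; exact (c.small h).le) (by omega)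

theorem w_lt : c.w < 2 ^ c.w := Nat.lt_two_pow_self

/-- The number that codes a name of a set. -/
def code (_ : Cfg d) (key : Key) : ℕ := (key.2.2 * (d + 1) + key.2.1) * 8 + key.1

/-- The name of a set from its code. -/
def keyOf (_ : Cfg d) (n : ℕ) : Key := (n % 8, n / 8 % (d + 1), n / 8 / (d + 1))

/-- Names of sets that can be addressed. -/
def Valid (key : Key) : Prop := key.1 < 8 ∧ key.2.1 ≤ d ∧ c.code key < c.B ^ (d + 3)

/-- The addresses used by a set: `kind = 0` for its size, `kind = 1` for its elements and
`kind = 2` for the positions of the elements. -/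
def addr (kind : ℕ) (key : Key) (x : ℕ) : ℕ := (x * c.B ^ (d + 3) + c.code key) * 4 + kind

theorem keyOf_code {key : Key} (h : c.Valid key) : c.keyOf (c.code key) = key := by
  obtain ⟨g, i, u⟩ := key
  obtain ⟨h1, h2, h3⟩ := h
  simp only [code, keyOf] at *
  have e1 : ((u * (d + 1) + i) * 8 + g) / 8 = u * (d + 1) + i := by omega
  have e2 : (u * (d + 1) + i) / (d + 1) = u := by
    rw [mul_comm, Nat.mul_add_div (by omega), Nat.div_eq_of_lt (by omega), add_zero]
  have e3 : (u * (d + 1) + i) % (d + 1) = i := by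
    rw [mul_comm, Nat.mul_add_mod, Nat.mod_eq_of_lt (by omega)]
  rw [e1, e2, e3]
  congr 1
  omega

theorem code_keyOf (n : ℕ) : c.code (c.keyOf n) = n := by
  simp only [code, keyOf]
  rw [mul_comm (n / 8 / (d + 1)), Nat.div_add_mod]
  omega

theorem valid_keyOf {n : ℕ} (h : n < c.B ^ (d + 3)) : c.Valid (c.keyOf n) := by
  refine ⟨Nat.mod_lt _ (by norm_num), ?_, by rw [c.code_keyOf]; exact h⟩
  have : n / 8 % (d + 1) < d + 1 := Nat.mod_lt _ (by omega)
  simp only [keyOf]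
  omega

theorem code_lt {key : Key} (h1 : key.1 < 8) (h2 : key.2.1 ≤ d) (h3 : key.2.2 < c.B ^ (d + 1)) :
    c.code key < c.B ^ (d + 2) := by
  have hs : 8 * (d + 1) < c.B := c.small (by omega)
  have : c.code key < c.B ^ (d + 1) * (8 * (d + 1)) := by
    simp only [code]
    nlinarith
  refine this.trans_le ?_
  rw [pow_succ c.B (d + 1)]
  exact Nat.mul_le_mul_left _ hs.le

theorem valid_of_lt {key : Key} (h1 : key.1 < 8) (h2 : key.2.1 ≤ d)
    (h3 : key.2.2 < c.B ^ (d + 1)) : c.Valid key :=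
  ⟨h1, h2, (c.code_lt h1 h2 h3).trans (Nat.pow_lt_pow_right c.one_lt_B (by omega))⟩

theorem addr_mod (kind : ℕ) (hk : kind < 4) (key : Key) (x : ℕ) : c.addr kind key x % 4 = kind := by
  simp only [addr]
  omega

theorem addr_div (kind : ℕ) (hk : kind < 4) (key : Key) (x : ℕ) :
    c.addr kind key x / 4 = x * c.B ^ (d + 3) + c.code key := by
  simp only [addr]
  omega

theorem addr_inj {kind kind' : ℕ} (hk : kind < 4) (hk' : kind' < 4) {key key' : Key}
    (h : c.Valid key) (h' : c.Valid key') {x x' : ℕ} :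
    c.addr kind key x = c.addr kind' key' x' ↔ kind = kind' ∧ key = key' ∧ x = x' := by
  constructor
  · intro heq
    have e1 := congrArg (· % 4) heq
    have e2 := congrArg (· / 4) heq
    simp only [c.addr_mod _ hk, c.addr_mod _ hk', c.addr_div _ hk, c.addr_div _ hk'] at e1 e2
    have hpos : 0 < c.B ^ (d + 3) := pow_pos c.B_pos _
    have e3 := congrArg (· % c.B ^ (d + 3)) e2
    have e4 := congrArg (· / c.B ^ (d + 3)) e2
    simp only [mul_comm _ (c.B ^ (d + 3)), Nat.mul_add_mod, Nat.mul_add_div hpos,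
      Nat.mod_eq_of_lt h.2.2, Nat.mod_eq_of_lt h'.2.2, Nat.div_eq_of_lt h.2.2,
      Nat.div_eq_of_lt h'.2.2, add_zero] at e3 e4
    refine ⟨e1, ?_, e4⟩
    rw [← c.keyOf_code h, ← c.keyOf_code h', e3]
  · rintro ⟨rfl, rfl, rfl⟩
    rfl

/-- The element contributes fewer than `d + 2` digits and the name `d + 3`; the factor 4 for the
kind costs at most one digit more. -/
theorem addr_lt {kind : ℕ} (hk : kind < 4) {key : Key} (h : c.Valid key) {x : ℕ}
    (hx : x ≤ c.B ^ (d + 1)) : c.addr kind key x < 2 ^ c.w := by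
  have h1 : x * c.B ^ (d + 3) + c.code key < c.B ^ (2 * d + 5) := by
    have e : c.B ^ (2 * d + 5) = c.B ^ (d + 2) * c.B ^ (d + 3) := by
      rw [← pow_add]
      congr 1
      omega
    have h3 : c.B ^ (d + 1) < c.B ^ (d + 2) := Nat.pow_lt_pow_right c.one_lt_B (by omega)
    have h2 := h.2.2
    rw [e]
    calc x * c.B ^ (d + 3) + c.code key < (x + 1) * c.B ^ (d + 3) := by
          rw [add_mul, one_mul]
          omega
      _ ≤ _ := Nat.mul_le_mul_right _ (by omega)
  have h4 : 4 < c.B := c.small (by omega)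
  refine c.lt_word (k := 2 * d + 6) ?_ (by omega)
  rw [pow_succ]
  simp only [addr]
  calc (x * c.B ^ (d + 3) + c.code key) * 4 + kind
      ≤ (x * c.B ^ (d + 3) + c.code key + 1) * 4 := by omega
    _ ≤ c.B ^ (2 * d + 5) * c.B := Nat.mul_le_mul h1 h4.le

/-- The content of the memory cell `x`, if the stored sets are `l` and the auxiliary cells
hold `it`. -/
def cell (l : Key → List ℕ) (it : ℕ → ℕ) (x : ℕ) : ℕ :=
  let key := c.keyOf (x / 4 % c.B ^ (d + 3))
  let y := x / 4 / c.B ^ (d + 3)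
  if x % 4 = 0 then (if y = 0 then (l key).length else 0)
  else if x % 4 = 1 then (l key).getD y 0
  else if x % 4 = 2 then pos (l key) y
  else it (x / 4)

/-- Every number is an address with a valid name, so a claim about all cells reduces to the four
residues modulo 4. For residue 3 the decomposition is formal: those are the auxiliary cells. -/
theorem exists_addr (x : ℕ) : ∃ key y, c.Valid key ∧ x = c.addr (x % 4) key y := by
  have hpos : 0 < c.B ^ (d + 3) := pow_pos c.B_pos _
  refine ⟨c.keyOf (x / 4 % c.B ^ (d + 3)), x / 4 / c.B ^ (d + 3),
    c.valid_keyOf (Nat.mod_lt _ hpos), ?_⟩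
  simp only [addr, code_keyOf]
  rw [mul_comm (x / 4 / c.B ^ (d + 3)), Nat.div_add_mod]
  omega

theorem cell_addr (l : Key → List ℕ) (it : ℕ → ℕ) {kind : ℕ} (hk : kind < 3) {key : Key}
    (h : c.Valid key) (y : ℕ) : c.cell l it (c.addr kind key y) =
      if kind = 0 then (if y = 0 then (l key).length else 0)
      else if kind = 1 then (l key).getD y 0 else pos (l key) y := by
  have hpos : 0 < c.B ^ (d + 3) := pow_pos c.B_pos _
  have e1 : (y * c.B ^ (d + 3) + c.code key) % c.B ^ (d + 3) = c.code key := by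
    rw [mul_comm, Nat.mul_add_mod, Nat.mod_eq_of_lt h.2.2]
  have e2 : (y * c.B ^ (d + 3) + c.code key) / c.B ^ (d + 3) = y := by
    rw [mul_comm, Nat.mul_add_div hpos, Nat.div_eq_of_lt h.2.2, add_zero]
  simp only [cell, c.addr_mod kind (by omega), c.addr_div kind (by omega), e1, e2,
    c.keyOf_code h]
  split_ifs <;> first | rfl | omega

theorem cell_cnt (l : Key → List ℕ) (it : ℕ → ℕ) {key : Key} (h : c.Valid key) :
    c.cell l it (c.addr 0 key 0) = (l key).length := by
  rw [c.cell_addr l it (by norm_num) h]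
  simp

theorem cell_arr (l : Key → List ℕ) (it : ℕ → ℕ) {key : Key} (h : c.Valid key) (y : ℕ) :
    c.cell l it (c.addr 1 key y) = (l key).getD y 0 := by
  rw [c.cell_addr l it (by norm_num) h]
  simp

theorem cell_pos (l : Key → List ℕ) (it : ℕ → ℕ) {key : Key} (h : c.Valid key) (y : ℕ) :
    c.cell l it (c.addr 2 key y) = pos (l key) y := by
  rw [c.cell_addr l it (by norm_num) h]
  simp

theorem cell_it (l : Key → List ℕ) (it : ℕ → ℕ) (x : ℕ) : c.cell l it (x * 4 + 3) = it x := by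
  have h1 : (x * 4 + 3) % 4 = 3 := by omega
  have h2 : (x * 4 + 3) / 4 = x := by omega
  simp [cell, h1, h2]

end Cfg

variable {d : ℕ}

/-- An abstract state: the variables, the stored sets, the auxiliary cells, and a bound for the
number of memory cells in use. -/
structure AS (d : ℕ) where
  ρ : Var d → ℕ
  l : Key → List ℕ
  it : ℕ → ℕ
  n : ℕ

/-- Assignment of a value to a variable. -/
def AS.set (a : AS d) (v : Var d) (x : ℕ) : AS d := { a with ρ := Function.update a.ρ v x }

/-- Insertion into a stored set. -/
def insL (l : Key → List ℕ) (key : Key) (x : ℕ) : Key → List ℕ :=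
  if x ∈ l key then l else Function.update l key (l key ++ [x])

/-- Deletion from a stored set. -/
def ersL (l : Key → List ℕ) (key : Key) (x : ℕ) : Key → List ℕ :=
  Function.update l key (swapErase (l key) x)

theorem mem_insL {l : Key → List ℕ} {key key' : Key} {x y : ℕ} :
    y ∈ insL l key x key' ↔ y ∈ l key' ∨ (key' = key ∧ y = x) := by
  unfold insL
  split_ifs with h
  · constructor
    · exact Or.inl
    · rintro (h | ⟨rfl, rfl⟩) <;> assumption
  · by_cases hk : key' = key
    · subst hk
      simp
    · simp [hk]

theorem mem_ersL {l : Key → List ℕ} {key key' : Key} (hl : (l key).Nodup) {x y : ℕ} :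
    y ∈ ersL l key x key' ↔ y ∈ l key' ∧ ¬ (key' = key ∧ y = x) := by
  unfold ersL
  by_cases hk : key' = key
  · subst hk
    simp [mem_swapErase hl]
  · simp [hk]

theorem insL_of_ne {l : Key → List ℕ} {key key' : Key} {x : ℕ} (h : key' ≠ key) :
    insL l key x key' = l key' := by
  unfold insL
  split_ifs
  · rfl
  · rw [Function.update_of_ne h]

theorem ersL_of_ne {l : Key → List ℕ} {key key' : Key} {x : ℕ} (h : key' ≠ key) :
    ersL l key x key' = l key' := by
  unfold ersL
  rw [Function.update_of_ne h]

/-- The stored sets are lists without repetition of numbers with at most `d + 1` digits. -/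
def Sane (c : Cfg d) (l : Key → List ℕ) : Prop :=
  ∀ key, (l key).Nodup ∧ ∀ x ∈ l key, x < c.B ^ (d + 1)

theorem Sane.insL {c : Cfg d} {l : Key → List ℕ} (h : Sane c l) {key : Key} {x : ℕ}
    (hx : x < c.B ^ (d + 1)) : Sane c (insL l key x) := by
  intro key'
  constructor
  · unfold StarMaintenance.insL
    split_ifs with hm
    · exact (h key').1
    · by_cases hk : key' = key
      · subst hk
        rw [Function.update_self, List.nodup_append]
        refine ⟨(h _).1, by simp, ?_⟩
        rintro a ha b hb rfl
        rw [List.mem_singleton] at hb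
        exact hm (hb ▸ ha)
      · rw [Function.update_of_ne hk]
        exact (h key').1
  · intro y hy
    rcases mem_insL.1 hy with hy | ⟨-, rfl⟩
    exacts [(h key').2 y hy, hx]

theorem Sane.ersL {c : Cfg d} {l : Key → List ℕ} (h : Sane c l) (key : Key) (x : ℕ) :
    Sane c (ersL l key x) := by
  intro key'
  constructor
  · unfold StarMaintenance.ersL
    by_cases hk : key' = key
    · subst hk
      rw [Function.update_self]
      exact nodup_swapErase (h _).1 _
    · rw [Function.update_of_ne hk]
      exact (h key').1
  · intro y hy
    exact (h key').2 y ((mem_ersL (h key).1).1 hy).1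

theorem Sane.length_le {c : Cfg d} {l : Key → List ℕ} (h : Sane c l) (key : Key) :
    (l key).length ≤ c.B ^ (d + 1) := by
  rw [← List.toFinset_card_of_nodup (h key).1, ← Finset.card_range (c.B ^ (d + 1))]
  refine Finset.card_le_card fun x hx => ?_
  rw [List.mem_toFinset] at hx
  exact Finset.mem_range.2 ((h key).2 x hx)

theorem Sane.getD_lt {c : Cfg d} {l : Key → List ℕ} (h : Sane c l) (key : Key) (j : ℕ) :
    (l key).getD j 0 < c.B ^ (d + 1) := by
  by_cases hj : j < (l key).length
  · rw [List.getD_eq_getElem _ _ hj]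
    exact (h key).2 _ (List.getElem_mem hj)
  · rw [List.getD_eq_default _ _ (by omega)]
    exact pow_pos c.B_pos _

theorem pos_le (L : List ℕ) (x : ℕ) : pos L x ≤ L.length := by
  unfold pos
  split_ifs with h
  · exact List.idxOf_lt_length_of_mem h
  · omega

/-- The memory `m` realizes the abstract state `a`. -/
structure Good (c : Cfg d) (a : AS d) (m : ℕ →₀ ℕ) : Prop where
  mem : ∀ x, m x = c.cell a.l a.it x
  sane : Sane c a.l
  it_lt : ∀ x, a.it x < 2 ^ c.w
  card : m.support.card ≤ a.n

/-- The value of an expression in an abstract state. -/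
def ev (c : Cfg d) (a : AS d) (e : Expr d) : ℕ := e.eval c.w a.ρ (c.cell a.l a.it)

theorem Good.eval {c : Cfg d} {a : AS d} {m : ℕ →₀ ℕ} (h : Good c a m) (e : Expr d) :
    e.eval c.w a.ρ m = ev c a e := by
  have : (m : ℕ → ℕ) = c.cell a.l a.it := funext h.mem
  rw [ev, this]

/-- From the abstract state `a`, the program `p` terminates within `T` steps, without output and
within the space limit, in an abstract state that satisfies `Post`. -/
def Run (c : Cfg d) (p : Prog) (a : AS d) (T : ℕ) (Post : AS d → Prop) : Prop :=
  ∀ m, Good c a m → Does c.w c.S p a.ρ m T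
    fun ρ' m' => ∃ l' it' n', Good c ⟨ρ', l', it', n'⟩ m' ∧ Post ⟨ρ', l', it', n'⟩

end StarMaintenance

/-! ### Arithmetic of digits, tests, access to stored sets, and runs on abstract states. -/

namespace StarMaintenance

open WordRAM

variable {d : ℕ}

namespace Expr

/-! Operations on expressions. -/

def add (x y : Expr d) : Expr d := bin .add x y
def sub (x y : Expr d) : Expr d := bin .sub x y
def mul (x y : Expr d) : Expr d := bin .mul x y
def shl (x y : Expr d) : Expr d := bin .shiftLeft x y
def shr (x y : Expr d) : Expr d := bin .shiftRight x y
def mod (x y : Expr d) : Expr d := bin .mod x y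
def lt (x y : Expr d) : Expr d := bin .lt x y
def eq (x y : Expr d) : Expr d := bin .eq x y
def not (x : Expr d) : Expr d := eq x (const 0)
def or (x y : Expr d) : Expr d := lt (const 0) (add x y)
def and (x y : Expr d) : Expr d := mul x y

/-- The number of bits of a digit. -/
def digitBits : Expr d := bin .div wlen (const (4 * d + 16))

/-- Conjunction of a family of tests. -/
def all (f : ℕ → Expr d) : ℕ → Expr d
  | 0 => const 1
  | n + 1 => and (all f n) (f n)

/-- The number with digits `f 0, …, f (n - 1)`. -/
def pack (f : ℕ → Expr d) : ℕ → Expr d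
  | 0 => const 0
  | n + 1 => add (pack f n) (shl (f n) (mul digitBits (const n)))

/-- The digit number `i`. -/
def dig (i : ℕ) (x : Expr d) : Expr d :=
  mod (shr x (mul digitBits (const i))) (shl (const 1) digitBits)

end Expr

/-- The digit number `i` of `x` in base `B`. -/
def dig (B i x : ℕ) : ℕ := x / B ^ i % B

/-- The number with digits `f 0, …, f (n - 1)` in base `B`. -/
def pack (B : ℕ) (f : ℕ → ℕ) : ℕ → ℕ
  | 0 => 0
  | n + 1 => pack B f n + f n * B ^ n

theorem pack_lt {B : ℕ} {f : ℕ → ℕ} {n : ℕ} (hf : ∀ i < n, f i < B) :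
    pack B f n < B ^ n := by
  induction n with
  | zero => simp [pack]
  | succ n ih =>
    have h1 := ih fun i hi => hf i (by omega)
    have h2 := hf n (by omega)
    simp only [pack]
    calc pack B f n + f n * B ^ n < (f n + 1) * B ^ n := by
          rw [add_mul, one_mul]
          omega
      _ ≤ B * B ^ n := Nat.mul_le_mul_right _ h2
      _ = B ^ (n + 1) := by rw [pow_succ, mul_comm]

theorem dig_lt {B : ℕ} (hB : 0 < B) (i x : ℕ) : dig B i x < B := Nat.mod_lt _ hB

theorem dig_pack {B : ℕ} (hB : 0 < B) {f : ℕ → ℕ} {n : ℕ} (hf : ∀ i < n, f i < B) {i : ℕ}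
    (hi : i < n) : dig B i (pack B f n) = f i := by
  induction n with
  | zero => omega
  | succ n ih =>
    have hf' : ∀ i < n, f i < B := fun i hi => hf i (by omega)
    have hlt := pack_lt hf'
    have hpos : 0 < B ^ n := pow_pos hB _
    simp only [pack, dig]
    rcases Nat.lt_succ_iff_lt_or_eq.1 hi with h | rfl
    · have e : f n * B ^ n = B ^ i * (B * (f n * B ^ (n - i - 1))) := by
        have : n = i + 1 + (n - i - 1) := by omega
        conv_lhs => rw [this, pow_add, pow_succ]
        rw [← this]
        ring
      rw [e, add_comm, Nat.mul_add_div (pow_pos hB _), Nat.mul_add_mod]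
      exact ih hf' h
    · rw [add_comm, mul_comm, Nat.mul_add_div hpos, Nat.div_eq_of_lt hlt, add_zero,
        Nat.mod_eq_of_lt (hf i (by omega))]

theorem pack_mod {B : ℕ} {f : ℕ → ℕ} {n m : ℕ} (hf : ∀ i < n, f i < B) (hm : m ≤ n) :
    pack B f n % B ^ m = pack B f m := by
  induction n with
  | zero =>
    obtain rfl : m = 0 := by omega
    simp [pack]
  | succ n ih =>
    have hf' : ∀ i < n, f i < B := fun i hi => hf i (by omega)
    rcases Nat.lt_succ_iff_lt_or_eq.1 (Nat.lt_succ_of_le hm) with h | rfl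
    · have e : f n * B ^ n = B ^ m * (f n * B ^ (n - m)) := by
        have : n = m + (n - m) := by omega
        conv_lhs => rw [this, pow_add]
        rw [← this]
        ring
      simp only [pack]
      rw [e, add_comm, Nat.mul_add_mod]
      exact ih hf' (by omega)
    · exact Nat.mod_eq_of_lt (pack_lt hf)

theorem pack_congr {B : ℕ} {f g : ℕ → ℕ} {n : ℕ} (h : ∀ i < n, f i = g i) :
    pack B f n = pack B g n := by
  induction n with
  | zero => rfl
  | succ n ih =>
    simp only [pack]
    rw [ih fun i hi => h i (by omega), h n (by omega)]

theorem pack_dig {B : ℕ} (n x : ℕ) : pack B (fun i => dig B i x) n = x % B ^ n := by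
  induction n with
  | zero => simp [pack, Nat.mod_one]
  | succ n ih =>
    simp only [pack]
    rw [ih, dig, pow_succ, Nat.mod_mul, mul_comm]

theorem eq_of_dig_eq {B n x y : ℕ} (hx : x < B ^ n) (hy : y < B ^ n)
    (h : ∀ i < n, dig B i x = dig B i y) : x = y := by
  rw [← Nat.mod_eq_of_lt hx, ← Nat.mod_eq_of_lt hy, ← pack_dig, ← pack_dig]
  exact pack_congr h

theorem dig_mod {B : ℕ} (hB : 0 < B) {m i : ℕ} (hi : i < m) (x : ℕ) :
    dig B i (x % B ^ m) = dig B i x := by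
  rw [← pack_dig, dig_pack hB (fun i _ => dig_lt hB i x) hi]

theorem dig_div (B m i x : ℕ) : dig B i (x / B ^ m) = dig B (m + i) x := by
  simp only [dig]
  rw [Nat.div_div_eq_div_mul, ← pow_add]

section eval

variable {c : Cfg d} {ρ : Var d → ℕ} {μ : ℕ → ℕ} {x y : Expr d} {m n : ℕ}

theorem eval_var (v : Var d) (h : ρ v = n) (hn : n < 2 ^ c.w) : (Expr.var v).eval c.w ρ μ = n := by
  rw [Expr.eval, h, Nat.mod_eq_of_lt hn]

theorem eval_const (hn : n ≤ 64 * (d + 4)) : (Expr.const n : Expr d).eval c.w ρ μ = n :=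
  Nat.mod_eq_of_lt (c.small_lt_word hn)

theorem eval_add (hx : x.eval c.w ρ μ = m) (hy : y.eval c.w ρ μ = n) (h : m + n < 2 ^ c.w) :
    (x.add y).eval c.w ρ μ = m + n := by
  simp only [Expr.add, Expr.eval, BinOp.eval, hx, hy]
  exact Nat.mod_eq_of_lt h

theorem eval_sub (hx : x.eval c.w ρ μ = m) (hy : y.eval c.w ρ μ = n) (h : n ≤ m)
    (hm : m < 2 ^ c.w) : (x.sub y).eval c.w ρ μ = m - n := by
  simp only [Expr.sub, Expr.eval, BinOp.eval, hx, hy]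
  rw [Nat.add_sub_assoc h, Nat.add_mod_left]
  exact Nat.mod_eq_of_lt (by omega)

theorem eval_mul (hx : x.eval c.w ρ μ = m) (hy : y.eval c.w ρ μ = n) (h : m * n < 2 ^ c.w) :
    (x.mul y).eval c.w ρ μ = m * n := by
  simp only [Expr.mul, Expr.eval, BinOp.eval, hx, hy]
  exact Nat.mod_eq_of_lt h

theorem eval_shl (hx : x.eval c.w ρ μ = m) (hy : y.eval c.w ρ μ = n) (h : m * 2 ^ n < 2 ^ c.w) :
    (x.shl y).eval c.w ρ μ = m * 2 ^ n := by
  simp only [Expr.shl, Expr.eval, BinOp.eval, hx, hy]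
  exact Nat.mod_eq_of_lt h

theorem eval_shr (hx : x.eval c.w ρ μ = m) (hy : y.eval c.w ρ μ = n) (hm : m < 2 ^ c.w) :
    (x.shr y).eval c.w ρ μ = m / 2 ^ n := by
  simp only [Expr.shr, Expr.eval, BinOp.eval, hx, hy]
  exact Nat.mod_eq_of_lt ((Nat.div_le_self _ _).trans_lt hm)

theorem eval_mod (hx : x.eval c.w ρ μ = m) (hy : y.eval c.w ρ μ = n) (hm : m < 2 ^ c.w) :
    (x.mod y).eval c.w ρ μ = m % n := by
  simp only [Expr.mod, Expr.eval, BinOp.eval, hx, hy]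
  exact Nat.mod_eq_of_lt ((Nat.mod_le _ _).trans_lt hm)

theorem eval_digitBits : (Expr.digitBits : Expr d).eval c.w ρ μ = c.b := by
  simp only [Expr.digitBits, Expr.eval, BinOp.eval]
  rw [Nat.mod_eq_of_lt c.w_lt,
    Nat.mod_eq_of_lt (c.small_lt_word (show 4 * d + 16 ≤ 64 * (d + 4) by omega)), ← c.b_eq]
  refine Nat.mod_eq_of_lt (lt_of_le_of_lt ?_ c.w_lt)
  rw [c.b_eq]
  exact Nat.div_le_self _ _

theorem eval_bits_mul (hn : n ≤ 64 * (d + 4)) :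
    (Expr.digitBits.mul (.const n) : Expr d).eval c.w ρ μ = c.b * n := by
  refine eval_mul eval_digitBits (eval_const hn) ?_
  refine c.lt_word (k := 2) ?_ (by omega)
  rw [pow_two]
  exact Nat.mul_le_mul Nat.lt_two_pow_self.le (c.small hn).le

theorem eval_shl_bits (hx : x.eval c.w ρ μ = m) (hn : n ≤ 64 * (d + 4))
    (h : m * c.B ^ n < 2 ^ c.w) :
    (x.shl (Expr.digitBits.mul (.const n))).eval c.w ρ μ = m * c.B ^ n := by
  have e : c.B ^ n = 2 ^ (c.b * n) := by rw [Cfg.B, pow_mul]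
  rw [e] at h ⊢
  exact eval_shl hx (eval_bits_mul hn) h

theorem eval_shr_bits (hx : x.eval c.w ρ μ = m) (hn : n ≤ 64 * (d + 4)) (hm : m < 2 ^ c.w) :
    (x.shr (Expr.digitBits.mul (.const n))).eval c.w ρ μ = m / c.B ^ n := by
  have e : c.B ^ n = 2 ^ (c.b * n) := by rw [Cfg.B, pow_mul]
  rw [e]
  exact eval_shr hx (eval_bits_mul hn) hm

theorem eval_dig {i : ℕ} (hx : x.eval c.w ρ μ = m) (hi : i ≤ d) (hm : m < 2 ^ c.w) :
    (Expr.dig i x).eval c.w ρ μ = dig c.B i m := by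
  refine eval_mod (eval_shr_bits hx (by omega) hm) ?_ ((Nat.div_le_self _ _).trans_lt hm)
  have h1 : 1 * 2 ^ c.b < 2 ^ c.w := by
    rw [one_mul]
    exact c.lt_word (k := 1) (by rw [pow_one, Cfg.B]) (by omega)
  rw [eval_shl (eval_const (by omega)) eval_digitBits h1, one_mul, Cfg.B]

theorem eval_pack {f : ℕ → Expr d} {g : ℕ → ℕ} (hn : n ≤ d + 1)
    (hf : ∀ i < n, (f i).eval c.w ρ μ = g i) (hg : ∀ i < n, g i < c.B) :
    (Expr.pack f n).eval c.w ρ μ = pack c.B g n := by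
  induction n with
  | zero => exact eval_const (by omega)
  | succ n ih =>
    have h1 := pack_lt hg
    have h2 : c.B ^ (n + 1) < 2 ^ c.w := c.lt_word le_rfl (by omega)
    have h3 : pack c.B g (n + 1) = pack c.B g n + g n * c.B ^ n := rfl
    refine eval_add (ih (by omega) (fun i hi => hf i (by omega)) (fun i hi => hg i (by omega)))
      (eval_shl_bits (hf n (by omega)) (by omega) (by omega)) (by omega)

/-- The expression `x` evaluates to the truth value of `P`. -/
def Tests (c : Cfg d) (ρ : Var d → ℕ) (μ : ℕ → ℕ) (x : Expr d) (P : Prop) : Prop :=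
  (P → x.eval c.w ρ μ = 1) ∧ (¬ P → x.eval c.w ρ μ = 0)

theorem Tests.ne_zero {P : Prop} (h : Tests c ρ μ x P) : x.eval c.w ρ μ ≠ 0 ↔ P := by
  constructor
  · intro h1
    by_contra h2
    exact h1 (h.2 h2)
  · intro h1
    rw [h.1 h1]
    norm_num

theorem Tests.le_one {P : Prop} (h : Tests c ρ μ x P) : x.eval c.w ρ μ ≤ 1 := by
  by_cases hP : P
  · exact (h.1 hP).le
  · rw [h.2 hP]
    norm_num

theorem one_lt_word : 1 < 2 ^ c.w := c.small_lt_word (by omega)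

theorem Tests.lt (hx : x.eval c.w ρ μ = m) (hy : y.eval c.w ρ μ = n) :
    Tests c ρ μ (x.lt y) (m < n) := by
  have h1 := one_lt_word (c := c)
  constructor <;> intro h <;> simp only [Expr.lt, Expr.eval, BinOp.eval, hx, hy, h] <;>
    simp [Nat.mod_eq_of_lt h1]

theorem Tests.eq (hx : x.eval c.w ρ μ = m) (hy : y.eval c.w ρ μ = n) :
    Tests c ρ μ (x.eq y) (m = n) := by
  have h1 := one_lt_word (c := c)
  constructor <;> intro h <;> simp only [Expr.eq, Expr.eval, BinOp.eval, hx, hy] <;>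
    simp [Nat.mod_eq_of_lt h1, h]

theorem Tests.congr {P Q : Prop} (h : Tests c ρ μ x P) (hPQ : P ↔ Q) : Tests c ρ μ x Q :=
  ⟨fun hq => h.1 (hPQ.2 hq), fun hq => h.2 fun hp => hq (hPQ.1 hp)⟩

theorem Tests.not {P : Prop} (h : Tests c ρ μ x P) : Tests c ρ μ x.not (¬ P) := by
  refine (Tests.eq rfl (eval_const (by omega))).congr ?_
  rw [← h.ne_zero, Ne, not_not]

theorem Tests.or {P Q : Prop} (h : Tests c ρ μ x P) (h' : Tests c ρ μ y Q) :
    Tests c ρ μ (x.or y) (P ∨ Q) := by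
  have h1 := h.le_one
  have h2 := h'.le_one
  refine (Tests.lt (eval_const (by omega)) (eval_add rfl rfl
    (c.small_lt_word (by omega)))).congr ?_
  rw [← h.ne_zero, ← h'.ne_zero]
  omega

theorem Tests.and {P Q : Prop} (h : Tests c ρ μ x P) (h' : Tests c ρ μ y Q) :
    Tests c ρ μ (x.and y) (P ∧ Q) := by
  have h1 := h.le_one
  have h2 := h'.le_one
  have h3 : (x.and y).eval c.w ρ μ = x.eval c.w ρ μ * y.eval c.w ρ μ :=
    eval_mul rfl rfl (c.small_lt_word (by nlinarith))
  constructor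
  · rintro ⟨hp, hq⟩
    rw [h3, h.1 hp, h'.1 hq]
  · intro hn
    rw [h3]
    by_cases hp : P
    · rw [h'.2 fun hq => hn ⟨hp, hq⟩, mul_zero]
    · rw [h.2 hp, zero_mul]

theorem Tests.all {f : ℕ → Expr d} {P : ℕ → Prop} (h : ∀ i < n, Tests c ρ μ (f i) (P i)) :
    Tests c ρ μ (Expr.all f n) (∀ i < n, P i) := by
  induction n with
  | zero => exact ⟨fun _ => eval_const (by omega), fun h => absurd (fun i hi => by omega) h⟩
  | succ n ih =>
    refine ((ih fun i hi => h i (by omega)).and (h n (by omega))).congr ?_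
    constructor
    · rintro ⟨h1, h2⟩ i hi
      rcases Nat.lt_succ_iff_lt_or_eq.1 hi with h | rfl
      exacts [h1 i h, h2]
    · exact fun h1 => ⟨fun i hi => h1 i (by omega), h1 n (by omega)⟩

theorem Tests.true : Tests c ρ μ (Expr.const 1) True :=
  ⟨fun _ => eval_const (by omega), fun h => absurd trivial h⟩

end eval

/-- The name of a stored set with a computed component. -/
structure KeyE (d : ℕ) where
  g : ℕ
  i : ℕ
  u : Expr d

namespace KeyE

def code (κ : KeyE d) : Expr d :=
  (((κ.u.mul (.const (d + 1))).add (.const κ.i)).mul (.const 8)).add (.const κ.g)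

def addr (kind : ℕ) (κ : KeyE d) (x : Expr d) : Expr d :=
  (((x.shl (Expr.digitBits.mul (.const (d + 3)))).add κ.code).mul (.const 4)).add (.const kind)

/-- The number of elements. -/
def size (κ : KeyE d) : Expr d := .load (κ.addr 0 (.const 0))

/-- The element with a given index. -/
def get (κ : KeyE d) (j : Expr d) : Expr d := .load (κ.addr 1 j)

/-- The position of an element, counted from `1`. -/
def find (κ : KeyE d) (x : Expr d) : Expr d := .load (κ.addr 2 x)

/-- The membership test. -/
def has (κ : KeyE d) (x : Expr d) : Expr d := (Expr.const 0).lt (κ.find x)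

/-- The expression `κ` denotes the name `key`. -/
structure Is (c : Cfg d) (ρ : Var d → ℕ) (κ : KeyE d) (key : Key) : Prop where
  g_lt : κ.g < 8
  i_le : κ.i ≤ d
  g_eq : key.1 = κ.g
  i_eq : key.2.1 = κ.i
  u_lt : key.2.2 < c.B ^ (d + 1)
  u_eq : ∀ μ, κ.u.eval c.w ρ μ = key.2.2

variable {c : Cfg d} {ρ : Var d → ℕ} {κ : KeyE d} {key : Key} {x : Expr d} {y : ℕ}

theorem Is.valid (h : κ.Is c ρ key) : c.Valid key :=
  c.valid_of_lt (h.g_eq ▸ h.g_lt) (h.i_eq ▸ h.i_le) h.u_lt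

theorem Is.addr_eq {μ : ℕ → ℕ} (h : κ.Is c ρ key) {kind : ℕ} (hk : kind < 4)
    (hx : x.eval c.w ρ μ = y) (hy : y ≤ c.B ^ (d + 1)) :
    (κ.addr kind x).eval c.w ρ μ = c.addr kind key y := by
  have h1 := c.addr_lt hk h.valid hy
  have h2 := h.g_lt
  have h3 := h.i_le
  have h4 : c.code key = (key.2.2 * (d + 1) + κ.i) * 8 + κ.g := by
    rw [Cfg.code, h.g_eq, h.i_eq]
  simp only [Cfg.addr] at h1 ⊢
  have hcode : κ.code.eval c.w ρ μ = c.code key := by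
    rw [h4]
    refine eval_add (eval_mul (eval_add (eval_mul (h.u_eq μ) (eval_const (by omega)) ?_)
      (eval_const (by omega)) ?_) (eval_const (by omega)) ?_) (eval_const (by omega)) ?_ <;> omega
  refine eval_add (eval_mul (eval_add (eval_shl_bits hx (by omega) ?_) hcode ?_)
    (eval_const (by omega)) ?_) (eval_const (by omega)) ?_ <;> omega

variable {l : Key → List ℕ} {it : ℕ → ℕ}

theorem Is.size_eq (h : κ.Is c ρ key) (hl : Sane c l) :
    κ.size.eval c.w ρ (c.cell l it) = (l key).length := by
  have e := h.addr_eq (μ := c.cell l it) (kind := 0) (by norm_num)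
    (eval_const (by omega)) (Nat.zero_le _)
  rw [size, Expr.eval, e, c.cell_cnt _ _ h.valid]
  exact Nat.mod_eq_of_lt (c.lt_word (hl.length_le key) (by omega))

theorem Is.get_eq (h : κ.Is c ρ key) (hl : Sane c l) (hx : x.eval c.w ρ (c.cell l it) = y)
    (hy : y ≤ c.B ^ (d + 1)) : (κ.get x).eval c.w ρ (c.cell l it) = (l key).getD y 0 := by
  have e := h.addr_eq (kind := 1) (by norm_num) hx hy
  rw [get, Expr.eval, e, c.cell_arr _ _ h.valid]
  exact Nat.mod_eq_of_lt (c.lt_word (hl.getD_lt key y).le (by omega))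

theorem Is.find_eq (h : κ.Is c ρ key) (hl : Sane c l) (hx : x.eval c.w ρ (c.cell l it) = y)
    (hy : y ≤ c.B ^ (d + 1)) : (κ.find x).eval c.w ρ (c.cell l it) = pos (l key) y := by
  have e := h.addr_eq (kind := 2) (by norm_num) hx hy
  rw [find, Expr.eval, e, c.cell_pos _ _ h.valid]
  exact Nat.mod_eq_of_lt (c.lt_word ((pos_le _ _).trans (hl.length_le key)) (by omega))

theorem Is.has (h : κ.Is c ρ key) (hl : Sane c l) (hx : x.eval c.w ρ (c.cell l it) = y)
    (hy : y ≤ c.B ^ (d + 1)) : Tests c ρ (c.cell l it) (κ.has x) (y ∈ l key) := by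
  refine (Tests.lt (eval_const (by omega)) (h.find_eq hl hx hy)).congr ?_
  rw [Nat.pos_iff_ne_zero, Ne, pos_eq_zero, not_not]

end KeyE

section Run

variable {c : Cfg d} {p q : Prog} {a : AS d} {T T₁ T₂ : ℕ} {Post Mid : AS d → Prop}

theorem Run.mono (h : Run c p a T₁ Mid) (hT : T₁ ≤ T) (hP : ∀ b, Mid b → Post b) :
    Run c p a T Post := by
  intro m hm
  refine (h m hm).mono hT ?_
  rintro ρ' m' ⟨l', it', n', h1, h2⟩
  exact ⟨l', it', n', h1, hP _ h2⟩

theorem Run.seq (h : Run c p a T₁ Mid) (h' : ∀ b, Mid b → Run c q b T₂ Post) :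
    Run c (.seq p q) a (T₁ + T₂) Post := by
  intro m hm
  refine (h m hm).seq ?_
  rintro ρ' m' ⟨l', it', n', h1, h2⟩
  exact h' _ h2 m' h1

/-- Sanity of the stored lists is part of `Good`, so it is available as a hypothesis at any point
where a run has to be established. -/
theorem Run.sane (h : Sane c a.l → Run c p a T Post) : Run c p a T Post :=
  fun m hm => h hm.sane m hm

theorem run_nop (hn : a.n ≤ c.S) (hP : Post a) : Run c .nop a 1 Post :=
  fun _ hm => Does.nop (hm.card.trans hn) ⟨a.l, a.it, a.n, hm, hP⟩

theorem run_asg {v : Var d} {e : Expr d} (hn : a.n ≤ c.S) (hP : Post (a.set v (ev c a e))) :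
    Run c (asg v e) a (tm (asg v e)) Post := by
  intro m hm
  refine Does.asg (hm.card.trans hn) ⟨a.l, a.it, a.n, ⟨hm.mem, hm.sane, hm.it_lt, hm.card⟩, ?_⟩
  rw [hm.eval]
  exact hP

theorem run_cond {e : Expr d} (hn : a.n ≤ c.S) (hp : ev c a e ≠ 0 → Run c p a T Post)
    (hq : ev c a e = 0 → Run c q a T Post) :
    Run c (cond e p q) a (tm (e.compile 0) + 1 + T) Post := by
  intro m hm
  refine Does.cond (hm.card.trans hn) (fun h => ?_) (fun h => ?_)
  · rw [hm.eval] at h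
    exact hp h m hm
  · rw [hm.eval] at h
    exact hq h m hm

/-- The stored sets and the auxiliary cells take at most `n` cells. -/
def Holds (l : Key → List ℕ) (it : ℕ → ℕ) (n : ℕ) : Prop :=
  ∃ (E : Finset (Key × ℕ)) (E' : Finset ℕ), (∀ key, ∀ x ∈ l key, (key, x) ∈ E) ∧
    (∀ x, it x ≠ 0 → x ∈ E') ∧ 3 * E.card + E'.card ≤ n

/-- Each nonzero cell is charged to a stored pair or to an auxiliary cell: an array cell to the
element it contains, a position cell to its element, and a size cell to an arbitrary element of its
list, which is nonempty. A pair is charged at most three times. -/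
theorem Good.holds {m : ℕ →₀ ℕ} (h : Good c a m) {n : ℕ} (hn : Holds a.l a.it n) :
    Good c { a with n := n } m := by
  classical
  refine ⟨h.mem, h.sane, h.it_lt, ?_⟩
  obtain ⟨E, E', h1, h2, h3⟩ := hn
  refine le_trans ?_ h3
  have hsub : m.support ⊆ E.image (fun e => c.addr 0 e.1 0) ∪
      (E.image (fun e => c.addr 1 e.1 ((a.l e.1).idxOf e.2)) ∪
        (E.image (fun e => c.addr 2 e.1 e.2) ∪ E'.image (fun x => x * 4 + 3))) := by
    intro x hx
    rw [Finsupp.mem_support_iff, h.mem] at hx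
    obtain ⟨key, y, hv, hxa⟩ := c.exists_addr x
    have hmod : x % 4 < 4 := Nat.mod_lt _ (by norm_num)
    simp only [Finset.mem_union, Finset.mem_image]
    obtain hk | hk | hk | hk : x % 4 = 0 ∨ x % 4 = 1 ∨ x % 4 = 2 ∨ x % 4 = 3 := by omega
    · rw [hk] at hxa
      rw [hxa, c.cell_addr _ _ (by norm_num) hv] at hx
      simp only [if_true, ne_eq, ite_eq_right_iff, not_forall] at hx
      obtain ⟨rfl, hl⟩ := hx
      obtain ⟨z, hz⟩ := List.exists_mem_of_length_pos (Nat.pos_of_ne_zero hl)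
      exact Or.inl ⟨(key, z), h1 _ _ hz, hxa.symm⟩
    · rw [hk] at hxa
      rw [hxa, c.cell_arr _ _ hv] at hx
      by_cases hy : y < (a.l key).length
      · refine Or.inr (Or.inl ⟨(key, (a.l key)[y]), h1 _ _ (List.getElem_mem hy), ?_⟩)
        simp only
        rw [(h.sane key).1.idxOf_getElem y hy, hxa]
      · rw [List.getD_eq_default _ _ (by omega)] at hx
        exact absurd rfl hx
    · rw [hk] at hxa
      rw [hxa, c.cell_pos _ _ hv] at hx
      rw [Ne, pos_eq_zero, not_not] at hx
      exact Or.inr (Or.inr (Or.inl ⟨(key, y), h1 _ _ hx, hxa.symm⟩))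
    · have e : x = x / 4 * 4 + 3 := by omega
      rw [e, c.cell_it] at hx
      exact Or.inr (Or.inr (Or.inr ⟨x / 4, h2 _ hx, e.symm⟩))
  have c1 := Finset.card_le_card hsub
  have c2 := Finset.card_union_le (E.image (fun e => c.addr 0 e.1 0))
      (E.image (fun e => c.addr 1 e.1 ((a.l e.1).idxOf e.2)) ∪
        (E.image (fun e => c.addr 2 e.1 e.2) ∪ E'.image (fun x => x * 4 + 3)))
  have c3 := Finset.card_union_le (E.image (fun e => c.addr 1 e.1 ((a.l e.1).idxOf e.2)))
        (E.image (fun e => c.addr 2 e.1 e.2) ∪ E'.image (fun x => x * 4 + 3))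
  have c4 := Finset.card_union_le (E.image (fun e => c.addr 2 e.1 e.2))
    (E'.image (fun x => x * 4 + 3))
  have d1 := Finset.card_image_le (s := E) (f := fun e => c.addr 0 e.1 0)
  have d2 := Finset.card_image_le (s := E) (f := fun e => c.addr 1 e.1 ((a.l e.1).idxOf e.2))
  have d3 := Finset.card_image_le (s := E) (f := fun e => c.addr 2 e.1 e.2)
  have d4 := Finset.card_image_le (s := E') (f := fun x => x * 4 + 3)
  omega

/-- The bound on the number of cells in an abstract state increases with every write, even with one
that overwrites or erases. After an operation it is recomputed from the content; otherwise it would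
grow with the running time. -/
theorem Run.tighten (h : Run c p a T Mid)
    (hP : ∀ b, Mid b → ∃ n, Holds b.l b.it n ∧ Post { b with n := n }) : Run c p a T Post := by
  intro m hm
  refine (h m hm).mono le_rfl ?_
  rintro ρ' m' ⟨l', it', n', h1, h2⟩
  obtain ⟨n, h3, h4⟩ := hP _ h2
  exact ⟨l', it', n, h1.holds h3, h4⟩

/-- Insertion into a stored set. -/
def ins (κ : KeyE d) (x : Expr d) : Prog :=
  cond (κ.find x) .nop (.seq (store (κ.addr 1 κ.size) x)
    (.seq (store (κ.addr 2 x) (κ.size.add (.const 1)))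
      (store (κ.addr 0 (.const 0)) (κ.size.add (.const 1)))))

/-- Deletion from a stored set. -/
def ers (κ : KeyE d) (x : Expr d) : Prog :=
  cond (κ.find x) (.seq (store (κ.addr 1 ((κ.find x).sub (.const 1)))
      (κ.get (κ.size.sub (.const 1))))
    (.seq (store (κ.addr 2 (κ.get (κ.size.sub (.const 1)))) (κ.find x))
      (.seq (store (κ.addr 1 (κ.size.sub (.const 1))) (.const 0))
        (.seq (store (κ.addr 2 x) (.const 0))
          (store (κ.addr 0 (.const 0)) (κ.size.sub (.const 1))))))) .nop

end Run

end StarMaintenance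

/-! ### Insertion, deletion and iteration for stored sets. -/

namespace StarMaintenance

open WordRAM

variable {d : ℕ}

section cells

variable {c : Cfg d} {l : Key → List ℕ} {it : ℕ → ℕ} {key : Key} {x : ℕ}

theorem cell_congr {l' : Key → List ℕ} {z : ℕ} {key' : Key} {y : ℕ} (hv : c.Valid key')
    (hz : z = c.addr (z % 4) key' y) (h : l' key' = l key') :
    c.cell l' it z = c.cell l it z := by
  have hmod : z % 4 < 4 := Nat.mod_lt _ (by norm_num)
  obtain hk | hk : z % 4 < 3 ∨ z % 4 = 3 := by omega
  · rw [hz, c.cell_addr _ _ hk hv, c.cell_addr _ _ hk hv, h]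
  · have e : z = z / 4 * 4 + 3 := by omega
    rw [e, c.cell_it, c.cell_it]

theorem getD_append_singleton (L : List ℕ) (x y : ℕ) :
    (L ++ [x]).getD y 0 = if y = L.length then x else L.getD y 0 := by
  simp only [List.getD_eq_getElem?_getD, List.getElem?_append]
  split_ifs with h1 h2 h2
  · omega
  · rfl
  · simp [h2]
  · rw [List.getElem?_eq_none (by simp; omega), List.getElem?_eq_none (by omega)]

theorem pos_append_singleton (L : List ℕ) {x : ℕ} (hx : x ∉ L) (y : ℕ) :
    pos (L ++ [x]) y = if y = x then L.length + 1 else pos L y := by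
  unfold pos
  by_cases h1 : y ∈ L
  · have h2 : y ≠ x := fun h => hx (h ▸ h1)
    simp [h1, h2, List.idxOf_append_of_mem h1]
  · by_cases h2 : y = x
    · subst h2
      simp [h1, List.idxOf_append_of_notMem h1]
    · simp [h1, h2]

theorem getD_swapErase {L : List ℕ} {x : ℕ} (h : x ∈ L) (j : ℕ) :
    (swapErase L x).getD j 0 = if j = L.length - 1 then 0 else
      if j = L.idxOf x then L.getD (L.length - 1) 0 else L.getD j 0 := by
  have h0 := List.idxOf_lt_length_of_mem h
  rw [List.getD_eq_getElem?_getD, getElem?_swapErase h]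
  by_cases h1 : j < L.length - 1
  · rw [if_pos h1, if_neg (show j ≠ L.length - 1 by omega)]
    split_ifs
    · rfl
    · rw [List.getD_eq_getElem?_getD]
  · rw [if_neg h1]
    by_cases h2 : j = L.length - 1
    · rw [if_pos h2]
      rfl
    · rw [if_neg h2, if_neg (by omega), List.getD_eq_default _ _ (by omega)]
      rfl

theorem cell_insL (hv : c.Valid key) (hx : x ∉ l key) :
    c.cell (insL l key x) it = Function.update (Function.update (Function.update (c.cell l it)
      (c.addr 1 key (l key).length) x) (c.addr 2 key x) ((l key).length + 1))
      (c.addr 0 key 0) ((l key).length + 1) := by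
  funext z
  obtain ⟨key', y, hv', hz⟩ := c.exists_addr z
  have hmod : z % 4 < 4 := Nat.mod_lt _ (by norm_num)
  have e0 : z = c.addr 0 key 0 ↔ z % 4 = 0 ∧ key' = key ∧ y = 0 := by
    conv_lhs => rw [hz]
    exact c.addr_inj hmod (by norm_num) hv' hv
  have e1 : z = c.addr 1 key (l key).length ↔ z % 4 = 1 ∧ key' = key ∧ y = (l key).length := by
    conv_lhs => rw [hz]
    exact c.addr_inj hmod (by norm_num) hv' hv
  have e2 : z = c.addr 2 key x ↔ z % 4 = 2 ∧ key' = key ∧ y = x := by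
    conv_lhs => rw [hz]
    exact c.addr_inj hmod (by norm_num) hv' hv
  have q0 : z % 4 = 0 → ∀ l', c.cell l' it z = if y = 0 then (l' key').length else 0 := by
    intro h l'
    rw [hz, h, c.cell_addr _ _ (by norm_num) hv', if_pos rfl]
  have q1 : z % 4 = 1 → ∀ l', c.cell l' it z = (l' key').getD y 0 := by
    intro h l'
    rw [hz, h, c.cell_arr _ _ hv']
  have q2 : z % 4 = 2 → ∀ l', c.cell l' it z = pos (l' key') y := by
    intro h l'
    rw [hz, h, c.cell_pos _ _ hv']
  simp only [Function.update_apply, e0, e1, e2]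
  by_cases hk : key' = key
  · subst hk
    have hl : insL l key' x key' = l key' ++ [x] := by
      rw [insL, if_neg hx, Function.update_self]
    obtain h | h | h | h : z % 4 = 0 ∨ z % 4 = 1 ∨ z % 4 = 2 ∨ z % 4 = 3 := by omega
    · rw [q0 h, q0 h, hl, h]
      by_cases hy : y = 0 <;> simp [hy]
    · rw [q1 h, q1 h, hl, getD_append_singleton, h]
      simp
    · rw [q2 h, q2 h, hl, pos_append_singleton _ hx, h]
      simp
    · have e : z = z / 4 * 4 + 3 := by omega
      rw [e, c.cell_it, c.cell_it]
      have : (z / 4 * 4 + 3) % 4 = 3 := by omega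
      simp [this]
  · simp only [hk, false_and, and_false, if_false]
    exact cell_congr hv' hz (insL_of_ne hk)

/-- The order of the writes matters when `x` is the last element: what is then written to its place
and to its position is overwritten by the zeros that follow. The zeros also keep the number of cells
in use proportional to the content. -/
theorem cell_ersL (hv : c.Valid key) (hl : (l key).Nodup) (hx : x ∈ l key) :
    c.cell (ersL l key x) it = Function.update (Function.update (Function.update
      (Function.update (Function.update (c.cell l it)
      (c.addr 1 key ((l key).idxOf x)) ((l key).getD ((l key).length - 1) 0))
      (c.addr 2 key ((l key).getD ((l key).length - 1) 0)) ((l key).idxOf x + 1))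
      (c.addr 1 key ((l key).length - 1)) 0) (c.addr 2 key x) 0)
      (c.addr 0 key 0) ((l key).length - 1) := by
  funext z
  obtain ⟨key', y, hv', hz⟩ := c.exists_addr z
  have hmod : z % 4 < 4 := Nat.mod_lt _ (by norm_num)
  have e0 : ∀ k < 4, ∀ n, z = c.addr k key n ↔ z % 4 = k ∧ key' = key ∧ y = n := by
    intro k hk n
    conv_lhs => rw [hz]
    exact c.addr_inj hmod hk hv' hv
  have q0 : z % 4 = 0 → ∀ l', c.cell l' it z = if y = 0 then (l' key').length else 0 := by
    intro h l'
    rw [hz, h, c.cell_addr _ _ (by norm_num) hv', if_pos rfl]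
  have q1 : z % 4 = 1 → ∀ l', c.cell l' it z = (l' key').getD y 0 := by
    intro h l'
    rw [hz, h, c.cell_arr _ _ hv']
  have q2 : z % 4 = 2 → ∀ l', c.cell l' it z = pos (l' key') y := by
    intro h l'
    rw [hz, h, c.cell_pos _ _ hv']
  simp only [Function.update_apply, e0 0 (by norm_num), e0 1 (by norm_num), e0 2 (by norm_num)]
  by_cases hk : key' = key
  · subst hk
    have hl' : ersL l key' x key' = swapErase (l key') x := by
      rw [ersL, Function.update_self]
    have hlen := List.idxOf_lt_length_of_mem hx
    obtain h | h | h | h : z % 4 = 0 ∨ z % 4 = 1 ∨ z % 4 = 2 ∨ z % 4 = 3 := by omega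
    · rw [q0 h, q0 h, hl', length_swapErase hx, h]
      by_cases hy : y = 0 <;> simp [hy]
    · rw [q1 h, q1 h, hl', getD_swapErase hx, h]
      simp
    · rw [q2 h, q2 h, hl', pos_swapErase hl hx, h]
      simp
    · have e : z = z / 4 * 4 + 3 := by omega
      rw [e, c.cell_it, c.cell_it]
      have : (z / 4 * 4 + 3) % 4 = 3 := by omega
      simp [this]
  · simp only [hk, false_and, and_false, if_false]
    exact cell_congr hv' hz (ersL_of_ne hk)

end cells

section raw

variable {c : Cfg d} {ρ : Var d → ℕ} {κ : KeyE d} {key : Key} {x : Expr d} {y : ℕ} {μ : ℕ → ℕ}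

theorem KeyE.Is.size_raw (h : κ.Is c ρ key) :
    κ.size.eval c.w ρ μ = μ (c.addr 0 key 0) % 2 ^ c.w := by
  rw [KeyE.size, Expr.eval, h.addr_eq (by norm_num) (eval_const (by omega)) (Nat.zero_le _)]

theorem KeyE.Is.get_raw (h : κ.Is c ρ key) (hx : x.eval c.w ρ μ = y)
    (hy : y ≤ c.B ^ (d + 1)) : (κ.get x).eval c.w ρ μ = μ (c.addr 1 key y) % 2 ^ c.w := by
  rw [KeyE.get, Expr.eval, h.addr_eq (by norm_num) hx hy]

theorem KeyE.Is.find_raw (h : κ.Is c ρ key) (hx : x.eval c.w ρ μ = y)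
    (hy : y ≤ c.B ^ (d + 1)) : (κ.find x).eval c.w ρ μ = μ (c.addr 2 key y) % 2 ^ c.w := by
  rw [KeyE.find, Expr.eval, h.addr_eq (by norm_num) hx hy]

end raw

section Run

variable {c : Cfg d} {a : AS d} {Post : AS d → Prop} {κ : KeyE d} {key : Key} {x : Expr d} {y : ℕ}

theorem run_ins (hκ : κ.Is c a.ρ key) (hx : ∀ μ, x.eval c.w a.ρ μ = y) (hy : y < c.B ^ (d + 1))
    (hn : a.n + 3 ≤ c.S) (hP : Post { a with l := insL a.l key y, n := a.n + 3 }) :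
    Run c (ins κ x) a (tm (ins κ x)) Post := by
  intro m hm
  have hcard := hm.card
  have hv := hκ.valid
  have hmem : (m : ℕ → ℕ) = c.cell a.l a.it := funext hm.mem
  have hlen := hm.sane.length_le key
  have hw : c.B ^ (d + 1) + 1 < 2 ^ c.w := by
    have h1 : c.B ^ (d + 1) < c.B ^ (d + 2) := Nat.pow_lt_pow_right c.one_lt_B (by omega)
    have h2 : c.B ^ (d + 2) < 2 ^ c.w := c.lt_word le_rfl (by omega)
    omega
  have hfind : (κ.find x).eval c.w a.ρ m = pos (a.l key) y := by
    rw [hmem]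
    exact hκ.find_eq hm.sane (hx _) hy.le
  refine Does.mono (Does.cond (T := tm (store (κ.addr 1 κ.size) x) +
    (tm (store (κ.addr 2 x) (κ.size.add (.const 1))) +
      tm (store (κ.addr 0 (.const 0)) (κ.size.add (.const 1)))))
    (Post := fun ρ' m' => ∃ l' it' n', Good c ⟨ρ', l', it', n'⟩ m' ∧ Post ⟨ρ', l', it', n'⟩)
    (by omega) (fun h => ?_) (fun h => ?_)) ?_ (fun _ _ h => h)
  · refine Does.mono (Does.nop (by omega)
      ⟨insL a.l key y, a.it, a.n + 3, ⟨?_, hm.sane.insL hy, hm.it_lt, by simp; omega⟩, hP⟩) ?_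
      (fun _ _ h => h)
    · simp only [store, tm]
      omega
    · rw [hfind, Ne, pos_eq_zero, not_not] at h
      have : insL a.l key y = a.l := if_pos h
      rw [this]
      exact hm.mem
  · rw [hfind, pos_eq_zero] at h
    set n := (a.l key).length with hn'
    have es0 : κ.size.eval c.w a.ρ m = n := by
      rw [hmem]
      exact hκ.size_eq hm.sane
    have c1 := card_support_update_le m (c.addr 1 key n) y
    set m1 := m.update (c.addr 1 key n) y with hm1
    have c2 := card_support_update_le m1 (c.addr 2 key y) (n + 1)
    set m2 := m1.update (c.addr 2 key y) (n + 1) with hm2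
    have c3 := card_support_update_le m2 (c.addr 0 key 0) (n + 1)
    set m3 := m2.update (c.addr 0 key 0) (n + 1) with hm3
    have f1 : m1 (c.addr 0 key 0) = n := by
      rw [hm1, Finsupp.coe_update, Function.update_of_ne, hmem, c.cell_cnt _ _ hv]
      rw [Ne, c.addr_inj (by norm_num) (by norm_num) hv hv]
      simp
    have f2 : m2 (c.addr 0 key 0) = n := by
      rw [hm2, Finsupp.coe_update, Function.update_of_ne, f1]
      rw [Ne, c.addr_inj (by norm_num) (by norm_num) hv hv]
      simp
    have es1 : (κ.size.add (.const 1)).eval c.w a.ρ m1 = n + 1 := by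
      refine eval_add ?_ (eval_const (by omega)) (by omega)
      rw [hκ.size_raw, f1, Nat.mod_eq_of_lt (by omega)]
    have es2 : (κ.size.add (.const 1)).eval c.w a.ρ m2 = n + 1 := by
      refine eval_add ?_ (eval_const (by omega)) (by omega)
      rw [hκ.size_raw, f2, Nat.mod_eq_of_lt (by omega)]
    refine Does.seq (Mid := fun ρ' m' => ρ' = a.ρ ∧ m' = m1) (Does.store (by omega) ⟨rfl, ?_⟩) ?_
    · rw [hκ.addr_eq (by norm_num) es0 hlen, hx]
    rintro _ _ ⟨rfl, rfl⟩
    refine Does.seq (Mid := fun ρ' m' => ρ' = a.ρ ∧ m' = m2) (Does.store (by omega) ⟨rfl, ?_⟩) ?_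
    · rw [hκ.addr_eq (by norm_num) (hx _) hy.le, es1]
    rintro _ _ ⟨rfl, rfl⟩
    refine Does.store (by omega) ⟨insL a.l key y, a.it, a.n + 3,
      ⟨?_, hm.sane.insL hy, hm.it_lt, ?_⟩, hP⟩
    · rw [hκ.addr_eq (by norm_num) (eval_const (by omega)) (Nat.zero_le _), es2]
      intro z
      simp only
      rw [cell_insL hv h, ← hmem, Finsupp.coe_update, hm2, Finsupp.coe_update, hm1,
        Finsupp.coe_update]
    · rw [hκ.addr_eq (by norm_num) (eval_const (by omega)) (Nat.zero_le _), es2, ← hm3]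
      simp only
      omega
  · simp only [ins, cond, tm]
    omega

theorem run_ers (hκ : κ.Is c a.ρ key) (hx : ∀ μ, x.eval c.w a.ρ μ = y) (hy : y < c.B ^ (d + 1))
    (hn : a.n + 5 ≤ c.S) (hP : Post { a with l := ersL a.l key y, n := a.n + 5 }) :
    Run c (ers κ x) a (tm (ers κ x)) Post := by
  intro m hm
  have hcard := hm.card
  have hv := hκ.valid
  have hmem : (m : ℕ → ℕ) = c.cell a.l a.it := funext hm.mem
  have hlen := hm.sane.length_le key
  have hw : c.B ^ (d + 1) + 1 < 2 ^ c.w := by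
    have h1 : c.B ^ (d + 1) < c.B ^ (d + 2) := Nat.pow_lt_pow_right c.one_lt_B (by omega)
    have h2 : c.B ^ (d + 2) < 2 ^ c.w := c.lt_word le_rfl (by omega)
    omega
  have hfind : (κ.find x).eval c.w a.ρ m = pos (a.l key) y := by
    rw [hmem]
    exact hκ.find_eq hm.sane (hx _) hy.le
  refine Does.mono (Does.cond (T := tm (.seq (store (κ.addr 1 ((κ.find x).sub (.const 1)))
      (κ.get (κ.size.sub (.const 1))))
    (.seq (store (κ.addr 2 (κ.get (κ.size.sub (.const 1)))) (κ.find x))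
      (.seq (store (κ.addr 1 (κ.size.sub (.const 1))) (.const 0))
        (.seq (store (κ.addr 2 x) (.const 0))
          (store (κ.addr 0 (.const 0)) (κ.size.sub (.const 1))))))) + 1)
    (Post := fun ρ' m' => ∃ l' it' n', Good c ⟨ρ', l', it', n'⟩ m' ∧ Post ⟨ρ', l', it', n'⟩)
    (by omega) (fun h => ?_) (fun h => ?_)) ?_ (fun _ _ h => h)
  · rw [hfind, Ne, pos_eq_zero, not_not] at h
    set n := (a.l key).length with hn'
    set i := (a.l key).idxOf y with hi
    set last := (a.l key).getD (n - 1) 0 with hlast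
    have hin : i < n := List.idxOf_lt_length_of_mem h
    have hpos : pos (a.l key) y = i + 1 := by rw [pos, if_pos h]
    have hll : last < c.B ^ (d + 1) := hm.sane.getD_lt _ _
    have eq_n0 : m (c.addr 0 key 0) = n := by rw [hmem, c.cell_cnt _ _ hv]
    have c1 := card_support_update_le m (c.addr 1 key i) last
    set m1 := m.update (c.addr 1 key i) last with hm1
    have c2 := card_support_update_le m1 (c.addr 2 key last) (i + 1)
    set m2 := m1.update (c.addr 2 key last) (i + 1) with hm2
    have c3 := card_support_update_le m2 (c.addr 1 key (n - 1)) 0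
    set m3 := m2.update (c.addr 1 key (n - 1)) 0 with hm3
    have c4 := card_support_update_le m3 (c.addr 2 key y) 0
    set m4 := m3.update (c.addr 2 key y) 0 with hm4
    have c5 := card_support_update_le m4 (c.addr 0 key 0) (n - 1)
    set m5 := m4.update (c.addr 0 key 0) (n - 1) with hm5
    have other : ∀ (f : ℕ →₀ ℕ) (k k' j j' v : ℕ), k < 4 → k' < 4 → k ≠ k' →
        (f.update (c.addr k key j) v) (c.addr k' key j') = f (c.addr k' key j') := by
      intro f k k' j j' v h1 h2 h3
      rw [Finsupp.coe_update, Function.update_of_ne]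
      rw [Ne, c.addr_inj h2 h1 hv hv]
      exact fun hh => h3 hh.1.symm
    have n1 : m1 (c.addr 0 key 0) = n := by rw [hm1, other _ _ _ _ _ _ (by omega) (by omega)
      (by omega), eq_n0]
    have n2 : m2 (c.addr 0 key 0) = n := by rw [hm2, other _ _ _ _ _ _ (by omega) (by omega)
      (by omega), n1]
    have n3 : m3 (c.addr 0 key 0) = n := by rw [hm3, other _ _ _ _ _ _ (by omega) (by omega)
      (by omega), n2]
    have n4 : m4 (c.addr 0 key 0) = n := by rw [hm4, other _ _ _ _ _ _ (by omega) (by omega)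
      (by omega), n3]
    have sz : ∀ f : ℕ →₀ ℕ, f (c.addr 0 key 0) = n →
        (κ.size.sub (.const 1)).eval c.w a.ρ f = n - 1 := by
      intro f hf
      refine eval_sub ?_ (eval_const (by omega)) (by omega) (show n < 2 ^ c.w by omega)
      rw [hκ.size_raw, hf, Nat.mod_eq_of_lt (by omega)]
    have g0 : (κ.get (κ.size.sub (.const 1))).eval c.w a.ρ m = last := by
      rw [hκ.get_raw (sz m eq_n0) (by omega), hmem, c.cell_arr _ _ hv]
      exact Nat.mod_eq_of_lt (by omega)
    -- The last element is read again after the first write. If `x` itself was the last element,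
    -- that write hit the cell in question, but with the value it had before.
    have g1 : (κ.get (κ.size.sub (.const 1))).eval c.w a.ρ m1 = last := by
      rw [hκ.get_raw (sz m1 n1) (by omega), hm1, Finsupp.coe_update]
      by_cases hh : i = n - 1
      · rw [hh, Function.update_self]
        exact Nat.mod_eq_of_lt (by omega)
      · rw [Function.update_of_ne, hmem, c.cell_arr _ _ hv]
        · exact Nat.mod_eq_of_lt (by omega)
        · rw [Ne, c.addr_inj (by norm_num) (by norm_num) hv hv]
          omega
    have p0 : ((κ.find x).sub (.const 1)).eval c.w a.ρ m = i := by
      rw [eval_sub (hfind.trans hpos) (eval_const (by omega)) (by omega) (by omega)]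
      omega
    have p1 : (κ.find x).eval c.w a.ρ m1 = i + 1 := by
      rw [hκ.find_raw (hx _) hy.le, hm1, other _ _ _ _ _ _ (by omega) (by omega) (by omega), hmem,
        c.cell_pos _ _ hv, hpos]
      exact Nat.mod_eq_of_lt (by omega)
    refine Does.mono ?_ (Nat.le_succ _) (fun _ _ h => h)
    refine Does.seq (Mid := fun ρ' m' => ρ' = a.ρ ∧ m' = m1) (Does.store (by omega) ⟨rfl, ?_⟩) ?_
    · rw [hκ.addr_eq (by norm_num) p0 (by omega), g0]
    rintro _ _ ⟨rfl, rfl⟩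
    refine Does.seq (Mid := fun ρ' m' => ρ' = a.ρ ∧ m' = m2) (Does.store (by omega) ⟨rfl, ?_⟩) ?_
    · rw [hκ.addr_eq (by norm_num) g1 hll.le, p1]
    rintro _ _ ⟨rfl, rfl⟩
    refine Does.seq (Mid := fun ρ' m' => ρ' = a.ρ ∧ m' = m3) (Does.store (by omega) ⟨rfl, ?_⟩) ?_
    · rw [hκ.addr_eq (by norm_num) (sz m2 n2) (by omega), eval_const (by omega)]
    rintro _ _ ⟨rfl, rfl⟩
    refine Does.seq (Mid := fun ρ' m' => ρ' = a.ρ ∧ m' = m4) (Does.store (by omega) ⟨rfl, ?_⟩) ?_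
    · rw [hκ.addr_eq (by norm_num) (hx _) hy.le, eval_const (by omega)]
    rintro _ _ ⟨rfl, rfl⟩
    have last5 : m4.update ((κ.addr 0 (.const 0)).eval c.w a.ρ m4)
        ((κ.size.sub (.const 1)).eval c.w a.ρ m4) = m5 := by
      rw [hκ.addr_eq (by norm_num) (eval_const (by omega)) (Nat.zero_le _), sz m4 n4]
    refine Does.store (by omega) ⟨ersL a.l key y, a.it, a.n + 5,
      ⟨?_, hm.sane.ersL _ _, hm.it_lt, ?_⟩, hP⟩
    · rw [last5]
      intro z
      simp only
      rw [cell_ersL hv (hm.sane key).1 h, ← hmem, hm5, Finsupp.coe_update, hm4, Finsupp.coe_update,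
        hm3, Finsupp.coe_update, hm2, Finsupp.coe_update, hm1, Finsupp.coe_update]
    · rw [last5]
      simp only
      omega
  · refine Does.mono (Does.nop (by omega)
      ⟨ersL a.l key y, a.it, a.n + 5, ⟨?_, hm.sane.ersL _ _, hm.it_lt, by simp; omega⟩, hP⟩)
      (Nat.le_add_left _ _) (fun _ _ h => h)
    rw [hfind, pos_eq_zero] at h
    have : ersL a.l key y = a.l := by
      rw [ersL, swapErase, if_neg h, Function.update_eq_self]
    rw [this]
    exact hm.mem
  · simp only [ers, cond, tm]
    omega

/-- Loop over the elements of a stored set. -/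
def forE (vi vx : Var d) (κ : KeyE d) (p : Prog) : Prog :=
  .seq (asg vi (.const 0)) (while_ ((Expr.var vi).lt κ.size)
    (.seq (asg vx (κ.get (.var vi))) (.seq p (asg vi ((Expr.var vi).add (.const 1))))))

/-- The time per iteration that is spent on the control of a loop. -/
def forCost (vi vx : Var d) (κ : KeyE d) : ℕ :=
  tm (asg vi (.const 0)) + tm (((Expr.var vi).lt κ.size).compile 0) + 1 +
    tm (asg vx (κ.get (.var vi))) + tm (asg vi ((Expr.var vi).add (.const 1)))

/-- The body may change any stored set except the one that is traversed, which is what the list `L`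
in the invariant ensures. The invariant must not depend on the two loop variables, and the body has
to preserve the counter. -/
theorem run_forE {vi vx : Var d} (hne : vi ≠ vx) {p : Prog} {T : ℕ} {L : List ℕ}
    (I : ℕ → AS d → Prop) (h0 : I 0 a)
    (hset : ∀ n b y, I n b → I n (b.set vi y) ∧ I n (b.set vx y))
    (hI : ∀ n b, I n b → κ.Is c b.ρ key ∧ b.l key = L ∧ b.n ≤ c.S)
    (hbody : ∀ n (hn : n < L.length) b, I n b → b.ρ vi = n → b.ρ vx = L[n] →
      Run c p b T fun b' => I (n + 1) b' ∧ b'.ρ vi = n) :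
    Run c (forE vi vx κ p) a ((L.length + 1) * (T + forCost vi vx κ)) (I L.length) := by
  intro m hm
  have key_lem : ∀ (n : ℕ) (ρ : Var d → ℕ) (m : ℕ →₀ ℕ) (l' it' n'), Good c ⟨ρ, l', it', n'⟩ m →
      I n ⟨ρ, l', it', n'⟩ → ρ vi = n → n ≤ L.length →
      Tests c ρ m ((Expr.var vi).lt κ.size) (n < L.length) := by
    intro n ρ m l' it' n' hg hIn hv hle
    obtain ⟨k1, k2, k3⟩ := hI _ _ hIn
    simp only at k1 k2 k3
    have hmem : (m : ℕ → ℕ) = c.cell l' it' := funext hg.mem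
    have hlen := hg.sane.length_le key
    simp only [k2] at hlen
    rw [hmem]
    refine Tests.lt (eval_var vi hv (c.lt_word (hle.trans hlen) (by omega))) ?_
    rw [k1.size_eq hg.sane]
    exact congrArg List.length k2
  obtain ⟨-, -, hS⟩ := hI 0 a h0
  refine Does.mono (Does.seq (Mid := fun ρ' m' => ∃ l' it' n', Good c ⟨ρ', l', it', n'⟩ m' ∧
    I 0 ⟨ρ', l', it', n'⟩ ∧ ρ' vi = 0) (Does.asg (hm.card.trans hS) ?_)
    (T₂ := (L.length + 1) * (tm (((Expr.var vi).lt κ.size).compile 0) + 1 +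
      (tm (asg vx (κ.get (.var vi))) + (T + tm (asg vi ((Expr.var vi).add (.const 1))))))) ?_)
      ?_ (fun _ _ h => h)
  · rw [eval_const (by omega)]
    exact ⟨a.l, a.it, a.n, ⟨hm.mem, hm.sane, hm.it_lt, hm.card⟩, (hset 0 a 0 h0).1, by simp⟩
  · rintro ρ1 m1 ⟨l1, it1, n1, hg1, hI1, hv1⟩
    refine Does.mono (Does.while_ (L := L.length) (fun n ρ' m' => n ≤ L.length ∧
      ∃ l' it' n', Good c ⟨ρ', l', it', n'⟩ m' ∧ I n ⟨ρ', l', it', n'⟩ ∧ ρ' vi = n)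
      ?_ ?_ ?_ ?_) le_rfl ?_
    · rintro n ρ m ⟨-, l', it', n', hg, hI', hv⟩
      exact hg.card.trans (hI _ _ hI').2.2
    · rintro n hn ρ m ⟨-, l', it', n', hg, hI', hv⟩
      obtain ⟨k1, k2, k3⟩ := hI _ _ hI'
      simp only at k1 k2 k3
      have hlen := hg.sane.length_le key
      simp only [k2] at hlen
      refine ⟨((key_lem n ρ m l' it' n' hg hI' hv hn.le).ne_zero).2 hn, ?_⟩
      have hmem : (m : ℕ → ℕ) = c.cell l' it' := funext hg.mem
      have hw : n < 2 ^ c.w := c.lt_word (hn.le.trans hlen) (by omega)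
      have hget : (κ.get (.var vi)).eval c.w ρ m = L[n] := by
        rw [hmem, k1.get_eq hg.sane (eval_var vi hv hw) (by omega)]
        simp only [k2]
        exact List.getD_eq_getElem _ _ hn
      refine Does.seq (Mid := fun ρ' m' => ρ' = Function.update ρ vx L[n] ∧ m' = m)
        (Does.asg (hg.card.trans k3) ⟨by rw [hget], rfl⟩) ?_
      rintro _ _ ⟨rfl, rfl⟩
      refine Does.seq (Mid := fun ρ' m' => ∃ l' it' n', Good c ⟨ρ', l', it', n'⟩ m' ∧
        I (n + 1) ⟨ρ', l', it', n'⟩ ∧ ρ' vi = n) (Does.mono (hbody n hn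
          (AS.set ⟨ρ, l', it', n'⟩ vx L[n]) (hset _ _ _ hI').2 ?_ ?_ _
          ⟨hg.mem, hg.sane, hg.it_lt, hg.card⟩) le_rfl (fun _ _ h => h)) ?_
      · simp only [AS.set]
        rw [Function.update_of_ne hne]
        exact hv
      · simp [AS.set]
      rintro ρ2 m2 ⟨l2, it2, n2, hg2, hI2, hv2⟩
      -- The counter is below the length of a list of distinct numbers with at most `d + 1` digits,
      -- so the increment does not wrap around.
      have hadd : ((Expr.var vi).add (.const 1)).eval c.w ρ2 m2 = n + 1 :=
        eval_add (eval_var vi hv2 hw) (eval_const (by omega))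
          (c.lt_word (k := d + 1) (by omega) (by omega))
      refine Does.asg (hg2.card.trans (hI _ _ hI2).2.2) ⟨by omega, l2, it2, n2,
        ⟨hg2.mem, hg2.sane, hg2.it_lt, hg2.card⟩, ?_, ?_⟩
      · rw [hadd]
        exact (hset _ _ _ hI2).1
      · rw [hadd]
        simp
    · rintro ρ m ⟨-, l', it', n', hg, hI', hv⟩
      exact (key_lem _ ρ m l' it' n' hg hI' hv le_rfl).2 (lt_irrefl _)
    · exact ⟨Nat.zero_le _, l1, it1, n1, hg1, hI1, hv1⟩
    · rintro ρ' m' ⟨-, l', it', n', h1, h2, -⟩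
      exact ⟨l', it', n', h1, h2⟩
  · simp only [forCost]
    rw [add_mul, one_mul, add_mul, one_mul]
    have : L.length * (tm (((Expr.var vi).lt κ.size).compile 0) + 1 +
      (tm (asg vx (κ.get (.var vi))) + (T + tm (asg vi ((Expr.var vi).add (.const 1)))))) ≤
      L.length * (T + (tm (asg vi (.const 0)) + tm (((Expr.var vi).lt κ.size).compile 0) + 1 +
    tm (asg vx (κ.get (.var vi))) + tm (asg vi ((Expr.var vi).add (.const 1))))) :=
      Nat.mul_le_mul_left _ (by omega)
    omega

/-- The programs `f 0, …, f (n - 1)`, one after the other. -/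
def seqs (f : ℕ → Prog) : ℕ → Prog
  | 0 => .nop
  | n + 1 => .seq (seqs f n) (f n)

theorem run_seqs {f : ℕ → Prog} {T : ℕ → ℕ} (I : ℕ → AS d → Prop) (h0 : I 0 a)
    (hS : a.n ≤ c.S) (n : ℕ) (hstep : ∀ i < n, ∀ b, I i b → Run c (f i) b (T i) (I (i + 1))) :
    Run c (seqs f n) a (1 + ∑ i ∈ Finset.range n, T i) (I n) := by
  induction n with
  | zero => exact run_nop hS h0
  | succ n ih =>
    rw [Finset.sum_range_succ, ← add_assoc]
    exact (ih fun i hi => hstep i (by omega)).seq fun b hb => hstep n (by omega) b hb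

end Run

end StarMaintenance

/-! ### The logical content: heavy values, patterns, groups, and registration of tuples. -/

namespace StarMaintenance

open WordRAM Classical

/-- The logical content of the data structure for a star query `Q`: the base `B` of the coding of
tuples as numbers, the codes of the tuples of the center relation (as seen by each attribute), the
satellite relations, the degree threshold `thr` between light and heavy values, and the set `reg`
of the tuples that are registered in the groups. -/
structure Sem (Q : StarQuery) where
  B : ℕ
  cen : ℕ → Finset ℕ
  sat : ℕ → Finset ℕ
  thr : ℕ
  reg : Finset ℕ

namespace Sem

variable {Q : StarQuery}

/-- The number of bound variables. -/
abbrev _root_.StarQuery.e (Q : StarQuery) : ℕ := Q.d - Q.j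

variable (σ : Sem Q)

/-- The degree of a value of the attribute `i`. -/
noncomputable def deg (i v : ℕ) : ℕ := ((σ.cen i).filter fun y => dig σ.B i y = v).card

def Heavy (i v : ℕ) : Prop := σ.thr ≤ σ.deg i v

/-- The digit number `i` of the pattern of the tuple `y`: its value there if it is heavy. -/
noncomputable def pdig (y i : ℕ) : ℕ :=
  if σ.Heavy i (dig σ.B i y) then dig σ.B i y + 1 else 0

/-- The pattern of a tuple: its heavy values. -/
noncomputable def P (y : ℕ) : ℕ := pack σ.B (σ.pdig y) Q.d

/-- The group of a tuple: its heavy values of bound attributes and its values of output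
attributes. -/
noncomputable def G (y : ℕ) : ℕ :=
  pack σ.B (fun i => if i < Q.e then σ.pdig y i else dig σ.B i y + 1) Q.d

/-- The light values of the tuple belong to the satellites. -/
def LightAlive (y : ℕ) : Prop :=
  ∀ i < Q.k, σ.Heavy i (dig σ.B i y) ∨ dig σ.B i y ∈ σ.sat i

/-- The values of output attributes in a pattern belong to the satellites. -/
def OutAlive (p : ℕ) : Prop :=
  ∀ i < Q.k, Q.e ≤ i → dig σ.B i p = 0 ∨ (1 ≤ dig σ.B i p ∧ dig σ.B i p - 1 ∈ σ.sat i)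

/-- The stored sets: for every name of a set, its elements. -/
def spec : Key → ℕ → Prop
  | (0, i, u), z => i = 0 ∧ u = 0 ∧
      ∃ y ∈ σ.reg, σ.LightAlive y ∧ σ.OutAlive (σ.P y) ∧ σ.P y % σ.B ^ Q.e = z
  | (1, i, v), z => i < Q.d ∧ z ∈ σ.cen i ∧ dig σ.B i z = v
  | (2, i, δ), z => i < Q.d ∧ 1 ≤ δ ∧ δ ≤ σ.deg i z
  | (3, i, u), z => i < Q.k ∧ u = 0 ∧ 1 ≤ z ∧ z - 1 ∈ σ.sat i
  | (4, i, q), z => i = 0 ∧ z ∈ σ.reg ∧ σ.LightAlive z ∧ σ.G z = q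
  | (5, i, p), z => i = 0 ∧ ∃ y ∈ σ.reg, σ.LightAlive y ∧ σ.P y = p ∧ σ.G y = z
  | (6, i, u), z => Q.e ≤ i ∧ i < Q.k ∧ u ≠ 0 ∧ dig σ.B i z = u ∧
      ∃ y ∈ σ.reg, σ.LightAlive y ∧ σ.P y = z
  | (7, i, β), z => i = 0 ∧ z % σ.B ^ Q.e = β ∧ σ.OutAlive z ∧
      ∃ y ∈ σ.reg, σ.LightAlive y ∧ σ.P y = z
  | _, _ => False

/-- The number `y` codes a tuple, and there is room for `0` besides its digits. -/
def Ok (Q : StarQuery) (B y : ℕ) : Prop := y < B ^ Q.d ∧ ∀ i < Q.d, dig B i y + 1 < B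

variable {σ} {y y' : ℕ}

theorem pdig_lt (h : Ok Q σ.B y) {i : ℕ} (hi : i < Q.d) : σ.pdig y i < σ.B := by
  have := h.2 i hi
  unfold pdig
  split_ifs <;> omega

theorem gdig_lt (h : Ok Q σ.B y) {i : ℕ} (hi : i < Q.d) :
    (if i < Q.e then σ.pdig y i else dig σ.B i y + 1) < σ.B := by
  split_ifs
  exacts [pdig_lt h hi, h.2 i hi]

theorem e_le : Q.e ≤ Q.d := Nat.sub_le _ _

theorem dig_P (h : Ok Q σ.B y) {i : ℕ} (hi : i < Q.d) : dig σ.B i (σ.P y) = σ.pdig y i :=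
  dig_pack (lt_of_le_of_lt (Nat.zero_le _) (h.2 i hi)) (fun _ hj => pdig_lt h hj) hi

theorem dig_G (h : Ok Q σ.B y) {i : ℕ} (hi : i < Q.d) :
    dig σ.B i (σ.G y) = if i < Q.e then σ.pdig y i else dig σ.B i y + 1 :=
  dig_pack (lt_of_le_of_lt (Nat.zero_le _) (h.2 i hi)) (fun _ hj => gdig_lt h hj) hi

theorem P_lt (h : Ok Q σ.B y) : σ.P y < σ.B ^ Q.d := pack_lt fun _ hj => pdig_lt h hj

theorem G_lt (h : Ok Q σ.B y) : σ.G y < σ.B ^ Q.d := pack_lt fun _ hj => gdig_lt h hj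

/-- The group determines the pattern: at a bound attribute it contains the digit of the pattern, and
at an output attribute the value itself, which decides whether it is heavy. -/
theorem pdig_eq_of_G_eq (h : Ok Q σ.B y) (h' : Ok Q σ.B y') (hG : σ.G y = σ.G y') {i : ℕ}
    (hi : i < Q.d) : σ.pdig y i = σ.pdig y' i := by
  have h1 := dig_G h hi
  rw [hG, dig_G h' hi] at h1
  split_ifs at h1 with h2
  · exact h1.symm
  · have : dig σ.B i y = dig σ.B i y' := by omega
    rw [pdig, pdig, this]

theorem P_eq_of_G_eq (h : Ok Q σ.B y) (h' : Ok Q σ.B y') (hG : σ.G y = σ.G y') :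
    σ.P y = σ.P y' :=
  pack_congr fun _ hi => pdig_eq_of_G_eq h h' hG hi

/-- Registration of a tuple. -/
noncomputable def addReg (σ : Sem Q) (y : ℕ) : Sem Q := { σ with reg := insert y σ.reg }

/-- Removal of a tuple from the groups. -/
noncomputable def delReg (σ : Sem Q) (y : ℕ) : Sem Q := { σ with reg := σ.reg.erase y }

/-- What is to be inserted for the registration of a light-alive tuple `y`. -/
def news (σ : Sem Q) (y : ℕ) (key : Key) (z : ℕ) : Prop :=
  (key = (4, 0, σ.G y) ∧ z = y) ∨ (key = (5, 0, σ.P y) ∧ z = σ.G y) ∨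
  (∃ i < Q.k, Q.e ≤ i ∧ dig σ.B i (σ.P y) ≠ 0 ∧ key = (6, i, dig σ.B i (σ.P y)) ∧ z = σ.P y) ∨
  (σ.OutAlive (σ.P y) ∧ key = (7, 0, σ.P y % σ.B ^ Q.e) ∧ z = σ.P y) ∨
  (σ.OutAlive (σ.P y) ∧ key = (0, 0, 0) ∧ z = σ.P y % σ.B ^ Q.e)

/-- The registered tuples enter the specification only through existential statements, so a new
tuple adds exactly those pairs of which it is a witness itself. -/
theorem spec_addReg (hy : σ.LightAlive y) (key : Key) (z : ℕ) :
    (σ.addReg y).spec key z ↔ σ.spec key z ∨ σ.news y key z := by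
  obtain ⟨g, i, u⟩ := key
  have e1 : ∀ x, (σ.addReg y).LightAlive x = σ.LightAlive x := fun _ => rfl
  have e2 : ∀ x, (σ.addReg y).OutAlive x = σ.OutAlive x := fun _ => rfl
  have e3 : ∀ x, (σ.addReg y).P x = σ.P x := fun _ => rfl
  have e4 : ∀ x, (σ.addReg y).G x = σ.G x := fun _ => rfl
  have e5 : ∀ x v, (σ.addReg y).deg x v = σ.deg x v := fun _ _ => rfl
  have e6 : (σ.addReg y).B = σ.B := rfl
  have e7 : (σ.addReg y).reg = insert y σ.reg := rfl
  have e8 : (σ.addReg y).sat = σ.sat := rfl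
  have e9 : (σ.addReg y).cen = σ.cen := rfl
  match g with
  | 0 =>
    simp only [spec, news, e1, e2, e3, e6, e7, Finset.exists_mem_insert,
      Prod.mk.injEq]
    grind
  | 1 => simp [spec, news, e6, e9]
  | 2 => simp [spec, news, e5]
  | 3 => simp [spec, news, e8]
  | 4 =>
    simp only [spec, news, e1, e4, e7, Finset.mem_insert,
      Prod.mk.injEq]
    grind
  | 5 =>
    simp only [spec, news, e1, e3, e4, e7, Finset.exists_mem_insert,
      Prod.mk.injEq]
    grind
  | 6 =>
    simp only [spec, news, e1, e3, e6, e7, Finset.exists_mem_insert,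
      Prod.mk.injEq]
    grind
  | 7 =>
    simp only [spec, news, e1, e2, e3, e6, e7, Finset.exists_mem_insert,
      Prod.mk.injEq]
    grind
  | n + 8 => simp [spec, news]

/-- All sets that refer to registered tuples demand live light values; a tuple with a dead light
value is registered without leaving a trace. -/
theorem spec_addReg_of_not (hy : ¬ σ.LightAlive y) (key : Key) (z : ℕ) :
    (σ.addReg y).spec key z ↔ σ.spec key z := by
  obtain ⟨g, i, u⟩ := key
  have e1 : ∀ x, (σ.addReg y).LightAlive x = σ.LightAlive x := fun _ => rfl
  have e2 : ∀ x, (σ.addReg y).OutAlive x = σ.OutAlive x := fun _ => rfl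
  have e3 : ∀ x, (σ.addReg y).P x = σ.P x := fun _ => rfl
  have e4 : ∀ x, (σ.addReg y).G x = σ.G x := fun _ => rfl
  have e6 : (σ.addReg y).B = σ.B := rfl
  have e7 : (σ.addReg y).reg = insert y σ.reg := rfl
  match g with
  | 1 | 2 | 3 => exact Iff.rfl
  | 0 | 5 | 6 | 7 =>
    simp [spec, e1, e2, e3, e4, e6, e7, hy]
  | 4 =>
    simp only [spec, e1, e4, e7, Finset.mem_insert]
    grind
  | n + 8 => simp [spec]

/-- Removal of a tuple from the groups, where empty groups are removed in a cascade. -/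
theorem spec_delReg (hok : ∀ x ∈ σ.reg, Ok Q σ.B x) (hy : Ok Q σ.B y) (key : Key) (z : ℕ) :
    (σ.delReg y).spec key z ↔ σ.spec key z ∧
      ¬ (key = (4, 0, σ.G y) ∧ z = y) ∧
      ((∀ x ∈ σ.reg, x ≠ y → σ.LightAlive x → σ.G x ≠ σ.G y) →
        ¬ (key = (5, 0, σ.P y) ∧ z = σ.G y)) ∧
      ((∀ x ∈ σ.reg, x ≠ y → σ.LightAlive x → σ.P x ≠ σ.P y) →
        ¬ (∃ i < Q.k, Q.e ≤ i ∧ dig σ.B i (σ.P y) ≠ 0 ∧ key = (6, i, dig σ.B i (σ.P y)) ∧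
          z = σ.P y) ∧
        ¬ (key = (7, 0, σ.P y % σ.B ^ Q.e) ∧ z = σ.P y)) ∧
      ((∀ x ∈ σ.reg, x ≠ y → σ.LightAlive x → σ.OutAlive (σ.P x) →
          σ.P x % σ.B ^ Q.e ≠ σ.P y % σ.B ^ Q.e) →
        ¬ (key = (0, 0, 0) ∧ z = σ.P y % σ.B ^ Q.e)) := by
  obtain ⟨g, i, u⟩ := key
  have e1 : ∀ x, (σ.delReg y).LightAlive x = σ.LightAlive x := fun _ => rfl
  have e2 : ∀ x, (σ.delReg y).OutAlive x = σ.OutAlive x := fun _ => rfl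
  have e3 : ∀ x, (σ.delReg y).P x = σ.P x := fun _ => rfl
  have e4 : ∀ x, (σ.delReg y).G x = σ.G x := fun _ => rfl
  have e5 : ∀ x v, (σ.delReg y).deg x v = σ.deg x v := fun _ _ => rfl
  have e6 : (σ.delReg y).B = σ.B := rfl
  have e7 : (σ.delReg y).reg = σ.reg.erase y := rfl
  have e8 : (σ.delReg y).sat = σ.sat := rfl
  have e9 : (σ.delReg y).cen = σ.cen := rfl
  match g with
  | 0 =>
    simp only [spec, e1, e2, e3, e6, e7, Finset.mem_erase, Prod.mk.injEq]
    constructor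
    · rintro ⟨h1, h2, x, ⟨h3, h4⟩, h5, h6, h7⟩
      grind
    · rintro ⟨⟨h1, h2, x, h4, h5, h6, h7⟩, -, -, -, h8⟩
      -- If the only known witness is the tuple that leaves, then either another tuple supports the
      -- same bound part or the cascade has removed it.
      by_cases hx : x = y
      · subst hx
        by_contra hcon
        refine h8 ?_ ⟨⟨trivial, h1, h2⟩, h7.symm⟩
        intro x' hx' hne hl ho heq
        exact hcon ⟨h1, h2, x', ⟨hne, hx'⟩, hl, ho, heq.trans h7⟩
      · exact ⟨h1, h2, x, ⟨hx, h4⟩, h5, h6, h7⟩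
  | 1 => simp [spec, e6, e9]
  | 2 => simp [spec, e5]
  | 3 => simp [spec, e8]
  | 4 =>
    simp only [spec, e1, e4, e7, Finset.mem_erase, Prod.mk.injEq]
    grind
  | 5 =>
    simp only [spec, e1, e3, e4, e7, Finset.mem_erase, Prod.mk.injEq]
    constructor
    · rintro ⟨h1, x, ⟨h3, h4⟩, h5, h6, h7⟩
      grind
    · rintro ⟨⟨h1, x, h4, h5, h6, h7⟩, -, h8, -, -⟩
      by_cases hx : x = y
      · subst hx
        by_contra hcon
        refine h8 ?_ ⟨⟨trivial, h1, h6.symm⟩, h7.symm⟩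
        intro x' hx' hne hl heq
        exact hcon ⟨h1, x', ⟨hne, hx'⟩, hl, (P_eq_of_G_eq (hok _ hx') hy heq).trans h6,
          heq.trans h7⟩
      · exact ⟨h1, x, ⟨hx, h4⟩, h5, h6, h7⟩
  | 6 =>
    simp only [spec, e1, e3, e6, e7, Finset.mem_erase, Prod.mk.injEq]
    constructor
    · rintro ⟨h1, h2, h0, h, x, ⟨h3, h4⟩, h5, h6⟩
      grind
    · rintro ⟨⟨h1, h2, h0, h, x, h4, h5, h6⟩, -, -, h8, -⟩
      by_cases hx : x = y
      · subst hx
        by_contra hcon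
        refine (h8 ?_).1 ⟨i, h2, h1, by rw [h6, h]; exact h0, ⟨trivial, rfl, by rw [h6, h]⟩, h6.symm⟩
        intro x' hx' hne hl heq
        exact hcon ⟨h1, h2, h0, h, x', ⟨hne, hx'⟩, hl, heq.trans h6⟩
      · exact ⟨h1, h2, h0, h, x, ⟨hx, h4⟩, h5, h6⟩
  | 7 =>
    simp only [spec, e1, e2, e3, e6, e7, Finset.mem_erase, Prod.mk.injEq]
    constructor
    · rintro ⟨h1, h2, h0, x, ⟨h3, h4⟩, h5, h6⟩
      grind
    · rintro ⟨⟨h1, h2, h0, x, h4, h5, h6⟩, -, -, h8, -⟩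
      by_cases hx : x = y
      · subst hx
        by_contra hcon
        refine (h8 ?_).2 ⟨⟨trivial, h1, by rw [h6, h2]⟩, h6.symm⟩
        intro x' hx' hne hl heq
        exact hcon ⟨h1, h2, h0, x', ⟨hne, hx'⟩, hl, heq.trans h6⟩
      · exact ⟨h1, h2, h0, x, ⟨hx, h4⟩, h5, h6⟩
  | n + 8 => simp [spec]

end Sem

end StarMaintenance

/-! ### Sizes of the stored sets, and the programs for registration and its reversal. -/

namespace StarMaintenance

open WordRAM Classical

variable {Q : StarQuery}

/-- The rank of a variable; procedures leave variables of small rank alone. -/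
def Var.rank {d : ℕ} : Var d → ℕ
  | .inp _ => 0
  | .loc n => n + 1

/-- The variables of rank less than `m` have the same values. -/
def Agree {d : ℕ} (m : ℕ) (ρ ρ' : Var d → ℕ) : Prop := ∀ v : Var d, v.rank < m → ρ' v = ρ v

theorem Agree.refl {d : ℕ} (m : ℕ) (ρ : Var d → ℕ) : Agree m ρ ρ := fun _ _ => rfl

theorem Agree.trans {d m : ℕ} {ρ ρ' ρ'' : Var d → ℕ} (h : Agree m ρ ρ') (h' : Agree m ρ' ρ'') :
    Agree m ρ ρ'' := fun v hv => (h' v hv).trans (h v hv)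

theorem Agree.mono {d m m' : ℕ} {ρ ρ' : Var d → ℕ} (h : Agree m ρ ρ') (hm : m' ≤ m) :
    Agree m' ρ ρ' := fun v hv => h v (hv.trans_le hm)

theorem Agree.update {d m : ℕ} {ρ ρ' : Var d → ℕ} (h : Agree m ρ ρ') {v : Var d}
    (hv : m ≤ v.rank) (x : ℕ) : Agree m ρ (Function.update ρ' v x) := by
  intro v' hv'
  rw [Function.update_of_ne (fun hh => by subst hh; omega)]
  exact h v' hv'

namespace Sem

/-- The parameters of `σ` fit the machine. -/
structure Wf (σ : Sem Q) (c : Cfg Q.d) : Prop where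
  B : σ.B = c.B
  reg : ∀ y ∈ σ.reg, Ok Q σ.B y
  cen : ∀ i < Q.d, ∀ y ∈ σ.cen i, Ok Q σ.B y
  sat : ∀ i < Q.k, ∀ v ∈ σ.sat i, v + 1 < σ.B
  thr : σ.thr ≤ σ.B ^ Q.d

/-- A bound for the number of elements of the stored sets. -/
def weight (σ : Sem Q) : ℕ :=
  2 * ∑ i ∈ Finset.range Q.d, (σ.cen i).card + ∑ i ∈ Finset.range Q.k, (σ.sat i).card +
    (Q.k + 4) * σ.reg.card

variable {σ : Sem Q}

/-- Each tuple is counted at exactly one value. This keeps the sets of kind 2 linear, in which a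
value occurs once for every level up to its degree. -/
theorem sum_deg (i : ℕ) : ∑ v ∈ (σ.cen i).image (dig σ.B i), σ.deg i v = (σ.cen i).card :=
  (Finset.card_eq_sum_card_image (dig σ.B i) (σ.cen i)).symm

theorem mem_image_of_deg {i v : ℕ} (h : 1 ≤ σ.deg i v) : v ∈ (σ.cen i).image (dig σ.B i) := by
  obtain ⟨y, hy⟩ := Finset.card_pos.1 (show 0 < σ.deg i v from h)
  rw [Finset.mem_filter] at hy
  exact Finset.mem_image.2 ⟨y, hy⟩

/-- The pairs of names and elements of the stored sets. -/
noncomputable def pairs (σ : Sem Q) : Finset (Key × ℕ) :=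
  ((Finset.range Q.d).biUnion fun i => (σ.cen i).image fun y => ((1, i, dig σ.B i y), y)) ∪
  ((Finset.range Q.d).biUnion fun i => ((σ.cen i).image (dig σ.B i)).biUnion fun v =>
    (Finset.Icc 1 (σ.deg i v)).image fun δ => ((2, i, δ), v)) ∪
  ((Finset.range Q.k).biUnion fun i => (σ.sat i).image fun v => ((3, i, 0), v + 1)) ∪
  (σ.reg.image fun y => ((4, 0, σ.G y), y)) ∪ (σ.reg.image fun y => ((5, 0, σ.P y), σ.G y)) ∪
  ((Finset.range Q.k).biUnion fun i => σ.reg.image fun y => ((6, i, dig σ.B i (σ.P y)), σ.P y)) ∪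
  (σ.reg.image fun y => ((7, 0, σ.P y % σ.B ^ Q.e), σ.P y)) ∪
  (σ.reg.image fun y => ((0, 0, 0), σ.P y % σ.B ^ Q.e))

theorem mem_pairs {key : Key} {z : ℕ} (h : σ.spec key z) : (key, z) ∈ σ.pairs := by
  obtain ⟨g, i, u⟩ := key
  simp only [pairs, Finset.mem_union, Finset.mem_biUnion, Finset.mem_image, Finset.mem_range,
    Finset.mem_Icc, Prod.mk.injEq]
  match g, h with
  | 0, h =>
    obtain ⟨rfl, rfl, y, h1, h2, h3, h4⟩ := h
    exact Or.inr ⟨y, h1, ⟨rfl, rfl, rfl⟩, h4⟩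
  | 1, h =>
    obtain ⟨h1, h2, h3⟩ := h
    iterate 7 apply Or.inl
    exact ⟨i, h1, z, h2, ⟨rfl, rfl, h3⟩, rfl⟩
  | 2, h =>
    obtain ⟨h1, h2, h3⟩ := h
    iterate 6 apply Or.inl
    exact Or.inr ⟨i, h1, z, Finset.mem_image.1 (mem_image_of_deg (h2.trans h3)), u, ⟨h2, h3⟩,
      ⟨rfl, rfl, rfl⟩, rfl⟩
  | 3, h =>
    obtain ⟨h1, rfl, h2, h3⟩ := h
    iterate 5 apply Or.inl
    exact Or.inr ⟨i, h1, z - 1, h3, ⟨rfl, rfl, rfl⟩, by omega⟩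
  | 4, h =>
    obtain ⟨rfl, h1, h2, h3⟩ := h
    iterate 4 apply Or.inl
    exact Or.inr ⟨z, h1, ⟨rfl, rfl, h3⟩, rfl⟩
  | 5, h =>
    obtain ⟨rfl, y, h1, h2, h3, h4⟩ := h
    iterate 3 apply Or.inl
    exact Or.inr ⟨y, h1, ⟨rfl, rfl, h3⟩, h4⟩
  | 6, h =>
    obtain ⟨h0, h1, h2, h3, y, h4, h5, h6⟩ := h
    iterate 2 apply Or.inl
    exact Or.inr ⟨i, h1, y, h4, ⟨rfl, rfl, by rw [h6, h3]⟩, h6⟩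
  | 7, h =>
    obtain ⟨rfl, h1, h2, y, h3, h4, h5⟩ := h
    exact Or.inl (Or.inr ⟨y, h3, ⟨rfl, rfl, by rw [h5, h1]⟩, h5⟩)

/-- Kinds 1 and 2 each contribute the size of the center per attribute, the latter by `sum_deg`;
kind 3 contributes the satellites, kind 6 at most `Q.k` pairs per registered tuple, and kinds 0, 4,
5 and 7 at most one each. -/
theorem card_pairs_le : σ.pairs.card ≤ σ.weight := by
  unfold pairs weight
  refine (Finset.card_union_le _ _).trans ?_
  refine (add_le_add_left (Finset.card_union_le _ _) _).trans ?_
  refine (add_le_add_left (add_le_add_left (Finset.card_union_le _ _) _) _).trans ?_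
  refine (add_le_add_left (add_le_add_left (add_le_add_left (Finset.card_union_le _ _) _) _)
    _).trans ?_
  refine (add_le_add_left (add_le_add_left (add_le_add_left (add_le_add_left
    (Finset.card_union_le _ _) _) _) _) _).trans ?_
  refine (add_le_add_left (add_le_add_left (add_le_add_left (add_le_add_left (add_le_add_left
    (Finset.card_union_le _ _) _) _) _) _) _).trans ?_
  refine (add_le_add_left (add_le_add_left (add_le_add_left (add_le_add_left (add_le_add_left
    (add_le_add_left (Finset.card_union_le _ _) _) _) _) _) _) _).trans ?_
  have h1 : ((Finset.range Q.d).biUnion fun i => (σ.cen i).image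
      fun y => (((1, i, dig σ.B i y), y) : Key × ℕ)).card ≤
      ∑ i ∈ Finset.range Q.d, (σ.cen i).card :=
    Finset.card_biUnion_le.trans (Finset.sum_le_sum fun i _ => Finset.card_image_le)
  have h2 : ((Finset.range Q.d).biUnion fun i => ((σ.cen i).image (dig σ.B i)).biUnion fun v =>
      (Finset.Icc 1 (σ.deg i v)).image fun δ => (((2, i, δ), v) : Key × ℕ)).card ≤
      ∑ i ∈ Finset.range Q.d, (σ.cen i).card := by
    refine Finset.card_biUnion_le.trans (Finset.sum_le_sum fun i _ => ?_)
    rw [← sum_deg]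
    refine Finset.card_biUnion_le.trans (Finset.sum_le_sum fun v _ => ?_)
    exact Finset.card_image_le.trans (by simp)
  have h3 : ((Finset.range Q.k).biUnion fun i => (σ.sat i).image
      fun v => (((3, i, 0), v + 1) : Key × ℕ)).card ≤ ∑ i ∈ Finset.range Q.k, (σ.sat i).card :=
    Finset.card_biUnion_le.trans (Finset.sum_le_sum fun i _ => Finset.card_image_le)
  have h4 : ∀ f : ℕ → Key × ℕ, (σ.reg.image f).card ≤ σ.reg.card := fun f => Finset.card_image_le
  have h6 : ((Finset.range Q.k).biUnion fun i => σ.reg.image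
      fun y => (((6, i, dig σ.B i (σ.P y)), σ.P y) : Key × ℕ)).card ≤ Q.k * σ.reg.card := by
    refine Finset.card_biUnion_le.trans ((Finset.sum_le_sum fun i _ => h4 _).trans ?_)
    simp
  have h7 := h4 fun y => ((4, 0, σ.G y), y)
  have h8 := h4 fun y => ((5, 0, σ.P y), σ.G y)
  have h9 := h4 fun y => ((7, 0, σ.P y % σ.B ^ Q.e), σ.P y)
  have h10 := h4 fun y => ((0, 0, 0), σ.P y % σ.B ^ Q.e)
  rw [add_mul]
  omega

end Sem

theorem holds_of_spec {σ : Sem Q} {l : Key → List ℕ} {it : ℕ → ℕ} {n : ℕ} {E' : Finset ℕ}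
    (h : ∀ key z, z ∈ l key → σ.spec key z) (hit : ∀ x, it x ≠ 0 → x ∈ E')
    (hn : 3 * σ.weight + E'.card ≤ n) : Holds l it n := by
  refine ⟨σ.pairs, E', fun key z hz => Sem.mem_pairs (h key z hz), hit, ?_⟩
  have := σ.card_pairs_le
  omega

/-- The abstract state `a` stores the sets of `σ`, and is stored in at most `W` cells. -/
structure St (c : Cfg Q.d) (W : ℕ) (σ : Sem Q) (a : AS Q.d) : Prop where
  wf : σ.Wf c
  mem : ∀ key z, z ∈ a.l key ↔ σ.spec key z
  thr : a.ρ (.loc 1) = σ.thr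
  n : a.n ≤ W
  it : ∀ x, a.it x = 0

/-- The procedures that maintain the groups leave the other sets alone. -/
def Keeps (l l' : Key → List ℕ) : Prop := ∀ g i u, 1 ≤ g → g ≤ 3 → l' (g, i, u) = l (g, i, u)

theorem Keeps.refl (l : Key → List ℕ) : Keeps l l := fun _ _ _ _ _ => rfl

theorem Keeps.trans {l l' l'' : Key → List ℕ} (h : Keeps l l') (h' : Keeps l' l'') :
    Keeps l l'' := fun g i u h1 h2 => (h' g i u h1 h2).trans (h g i u h1 h2)

theorem Keeps.insL {l l' : Key → List ℕ} (h : Keeps l l') {key : Key} {x : ℕ}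
    (hk : key.1 = 0 ∨ 4 ≤ key.1) : Keeps l (insL l' key x) := by
  intro g i u h1 h2
  rw [insL_of_ne, h g i u h1 h2]
  rintro rfl
  simp only at hk
  omega

theorem Keeps.ersL {l l' : Key → List ℕ} (h : Keeps l l') {key : Key} {x : ℕ}
    (hk : key.1 = 0 ∨ 4 ≤ key.1) : Keeps l (ersL l' key x) := by
  intro g i u h1 h2
  rw [ersL_of_ne, h g i u h1 h2]
  rintro rfl
  simp only at hk
  omega

section programs

variable (Q)

/-- The value of a local variable. -/
abbrev rv (n : ℕ) : Expr Q.d := .var (.loc n)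

/-- The test whether a value is heavy. -/
def heavyE (i : ℕ) (v : Expr Q.d) : Expr Q.d :=
  ((KeyE.mk 1 i v).size.lt (rv Q 1)).not

/-- The truth value of the test, used as a factor, selects between the value plus one and zero. -/
def pdigE (i : ℕ) : Expr Q.d :=
  (heavyE Q i (Expr.dig i (rv Q 10))).mul ((Expr.dig i (rv Q 10)).add (.const 1))

/-- The pattern of the tuple in variable `10` goes to variable `11`, its group to `12`, and the
test of its light values to `14`. -/
def loadTuple : Prog :=
  .seq (asg (d := Q.d) (.loc 11) (Expr.pack (pdigE Q) Q.d))
    (.seq (asg (d := Q.d) (.loc 12) (Expr.pack (fun i => if i < Q.e then pdigE Q i else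
      (Expr.dig i (rv Q 10)).add (.const 1)) Q.d))
      (asg (d := Q.d) (.loc 14) (Expr.all (fun i => (heavyE Q i (Expr.dig i (rv Q 10))).or
        ((KeyE.mk 3 i (.const 0)).has ((Expr.dig i (rv Q 10)).add (.const 1)))) Q.k)))

/-- The bound part of the pattern in variable `11` goes to variable `13`, and the test of its output
part to `15`. -/
def loadPattern : Prog :=
  .seq (asg (d := Q.d) (.loc 13) ((rv Q 11).mod
      ((Expr.const 1).shl (Expr.digitBits.mul (.const Q.e)))))
    (asg (d := Q.d) (.loc 15) (Expr.all (fun i => if Q.e ≤ i then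
      ((Expr.dig i (rv Q 11)).eq (.const 0)).or
        ((KeyE.mk 3 i (.const 0)).has (Expr.dig i (rv Q 11))) else .const 1) Q.k))

/-- The following names refer to kinds 7, 0, 4, 5 and 6 of `Sem.spec`; their components are the
variables filled by `loadTuple` and `loadPattern`. -/
def linkKey : KeyE Q.d := ⟨7, 0, rv Q 13⟩
def rootKey : KeyE Q.d := ⟨0, 0, .const 0⟩
def tupKey : KeyE Q.d := ⟨4, 0, rv Q 12⟩
def grpKey : KeyE Q.d := ⟨5, 0, rv Q 11⟩
def patKey (i : ℕ) : KeyE Q.d := ⟨6, i, Expr.dig i (rv Q 11)⟩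

/-- Variable `10` holds the tuple. Insertions are idempotent, so there is no need to test whether
the group, the pattern or the bound part is present already. -/
def register : Prog :=
  .seq (loadTuple Q) (.seq (loadPattern Q) (cond (rv Q 14)
    (.seq (ins (tupKey Q) (rv Q 10)) (.seq (ins (grpKey Q) (rv Q 12))
      (.seq (seqs (fun i => if Q.e ≤ i then
          cond (Expr.dig i (rv Q 11)) (ins (patKey Q i) (rv Q 11)) .nop else .nop) Q.k)
        (cond (rv Q 15) (.seq (ins (linkKey Q) (rv Q 11))
          (ins (rootKey Q) (rv Q 13))) .nop)))) .nop))

/-- Deletion of the pattern in variable `11` from the list of its bound part. -/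
def unlink : Prog :=
  .seq (ers (linkKey Q) (rv Q 11))
    (cond (linkKey Q).size .nop (ers (rootKey Q) (rv Q 13)))

/-- A cascade: a group leaves its pattern only after its last tuple, a pattern leaves all lists only
after its last group, and `unlink` removes a bound part only after its last live pattern. No empty
group is left behind, on which the constant delay of the enumeration relies. -/
def unregister : Prog :=
  .seq (loadTuple Q) (.seq (loadPattern Q)
    (.seq (ers (tupKey Q) (rv Q 10)) (cond (tupKey Q).size .nop
      (.seq (ers (grpKey Q) (rv Q 12)) (cond (grpKey Q).size .nop
        (.seq (seqs (fun i => if Q.e ≤ i then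
          cond (Expr.dig i (rv Q 11)) (ers (patKey Q i) (rv Q 11)) .nop else .nop) Q.k)
          (unlink Q)))))))

end programs

section eval

variable {c : Cfg Q.d} {W : ℕ} {σ : Sem Q} {a : AS Q.d} {y : ℕ}

theorem length_eq_card {l : List ℕ} {s : Finset ℕ} (hl : l.Nodup) (h : ∀ x, x ∈ l ↔ x ∈ s) :
    l.length = s.card := by
  rw [← List.toFinset_card_of_nodup hl]
  congr 1
  ext x
  rw [List.mem_toFinset, h]

theorem length_tuples {l : Key → List ℕ} (hl : Sane c l) {i v : ℕ}
    (hmem : ∀ z, z ∈ l (1, i, v) ↔ σ.spec (1, i, v) z) (hi : i < Q.d) :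
    (l (1, i, v)).length = σ.deg i v := by
  refine length_eq_card (hl _).1 fun x => ?_
  rw [hmem, Finset.mem_filter]
  simp [Sem.spec, hi]

theorem lt_word_of_lt {n k : ℕ} (h : n < c.B ^ k) (hk : k ≤ Q.d + 4) : n < 2 ^ c.w :=
  c.lt_word h.le (by omega)

theorem dig_lt_pow {i x : ℕ} : dig c.B i x < c.B ^ (Q.d + 1) :=
  (dig_lt c.B_pos i x).trans_le (Nat.le_self_pow (by omega) _)

theorem Sem.Wf.thr_lt (h : σ.Wf c) : σ.thr < 2 ^ c.w :=
  c.lt_word (h.B ▸ h.thr) (by omega)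

/-- The part of a state that is relevant for the evaluation of heaviness and satellites. -/
structure View (c : Cfg Q.d) (σ : Sem Q) (ρ : Var Q.d → ℕ) (l : Key → List ℕ) : Prop where
  wf : σ.Wf c
  sane : Sane c l
  mem : ∀ g i u z, 1 ≤ g → g ≤ 3 → (z ∈ l (g, i, u) ↔ σ.spec (g, i, u) z)
  thr : ρ (.loc 1) = σ.thr

theorem St.view (h : St c W σ a) (hl : Sane c a.l) : View c σ a.ρ a.l :=
  ⟨h.wf, hl, fun _ _ _ _ _ _ => h.mem _ _, h.thr⟩

variable {ρ : Var Q.d → ℕ} {l : Key → List ℕ} {it : ℕ → ℕ}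

theorem key_is {g i : ℕ} {u : Expr Q.d} {v : ℕ} (hg : g < 8) (hi : i ≤ Q.d)
    (hu : ∀ μ, u.eval c.w ρ μ = v) (hv : v < c.B ^ (Q.d + 1)) :
    (KeyE.mk g i u).Is c ρ (g, i, v) :=
  ⟨hg, hi, rfl, rfl, hv, hu⟩

theorem View.heavy (h : View c σ ρ l) {i v : ℕ} {e : Expr Q.d} (hi : i < Q.d)
    (he : ∀ μ, e.eval c.w ρ μ = v) (hv : v < c.B ^ (Q.d + 1)) :
    Tests c ρ (c.cell l it) (heavyE Q i e) (σ.Heavy i v) := by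
  have h1 := (key_is (g := 1) (by norm_num) hi.le he hv).size_eq (it := it) h.sane
  rw [length_tuples h.sane (fun z => h.mem 1 i v z le_rfl (by norm_num)) hi] at h1
  exact (Tests.lt h1 (eval_var _ h.thr h.wf.thr_lt)).not.congr not_lt

theorem View.sat (h : View c σ ρ l) {i v : ℕ} {e : Expr Q.d} (hi : i < Q.k)
    (he : e.eval c.w ρ (c.cell l it) = v) (hv : v < c.B ^ (Q.d + 1)) :
    Tests c ρ (c.cell l it) ((KeyE.mk 3 i (.const 0)).has e) (1 ≤ v ∧ v - 1 ∈ σ.sat i) := by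
  have hk := Q.k_le
  have h1 := (key_is (c := c) (ρ := ρ) (g := 3) (i := i) (by norm_num) (by omega)
    (fun μ => eval_const (Nat.zero_le _)) (pow_pos c.B_pos _)).has (it := it) h.sane he hv.le
  refine h1.congr ?_
  rw [h.mem 3 i 0 v (by norm_num) le_rfl]
  simp [Sem.spec, hi]

theorem eval_digX (hy : Sem.Ok Q c.B y) (hX : ρ (.loc 10) = y) {i : ℕ} (hi : i < Q.d) (μ : ℕ → ℕ) :
    (Expr.dig i (.var (.loc 10)) : Expr Q.d).eval c.w ρ μ = dig c.B i y := by
  have := lt_word_of_lt hy.1 (by omega)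
  exact eval_dig (eval_var _ hX this) hi.le this

theorem eval_digX_succ (hy : Sem.Ok Q c.B y) (hX : ρ (.loc 10) = y) {i : ℕ} (hi : i < Q.d)
    (μ : ℕ → ℕ) : ((Expr.dig i (.var (.loc 10))).add (.const 1) : Expr Q.d).eval c.w ρ μ =
      dig c.B i y + 1 :=
  eval_add (eval_digX hy hX hi μ) (eval_const (by omega))
    (lt_word_of_lt (k := 1) (by rw [pow_one]; exact hy.2 i hi) (by omega))

theorem View.pdig (h : View c σ ρ l) (hy : Sem.Ok Q c.B y) (hX : ρ (.loc 10) = y) {i : ℕ}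
    (hi : i < Q.d) : (pdigE Q i).eval c.w ρ (c.cell l it) = σ.pdig y i := by
  have h1 := h.heavy (it := it) hi (eval_digX hy hX hi) dig_lt_pow
  have h2 := hy.2 i hi
  have h3 : c.B < 2 ^ c.w := c.lt_word (k := 1) (by simp) (by omega)
  have h4 := h1.le_one
  rw [pdigE, eval_mul rfl (eval_digX_succ hy hX hi _) (by nlinarith)]
  unfold Sem.pdig
  rw [h.wf.B]
  split_ifs with h5
  · rw [h1.1 h5, one_mul]
  · rw [h1.2 h5, zero_mul]

end eval

end StarMaintenance

/-! ### Correctness of registration. -/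

namespace StarMaintenance

open WordRAM Classical

variable {Q : StarQuery} {c : Cfg Q.d} {W : ℕ} {σ : Sem Q} {a : AS Q.d} {y : ℕ}

theorem run_ite {p q : Prog} {a : AS Q.d} {T₁ T₂ : ℕ} {Post : AS Q.d → Prop} {e : Expr Q.d}
    (hn : a.n ≤ c.S) (hp : ev c a e ≠ 0 → Run c p a T₁ Post)
    (hq : ev c a e = 0 → Run c q a T₂ Post) :
    Run c (cond e p q) a (tm (e.compile 0) + (1 + T₁ + T₂)) Post := by
  refine (run_cond (T := T₁ + T₂) hn (fun h => (hp h).mono (by omega) fun _ h => h)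
    (fun h => (hq h).mono (by omega) fun _ h => h)).mono (by omega) fun _ h => h

theorem tm_seqs (f : ℕ → Prog) (n : ℕ) : tm (seqs f n) = 1 + ∑ i ∈ Finset.range n, tm (f i) := by
  induction n with
  | zero => rfl
  | succ n ih => rw [Finset.sum_range_succ, ← add_assoc, ← ih]; rfl

/-- `f` is the truth value of `P`. -/
def Flag (f : ℕ) (P : Prop) : Prop := (P → f = 1) ∧ (¬ P → f = 0)

theorem Tests.flag {ρ : Var Q.d → ℕ} {μ : ℕ → ℕ} {x : Expr Q.d} {P : Prop}
    (h : Tests c ρ μ x P) : Flag (x.eval c.w ρ μ) P := h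

theorem Flag.ne_zero {f : ℕ} {P : Prop} (h : Flag f P) : f ≠ 0 ↔ P := by
  by_cases hP : P
  · simp [h.1 hP, hP]
  · simp [h.2 hP, hP]

theorem View.agree {ρ ρ' : Var Q.d → ℕ} {l : Key → List ℕ} (h : View c σ ρ l)
    (hρ : ρ' (.loc 1) = ρ (.loc 1)) : View c σ ρ' l :=
  ⟨h.wf, h.sane, h.mem, hρ.trans h.thr⟩

theorem run_loadTuple (hv : View c σ a.ρ a.l) (hy : Sem.Ok Q c.B y) (hX : a.ρ (.loc 10) = y)
    (hn : a.n ≤ c.S) : Run c (loadTuple Q) a (tm (loadTuple Q)) fun b => ∃ f,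
      b = ((a.set (.loc 11) (σ.P y)).set (.loc 12) (σ.G y)).set (.loc 14) f ∧
      Flag f (σ.LightAlive y) := by
  have hk := Q.k_le
  have hB := hv.wf.B
  have hyB : Sem.Ok Q σ.B y := hB ▸ hy
  refine Run.seq (Mid := fun b => b = a.set (.loc 11) (σ.P y)) (run_asg hn ?_) ?_
  · congr 1
    rw [Sem.P, hB]
    exact eval_pack (by omega) (fun i hi => hv.pdig hy hX hi) (fun i hi => hB ▸ Sem.pdig_lt hyB hi)
  rintro _ rfl
  refine Run.seq (Mid := fun b => b = (a.set (.loc 11) (σ.P y)).set (.loc 12) (σ.G y))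
    (run_asg hn ?_) ?_
  · congr 1
    rw [Sem.G, hB]
    have hv1 : View c σ (a.set (.loc 11) (σ.P y)).ρ a.l := hv.agree (by simp [AS.set])
    have hX1 : (a.set (.loc 11) (σ.P y)).ρ (.loc 10) = y := by simp [AS.set, hX]
    refine eval_pack (by omega) (fun i hi => ?_) (fun i hi => ?_)
    · split_ifs
      · exact hv1.pdig hy hX1 hi
      · exact eval_digX_succ hy hX1 hi _
    · rw [← hB]
      exact Sem.gdig_lt hyB hi
  rintro _ rfl
  refine run_asg hn ⟨_, rfl, ?_⟩
  set a2 := (a.set (.loc 11) (σ.P y)).set (.loc 12) (σ.G y) with ha2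
  have hv2 : View c σ a2.ρ a2.l := hv.agree (by simp [ha2, AS.set])
  have hX2 : a2.ρ (.loc 10) = y := by simp [ha2, AS.set, hX]
  refine (Tests.all (P := fun i => σ.Heavy i (dig σ.B i y) ∨ dig σ.B i y ∈ σ.sat i)
    fun i hi => ?_).flag
  rw [hB]
  refine ((hv2.heavy (by omega) (eval_digX hy hX2 (by omega)) dig_lt_pow).or (hv2.sat hi
    (eval_digX_succ hy hX2 (by omega) _) ?_)).congr (by simp)
  exact (hy.2 i (by omega)).trans_le (Nat.le_self_pow (by omega) _)

theorem run_loadPattern {p : ℕ} (hv : View c σ a.ρ a.l) (hp : p < c.B ^ Q.d)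
    (hP : a.ρ (.loc 11) = p) (hn : a.n ≤ c.S) :
    Run c (loadPattern Q) a (tm (loadPattern Q)) fun b => ∃ f,
      b = (a.set (.loc 13) (p % σ.B ^ Q.e)).set (.loc 15) f ∧ Flag f (σ.OutAlive p) := by
  have hk := Q.k_le
  have he := Sem.e_le (Q := Q)
  have hB := hv.wf.B
  have hpw : p < 2 ^ c.w := lt_word_of_lt hp (by omega)
  refine Run.seq (Mid := fun b => b = a.set (.loc 13) (p % σ.B ^ Q.e)) (run_asg hn ?_) ?_
  · congr 1
    rw [hB]
    refine eval_mod (eval_var _ hP hpw) ?_ hpw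
    rw [eval_shl_bits (eval_const (by omega)) (by omega), one_mul]
    rw [one_mul]
    exact c.lt_word le_rfl (by omega)
  rintro _ rfl
  refine run_asg hn ⟨_, rfl, ?_⟩
  set a1 := a.set (.loc 13) (p % σ.B ^ Q.e) with ha1
  have hv1 : View c σ a1.ρ a1.l := hv.agree (by simp [ha1, AS.set])
  have hP1 : a1.ρ (.loc 11) = p := by simp [ha1, AS.set, hP]
  refine (Tests.all (P := fun i => Q.e ≤ i → dig σ.B i p = 0 ∨
    (1 ≤ dig σ.B i p ∧ dig σ.B i p - 1 ∈ σ.sat i)) fun i hi => ?_).flag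
  rw [hB]
  split_ifs with h
  · have hd : ∀ μ, (Expr.dig i (rv Q 11)).eval c.w a1.ρ μ = dig c.B i p := fun μ =>
      eval_dig (eval_var _ hP1 hpw) (by omega) hpw
    exact ((Tests.eq (hd _) (eval_const (by omega))).or (hv1.sat hi (hd _) dig_lt_pow)).congr
      (by simp [h])
  · exact Tests.true.congr (by simp [h])

/-- The variables after the preparations for the tuple `y`. -/
structure Prep (c : Cfg Q.d) (σ : Sem Q) (y : ℕ) (ρ : Var Q.d → ℕ) : Prop where
  tup : ρ (.loc 10) = y
  pat : ρ (.loc 11) = σ.P y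
  grp : ρ (.loc 12) = σ.G y
  root : ρ (.loc 13) = σ.P y % σ.B ^ Q.e
  light : Flag (ρ (.loc 14)) (σ.LightAlive y)
  out : Flag (ρ (.loc 15)) (σ.OutAlive (σ.P y))
  ok : Sem.Ok Q c.B y
  view : ∃ l, View c σ ρ l

theorem run_prep {p : Prog} {T : ℕ} {Post : AS Q.d → Prop} (hv : View c σ a.ρ a.l)
    (hy : Sem.Ok Q c.B y) (hX : a.ρ (.loc 10) = y) (hn : a.n ≤ c.S)
    (h : ∀ ρ, Prep c σ y ρ → Agree 12 a.ρ ρ → Run c p { a with ρ := ρ } T Post) :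
    Run c (.seq (loadTuple Q) (.seq (loadPattern Q) p)) a
      (tm (loadTuple Q) + (tm (loadPattern Q) + T)) Post := by
  have hB := hv.wf.B
  refine Run.seq (run_loadTuple hv hy hX hn) ?_
  rintro _ ⟨f, rfl, hf⟩
  refine Run.seq (run_loadPattern (p := σ.P y) (hv.agree (by simp [AS.set])) ?_
    (by simp [AS.set]) hn) ?_
  · rw [← hB] at hy ⊢
    exact Sem.P_lt hy
  rintro _ ⟨f', rfl, hf'⟩
  refine h _ ⟨?_, ?_, ?_, ?_, ?_, ?_, hy, a.l, hv.agree ?_⟩ ?_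
  · simp [AS.set, hX]
  · simp [AS.set]
  · simp [AS.set]
  · simp [AS.set]
  · simpa [AS.set] using hf
  · simpa [AS.set] using hf'
  · simp [AS.set]
  · simp only [AS.set]
    refine ((((Agree.refl _ _).update ?_ _).update ?_ _).update ?_ _).update ?_ _ |>.update ?_ _ <;>
      simp [Var.rank]

namespace Prep

variable {ρ : Var Q.d → ℕ}

theorem okσ (h : Prep c σ y ρ) : Sem.Ok Q σ.B y := by
  obtain ⟨l, hl⟩ := h.view
  rw [hl.wf.B]
  exact h.ok

theorem B (h : Prep c σ y ρ) : σ.B = c.B := by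
  obtain ⟨l, hl⟩ := h.view
  exact hl.wf.B

theorem lt_pow {n : ℕ} (h : Prep c σ y ρ) (hn : n < σ.B ^ Q.d) : n < c.B ^ (Q.d + 1) := by
  rw [h.B] at hn
  exact hn.trans (Nat.pow_lt_pow_right c.one_lt_B (by omega))

theorem P_lt (h : Prep c σ y ρ) : σ.P y < c.B ^ (Q.d + 1) := h.lt_pow (Sem.P_lt h.okσ)

theorem G_lt (h : Prep c σ y ρ) : σ.G y < c.B ^ (Q.d + 1) := h.lt_pow (Sem.G_lt h.okσ)

theorem y_lt (h : Prep c σ y ρ) : y < c.B ^ (Q.d + 1) := h.lt_pow h.okσ.1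

theorem root_lt (h : Prep c σ y ρ) : σ.P y % σ.B ^ Q.e < c.B ^ (Q.d + 1) :=
  h.lt_pow ((Nat.mod_le _ _).trans_lt (Sem.P_lt h.okσ))

theorem eval_rv {n x : ℕ} (h : ρ (.loc n) = x) (hx : x < c.B ^ (Q.d + 1)) (μ : ℕ → ℕ) :
    (rv Q n).eval c.w ρ μ = x := eval_var _ h (lt_word_of_lt hx (by omega))

theorem tupKey (h : Prep c σ y ρ) : (tupKey Q).Is c ρ (4, 0, σ.G y) :=
  key_is (by norm_num) (Nat.zero_le _) (eval_rv h.grp h.G_lt) h.G_lt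

theorem grpKey (h : Prep c σ y ρ) : (grpKey Q).Is c ρ (5, 0, σ.P y) :=
  key_is (by norm_num) (Nat.zero_le _) (eval_rv h.pat h.P_lt) h.P_lt

theorem linkKey (h : Prep c σ y ρ) : (linkKey Q).Is c ρ (7, 0, σ.P y % σ.B ^ Q.e) :=
  key_is (by norm_num) (Nat.zero_le _) (eval_rv h.root h.root_lt) h.root_lt

theorem _root_.StarMaintenance.rootKey_is : (rootKey Q).Is c ρ (0, 0, 0) :=
  key_is (by norm_num) (Nat.zero_le _) (fun _ => eval_const (Nat.zero_le _)) (pow_pos c.B_pos _)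

theorem digP (h : Prep c σ y ρ) {i : ℕ} (hi : i < Q.k) (μ : ℕ → ℕ) :
    (Expr.dig i (rv Q 11)).eval c.w ρ μ = dig σ.B i (σ.P y) := by
  have := Q.k_le
  rw [h.B]
  exact eval_dig (eval_rv h.pat h.P_lt _) (by omega) (lt_word_of_lt h.P_lt (by omega))

theorem patKey (h : Prep c σ y ρ) {i : ℕ} (hi : i < Q.k) :
    (patKey Q i).Is c ρ (6, i, dig σ.B i (σ.P y)) := by
  have := Q.k_le
  refine key_is (by norm_num) (by omega) (fun μ => h.digP hi μ) ?_
  rw [h.B]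
  exact dig_lt_pow

end Prep

/-- Relative to `a₀`, the pairs `N` have been inserted in the state `b`. -/
structure Grow (a₀ : AS Q.d) (N : Key → ℕ → Prop) (n : ℕ) (b : AS Q.d) : Prop where
  ρ : b.ρ = a₀.ρ
  it : b.it = a₀.it
  n_le : b.n ≤ n
  keeps : Keeps a₀.l b.l
  mem : ∀ key z, z ∈ b.l key ↔ z ∈ a₀.l key ∨ N key z

/-- Relative to `a₀`, the pairs `N` have been deleted in the state `b`. -/
structure Shrink (a₀ : AS Q.d) (N : Key → ℕ → Prop) (n : ℕ) (b : AS Q.d) : Prop where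
  ρ : b.ρ = a₀.ρ
  it : b.it = a₀.it
  n_le : b.n ≤ n
  keeps : Keeps a₀.l b.l
  mem : ∀ key z, z ∈ b.l key ↔ z ∈ a₀.l key ∧ ¬ N key z

section

variable {a₀ b : AS Q.d} {N N' : Key → ℕ → Prop} {n n' : ℕ} {κ : KeyE Q.d} {key : Key} {x : Expr Q.d}
  {v : ℕ}

theorem Grow.mono (h : Grow a₀ N n b) (hn : n ≤ n') (hN : ∀ key z, N key z ↔ N' key z) :
    Grow a₀ N' n' b :=
  ⟨h.ρ, h.it, h.n_le.trans hn, h.keeps, fun key z => by rw [h.mem, hN]⟩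

theorem Shrink.mono (h : Shrink a₀ N n b) (hn : n ≤ n') (hN : ∀ key z, N key z ↔ N' key z) :
    Shrink a₀ N' n' b :=
  ⟨h.ρ, h.it, h.n_le.trans hn, h.keeps, fun key z => by rw [h.mem, hN]⟩

theorem Grow.ins (h : Grow a₀ N n b) (hκ : κ.Is c a₀.ρ key) (hx : ∀ μ, x.eval c.w a₀.ρ μ = v)
    (hv : v < c.B ^ (Q.d + 1)) (hn : n + 3 ≤ c.S) (hk : key.1 = 0 ∨ 4 ≤ key.1) :
    Run c (ins κ x) b (tm (ins κ x)) (Grow a₀ (fun k z => N k z ∨ (k = key ∧ z = v)) (n + 3)) := by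
  have := h.n_le
  rw [← h.ρ] at hκ hx
  refine run_ins hκ hx hv (by omega) ⟨h.ρ, h.it, by simp only; omega, h.keeps.insL hk, ?_⟩
  intro key' z
  rw [mem_insL, h.mem]
  tauto

theorem Shrink.ers (h : Shrink a₀ N n b) (hκ : κ.Is c a₀.ρ key) (hx : ∀ μ, x.eval c.w a₀.ρ μ = v)
    (hv : v < c.B ^ (Q.d + 1)) (hn : n + 5 ≤ c.S) (hk : key.1 = 0 ∨ 4 ≤ key.1) :
    Run c (ers κ x) b (tm (ers κ x))
      (Shrink a₀ (fun k z => N k z ∨ (k = key ∧ z = v)) (n + 5)) := by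
  have := h.n_le
  rw [← h.ρ] at hκ hx
  refine Run.sane fun hs => ?_
  refine run_ers hκ hx hv (by omega) ⟨h.ρ, h.it, by simp only; omega, h.keeps.ersL hk, ?_⟩
  intro key' z
  rw [mem_ersL (hs key).1, h.mem]
  tauto

theorem size_ne_zero (hs : Sane c b.l) (hκ : κ.Is c b.ρ key) :
    ev c b κ.size ≠ 0 ↔ ∃ z, z ∈ b.l key := by
  rw [ev, hκ.size_eq hs, Ne, List.length_eq_zero_iff]
  exact ⟨fun h => List.exists_mem_of_ne_nil _ h, fun ⟨z, hz⟩ h => by simp [h] at hz⟩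

end

theorem run_register (hSt : St c W σ a) (hy : Sem.Ok Q c.B y) (hX : a.ρ (.loc 10) = y)
    (hW : W + 3 * (Q.k + 6) ≤ c.S) (hw : 3 * (σ.addReg y).weight ≤ W) :
    Run c (register Q) a (tm (register Q)) fun b =>
      St c W (σ.addReg y) b ∧ Agree 12 a.ρ b.ρ ∧ Keeps a.l b.l := by
  have hk := Q.k_le
  have hnW := hSt.n
  refine Run.sane fun hs => ?_
  have hwf : (σ.addReg y).Wf c := by
    refine ⟨hSt.wf.B, fun x hx => ?_, hSt.wf.cen, hSt.wf.sat, hSt.wf.thr⟩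
    rcases Finset.mem_insert.1 hx with rfl | hx
    · have := hSt.wf.B
      rw [← this] at hy
      exact hy
    · exact hSt.wf.reg x hx
  -- Whatever the intermediate bound on the space, a state with the right content fits into `W`
  -- cells again.
  have fin : ∀ b : AS Q.d, Agree 12 a.ρ b.ρ → b.it = a.it → Keeps a.l b.l →
      (∀ key z, z ∈ b.l key ↔ (σ.addReg y).spec key z) →
      ∃ n, Holds b.l b.it n ∧ (St c W (σ.addReg y) { b with n := n } ∧ Agree 12 a.ρ b.ρ ∧
        Keeps a.l b.l) := by
    intro b h1 h2 h3 h4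
    refine ⟨W, holds_of_spec (E' := ∅) (fun key z hz => (h4 key z).1 hz) (fun x hx => ?_)
      (by simpa using hw), ⟨hwf, h4, ?_, le_rfl, ?_⟩, h1, h3⟩
    · rw [h2] at hx
      exact absurd (hSt.it x) hx
    · exact (h1 _ (by simp [Var.rank])).trans hSt.thr
    · intro x
      simp only
      rw [h2]
      exact hSt.it x
  refine Run.tighten (Mid := fun b => Agree 12 a.ρ b.ρ ∧ b.it = a.it ∧ Keeps a.l b.l ∧
      ∀ key z, z ∈ b.l key ↔ (σ.addReg y).spec key z) ?_
    (fun b hb => fin b hb.1 hb.2.1 hb.2.2.1 hb.2.2.2)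
  refine run_prep (hSt.view hs) hy hX (by omega) fun ρ hp hag => ?_
  set a₀ : AS Q.d := { a with ρ := ρ } with ha₀
  have hlight : ev c a₀ (rv Q 14) ≠ 0 ↔ σ.LightAlive y := by
    rw [← hp.light.ne_zero]
    have : ρ (.loc 14) ≤ 1 := by
      by_cases hl : σ.LightAlive y
      · exact (hp.light.1 hl).le
      · rw [hp.light.2 hl]; norm_num
    rw [ev, eval_var _ rfl (c.small_lt_word (by simp only [ha₀]; omega))]
  refine run_ite (by simp only [ha₀]; omega) (fun hl => ?_) (fun hl => ?_)
  · rw [hlight] at hl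
    have g0 : Grow a₀ (fun _ _ => False) W a₀ :=
      ⟨rfl, rfl, hnW, Keeps.refl _, by simp⟩
    refine Run.seq (g0.ins hp.tupKey (Prep.eval_rv hp.tup hp.y_lt) hp.y_lt (by omega) (by simp))
      fun b1 g1 => ?_
    refine Run.seq (g1.ins hp.grpKey (Prep.eval_rv hp.grp hp.G_lt) hp.G_lt (by omega) (by simp))
      fun b2 g2 => ?_
    -- A pattern is listed under its nonzero digits at output attributes that have a satellite.
    -- Bound attributes are skipped, because their satellites are consulted only during enumeration.
    refine Run.seq (Mid := fun b => Grow a₀ (fun key z =>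
      ((key = (4, 0, σ.G y) ∧ z = y) ∨ (key = (5, 0, σ.P y) ∧ z = σ.G y)) ∨
      (∃ i < Q.k, Q.e ≤ i ∧ dig σ.B i (σ.P y) ≠ 0 ∧ key = (6, i, dig σ.B i (σ.P y)) ∧
        z = σ.P y)) (W + 3 * (Q.k + 2)) b) ?_ fun b3 g3 => ?_
    · rw [tm_seqs]
      refine run_seqs (fun i => Grow a₀ (fun key z =>
        ((key = (4, 0, σ.G y) ∧ z = y) ∨ (key = (5, 0, σ.P y) ∧ z = σ.G y)) ∨
        (∃ j < i, Q.e ≤ j ∧ dig σ.B j (σ.P y) ≠ 0 ∧ key = (6, j, dig σ.B j (σ.P y)) ∧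
          z = σ.P y)) (W + 3 * (i + 2))) (g2.mono (by omega) (by simp))
        (g2.n_le.trans (by omega)) _ fun i hi b g => ?_
      have hbn := g.n_le
      have hPi : ev c b (Expr.dig i (rv Q 11)) = dig σ.B i (σ.P y) := by
        rw [ev, g.ρ]
        exact hp.digP hi _
      split_ifs with he
      · refine run_ite (by omega) (fun h => ?_) (fun h => ?_)
        · rw [hPi] at h
          refine (g.ins (hp.patKey hi) (Prep.eval_rv hp.pat hp.P_lt) hp.P_lt (by omega)
            (by simp)).mono le_rfl fun b' hb' => hb'.mono (by omega) fun key z => ?_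
          constructor
          · rintro ((h1 | ⟨j, h1, h2⟩) | h1)
            · exact Or.inl h1
            · exact Or.inr ⟨j, by omega, h2⟩
            · exact Or.inr ⟨i, by omega, he, h, h1⟩
          · rintro (h1 | ⟨j, h1, h2⟩)
            · exact Or.inl (Or.inl h1)
            · rcases Nat.lt_succ_iff_lt_or_eq.1 h1 with h1 | rfl
              · exact Or.inl (Or.inr ⟨j, h1, h2⟩)
              · exact Or.inr h2.2.2
        · rw [hPi] at h
          refine run_nop (by omega) (g.mono (by omega) fun key z => ?_)
          constructor
          · rintro (h1 | ⟨j, h1, h2⟩)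
            · exact Or.inl h1
            · exact Or.inr ⟨j, by omega, h2⟩
          · rintro (h1 | ⟨j, h1, h2⟩)
            · exact Or.inl h1
            · rcases Nat.lt_succ_iff_lt_or_eq.1 h1 with h1 | rfl
              · exact Or.inr ⟨j, h1, h2⟩
              · exact absurd h h2.2.1
      · refine run_nop (by omega) (g.mono (by omega) fun key z => ?_)
        constructor
        · rintro (h1 | ⟨j, h1, h2⟩)
          · exact Or.inl h1
          · exact Or.inr ⟨j, by omega, h2⟩
        · rintro (h1 | ⟨j, h1, h2⟩)
          · exact Or.inl h1
          · rcases Nat.lt_succ_iff_lt_or_eq.1 h1 with h1 | rfl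
            · exact Or.inr ⟨j, h1, h2⟩
            · exact absurd h2.1 he
    have hb3 := g3.n_le
    have hout : ev c b3 (rv Q 15) ≠ 0 ↔ σ.OutAlive (σ.P y) := by
      rw [← hp.out.ne_zero]
      have : ρ (.loc 15) ≤ 1 := by
        by_cases hl : σ.OutAlive (σ.P y)
        · exact (hp.out.1 hl).le
        · rw [hp.out.2 hl]; norm_num
      have h3 : b3.ρ (.loc 15) = ρ (.loc 15) := by rw [g3.ρ]
      rw [ev, eval_var _ h3 (c.small_lt_word (by omega))]
    refine run_ite (by omega) (fun ho => ?_) (fun ho => ?_)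
    · rw [hout] at ho
      refine Run.seq (g3.ins hp.linkKey (Prep.eval_rv hp.pat hp.P_lt) hp.P_lt (by omega) (by simp))
        fun b4 g4 => ?_
      refine (g4.ins rootKey_is (Prep.eval_rv hp.root hp.root_lt) hp.root_lt (by omega)
        (by simp)).mono le_rfl fun b5 g5 => ⟨?_, g5.it, g5.keeps, fun key z => ?_⟩
      · rw [g5.ρ]
        exact hag
      · rw [g5.mem, Sem.spec_addReg hl, ← hSt.mem, Sem.news]
        simp only [ha₀, ho, true_and, or_assoc]
    · have ho' : ¬ σ.OutAlive (σ.P y) := fun h => hout.2 h ho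
      refine run_nop (by omega) ⟨?_, g3.it, g3.keeps, fun key z => ?_⟩
      · rw [g3.ρ]
        exact hag
      · rw [g3.mem, Sem.spec_addReg hl, ← hSt.mem, Sem.news]
        simp only [ha₀, ho', false_and, or_false, or_assoc]
  · have hl' : ¬ σ.LightAlive y := fun h => hlight.2 h hl
    refine run_nop (by simp only [ha₀]; omega) ⟨hag, rfl, Keeps.refl _, fun key z => ?_⟩
    rw [Sem.spec_addReg_of_not hl', ← hSt.mem]

end StarMaintenance

/-! ### Correctness of the removal of a tuple from the groups. -/

namespace StarMaintenance

open WordRAM Classical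

variable {Q : StarQuery} {c : Cfg Q.d} {W : ℕ} {σ : Sem Q} {a : AS Q.d} {y : ℕ}

namespace Sem

/-- Another registered tuple is in the group of `y`. -/
def GroupStays (σ : Sem Q) (y : ℕ) : Prop := ∃ x ∈ σ.reg, x ≠ y ∧ σ.LightAlive x ∧ σ.G x = σ.G y

/-- Another registered tuple has the pattern of `y`. -/
def PatternStays (σ : Sem Q) (y : ℕ) : Prop :=
  ∃ x ∈ σ.reg, x ≠ y ∧ σ.LightAlive x ∧ σ.P x = σ.P y

/-- Another registered tuple keeps the bound part of the pattern of `y`. -/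
def RootStays (σ : Sem Q) (y : ℕ) : Prop :=
  ∃ x ∈ σ.reg, x ≠ y ∧ σ.LightAlive x ∧ σ.OutAlive (σ.P x) ∧
    σ.P x % σ.B ^ Q.e = σ.P y % σ.B ^ Q.e

theorem spec_delReg' (hok : ∀ x ∈ σ.reg, Ok Q σ.B x) (hy : Ok Q σ.B y) (key : Key) (z : ℕ) :
    (σ.delReg y).spec key z ↔ σ.spec key z ∧
      ¬ (key = (4, 0, σ.G y) ∧ z = y) ∧
      (¬ σ.GroupStays y → ¬ (key = (5, 0, σ.P y) ∧ z = σ.G y)) ∧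
      (¬ σ.PatternStays y →
        ¬ (∃ i < Q.k, Q.e ≤ i ∧ dig σ.B i (σ.P y) ≠ 0 ∧ key = (6, i, dig σ.B i (σ.P y)) ∧
          z = σ.P y) ∧
        ¬ (key = (7, 0, σ.P y % σ.B ^ Q.e) ∧ z = σ.P y)) ∧
      (¬ σ.RootStays y → ¬ (key = (0, 0, 0) ∧ z = σ.P y % σ.B ^ Q.e)) := by
  rw [spec_delReg hok hy]
  simp only [GroupStays, PatternStays, RootStays, not_exists, not_and]

theorem PatternStays.of_group (hok : ∀ x ∈ σ.reg, Ok Q σ.B x) (hy : Ok Q σ.B y)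
    (h : σ.GroupStays y) : σ.PatternStays y := by
  obtain ⟨x, h1, h2, h3, h4⟩ := h
  exact ⟨x, h1, h2, h3, P_eq_of_G_eq (hok x h1) hy h4⟩

/-- If the pattern persists but its bound part has no remaining support, then the pattern is not
live, so the tuple that leaves did not support the bound part either. -/
theorem root_of_pattern (h : σ.PatternStays y) (h' : ¬ σ.RootStays y) :
    ¬ σ.spec (0, 0, 0) (σ.P y % σ.B ^ Q.e) := by
  rintro ⟨-, -, x, h1, h2, h3, h4⟩
  by_cases hx : x = y
  · subst hx
    obtain ⟨x', g1, g2, g3, g4⟩ := h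
    exact h' ⟨x', g1, g2, g3, g4 ▸ h3, by rw [g4]⟩
  · exact h' ⟨x, h1, hx, h2, h3, h4⟩

/-- This justifies an early end of the cascade: as long as the pattern persists, its entries and its
bound part remain as they are. -/
theorem spec_delReg_of_pattern (hok : ∀ x ∈ σ.reg, Ok Q σ.B x) (hy : Ok Q σ.B y)
    (h : σ.PatternStays y) (key : Key) (z : ℕ) :
    (σ.delReg y).spec key z ↔ σ.spec key z ∧ ¬ (key = (4, 0, σ.G y) ∧ z = y) ∧
      (¬ σ.GroupStays y → ¬ (key = (5, 0, σ.P y) ∧ z = σ.G y)) := by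
  rw [spec_delReg' hok hy]
  constructor
  · rintro ⟨h1, h2, h3, -⟩
    exact ⟨h1, h2, h3⟩
  · rintro ⟨h1, h2, h3⟩
    refine ⟨h1, h2, h3, fun h' => absurd h h', fun h' => ?_⟩
    rintro ⟨rfl, rfl⟩
    exact root_of_pattern h h' h1

/-- The program can only observe whether a list is empty after the deletion. This lemma and the next
two translate that observation into the existence of another supporting tuple. The hypothesis that
the lower level has vanished ensures that this tuple gives a different list element. -/
theorem links_iff (h : ¬ σ.PatternStays y) :
    (∃ z, σ.spec (7, 0, σ.P y % σ.B ^ Q.e) z ∧ z ≠ σ.P y) ↔ σ.RootStays y := by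
  constructor
  · rintro ⟨z, ⟨-, h1, h2, x, h3, h4, h5⟩, h6⟩
    subst h5
    refine ⟨x, h3, ?_, h4, h2, h1⟩
    rintro rfl
    exact h6 rfl
  · rintro ⟨x, h1, h2, h3, h4, h5⟩
    exact ⟨σ.P x, ⟨rfl, h5, h4, x, h1, h3, rfl⟩, fun h6 => h ⟨x, h1, h2, h3, h6⟩⟩

theorem groups_iff (h : ¬ σ.GroupStays y) (hy : Ok Q σ.B y) :
    (∃ z, σ.spec (5, 0, σ.P y) z ∧ z ≠ σ.G y) ↔ σ.PatternStays y := by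
  constructor
  · rintro ⟨z, ⟨-, x, h3, h4, h5, h6⟩, h7⟩
    subst h6
    refine ⟨x, h3, ?_, h4, h5⟩
    rintro rfl
    exact h7 rfl
  · rintro ⟨x, h1, h2, h3, h4⟩
    exact ⟨σ.G x, ⟨rfl, x, h1, h3, h4, rfl⟩, fun h6 => h ⟨x, h1, h2, h3, h6⟩⟩

theorem tuples_iff : (∃ z, σ.spec (4, 0, σ.G y) z ∧ z ≠ y) ↔ σ.GroupStays y := by
  constructor
  · rintro ⟨z, ⟨-, h1, h2, h3⟩, h4⟩
    exact ⟨z, h1, h4, h2, h3⟩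
  · rintro ⟨x, h1, h2, h3, h4⟩
    exact ⟨x, ⟨rfl, h1, h3, h4⟩, h2⟩

end Sem

theorem Shrink.size {a₀ b : AS Q.d} {N : Key → ℕ → Prop} {n : ℕ} {κ : KeyE Q.d} {key : Key}
    (h : Shrink a₀ N n b) (hκ : κ.Is c a₀.ρ key) (hs : Sane c b.l) :
    ev c b κ.size ≠ 0 ↔ ∃ z, z ∈ a₀.l key ∧ ¬ N key z := by
  rw [← h.ρ] at hκ
  rw [size_ne_zero hs hκ]
  simp only [h.mem]

theorem run_unregister (hSt : St c W σ a) (hy : Sem.Ok Q c.B y) (hX : a.ρ (.loc 10) = y)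
    (hW : W + 5 * (Q.k + 6) ≤ c.S) (hw : 3 * (σ.delReg y).weight ≤ W) :
    Run c (unregister Q) a (tm (unregister Q)) fun b =>
      St c W (σ.delReg y) b ∧ Agree 12 a.ρ b.ρ ∧ Keeps a.l b.l := by
  have hk := Q.k_le
  have hnW := hSt.n
  refine Run.sane fun hs => ?_
  have hwf : (σ.delReg y).Wf c :=
    ⟨hSt.wf.B, fun x hx => hSt.wf.reg x (Finset.mem_of_mem_erase hx), hSt.wf.cen, hSt.wf.sat,
      hSt.wf.thr⟩
  have hok := hSt.wf.reg
  have fin : ∀ b : AS Q.d, Agree 12 a.ρ b.ρ → b.it = a.it → Keeps a.l b.l →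
      (∀ key z, z ∈ b.l key ↔ (σ.delReg y).spec key z) →
      ∃ n, Holds b.l b.it n ∧ (St c W (σ.delReg y) { b with n := n } ∧ Agree 12 a.ρ b.ρ ∧
        Keeps a.l b.l) := by
    intro b h1 h2 h3 h4
    refine ⟨W, holds_of_spec (E' := ∅) (fun key z hz => (h4 key z).1 hz) (fun x hx => ?_)
      (by simpa using hw), ⟨hwf, h4, ?_, le_rfl, ?_⟩, h1, h3⟩
    · rw [h2] at hx
      exact absurd (hSt.it x) hx
    · exact (h1 _ (by simp [Var.rank])).trans hSt.thr
    · intro x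
      simp only
      rw [h2]
      exact hSt.it x
  refine Run.tighten (Mid := fun b => Agree 12 a.ρ b.ρ ∧ b.it = a.it ∧ Keeps a.l b.l ∧
      ∀ key z, z ∈ b.l key ↔ (σ.delReg y).spec key z) ?_
    (fun b hb => fin b hb.1 hb.2.1 hb.2.2.1 hb.2.2.2)
  refine run_prep (hSt.view hs) hy hX (by omega) fun ρ hp hag => ?_
  have hyσ := hp.okσ
  set a₀ : AS Q.d := { a with ρ := ρ } with ha₀
  have hmem : ∀ key z, z ∈ a₀.l key ↔ σ.spec key z := hSt.mem
  have done : ∀ {N n b}, Shrink a₀ N n b → (∀ key z, (σ.delReg y).spec key z ↔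
      σ.spec key z ∧ ¬ N key z) → Agree 12 a.ρ b.ρ ∧ b.it = a.it ∧ Keeps a.l b.l ∧
      ∀ key z, z ∈ b.l key ↔ (σ.delReg y).spec key z := by
    intro N n b g h
    refine ⟨?_, g.it, g.keeps, fun key z => ?_⟩
    · rw [g.ρ]
      exact hag
    · rw [g.mem, h, hmem]
  have s0 : Shrink a₀ (fun _ _ => False) W a₀ := ⟨rfl, rfl, hnW, Keeps.refl _, by simp⟩
  refine Run.seq (s0.ers hp.tupKey (Prep.eval_rv hp.tup hp.y_lt) hp.y_lt (by omega) (by simp))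
    fun b1 g1 => ?_
  have hb1 := g1.n_le
  refine Run.sane fun hs1 => ?_
  have hz1 : ev c b1 (tupKey Q).size ≠ 0 ↔ σ.GroupStays y := by
    rw [g1.size hp.tupKey hs1, ← Sem.tuples_iff]
    simp [hmem]
  refine run_ite (by omega) (fun h1 => ?_) (fun h1 => ?_)
  · rw [hz1] at h1
    refine run_nop (by omega) (done g1 fun key z => ?_)
    rw [Sem.spec_delReg_of_pattern hok hyσ (.of_group hok hyσ h1)]
    simp [h1]
  have h1' : ¬ σ.GroupStays y := fun h => hz1.2 h h1
  refine Run.seq (g1.ers hp.grpKey (Prep.eval_rv hp.grp hp.G_lt) hp.G_lt (by omega) (by simp))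
    fun b2 g2 => ?_
  have hb2 := g2.n_le
  refine Run.sane fun hs2 => ?_
  have hz2 : ev c b2 (grpKey Q).size ≠ 0 ↔ σ.PatternStays y := by
    rw [g2.size hp.grpKey hs2, ← Sem.groups_iff h1' hyσ]
    simp [hmem]
  refine run_ite (by omega) (fun h2 => ?_) (fun h2 => ?_)
  · rw [hz2] at h2
    refine run_nop (by omega) (done g2 fun key z => ?_)
    rw [Sem.spec_delReg_of_pattern hok hyσ h2]
    simp [h1']
  have h2' : ¬ σ.PatternStays y := fun h => hz2.2 h h2
  refine Run.seq (Mid := fun b => Shrink a₀ (fun key z =>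
    ((key = (4, 0, σ.G y) ∧ z = y) ∨ (key = (5, 0, σ.P y) ∧ z = σ.G y)) ∨
    (∃ i < Q.k, Q.e ≤ i ∧ dig σ.B i (σ.P y) ≠ 0 ∧ key = (6, i, dig σ.B i (σ.P y)) ∧
      z = σ.P y)) (W + 5 * (Q.k + 2)) b) ?_ fun b3 g3 => ?_
  · rw [tm_seqs]
    refine run_seqs (fun i => Shrink a₀ (fun key z =>
      ((key = (4, 0, σ.G y) ∧ z = y) ∨ (key = (5, 0, σ.P y) ∧ z = σ.G y)) ∨
      (∃ j < i, Q.e ≤ j ∧ dig σ.B j (σ.P y) ≠ 0 ∧ key = (6, j, dig σ.B j (σ.P y)) ∧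
        z = σ.P y)) (W + 5 * (i + 2))) (g2.mono (by omega) (by simp))
      (g2.n_le.trans (by omega)) _ fun i hi b g => ?_
    have hbn := g.n_le
    have hPi : ev c b (Expr.dig i (rv Q 11)) = dig σ.B i (σ.P y) := by
      rw [ev, g.ρ]
      exact hp.digP hi _
    split_ifs with he
    · refine run_ite (by omega) (fun h => ?_) (fun h => ?_)
      · rw [hPi] at h
        refine (g.ers (hp.patKey hi) (Prep.eval_rv hp.pat hp.P_lt) hp.P_lt (by omega)
          (by simp)).mono le_rfl fun b' hb' => hb'.mono (by omega) fun key z => ?_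
        constructor
        · rintro ((h1 | ⟨j, h1, h2⟩) | h1)
          · exact Or.inl h1
          · exact Or.inr ⟨j, by omega, h2⟩
          · exact Or.inr ⟨i, by omega, he, h, h1⟩
        · rintro (h1 | ⟨j, h1, h2⟩)
          · exact Or.inl (Or.inl h1)
          · rcases Nat.lt_succ_iff_lt_or_eq.1 h1 with h1 | rfl
            · exact Or.inl (Or.inr ⟨j, h1, h2⟩)
            · exact Or.inr h2.2.2
      · rw [hPi] at h
        refine run_nop (by omega) (g.mono (by omega) fun key z => ?_)
        constructor
        · rintro (h1 | ⟨j, h1, h2⟩)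
          · exact Or.inl h1
          · exact Or.inr ⟨j, by omega, h2⟩
        · rintro (h1 | ⟨j, h1, h2⟩)
          · exact Or.inl h1
          · rcases Nat.lt_succ_iff_lt_or_eq.1 h1 with h1 | rfl
            · exact Or.inr ⟨j, h1, h2⟩
            · exact absurd h h2.2.1
    · refine run_nop (by omega) (g.mono (by omega) fun key z => ?_)
      constructor
      · rintro (h1 | ⟨j, h1, h2⟩)
        · exact Or.inl h1
        · exact Or.inr ⟨j, by omega, h2⟩
      · rintro (h1 | ⟨j, h1, h2⟩)
        · exact Or.inl h1
        · rcases Nat.lt_succ_iff_lt_or_eq.1 h1 with h1 | rfl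
          · exact Or.inr ⟨j, h1, h2⟩
          · exact absurd h2.1 he
  have hb3 := g3.n_le
  -- The pattern need not be linked, namely if one of its output values is dead; the deletion is
  -- then without effect.
  refine Run.seq (g3.ers hp.linkKey (Prep.eval_rv hp.pat hp.P_lt) hp.P_lt (by omega) (by simp))
    fun b4 g4 => ?_
  have hb4 := g4.n_le
  refine Run.sane fun hs4 => ?_
  have hz4 : ev c b4 (linkKey Q).size ≠ 0 ↔ σ.RootStays y := by
    rw [g4.size hp.linkKey hs4, ← Sem.links_iff h2']
    simp [hmem]
  refine run_ite (by omega) (fun h4 => ?_) (fun h4 => ?_)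
  · rw [hz4] at h4
    refine run_nop (by omega) (done g4 fun key z => ?_)
    rw [Sem.spec_delReg' hok hyσ]
    simp only [h1', h2', h4, not_or, not_true, not_false_iff, true_imp_iff, false_imp_iff, and_true,
      and_assoc]
  · have h4' : ¬ σ.RootStays y := fun h => hz4.2 h h4
    refine (g4.ers rootKey_is (Prep.eval_rv hp.root hp.root_lt) hp.root_lt (by omega)
      (by simp)).mono le_rfl fun b5 g5 => done g5 fun key z => ?_
    rw [Sem.spec_delReg' hok hyσ]
    simp only [h1', h2', h4', not_or, not_false_iff, true_imp_iff,
      and_assoc]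

end StarMaintenance

/-! ### Environments, loops over the tuples with a given value, and invariance of the
classification. -/

namespace StarMaintenance

open WordRAM Classical

variable {Q : StarQuery}

/-- The number of cells that suffice for a database with `n` tuples. -/
def room (Q : StarQuery) (n : ℕ) : ℕ := 3 * ((2 * Q.d + Q.k + 5) * n)

/-- The machine parameters during one request: all tuples that occur belong to the set `U`, and
at most `n` cells per set are needed. -/
structure Env (Q : StarQuery) where
  c : Cfg Q.d
  U : Finset ℕ
  n : ℕ
  card : U.card ≤ n
  ok : ∀ y ∈ U, Sem.Ok Q c.B y
  slack : room Q n + 5 * (Q.k + 6) ≤ c.S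

namespace Sem

/-- The tuples of `σ` belong to `U`. -/
structure Within (σ : Sem Q) (E : Env Q) : Prop where
  reg : σ.reg ⊆ E.U
  cen : ∀ i < Q.d, σ.cen i ⊆ E.U
  sat : ∑ i ∈ Finset.range Q.k, (σ.sat i).card ≤ E.n

theorem Within.weight_le {σ : Sem Q} {E : Env Q} (h : σ.Within E) : 3 * σ.weight ≤ room Q E.n := by
  have h1 : ∑ i ∈ Finset.range Q.d, (σ.cen i).card ≤ Q.d * E.n := by
    refine (Finset.sum_le_sum (g := fun _ => E.n) fun i hi => ?_).trans (by simp)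
    exact (Finset.card_le_card (h.cen i (Finset.mem_range.1 hi))).trans E.card
  have h2 : (Q.k + 4) * σ.reg.card ≤ (Q.k + 4) * E.n :=
    Nat.mul_le_mul_left _ ((Finset.card_le_card h.reg).trans E.card)
  have h3 := h.sat
  unfold weight room
  refine Nat.mul_le_mul_left _ ?_
  have : (2 * Q.d + Q.k + 5) * E.n = 2 * (Q.d * E.n) + E.n + (Q.k + 4) * E.n := by ring
  omega

/-- The same logical content, with the registered tuples `R`. -/
def withReg (σ : Sem Q) (R : Finset ℕ) : Sem Q := { σ with reg := R }

theorem Within.withReg {σ : Sem Q} {E : Env Q} (h : σ.Within E) {R : Finset ℕ} (hR : R ⊆ E.U) :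
    (σ.withReg R).Within E := ⟨hR, h.cen, h.sat⟩

end Sem

/-- The abstract state `a` stores the sets of `σ`, within the environment `E`. -/
structure Stage (E : Env Q) (σ : Sem Q) (a : AS Q.d) : Prop where
  st : St E.c (room Q E.n) σ a
  within : σ.Within E

variable {E : Env Q} {σ σ' : Sem Q} {a : AS Q.d} {y : ℕ}

theorem St.set {c : Cfg Q.d} {W : ℕ} (h : St c W σ a) {v : Var Q.d} (hv : v ≠ .loc 1) (x : ℕ) :
    St c W σ (a.set v x) :=
  ⟨h.wf, h.mem, by simpa [AS.set, Function.update_of_ne hv.symm] using h.thr, h.n, h.it⟩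

theorem Stage.set (h : Stage E σ a) {v : Var Q.d} (hv : v ≠ .loc 1) (x : ℕ) :
    Stage E σ (a.set v x) := ⟨h.st.set hv x, h.within⟩

theorem Stage.n_le (h : Stage E σ a) : a.n ≤ E.c.S := by
  have := E.slack
  have := h.st.n
  omega

theorem Stage.B (h : Stage E σ a) : σ.B = E.c.B := h.st.wf.B

theorem Stage.register (h : Stage E σ a) (hy : y ∈ E.U) (hX : a.ρ (.loc 10) = y) :
    Run E.c (register Q) a (tm (register Q)) fun b =>
      Stage E (σ.addReg y) b ∧ Agree 12 a.ρ b.ρ ∧ Keeps a.l b.l := by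
  have hs := E.slack
  have hw : (σ.addReg y).Within E :=
    h.within.withReg (Finset.insert_subset hy h.within.reg)
  exact (run_register h.st (E.ok y hy) hX (by omega) hw.weight_le).mono le_rfl
    fun b hb => ⟨⟨hb.1, hw⟩, hb.2⟩

theorem Stage.unregister (h : Stage E σ a) (hy : y ∈ E.U) (hX : a.ρ (.loc 10) = y) :
    Run E.c (unregister Q) a (tm (unregister Q)) fun b =>
      Stage E (σ.delReg y) b ∧ Agree 12 a.ρ b.ρ ∧ Keeps a.l b.l := by
  have hs := E.slack
  have hw : (σ.delReg y).Within E :=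
    h.within.withReg ((Finset.erase_subset _ _).trans h.within.reg)
  exact (run_unregister h.st (E.ok y hy) hX (by omega) hw.weight_le).mono le_rfl
    fun b hb => ⟨⟨hb.1, hw⟩, hb.2⟩

/-- Recomputation of the bound for the space. -/
theorem Stage.finish {b : AS Q.d} (hwf : σ'.Wf E.c) (hw : σ'.Within E)
    (hmem : ∀ key z, z ∈ b.l key ↔ σ'.spec key z) (hthr : b.ρ (.loc 1) = σ'.thr)
    (hit : ∀ x, b.it x = 0) :
    Holds b.l b.it (room Q E.n) ∧ Stage E σ' { b with n := room Q E.n } := by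
  refine ⟨holds_of_spec (E' := ∅) (fun key z hz => (hmem key z).1 hz)
    (fun x hx => absurd (hit x) hx) (by simpa using hw.weight_le), ⟨hwf, hmem, hthr, le_rfl, hit⟩,
    hw⟩

section lists

variable {κ : KeyE Q.d} {key : Key} {x : Expr Q.d}

end lists

namespace Sem

/-- The tuples with value `v` of the attribute `i`. -/
noncomputable def tuples (σ : Sem Q) (i v : ℕ) : Finset ℕ :=
  (σ.cen i).filter fun y => dig σ.B i y = v

theorem mem_tuples {i v : ℕ} : y ∈ σ.tuples i v ↔ y ∈ σ.cen i ∧ dig σ.B i y = v :=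
  Finset.mem_filter

end Sem

/-- The program `p` for all tuples with a given value of the attribute `i`. -/
def forTuples (i : ℕ) (u : Expr Q.d) (p : Prog) : Prog := forE (.loc 9) (.loc 10) ⟨1, i, u⟩ p

/-- The time per tuple of such a loop. -/
def tupleCost (i : ℕ) (u : Expr Q.d) (p : Prog) : ℕ := tm p + forCost (.loc 9) (.loc 10) ⟨1, i, u⟩

section loops

variable {i v : ℕ} {u : Expr Q.d}

theorem tuples_list (h : Stage E σ a) (hs : Sane E.c a.l) (hi : i < Q.d) :
    (∀ z, z ∈ a.l (1, i, v) ↔ z ∈ σ.tuples i v) ∧ (a.l (1, i, v)).length = σ.deg i v := by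
  refine ⟨fun z => ?_, length_tuples hs (fun z => h.st.mem _ _) hi⟩
  rw [h.st.mem, Sem.mem_tuples]
  simp [Sem.spec, hi]

/-- The traversed list is of kind 1, which the maintenance of groups leaves alone (`Keeps`), so it
may be iterated over while the groups change. The function `f` gives the set of registered tuples
after each iteration. -/
theorem run_forTuples {p : Prog} (R : ℕ → Finset ℕ) (h : Stage E σ a) (hi : i < Q.d)
    (hR : ∀ L : List ℕ, (∀ z, z ∈ L ↔ z ∈ σ.tuples i v) → ∃ f : ℕ → Finset ℕ, f 0 = σ.reg ∧
      f L.length = R v ∧ ∀ n (hn : n < L.length), ∀ b, Stage E (σ.withReg (f n)) b →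
        b.ρ (.loc 10) = L[n] → Run E.c p b (tm p) fun b' => Stage E (σ.withReg (f (n + 1))) b' ∧
          Agree 12 b.ρ b'.ρ ∧ Keeps b.l b'.l)
    (hu : ∀ ρ, Agree 10 a.ρ ρ → (KeyE.mk 1 i u).Is E.c ρ (1, i, v)) :
    Run E.c (forTuples i u p) a ((σ.deg i v + 1) * tupleCost i u p) fun b =>
      Stage E (σ.withReg (R v)) b ∧ Agree 10 a.ρ b.ρ ∧ Keeps a.l b.l := by
  refine Run.sane fun hs => ?_
  obtain ⟨h1, h2⟩ := tuples_list (v := v) h hs hi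
  obtain ⟨f, hf0, hf1, hf⟩ := hR _ h1
  rw [← h2, ← hf1]
  refine run_forE (key := (1, i, v)) (by simp) (fun n b => Stage E (σ.withReg (f n)) b ∧
    Agree 10 a.ρ b.ρ ∧ Keeps a.l b.l) ⟨?_, Agree.refl _ _, Keeps.refl _⟩ ?_ ?_ ?_
  · rw [hf0]
    exact h
  · rintro n b y ⟨g1, g2, g3⟩
    exact ⟨⟨g1.set (by simp) y, g2.update (by simp [Var.rank]) y, g3⟩,
      ⟨g1.set (by simp) y, g2.update (by simp [Var.rank]) y, g3⟩⟩
  · rintro n b ⟨g1, g2, g3⟩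
    exact ⟨hu _ g2, g3 _ _ _ le_rfl (by norm_num), g1.n_le⟩
  · rintro n hn b ⟨g1, g2, g3⟩ hv hx
    refine (hf n hn b g1 hx).mono le_rfl fun b' ⟨k1, k2, k3⟩ => ?_
    exact ⟨⟨k1, g2.trans (k2.mono (by norm_num)), g3.trans k3⟩,
      (k2 _ (by simp [Var.rank])).trans hv⟩

theorem run_registerAll (h : Stage E σ a) (hi : i < Q.d)
    (hu : ∀ ρ, Agree 10 a.ρ ρ → (KeyE.mk 1 i u).Is E.c ρ (1, i, v)) :
    Run E.c (forTuples i u (register Q)) a ((σ.deg i v + 1) * tupleCost i u (register Q)) fun b =>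
      Stage E (σ.withReg (σ.reg ∪ σ.tuples i v)) b ∧ Agree 10 a.ρ b.ρ ∧ Keeps a.l b.l := by
  refine run_forTuples (fun v => σ.reg ∪ σ.tuples i v) h hi (fun L hL => ?_) hu
  refine ⟨fun n => σ.reg ∪ (L.take n).toFinset, by simp, ?_, fun n hn b hb hx => ?_⟩
  · simp only [List.take_length]
    congr 1
    ext z
    rw [List.mem_toFinset, hL]
  · have hy : L[n] ∈ E.U :=
      h.within.cen i hi (Sem.mem_tuples.1 ((hL _).1 (List.getElem_mem hn))).1
    refine (hb.register hy hx).mono le_rfl fun b' hb' => ⟨?_, hb'.2⟩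
    have : (σ.withReg (σ.reg ∪ (L.take n).toFinset)).addReg L[n] =
        σ.withReg (σ.reg ∪ (L.take (n + 1)).toFinset) := by
      unfold Sem.addReg Sem.withReg
      congr 1
      ext z
      simp only [List.take_add_one, List.getElem?_eq_getElem hn, Option.toList_some,
        Finset.mem_insert, Finset.mem_union, List.mem_toFinset, List.mem_append,
        List.mem_singleton]
      tauto
    rw [← this]
    exact hb'.1

theorem run_unregisterAll (h : Stage E σ a) (hi : i < Q.d)
    (hu : ∀ ρ, Agree 10 a.ρ ρ → (KeyE.mk 1 i u).Is E.c ρ (1, i, v)) :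
    Run E.c (forTuples i u (unregister Q)) a ((σ.deg i v + 1) * tupleCost i u (unregister Q))
      fun b => Stage E (σ.withReg (σ.reg \ σ.tuples i v)) b ∧ Agree 10 a.ρ b.ρ ∧ Keeps a.l b.l := by
  refine run_forTuples (fun v => σ.reg \ σ.tuples i v) h hi (fun L hL => ?_) hu
  refine ⟨fun n => σ.reg \ (L.take n).toFinset, by simp, ?_, fun n hn b hb hx => ?_⟩
  · simp only [List.take_length]
    congr 1
    ext z
    rw [List.mem_toFinset, hL]
  · have hy : L[n] ∈ E.U :=
      h.within.cen i hi (Sem.mem_tuples.1 ((hL _).1 (List.getElem_mem hn))).1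
    refine (hb.unregister hy hx).mono le_rfl fun b' hb' => ⟨?_, hb'.2⟩
    have : (σ.withReg (σ.reg \ (L.take n).toFinset)).delReg L[n] =
        σ.withReg (σ.reg \ (L.take (n + 1)).toFinset) := by
      unfold Sem.delReg Sem.withReg
      congr 1
      ext z
      simp only [List.take_add_one, List.getElem?_eq_getElem hn, Option.toList_some,
        Finset.mem_erase, Finset.mem_sdiff, List.mem_toFinset, List.mem_append,
        List.mem_singleton]
      tauto
    rw [← this]
    exact hb'.1

end loops

namespace Sem

/-- The registered tuples are classified by `σ'` as by `σ`, and their light values are in the same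
satellites. -/
structure Same (σ σ' : Sem Q) : Prop where
  B : σ'.B = σ.B
  reg : σ'.reg = σ.reg
  heavy : ∀ y ∈ σ.reg, ∀ i < Q.d, σ'.Heavy i (dig σ.B i y) ↔ σ.Heavy i (dig σ.B i y)
  light : ∀ y ∈ σ.reg, ∀ i < Q.k, ¬ σ.Heavy i (dig σ.B i y) →
    (dig σ.B i y ∈ σ'.sat i ↔ dig σ.B i y ∈ σ.sat i)

theorem Same.pdig (h : Same σ σ') (hy : y ∈ σ.reg) {i : ℕ} (hi : i < Q.d) :
    σ'.pdig y i = σ.pdig y i := by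
  have := h.heavy y hy i hi
  unfold Sem.pdig
  rw [h.B]
  by_cases h1 : σ.Heavy i (dig σ.B i y)
  · rw [if_pos h1, if_pos (this.2 h1)]
  · rw [if_neg h1, if_neg (fun h2 => h1 (this.1 h2))]

theorem Same.P (h : Same σ σ') (hy : y ∈ σ.reg) : σ'.P y = σ.P y := by
  unfold Sem.P
  rw [h.B]
  exact pack_congr fun i hi => h.pdig hy hi

theorem Same.G (h : Same σ σ') (hy : y ∈ σ.reg) : σ'.G y = σ.G y := by
  unfold Sem.G
  rw [h.B]
  refine pack_congr fun i hi => ?_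
  split_ifs
  · exact h.pdig hy hi
  · rfl

theorem Same.lightAlive (h : Same σ σ') (hy : y ∈ σ.reg) : σ'.LightAlive y ↔ σ.LightAlive y := by
  have hk := Q.k_le
  unfold LightAlive
  rw [h.B]
  refine forall₂_congr fun i hi => ?_
  rw [h.heavy y hy i (by omega)]
  by_cases h1 : σ.Heavy i (dig σ.B i y)
  · simp [h1]
  · rw [h.light y hy i hi h1]

/-- The stored sets, where the patterns with the property `O` are considered as alive. -/
def linkSpec (σ : Sem Q) (O : ℕ → Prop) : Key → ℕ → Prop
  | (0, i, u), z => i = 0 ∧ u = 0 ∧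
      ∃ y ∈ σ.reg, σ.LightAlive y ∧ O (σ.P y) ∧ σ.P y % σ.B ^ Q.e = z
  | (7, i, β), z => i = 0 ∧ z % σ.B ^ Q.e = β ∧ O z ∧
      ∃ y ∈ σ.reg, σ.LightAlive y ∧ σ.P y = z
  | key, z => σ.spec key z

theorem linkSpec_outAlive (key : Key) (z : ℕ) : σ.linkSpec σ.OutAlive key z ↔ σ.spec key z := by
  obtain ⟨g, i, u⟩ := key
  match g with
  | 0 | 7 => exact Iff.rfl
  | 1 | 2 | 3 | 4 | 5 | 6 | n + 8 => exact Iff.rfl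

theorem linkSpec_congr {O O' : ℕ → Prop} (h : ∀ y ∈ σ.reg, O (σ.P y) ↔ O' (σ.P y)) (key : Key)
    (z : ℕ) : σ.linkSpec O key z ↔ σ.linkSpec O' key z := by
  obtain ⟨g, i, u⟩ := key
  match g with
  | 0 =>
    simp only [linkSpec]
    grind
  | 7 =>
    simp only [linkSpec]
    grind
  | 1 | 2 | 3 | 4 | 5 | 6 | n + 8 => exact Iff.rfl

/-- Patterns, groups and light status of the registered tuples coincide, so the group-related lists
could only differ in which patterns count as live; here this is frozen to the old state. -/
theorem Same.spec_iff (h : Same σ σ') {key : Key} (hk : key.1 = 0 ∨ 4 ≤ key.1) (z : ℕ) :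
    σ'.linkSpec σ.OutAlive key z ↔ σ.spec key z := by
  obtain ⟨g, i, u⟩ := key
  have e1 := fun y => h.P (y := y)
  have e2 := fun y => h.G (y := y)
  have e3 := fun y => h.lightAlive (y := y)
  have e4 := h.B
  have e5 := h.reg
  match g, hk with
  | 0, _ =>
    simp only [linkSpec, spec, e4, e5]
    grind
  | 4, _ =>
    simp only [linkSpec, spec, e5]
    grind
  | 5, _ =>
    simp only [linkSpec, spec, e5]
    grind
  | 6, _ =>
    simp only [linkSpec, spec, e4, e5]
    grind
  | 7, _ =>
    simp only [linkSpec, spec, e4, e5]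
    grind
  | n + 8, _ => simp [linkSpec, spec]

/-- The heavy values of the registered tuples are in the same satellites. -/
theorem Same.outAlive (h : Same σ σ') (hok : ∀ y ∈ σ.reg, Ok Q σ.B y)
    (hsat : ∀ y ∈ σ.reg, ∀ i < Q.k, Q.e ≤ i → σ.Heavy i (dig σ.B i y) →
      (dig σ.B i y ∈ σ'.sat i ↔ dig σ.B i y ∈ σ.sat i)) (hy : y ∈ σ.reg) :
    σ'.OutAlive (σ.P y) ↔ σ.OutAlive (σ.P y) := by
  have hk := Q.k_le
  unfold OutAlive
  rw [h.B]
  refine forall₂_congr fun i hi => forall_congr' fun he => ?_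
  rw [dig_P (hok y hy) (by omega), Sem.pdig]
  split_ifs with h1
  · simp [hsat y hy i hi he h1]
  · simp

theorem Same.spec_iff' (h : Same σ σ') (hok : ∀ y ∈ σ.reg, Ok Q σ.B y)
    (hsat : ∀ y ∈ σ.reg, ∀ i < Q.k, Q.e ≤ i → σ.Heavy i (dig σ.B i y) →
      (dig σ.B i y ∈ σ'.sat i ↔ dig σ.B i y ∈ σ.sat i)) {key : Key}
    (hk : key.1 = 0 ∨ 4 ≤ key.1) (z : ℕ) : σ'.spec key z ↔ σ.spec key z := by
  rw [← h.spec_iff hk, ← linkSpec_outAlive]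
  refine linkSpec_congr (fun y hy => ?_) key z
  rw [h.reg] at hy
  rw [h.P hy]
  exact h.outAlive hok hsat hy

end Sem

end StarMaintenance

/-! ### Counting patterns and bound parts, and updating the links of a pattern. -/

namespace StarMaintenance

open WordRAM Classical

variable {Q : StarQuery} {E : Env Q} {σ σ' : Sem Q} {a : AS Q.d} {y : ℕ}

/-- A number below `B ^ n` is determined by its digits, so the set embeds into a product. -/
theorem card_le_prod_digits {B n : ℕ} {S : Finset ℕ} (A : ℕ → Finset ℕ)
    (hS : ∀ z ∈ S, z < B ^ n ∧ ∀ j < n, dig B j z ∈ A j) :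
    S.card ≤ ∏ j ∈ Finset.range n, (A j).card := by
  rw [← Fin.prod_univ_eq_prod_range (fun j => (A j).card) n, ← Fintype.card_piFinset]
  refine Finset.card_le_card_of_injOn (fun z j => dig B j z) (fun z hz => ?_)
    (fun x hx z hz hxz => ?_)
  · exact Fintype.mem_piFinset.2 fun j => (hS z hz).2 j j.isLt
  · exact eq_of_dig_eq (hS x hx).1 (hS z hz).1 fun i hi => congrFun hxz ⟨i, hi⟩

namespace Sem

/-- The values of the attribute `i` with degree at least `δ`. -/
noncomputable def lev (σ : Sem Q) (i δ : ℕ) : Finset ℕ :=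
  ((σ.cen i).image (dig σ.B i)).filter fun v => δ ≤ σ.deg i v

/-- A value of positive degree occurs in the center, so for `1 ≤ δ` the restriction to occurring
values is void. -/
theorem mem_lev {i δ v : ℕ} (hδ : 1 ≤ δ) : v ∈ σ.lev i δ ↔ δ ≤ σ.deg i v := by
  rw [lev, Finset.mem_filter]
  exact ⟨fun h => h.2, fun h => ⟨mem_image_of_deg (hδ.trans h), h⟩⟩

theorem dig_P_mem (hok : Ok Q σ.B y) (ht : 1 ≤ σ.thr) {i : ℕ} (hi : i < Q.d) :
    dig σ.B i (σ.P y) ∈ insert 0 ((σ.lev i σ.thr).image (· + 1)) := by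
  rw [dig_P hok hi, pdig]
  split_ifs with h
  · exact Finset.mem_insert_of_mem (Finset.mem_image_of_mem _ ((mem_lev ht).2 h))
  · exact Finset.mem_insert_self _ _

theorem card_insert_lev (i : ℕ) {M : ℕ} (h : (σ.lev i σ.thr).card ≤ M) :
    (insert 0 ((σ.lev i σ.thr).image (· + 1))).card ≤ 1 + M := by
  have h1 := Finset.card_insert_le 0 ((σ.lev i σ.thr).image (· + 1))
  have h2 := Finset.card_image_le (s := σ.lev i σ.thr) (f := (· + 1))
  omega

/-- There are few patterns with a given digit. -/
theorem card_patterns_le (hok : ∀ y ∈ σ.reg, Ok Q σ.B y) (ht : 1 ≤ σ.thr) {M : ℕ}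
    (hM : ∀ i < Q.d, (σ.lev i σ.thr).card ≤ M) {i u : ℕ} (hi : i < Q.d) {S : Finset ℕ}
    (hS : ∀ z ∈ S, dig σ.B i z = u ∧ ∃ y ∈ σ.reg, σ.P y = z) : S.card ≤ (1 + M) ^ (Q.d - 1) := by
  refine (card_le_prod_digits (B := σ.B) (n := Q.d) (fun j => if j = i then {u} else
    insert 0 ((σ.lev j σ.thr).image (· + 1))) fun z hz => ?_).trans ?_
  · obtain ⟨h1, y, hy, rfl⟩ := hS z hz
    refine ⟨P_lt (hok y hy), fun j hj => ?_⟩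
    split_ifs with h
    · subst h
      exact Finset.mem_singleton.2 h1
    · exact dig_P_mem (hok y hy) ht hj
  · rw [← Finset.mul_prod_erase _ _ (Finset.mem_range.2 hi), if_pos rfl, Finset.card_singleton,
      one_mul]
    refine (Finset.prod_le_pow_card _ _ (1 + M) fun j hj => ?_).trans (by simp [hi])
    rw [Finset.mem_erase, Finset.mem_range] at hj
    rw [if_neg hj.1]
    exact card_insert_lev j (hM j hj.2)

/-- There are few bound parts of patterns. -/
theorem card_roots_le (hok : ∀ y ∈ σ.reg, Ok Q σ.B y) (ht : 1 ≤ σ.thr) {M : ℕ}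
    (hM : ∀ i < Q.d, (σ.lev i σ.thr).card ≤ M) {S : Finset ℕ}
    (hS : ∀ z ∈ S, ∃ y ∈ σ.reg, σ.P y % σ.B ^ Q.e = z) : S.card ≤ (1 + M) ^ Q.e := by
  have he := e_le (Q := Q)
  refine (card_le_prod_digits (B := σ.B) (n := Q.e) (fun j =>
    insert 0 ((σ.lev j σ.thr).image (· + 1))) fun z hz => ?_).trans ?_
  · obtain ⟨y, hy, rfl⟩ := hS z hz
    have hB : 0 < σ.B ^ Q.e ∨ Q.e = 0 := by
      by_cases h0 : Q.e = 0
      · exact Or.inr h0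
      · have := (hok y hy).2 0 (by omega)
        exact Or.inl (pow_pos (by omega) _)
    refine ⟨?_, fun j hj => ?_⟩
    · rcases hB with hB | hB
      · exact Nat.mod_lt _ hB
      · simp [hB, Nat.mod_one]
    · have := (hok y hy).2 j (by omega)
      rw [dig_mod (by omega) hj]
      exact dig_P_mem (hok y hy) ht (by omega)
  · refine (Finset.prod_le_pow_card _ _ (1 + M) fun j hj => ?_).trans (by simp)
    exact card_insert_lev j (hM j (by have := Finset.mem_range.1 hj; omega))

theorem mem_pairs_of_linkSpec {O : ℕ → Prop} {key : Key} {z : ℕ} (h : σ.linkSpec O key z) :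
    (key, z) ∈ σ.pairs := by
  obtain ⟨g, i, u⟩ := key
  match g, h with
  | 0, h =>
    obtain ⟨rfl, rfl, y, h1, h2, h3, rfl⟩ := h
    exact Finset.mem_union_right _ (Finset.mem_image_of_mem
      (fun y => (((0, 0, 0), σ.P y % σ.B ^ Q.e) : Key × ℕ)) h1)
  | 7, h =>
    obtain ⟨rfl, rfl, h2, y, h3, h4, rfl⟩ := h
    exact Finset.mem_union_left _ (Finset.mem_union_right _ (Finset.mem_image_of_mem
      (fun y => (((7, 0, σ.P y % σ.B ^ Q.e), σ.P y) : Key × ℕ)) h3))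
  | 1, h | 2, h | 3, h | 4, h | 5, h | 6, h => exact mem_pairs h
  | n + 8, h => exact mem_pairs h

theorem linkSpec_congr' {O O' : ℕ → Prop}
    (h : ∀ y ∈ σ.reg, σ.LightAlive y → (O (σ.P y) ↔ O' (σ.P y))) (key : Key) (z : ℕ) :
    σ.linkSpec O key z ↔ σ.linkSpec O' key z := by
  obtain ⟨g, i, u⟩ := key
  match g with
  | 0 =>
    simp only [linkSpec]
    grind
  | 7 =>
    simp only [linkSpec]
    grind
  | 1 | 2 | 3 | 4 | 5 | 6 | n + 8 => exact Iff.rfl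

/-- The number `p` is the pattern of a registered tuple whose light values are alive. -/
def IsPattern (σ : Sem Q) (p : ℕ) : Prop := ∃ y ∈ σ.reg, σ.LightAlive y ∧ σ.P y = p

theorem linkSpec_add {O : ℕ → Prop} {p : ℕ} (hp : σ.IsPattern p) (key : Key) (z : ℕ) :
    σ.linkSpec (fun q => O q ∨ q = p) key z ↔ (σ.linkSpec O key z ∨
      (key = (7, 0, p % σ.B ^ Q.e) ∧ z = p)) ∨ (key = (0, 0, 0) ∧ z = p % σ.B ^ Q.e) := by
  obtain ⟨x, h1, h2, rfl⟩ := hp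
  obtain ⟨g, i, u⟩ := key
  match g with
  | 0 =>
    simp only [linkSpec, Prod.mk.injEq]
    grind
  | 7 =>
    simp only [linkSpec, Prod.mk.injEq]
    grind
  | 1 | 2 | 3 | 4 | 5 | 6 | n + 8 => simp [linkSpec]

/-- If the pattern `p` was the witness for its bound part, any other live pattern over the same
bound part can replace it; otherwise the bound part goes as well. The emptiness of the remaining
list decides between the two. -/
theorem linkSpec_remove {O : ℕ → Prop} {p : ℕ} (key : Key) (z : ℕ) :
    σ.linkSpec (fun q => O q ∧ q ≠ p) key z ↔ (σ.linkSpec O key z ∧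
      ¬ (key = (7, 0, p % σ.B ^ Q.e) ∧ z = p)) ∧
      ((¬ ∃ z', σ.linkSpec O (7, 0, p % σ.B ^ Q.e) z' ∧ z' ≠ p) →
        ¬ (key = (0, 0, 0) ∧ z = p % σ.B ^ Q.e)) := by
  obtain ⟨g, i, u⟩ := key
  match g with
  | 0 =>
    simp only [linkSpec, Prod.mk.injEq]
    constructor
    · rintro ⟨h1, h2, x, h3, h4, ⟨h5, h6⟩, h7⟩
      refine ⟨⟨⟨h1, h2, x, h3, h4, h5, h7⟩, by simp⟩, fun h8 h9 => h8 ?_⟩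
      exact ⟨σ.P x, ⟨trivial, h7.trans h9.2, h5, x, h3, h4, rfl⟩, h6⟩
    · rintro ⟨⟨⟨h1, h2, x, h3, h4, h5, h7⟩, -⟩, h8⟩
      by_cases h6 : σ.P x = p
      · by_cases h9 : ∃ z', (True ∧ z' % σ.B ^ Q.e = p % σ.B ^ Q.e ∧ O z' ∧
            ∃ y ∈ σ.reg, σ.LightAlive y ∧ σ.P y = z') ∧ z' ≠ p
        · obtain ⟨z', ⟨-, g1, g2, x', g3, g4, rfl⟩, g6⟩ := h9
          exact ⟨h1, h2, x', g3, g4, ⟨g2, g6⟩, by rw [g1, ← h6, h7]⟩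
        · exact absurd ⟨⟨trivial, h1, h2⟩, by rw [← h7, h6]⟩ (h8 h9)
      · exact ⟨h1, h2, x, h3, h4, ⟨h5, h6⟩, h7⟩
  | 7 =>
    simp only [linkSpec, Prod.mk.injEq]
    grind
  | 1 | 2 | 3 | 4 | 5 | 6 | n + 8 => simp [linkSpec]

end Sem

/-- The abstract state `a` stores the sets of `σ`, where the patterns with the property `O` are
considered as alive. -/
structure Linked (E : Env Q) (σ : Sem Q) (O : ℕ → Prop) (a : AS Q.d) : Prop where
  wf : σ.Wf E.c
  mem : ∀ key z, z ∈ a.l key ↔ σ.linkSpec O key z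
  thr : a.ρ (.loc 1) = σ.thr
  n : a.n ≤ room Q E.n
  it : ∀ x, a.it x = 0
  within : σ.Within E

theorem Linked.stage {O : ℕ → Prop} (h : Linked E σ O a)
    (hO : ∀ y ∈ σ.reg, σ.LightAlive y → (O (σ.P y) ↔ σ.OutAlive (σ.P y))) : Stage E σ a := by
  refine ⟨⟨h.wf, fun key z => ?_, h.thr, h.n, h.it⟩, h.within⟩
  rw [h.mem, Sem.linkSpec_congr' hO, Sem.linkSpec_outAlive]

theorem Linked.set {O : ℕ → Prop} (h : Linked E σ O a) {v : Var Q.d} (hv : v ≠ .loc 1) (x : ℕ) :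
    Linked E σ O (a.set v x) :=
  ⟨h.wf, h.mem, by simpa [AS.set, Function.update_of_ne hv.symm] using h.thr, h.n, h.it, h.within⟩

theorem Linked.n_le {O : ℕ → Prop} (h : Linked E σ O a) : a.n ≤ E.c.S := by
  have := E.slack
  have := h.n
  omega

theorem Linked.view {O : ℕ → Prop} (h : Linked E σ O a) (hs : Sane E.c a.l) :
    View E.c σ a.ρ a.l := by
  refine ⟨h.wf, hs, fun g i u z h1 h2 => ?_, h.thr⟩
  rw [h.mem]
  match g, h1, h2 with
  | 1, _, _ | 2, _, _ | 3, _, _ => exact Iff.rfl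

theorem Linked.finish {O : ℕ → Prop} {b : AS Q.d} (hwf : σ.Wf E.c) (hw : σ.Within E)
    (hmem : ∀ key z, z ∈ b.l key ↔ σ.linkSpec O key z) (hthr : b.ρ (.loc 1) = σ.thr)
    (hit : ∀ x, b.it x = 0) :
    Holds b.l b.it (room Q E.n) ∧ Linked E σ O { b with n := room Q E.n } := by
  refine ⟨⟨σ.pairs, ∅, fun key z hz => Sem.mem_pairs_of_linkSpec ((hmem key z).1 hz),
    fun x hx => absurd (hit x) hx, ?_⟩, hwf, hmem, hthr, le_rfl, hit, hw⟩
  have := σ.card_pairs_le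
  have := hw.weight_le
  simp only [Finset.card_empty]
  omega

section lists

variable {κ : KeyE Q.d} {key : Key} {x : Expr Q.d} {O O' : ℕ → Prop}

theorem Linked.ins (h : Linked E σ O a) (hκ : κ.Is E.c a.ρ key)
    (hx : ∀ μ, x.eval E.c.w a.ρ μ = y) (hy : y < E.c.B ^ (Q.d + 1)) (hwf : σ'.Wf E.c)
    (hw : σ'.Within E) (hthr : σ'.thr = σ.thr)
    (hspec : ∀ key' z, σ'.linkSpec O' key' z ↔ σ.linkSpec O key' z ∨ (key' = key ∧ z = y)) :
    Run E.c (ins κ x) a (tm (ins κ x)) fun b =>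
      Linked E σ' O' b ∧ b.ρ = a.ρ ∧ ∀ key' ≠ key, b.l key' = a.l key' := by
  have hs := E.slack
  have hn := h.n
  refine Run.tighten (Mid := fun b => (∀ key z, z ∈ b.l key ↔ σ'.linkSpec O' key z) ∧ b.ρ = a.ρ ∧
    b.it = a.it ∧ ∀ key' ≠ key, b.l key' = a.l key') ?_ ?_
  · refine run_ins hκ hx hy (by omega) ⟨fun key' z => ?_, rfl, rfl, fun key' hk => insL_of_ne hk⟩
    rw [mem_insL, h.mem, hspec]
  · rintro b ⟨h1, h2, h3, h4⟩
    obtain ⟨h5, h6⟩ := Linked.finish (b := b) hwf hw h1 (by rw [h2, hthr, h.thr])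
      (fun x => by rw [h3, h.it])
    exact ⟨_, h5, h6, h2, h4⟩

theorem Linked.ers (h : Linked E σ O a) (hκ : κ.Is E.c a.ρ key)
    (hx : ∀ μ, x.eval E.c.w a.ρ μ = y) (hy : y < E.c.B ^ (Q.d + 1)) (hwf : σ'.Wf E.c)
    (hw : σ'.Within E) (hthr : σ'.thr = σ.thr)
    (hspec : ∀ key' z, σ'.linkSpec O' key' z ↔ σ.linkSpec O key' z ∧ ¬ (key' = key ∧ z = y)) :
    Run E.c (ers κ x) a (tm (ers κ x)) fun b =>
      Linked E σ' O' b ∧ b.ρ = a.ρ ∧ ∀ key' ≠ key, b.l key' = a.l key' := by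
  have hs := E.slack
  have hn := h.n
  refine Run.tighten (Mid := fun b => (∀ key z, z ∈ b.l key ↔ σ'.linkSpec O' key z) ∧ b.ρ = a.ρ ∧
    b.it = a.it ∧ ∀ key' ≠ key, b.l key' = a.l key') ?_ ?_
  · refine Run.sane fun hsane => ?_
    refine run_ers hκ hx hy (by omega) ⟨fun key' z => ?_, rfl, rfl, fun key' hk => ersL_of_ne hk⟩
    rw [mem_ersL (hsane key).1, h.mem, hspec]
  · rintro b ⟨h1, h2, h3, h4⟩
    obtain ⟨h5, h6⟩ := Linked.finish (b := b) hwf hw h1 (by rw [h2, hthr, h.thr])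
      (fun x => by rw [h3, h.it])
    exact ⟨_, h5, h6, h2, h4⟩

end lists

section programs

variable (Q)

/-- The value of an input variable. -/
abbrev iv (n : Fin (Q.d + 2)) : Expr Q.d := .var (.inp n)

/-- Update of the links of the pattern in variable `11`. -/
def relink : Prog :=
  .seq (loadPattern Q) (cond (iv Q 0)
    (cond (rv Q 15) (.seq (ins (linkKey Q) (rv Q 11)) (ins (rootKey Q) (rv Q 13))) .nop)
    (unlink Q))

end programs

/-- The lists other than links are kept. -/
def KeepsOthers (l l' : Key → List ℕ) : Prop := ∀ key, key.1 ≠ 0 → key.1 ≠ 7 → l' key = l key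

/-- After an insertion a pattern is linked if all its output values are alive now. After a deletion
it is unlinked without a test: the procedure is meant for patterns that contain the updated value.
-/
theorem Linked.relink {O : ℕ → Prop} {p f : ℕ} (h : Linked E σ O a) (hp : σ.IsPattern p)
    (hP : a.ρ (.loc 11) = p) (hf : a.ρ (.inp 0) = f) (hf1 : f ≤ 1) :
    Run E.c (relink Q) a (tm (relink Q)) fun b =>
      Linked E σ (fun q => if f = 0 then O q ∧ q ≠ p else O q ∨ (q = p ∧ σ.OutAlive p)) b ∧
        Agree 12 a.ρ b.ρ ∧ KeepsOthers a.l b.l := by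
  have hB := h.wf.B
  have hok : ∃ x, Sem.Ok Q E.c.B x ∧ σ.P x = p := by
    obtain ⟨x, h1, -, h2⟩ := hp
    exact ⟨x, hB ▸ h.wf.reg x h1, h2⟩
  have hpB : p < E.c.B ^ Q.d := by
    obtain ⟨x, h1, rfl⟩ := hok
    rw [← hB] at h1 ⊢
    exact Sem.P_lt h1
  have hpow : E.c.B ^ Q.d < E.c.B ^ (Q.d + 1) := Nat.pow_lt_pow_right E.c.one_lt_B (by omega)
  have hp' : p < E.c.B ^ (Q.d + 1) := hpB.trans hpow
  have hβ : p % σ.B ^ Q.e < E.c.B ^ (Q.d + 1) := (Nat.mod_le _ _).trans_lt hp'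
  have hβ1 : p % E.c.B ^ Q.e < E.c.B ^ (Q.d + 1) := hB ▸ hβ
  refine Run.sane fun hs => ?_
  refine Run.seq (run_loadPattern (h.view hs) hpB hP h.n_le) ?_
  rintro _ ⟨g, rfl, hg⟩
  have h' := (h.set (v := .loc 13) (by simp) (p % σ.B ^ Q.e)).set (v := .loc 15) (by simp) g
  set a1 := (a.set (.loc 13) (p % σ.B ^ Q.e)).set (.loc 15) g with ha1
  have hag : Agree 12 a.ρ a1.ρ :=
    ((Agree.refl _ _).update (by simp [Var.rank]) _).update (by simp [Var.rank]) _
  have r11 : a1.ρ (.loc 11) = p := by simp [ha1, AS.set, hP]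
  have r13 : a1.ρ (.loc 13) = p % E.c.B ^ Q.e := by simp [ha1, AS.set, hB]
  have r15 : a1.ρ (.loc 15) = g := by simp [ha1, AS.set]
  have r0 : a1.ρ (.inp 0) = f := by simp [ha1, AS.set, hf]
  have e0 : ev E.c a1 (iv Q 0) = f := eval_var _ r0 (E.c.small_lt_word (by omega))
  have e11 : ∀ μ, (rv Q 11).eval E.c.w a1.ρ μ = p := Prep.eval_rv r11 hp'
  have e13 : ∀ μ, (rv Q 13).eval E.c.w a1.ρ μ = p % E.c.B ^ Q.e := Prep.eval_rv r13 hβ1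
  have k7 : (linkKey Q).Is E.c a1.ρ (7, 0, p % E.c.B ^ Q.e) :=
    key_is (by norm_num) (Nat.zero_le _) e13 hβ1
  refine run_ite h'.n_le (fun hf0 => ?_) (fun hf0 => ?_)
  · rw [e0] at hf0
    have eg : ev E.c a1 (rv Q 15) = g := by
      refine eval_var _ r15 (E.c.small_lt_word ?_)
      by_cases ho : σ.OutAlive p
      · rw [hg.1 ho]; omega
      · rw [hg.2 ho]; omega
    refine run_ite h'.n_le (fun hg1 => ?_) (fun hg1 => ?_)
    · rw [eg, hg.ne_zero] at hg1
      have hadd := Sem.linkSpec_add (O := O) hp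
      rw [hB] at hadd
      have hs := E.slack
      have hn := h'.n
      refine Run.tighten (Mid := fun b => (∀ key z, z ∈ b.l key ↔
        σ.linkSpec (fun q => O q ∨ q = p) key z) ∧ b.ρ = a1.ρ ∧
        b.it = a1.it ∧ KeepsOthers a.l b.l) ?_ ?_
      · refine Run.seq (run_ins (Post := fun b => b = { a1 with
          l := insL a1.l (7, 0, p % E.c.B ^ Q.e) p, n := a1.n + 3 }) k7 e11 hp' (by omega) rfl) ?_
        rintro _ rfl
        refine run_ins rootKey_is e13 hβ1 (by simp only; omega) ⟨fun key z => ?_, rfl, rfl, ?_⟩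
        · rw [mem_insL, mem_insL, h'.mem, hadd]
        · intro key k1 k2
          simp only
          rw [insL_of_ne (by rintro rfl; simp at k1), insL_of_ne (by rintro rfl; simp at k2)]
          rfl
      · rintro b ⟨b1, b2, b3, b4⟩
        obtain ⟨h5, h6⟩ := Linked.finish (b := b) h.wf h.within b1 (by rw [b2, h'.thr])
          (fun x => by rw [b3, h'.it])
        refine ⟨_, h5, ?_, ?_, b4⟩
        · simp only [hf0, if_false, hg1, and_true]
          exact h6
        · simp only [b2]
          exact hag
    · rw [eg, ← not_ne_iff, hg.ne_zero] at hg1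
      refine run_nop h'.n_le ⟨?_, hag, fun key _ _ => rfl⟩
      simp only [hf0, if_false, hg1, and_false, or_false]
      exact h'
  · rw [e0] at hf0
    have hrem := Sem.linkSpec_remove (σ := σ) (O := O) (p := p)
    rw [hB] at hrem
    have hs := E.slack
    have hn := h'.n
    refine Run.tighten (Mid := fun b => (∀ key z, z ∈ b.l key ↔
      σ.linkSpec (fun q => O q ∧ q ≠ p) key z) ∧ b.ρ = a1.ρ ∧
      b.it = a1.it ∧ KeepsOthers a.l b.l) ?_ ?_
    · refine Run.sane fun hs1 => ?_
      refine Run.seq (run_ers (Post := fun b => b = { a1 with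
        l := ersL a1.l (7, 0, p % E.c.B ^ Q.e) p, n := a1.n + 5 }) k7 e11 hp' (by omega) rfl) ?_
      rintro _ rfl
      refine Run.sane fun hs2 => ?_
      have hsz : ev E.c { a1 with l := ersL a1.l (7, 0, p % E.c.B ^ Q.e) p, n := a1.n + 5 }
          (linkKey Q).size ≠ 0 ↔ ∃ z, σ.linkSpec O (7, 0, p % E.c.B ^ Q.e) z ∧ z ≠ p := by
        rw [size_ne_zero hs2 k7]
        simp only [mem_ersL (hs1 _).1, h'.mem, true_and]
      have keep : KeepsOthers a.l (ersL a1.l (7, 0, p % E.c.B ^ Q.e) p) := by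
        intro key k1 k2
        rw [ersL_of_ne (by rintro rfl; simp at k2)]
        rfl
      refine run_ite (by simp only; omega) (fun hz => ?_) (fun hz => ?_)
      · rw [hsz] at hz
        refine run_nop (by simp only; omega) ⟨fun key z => ?_, rfl, rfl, keep⟩
        simp only
        rw [mem_ersL (hs1 _).1, h'.mem, hrem]
        simp [hz]
      · rw [← not_ne_iff, hsz] at hz
        refine run_ers rootKey_is e13 hβ1 (by simp only; omega) ⟨fun key z => ?_, rfl, rfl, ?_⟩
        · rw [mem_ersL (hs2 _).1]
          simp only
          rw [mem_ersL (hs1 _).1, h'.mem, hrem]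
          simp only [hz, not_false_iff, true_imp_iff]
        · intro key k1 k2
          simp only
          rw [ersL_of_ne (by rintro rfl; simp at k1)]
          exact keep key k1 k2
    · rintro b ⟨b1, b2, b3, b4⟩
      obtain ⟨h5, h6⟩ := Linked.finish (b := b) h.wf h.within b1 (by rw [b2, h'.thr])
        (fun x => by rw [b3, h'.it])
      refine ⟨_, h5, ?_, ?_, b4⟩
      · simp only [hf0, if_true]
        exact h6
      · simp only [b2]
        exact hag

end StarMaintenance

/-! ### Updates of a satellite relation. -/

namespace StarMaintenance

open WordRAM Classical

variable {Q : StarQuery} {E : Env Q} {σ σ' : Sem Q} {a : AS Q.d} {i v f : ℕ}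

namespace Sem

/-- The same logical content, with the satellite relation number `i` replaced. -/
def withSat (σ : Sem Q) (i : ℕ) (S : Finset ℕ) : Sem Q :=
  { σ with sat := Function.update σ.sat i S }

/-- Insertion or deletion of `v`. -/
def toggled (S : Finset ℕ) (v f : ℕ) : Finset ℕ := if f = 0 then S.erase v else insert v S

theorem mem_toggled_of_ne {S : Finset ℕ} {x : ℕ} (h : x ≠ v) : x ∈ toggled S v f ↔ x ∈ S := by
  unfold toggled
  split_ifs <;> simp [h]

/-- All tuples are registered. -/
def Full (σ : Sem Q) : Prop := ∀ i < Q.d, σ.cen i = σ.reg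

theorem mem_sat_toggled {j x : ℕ} (h : j = i → x ≠ v) :
    x ∈ (σ.withSat i (toggled (σ.sat i) v f)).sat j ↔ x ∈ σ.sat j := by
  by_cases hj : j = i
  · subst hj
    simp only [withSat, Function.update_self]
    exact mem_toggled_of_ne (h rfl)
  · simp [withSat, Function.update_of_ne hj]

/-- Satellites are consulted for a tuple only at its light values, so toggling a heavy value affects
no tuple, only patterns. -/
theorem same_withSat_of_heavy (hv : σ.Heavy i v) :
    Same σ (σ.withSat i (toggled (σ.sat i) v f)) := by
  refine ⟨rfl, rfl, fun _ _ _ _ => Iff.rfl, fun y _ j _ hj => mem_sat_toggled ?_⟩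
  rintro rfl h
  exact hj (h ▸ hv)

theorem same_withSat_of_not_mem (h : ∀ y ∈ σ.reg, dig σ.B i y ≠ v) :
    Same σ (σ.withSat i (toggled (σ.sat i) v f)) :=
  ⟨rfl, rfl, fun _ _ _ _ => Iff.rfl, fun y hy _ _ _ => mem_sat_toggled fun hj => hj ▸ h y hy⟩

theorem outAlive_withSat {q : ℕ} (h : ¬ (Q.e ≤ i ∧ dig σ.B i q = v + 1)) :
    (σ.withSat i (toggled (σ.sat i) v f)).OutAlive q ↔ σ.OutAlive q := by
  refine forall₂_congr fun j hj => forall_congr' fun he => or_congr Iff.rfl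
    (and_congr_right fun h1 => mem_sat_toggled ?_)
  rintro rfl h2
  change 1 ≤ dig σ.B j q at h1
  change dig σ.B j q - 1 = v at h2
  exact h ⟨he, by omega⟩

theorem OutAlive.insert {q : ℕ} (hf : f ≠ 0) (h : σ.OutAlive q) :
    (σ.withSat i (toggled (σ.sat i) v f)).OutAlive q := by
  intro j hj he
  refine (h j hj he).imp id fun h1 => ⟨h1.1, ?_⟩
  by_cases hji : j = i
  · subst hji
    simp only [withSat, Function.update_self, toggled, if_neg hf]
    exact Finset.mem_insert_of_mem h1.2
  · simp only [withSat, Function.update_of_ne hji]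
    exact h1.2

theorem not_outAlive_erase {q : ℕ} (hi : i < Q.k) (he : Q.e ≤ i) (hq : dig σ.B i q = v + 1) :
    ¬ (σ.withSat i (toggled (σ.sat i) v 0)).OutAlive q := by
  intro h
  have h1 := h i hi he
  change dig σ.B i q = 0 ∨ 1 ≤ dig σ.B i q ∧ dig σ.B i q - 1 ∈ _ at h1
  rw [hq] at h1
  simp [withSat, toggled] at h1

end Sem

section programs

variable (Q)

/-- The value of a satellite update, plus one. -/
abbrev satVal : Expr Q.d := (iv Q 2).add (.const 1)

/-- The update of the satellite relation number `i` itself. -/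
def toggleSat (i : ℕ) : Prog :=
  cond (iv Q 0) (ins (KeyE.mk 3 i (.const 0)) (satVal Q)) (ers (KeyE.mk 3 i (.const 0)) (satVal Q))

/-- An update of the satellite relation number `i`. -/
def updateSat (i : ℕ) : Prog :=
  cond (heavyE Q i (iv Q 2))
    (.seq (toggleSat Q i) (forE (.loc 9) (.loc 11) (KeyE.mk 6 i (satVal Q)) (relink Q)))
    (.seq (forTuples i (iv Q 2) (unregister Q)) (.seq (toggleSat Q i)
      (forTuples i (iv Q 2) (register Q))))

/-- A factor in the time of a satellite update. -/
def updateSatCost (i : ℕ) : ℕ :=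
  tm ((heavyE Q i (iv Q 2)).compile 0) + tm (toggleSat Q i) + tm (relink Q) +
    forCost (.loc 9) (.loc 11) (KeyE.mk 6 i (satVal Q)) + tupleCost i (iv Q 2) (unregister Q) +
    tupleCost i (iv Q 2) (register Q) + 1

end programs

/-- The inputs of a satellite update. -/
structure SatInput (E : Env Q) (a : AS Q.d) (i v f : ℕ) : Prop where
  i_lt : i < Q.k
  v_lt : v + 1 < E.c.B
  flag : a.ρ (.inp 0) = f
  flag_le : f ≤ 1
  val : a.ρ (.inp 2) = v

namespace SatInput

theorem agree (h : SatInput E a i v f) {b : AS Q.d} {m : ℕ} (hab : Agree m a.ρ b.ρ) (hm : 0 < m) :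
    SatInput E b i v f :=
  ⟨h.i_lt, h.v_lt, (hab (.inp 0) hm).trans h.flag, h.flag_le, (hab (.inp 2) hm).trans h.val⟩

theorem lt_pow (h : SatInput E a i v f) : v + 1 < E.c.B ^ (Q.d + 1) :=
  h.v_lt.trans_le (Nat.le_self_pow (by omega) _)

theorem lt_word (h : SatInput E a i v f) : v + 1 < 2 ^ E.c.w :=
  lt_word_of_lt h.lt_pow (by omega)

theorem eval_val (h : SatInput E a i v f) (μ : ℕ → ℕ) : (iv Q 2).eval E.c.w a.ρ μ = v :=
  eval_var _ h.val (by have := h.lt_word; omega)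

theorem eval_succ (h : SatInput E a i v f) (μ : ℕ → ℕ) : (satVal Q).eval E.c.w a.ρ μ = v + 1 :=
  eval_add (h.eval_val μ) (eval_const (by omega)) h.lt_word

theorem eval_flag (h : SatInput E a i v f) : ev E.c a (iv Q 0) = f :=
  eval_var _ h.flag (E.c.small_lt_word (by have := h.flag_le; omega))

theorem tupleKey (h : SatInput E a i v f) : (KeyE.mk 1 i (iv Q 2)).Is E.c a.ρ (1, i, v) := by
  have := Q.k_le
  have := h.i_lt
  exact key_is (by norm_num) (by omega) h.eval_val (by have := h.lt_pow; omega)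

end SatInput

theorem SatInput.tupleKeys (h : SatInput E a i v f) {ρ : Var Q.d → ℕ} (hρ : Agree 10 a.ρ ρ) :
    (KeyE.mk 1 i (iv Q 2)).Is E.c ρ (1, i, v) :=
  (h.agree (b := { a with ρ := ρ }) hρ (by norm_num)).tupleKey

theorem Stage.linked (h : Stage E σ a) : Linked E σ σ.OutAlive a :=
  ⟨h.st.wf, fun key z => by rw [h.st.mem, Sem.linkSpec_outAlive], h.st.thr, h.st.n, h.st.it,
    h.within⟩

/-- The satellite is new but the links still reflect the old one, hence the mixed description by
`Linked` with the old notion of a live pattern. -/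
theorem run_toggleSat (h : Stage E σ a) (hin : SatInput E a i v f)
    (hsame : Sem.Same σ (σ.withSat i (Sem.toggled (σ.sat i) v f)))
    (hw : (σ.withSat i (Sem.toggled (σ.sat i) v f)).Within E) :
    Run E.c (toggleSat Q i) a (tm (toggleSat Q i)) fun b =>
      Linked E (σ.withSat i (Sem.toggled (σ.sat i) v f)) σ.OutAlive b ∧ b.ρ = a.ρ := by
  have hk := Q.k_le
  have hi := hin.i_lt
  have hv := hin.v_lt
  have hwf : (σ.withSat i (Sem.toggled (σ.sat i) v f)).Wf E.c := by
    refine ⟨h.st.wf.B, h.st.wf.reg, h.st.wf.cen, fun j hj x hx => ?_, h.st.wf.thr⟩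
    by_cases hxv : x = v
    · rw [hxv]
      exact hv.trans_eq h.B.symm
    · exact h.st.wf.sat j hj x ((Sem.mem_sat_toggled fun _ => hxv).1 hx)
  have hκ : (KeyE.mk 3 i (.const 0) : KeyE Q.d).Is E.c a.ρ (3, i, 0) :=
    key_is (by norm_num) (by omega) (fun _ => eval_const (Nat.zero_le _)) (pow_pos E.c.B_pos _)
  have hother : ∀ key z, key ≠ (3, i, 0) → ((σ.withSat i (Sem.toggled (σ.sat i) v f)).linkSpec
      σ.OutAlive key z ↔ σ.linkSpec σ.OutAlive key z) := by
    rintro ⟨g, j, u⟩ z hkey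
    match g with
    | 1 | 2 => exact Iff.rfl
    | 3 =>
      simp only [Sem.linkSpec, Sem.spec]
      by_cases hj : j = i
      · subst hj
        have : u ≠ 0 := by
          rintro rfl
          exact hkey rfl
        simp [this]
      · simp [Sem.withSat, Function.update_of_ne hj]
    | 0 | n + 4 =>
      rw [hsame.spec_iff (by simp), Sem.linkSpec_outAlive]
  refine run_ite h.n_le (fun hf => ?_) (fun hf => ?_)
  · rw [hin.eval_flag] at hf
    refine (h.linked.ins hκ hin.eval_succ hin.lt_pow hwf hw rfl fun key z => ?_).mono le_rfl
      fun b hb => ⟨hb.1, hb.2.1⟩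
    by_cases hkey : key = (3, i, 0)
    · subst hkey
      simp only [Sem.linkSpec, Sem.spec, Sem.withSat, Function.update_self, Sem.toggled, if_neg hf,
        Finset.mem_insert, hi, true_and]
      constructor
      · rintro ⟨h1, h2 | h2⟩
        · exact Or.inr (by omega)
        · exact Or.inl ⟨h1, h2⟩
      · rintro (h1 | rfl)
        · exact ⟨h1.1, Or.inr h1.2⟩
        · simp
    · rw [hother key z hkey]
      simp [hkey]
  · rw [hin.eval_flag] at hf
    subst hf
    refine (h.linked.ers hκ hin.eval_succ hin.lt_pow hwf hw rfl fun key z => ?_).mono le_rfl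
      fun b hb => ⟨hb.1, hb.2.1⟩
    by_cases hkey : key = (3, i, 0)
    · subst hkey
      simp only [Sem.linkSpec, Sem.spec, Sem.withSat, Function.update_self, Sem.toggled, if_true,
        Finset.mem_erase, hi, true_and]
      constructor
      · rintro ⟨h1, h2, h3⟩
        exact ⟨⟨h1, h3⟩, by omega⟩
      · rintro ⟨⟨h1, h2⟩, h3⟩
        exact ⟨h1, by omega, h2⟩
    · rw [hother key z hkey]
      simp [hkey]

/-- While the tuples with this value are out of the groups, no registered tuple carries the value,
and the satellite can be toggled without any effect on the groups. Then the tuples are put back,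
where their new status takes effect. -/
theorem run_updateSat_light (h : Stage E σ a) (hfull : σ.Full) (hin : SatInput E a i v f)
    (hw : (σ.withSat i (Sem.toggled (σ.sat i) v f)).Within E) :
    Run E.c (.seq (forTuples i (iv Q 2) (unregister Q)) (.seq (toggleSat Q i)
      (forTuples i (iv Q 2) (register Q)))) a
      ((σ.deg i v + 1) * tupleCost i (iv Q 2) (unregister Q) + (tm (toggleSat Q i) +
        (σ.deg i v + 1) * tupleCost i (iv Q 2) (register Q)))
      fun b => Stage E (σ.withSat i (Sem.toggled (σ.sat i) v f)) b ∧ Agree 10 a.ρ b.ρ := by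
  have hk := Q.k_le
  have hi := hin.i_lt
  have hid : i < Q.d := by omega
  refine Run.seq (run_unregisterAll (v := v) h hid fun ρ hρ => hin.tupleKeys hρ) ?_
  rintro b1 ⟨h1, hag1, -⟩
  set σ1 := σ.withReg (σ.reg \ σ.tuples i v) with hσ1
  have hne : ∀ y ∈ σ1.reg, dig σ1.B i y ≠ v := by
    intro y hy hyv
    simp only [hσ1, Sem.withReg, Finset.mem_sdiff, Sem.mem_tuples, hfull i hid] at hy
    exact hy.2 ⟨hy.1, hyv⟩
  have hsame := Sem.same_withSat_of_not_mem (f := f) hne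
  have hin1 := hin.agree hag1 (by norm_num)
  refine Run.seq (run_toggleSat h1 hin1 hsame (hw.withReg (h1.within.reg))) ?_
  rintro b2 ⟨h2, hρ2⟩
  have h3 : Stage E (σ1.withSat i (Sem.toggled (σ1.sat i) v f)) b2 := by
    refine h2.stage fun y hy _ => ?_
    rw [hsame.P hy]
    exact (hsame.outAlive h1.st.wf.reg (fun x hx j _ _ _ =>
      Sem.mem_sat_toggled fun hj => hj ▸ hne x hx) hy).symm
  have hin2 : SatInput E b2 i v f :=
    hin1.agree (m := 1) (fun w _ => by rw [hρ2]) (by norm_num)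
  refine (run_registerAll (v := v) h3 hid fun ρ hρ => hin2.tupleKeys hρ).mono le_rfl ?_
  rintro b3 ⟨h4, hag3, -⟩
  rw [hρ2] at hag3
  refine ⟨?_, hag1.trans hag3⟩
  convert h4 using 1
  unfold Sem.withReg Sem.withSat
  congr 1
  have hsub : σ.tuples i v ⊆ σ.reg := by
    rw [← hfull i hid]
    exact Finset.filter_subset _ _
  change σ.reg = σ.reg \ σ.tuples i v ∪ σ.tuples i v
  rw [Finset.sdiff_union_of_subset hsub]

/-- For an output attribute, only patterns that carry the value can change their status; they form a
list of kind 6, which has at most `(1 + M) ^ (Q.d - 1)` elements. For a bound attribute this list is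
empty, and nothing is to be done since bound values are tested during enumeration. -/
theorem run_updateSat_heavy (h : Stage E σ a) (hin : SatInput E a i v f) (hv : σ.Heavy i v)
    (hw : (σ.withSat i (Sem.toggled (σ.sat i) v f)).Within E) (ht : 1 ≤ σ.thr) {M : ℕ}
    (hM : ∀ i < Q.d, (σ.lev i σ.thr).card ≤ M) :
    Run E.c (.seq (toggleSat Q i) (forE (.loc 9) (.loc 11) (KeyE.mk 6 i (satVal Q)) (relink Q))) a
      (tm (toggleSat Q i) + ((1 + M) ^ (Q.d - 1) + 1) * (tm (relink Q) +
        forCost (.loc 9) (.loc 11) (KeyE.mk 6 i (satVal Q))))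
      fun b => Stage E (σ.withSat i (Sem.toggled (σ.sat i) v f)) b ∧ Agree 10 a.ρ b.ρ := by
  have hk := Q.k_le
  have hi := hin.i_lt
  have hid : i < Q.d := by omega
  refine Run.seq (run_toggleSat h hin (Sem.same_withSat_of_heavy hv) hw) ?_
  rintro b1 ⟨h1, hρ1⟩
  set σ1 := σ.withSat i (Sem.toggled (σ.sat i) v f) with hσ1
  have hin1 : SatInput E b1 i v f := hin.agree (m := 1) (fun w _ => by rw [hρ1]) (by norm_num)
  refine Run.sane fun hsane => ?_
  set L := b1.l (6, i, v + 1) with hL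
  have hmem : ∀ z, z ∈ L ↔ (Q.e ≤ i ∧ dig σ.B i z = v + 1) ∧ σ1.IsPattern z := by
    intro z
    rw [hL, h1.mem]
    simp only [Sem.linkSpec, Sem.spec, hi, Sem.IsPattern]
    constructor
    · rintro ⟨g1, -, -, g2, g3⟩
      exact ⟨⟨g1, g2⟩, g3⟩
    · rintro ⟨⟨g1, g2⟩, g3⟩
      exact ⟨g1, trivial, by omega, g2, g3⟩
  have hlen : L.length ≤ (1 + M) ^ (Q.d - 1) := by
    rw [← List.toFinset_card_of_nodup (hsane (6, i, v + 1)).1]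
    refine Sem.card_patterns_le (σ := σ1) (u := v + 1) h1.wf.reg ht hM hid fun z hz => ?_
    rw [List.mem_toFinset, ← hL, hmem] at hz
    obtain ⟨hz, x, hx, -, hxz⟩ := hz
    exact ⟨hz.2, x, hx, hxz⟩
  -- The patterns that count as live after `n` iterations: the old status, corrected on the first
  -- `n` patterns of the list.
  set O : ℕ → ℕ → Prop := fun n q => if f = 0 then σ.OutAlive q ∧ q ∉ L.take n else
    σ.OutAlive q ∨ (q ∈ L.take n ∧ σ1.OutAlive q) with hO
  have hO0 : O 0 = σ.OutAlive := by
    funext q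
    simp [hO]
  refine (run_forE (key := (6, i, v + 1)) (L := L) (T := tm (relink Q)) (by simp)
    (fun n b => Linked E σ1 (O n) b ∧ Agree 10 a.ρ b.ρ ∧ b.l (6, i, v + 1) = L) ⟨?_, ?_, rfl⟩
    ?_ ?_ ?_).mono ?_ ?_
  · rw [hO0]
    exact h1
  · rw [hρ1]
    exact Agree.refl _ _
  · rintro n b y ⟨g1, g2, g3⟩
    exact ⟨⟨g1.set (by simp) y, g2.update (by simp [Var.rank]) y, g3⟩,
      ⟨g1.set (by simp) y, g2.update (by simp [Var.rank]) y, g3⟩⟩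
  · rintro n b ⟨g1, g2, g3⟩
    have hinb := hin.agree g2 (by norm_num)
    exact ⟨key_is (by norm_num) (by omega) hinb.eval_succ hin.lt_pow, g3, g1.n_le⟩
  · rintro n hn b ⟨g1, g2, g3⟩ hvn hx
    have hinb := hin.agree g2 (by norm_num)
    refine (g1.relink ((hmem _).1 (List.getElem_mem hn)).2 hx hinb.flag hinb.flag_le).mono le_rfl ?_
    rintro b' ⟨k1, k2, k3⟩
    refine ⟨⟨?_, g2.trans (k2.mono (by norm_num)), ?_⟩, (k2 _ (by simp [Var.rank])).trans hvn⟩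
    · convert k1 using 1
      funext q
      simp only [hO, List.take_add_one, List.getElem?_eq_getElem hn, Option.toList_some,
        List.mem_append, List.mem_singleton, eq_iff_iff]
      split_ifs with hf
      · tauto
      · constructor
        · rintro (h1 | ⟨h1 | rfl, h2⟩)
          · exact Or.inl (Or.inl h1)
          · exact Or.inl (Or.inr ⟨h1, h2⟩)
          · exact Or.inr ⟨rfl, h2⟩
        · rintro ((h1 | h1) | ⟨rfl, h2⟩)
          · exact Or.inl h1
          · exact Or.inr ⟨Or.inl h1.1, h1.2⟩
          · exact Or.inr ⟨Or.inr rfl, h2⟩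
    · rw [k3 _ (by simp) (by simp), g3]
  · exact Nat.mul_le_mul_right _ (by omega)
  · rintro b ⟨g1, g2, -⟩
    refine ⟨g1.stage fun y hy hla => ?_, g2⟩
    simp only [hO, List.take_length]
    -- Patterns that contain the value have been treated by the loop, and the status of all others
    -- is unaffected by the update.
    by_cases hq : Q.e ≤ i ∧ dig σ.B i (σ1.P y) = v + 1
    · have hqL : σ1.P y ∈ L := (hmem _).2 ⟨hq, y, hy, hla, rfl⟩
      split_ifs with hf
      · have := Sem.not_outAlive_erase (σ := σ) hi hq.1 hq.2
        subst hf
        simp only [hqL, not_true, and_false, false_iff]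
        exact this
      · have := Sem.OutAlive.insert (σ := σ) (i := i) (v := v) (q := σ1.P y) hf
        simp only [hqL, true_and]
        exact ⟨fun h => h.elim this id, Or.inr⟩
    · have hqL : σ1.P y ∉ L := fun h => hq ((hmem _).1 h).1
      rw [hσ1, Sem.outAlive_withSat (by exact hq), ← hσ1]
      simp [hqL]

theorem run_updateSat (h : Stage E σ a) (hfull : σ.Full) (hin : SatInput E a i v f)
    (hw : (σ.withSat i (Sem.toggled (σ.sat i) v f)).Within E) (ht : 1 ≤ σ.thr) {M : ℕ}
    (hM : ∀ i < Q.d, (σ.lev i σ.thr).card ≤ M) :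
    Run E.c (updateSat Q i) a ((σ.thr + (1 + M) ^ (Q.d - 1) + 1) * updateSatCost Q i)
      fun b => Stage E (σ.withSat i (Sem.toggled (σ.sat i) v f)) b ∧ Agree 10 a.ρ b.ρ := by
  have hk := Q.k_le
  have hi := hin.i_lt
  refine Run.sane fun hs => ?_
  have htest := (h.st.view hs).heavy (it := a.it) (i := i) (by omega) hin.eval_val
    (by have := hin.lt_pow; omega)
  set X := σ.thr + (1 + M) ^ (Q.d - 1) + 1 with hX
  have hle : ∀ n, n ≤ X * n := fun n => Nat.le_mul_of_pos_left _ (by omega)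
  have hle1 := hle 1
  have hle2 := hle (tm ((heavyE Q i (iv Q 2)).compile 0))
  have hle3 := hle (tm (toggleSat Q i))
  unfold updateSatCost
  simp only [Nat.mul_add]
  by_cases hv : σ.Heavy i v
  · refine (run_cond h.n_le (fun _ => run_updateSat_heavy h hin hv hw ht hM)
      (fun h0 => absurd hv (fun hh => (htest.ne_zero.2 hh) h0))).mono ?_ fun b hb => hb
    have := Nat.mul_le_mul_right (tm (relink Q) +
        forCost (.loc 9) (.loc 11) (KeyE.mk 6 i (satVal Q)))
      (show (1 + M) ^ (Q.d - 1) + 1 ≤ X by omega)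
    rw [Nat.mul_add X] at this
    omega
  · have hdeg : σ.deg i v < σ.thr := not_le.1 hv
    refine (run_cond h.n_le (fun h0 => absurd (htest.ne_zero.1 h0) hv)
      (fun _ => run_updateSat_light h hfull hin hw)).mono ?_ fun b hb => hb
    have h1 := Nat.mul_le_mul_right (tupleCost i (iv Q 2) (unregister Q))
      (show σ.deg i v + 1 ≤ X by omega)
    have h2 := Nat.mul_le_mul_right (tupleCost i (iv Q 2) (register Q))
      (show σ.deg i v + 1 ≤ X by omega)
    omega

end StarMaintenance

/-! ### Change of one degree: the center relation as seen by a single attribute. -/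

namespace StarMaintenance

open WordRAM Classical

variable {Q : StarQuery} {E : Env Q} {σ σ' : Sem Q} {a : AS Q.d} {y f i : ℕ}

namespace Sem

/-- The same logical content, with the center relation as seen by the attribute `i` replaced. -/
def withCen (σ : Sem Q) (i : ℕ) (S : Finset ℕ) : Sem Q :=
  { σ with cen := Function.update σ.cen i S }

theorem deg_withCen_insert (hy : y ∉ σ.cen i) (j u : ℕ) :
    (σ.withCen i (insert y (σ.cen i))).deg j u =
      σ.deg j u + if j = i ∧ dig σ.B i y = u then 1 else 0 := by
  unfold deg withCen
  by_cases hj : j = i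
  · subst hj
    simp only [Function.update_self, true_and, Finset.filter_insert]
    split_ifs
    · rw [Finset.card_insert_of_notMem (by simp [hy])]
    · rfl
  · simp [hj]

theorem deg_withCen_erase (hy : y ∈ σ.cen i) (j u : ℕ) :
    (σ.withCen i ((σ.cen i).erase y)).deg j u + (if j = i ∧ dig σ.B i y = u then 1 else 0) =
      σ.deg j u := by
  unfold deg withCen
  by_cases hj : j = i
  · subst hj
    simp only [Function.update_self, true_and, Finset.filter_erase]
    split_ifs with h
    · rw [Finset.card_erase_add_one (by simp [hy, h])]
    · rw [Finset.erase_eq_of_notMem (by simp [h]), add_zero]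
  · simp [hj]

theorem Wf.deg_lt {c : Cfg Q.d} (h : σ.Wf c) (hi : i < Q.d) (v : ℕ) :
    σ.deg i v < c.B ^ (Q.d + 1) := by
  have h1 : (σ.cen i).card ≤ c.B ^ Q.d := by
    rw [← Finset.card_range (c.B ^ Q.d)]
    refine Finset.card_le_card fun y hy => ?_
    rw [Finset.mem_range, ← h.B]
    exact (h.cen i hi y hy).1
  have h2 : c.B ^ Q.d < c.B ^ (Q.d + 1) := Nat.pow_lt_pow_right c.one_lt_B (by omega)
  exact ((Finset.card_filter_le _ _).trans h1).trans_lt h2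

theorem Wf.withCen {c : Cfg Q.d} (h : σ.Wf c) {S : Finset ℕ} (hS : ∀ y ∈ S, Ok Q σ.B y) :
    (σ.withCen i S).Wf c := by
  refine ⟨h.B, h.reg, fun j hj y hy => ?_, h.sat, h.thr⟩
  by_cases hji : j = i
  · subst hji
    simp only [Sem.withCen, Function.update_self] at hy
    exact hS y hy
  · simp only [Sem.withCen, Function.update_of_ne hji] at hy
    exact h.cen j hj y hy

theorem Within.withCen (h : σ.Within E) {S : Finset ℕ} (hS : S ⊆ E.U) :
    (σ.withCen i S).Within E := by
  refine ⟨h.reg, fun j hj => ?_, h.sat⟩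
  by_cases hji : j = i
  · subst hji
    simpa [Sem.withCen] using hS
  · simpa [Sem.withCen, hji] using h.cen j hj

theorem same_insert (hy : y ∉ σ.cen i)
    (h : ∀ x ∈ σ.reg, dig σ.B i x = dig σ.B i y → σ.thr < σ.deg i (dig σ.B i y)) :
    Same σ (σ.withCen i (insert y (σ.cen i))) := by
  refine ⟨rfl, rfl, fun x hx j _ => ?_, fun _ _ _ _ _ => Iff.rfl⟩
  unfold Heavy
  rw [deg_withCen_insert hy]
  change σ.thr ≤ _ ↔ _
  split_ifs with hj
  · obtain ⟨rfl, hj⟩ := hj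
    have := h x hx hj.symm
    rw [hj] at this
    omega
  · rfl

/-- The inequality has to be strict here: a degree equal to the threshold would fall below it, and
registered tuples with this value would change their pattern. -/
theorem same_erase (hy : y ∈ σ.cen i)
    (h : ∀ x ∈ σ.reg, dig σ.B i x = dig σ.B i y → σ.thr < σ.deg i (dig σ.B i y)) :
    Same σ (σ.withCen i ((σ.cen i).erase y)) := by
  refine ⟨rfl, rfl, fun x hx j _ => ?_, fun _ _ _ _ _ => Iff.rfl⟩
  have h1 := deg_withCen_erase hy j (dig σ.B j x)
  unfold Heavy
  change σ.thr ≤ _ ↔ _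
  split_ifs at h1 with hj
  · obtain ⟨rfl, hj⟩ := hj
    have := h x hx hj.symm
    rw [hj] at this
    omega
  · omega

/-- A value is recorded at every level up to its degree, so a change of the degree by one concerns a
single level. This is why kind 2 stores levels rather than exact degrees. -/
theorem spec_insert (hi : i < Q.d) (hok : ∀ y ∈ σ.reg, Ok Q σ.B y) (hy : y ∉ σ.cen i)
    (h : ∀ x ∈ σ.reg, dig σ.B i x = dig σ.B i y → σ.thr < σ.deg i (dig σ.B i y)) (key : Key)
    (z : ℕ) : (σ.withCen i (insert y (σ.cen i))).spec key z ↔ (σ.spec key z ∨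
      (key = (1, i, dig σ.B i y) ∧ z = y)) ∨
      (key = (2, i, σ.deg i (dig σ.B i y) + 1) ∧ z = dig σ.B i y) := by
  obtain ⟨g, j, u⟩ := key
  match g with
  | 0 | n + 4 =>
    rw [(same_insert hy h).spec_iff' hok (fun _ _ _ _ _ _ => Iff.rfl) (by simp)]
    simp
  | 1 =>
    by_cases hj : j = i
    · subst hj
      simp only [spec, withCen, Function.update_self, Prod.mk.injEq, Finset.mem_insert]
      grind
    · simp [spec, withCen, hj]
  | 2 =>
    simp only [spec, deg_withCen_insert hy, Prod.mk.injEq]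
    grind
  | 3 => simp [spec, withCen]

theorem spec_erase (hi : i < Q.d) (hok : ∀ y ∈ σ.reg, Ok Q σ.B y) (hy : y ∈ σ.cen i)
    (h : ∀ x ∈ σ.reg, dig σ.B i x = dig σ.B i y → σ.thr < σ.deg i (dig σ.B i y)) (key : Key)
    (z : ℕ) : (σ.withCen i ((σ.cen i).erase y)).spec key z ↔ (σ.spec key z ∧
      ¬ (key = (2, i, σ.deg i (dig σ.B i y)) ∧ z = dig σ.B i y)) ∧
      ¬ (key = (1, i, dig σ.B i y) ∧ z = y) := by
  obtain ⟨g, j, u⟩ := key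
  match g with
  | 0 | n + 4 =>
    rw [(same_erase hy h).spec_iff' hok (fun _ _ _ _ _ _ => Iff.rfl) (by simp)]
    simp
  | 1 =>
    by_cases hj : j = i
    · subst hj
      simp only [spec, withCen, Function.update_self, Prod.mk.injEq, Finset.mem_erase]
      grind
    · simp [spec, withCen, hj]
  | 2 =>
    have := deg_withCen_erase hy j z
    simp only [spec, Prod.mk.injEq]
    grind
  | 3 => simp [spec, withCen]

end Sem

section programs

variable (Q)

/-- The component number `i` of the tuple in variable `2`. -/
abbrev comp (i : ℕ) : Expr Q.d := Expr.dig i (rv Q 2)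

/-- The tuples that share the component number `i`. -/
abbrev compKey (i : ℕ) : KeyE Q.d := ⟨1, i, comp Q i⟩

/-- The values of the attribute `i` of the degree in variable `5`. -/
abbrev levKey (i : ℕ) : KeyE Q.d := ⟨2, i, rv Q 5⟩

/-- The size of the tuple list is read after the insertion, when it is the new degree, which is the
level to be added. In `eraseCen` it is read before the deletion, when it is the level to be removed.
-/
def insertCen (i : ℕ) : Prog :=
  .seq (ins (compKey Q i) (rv Q 2)) (.seq (asg (d := Q.d) (.loc 5) (compKey Q i).size)
    (ins (levKey Q i) (comp Q i)))

def eraseCen (i : ℕ) : Prog :=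
  .seq (asg (d := Q.d) (.loc 5) (compKey Q i).size) (.seq (ers (levKey Q i) (comp Q i))
    (ers (compKey Q i) (rv Q 2)))

end programs

/-- The variables of a center update: the code of the tuple, and whether it is inserted. -/
structure CenVars (E : Env Q) (ρ : Var Q.d → ℕ) (y f : ℕ) : Prop where
  tup : ρ (.loc 2) = y
  flag : ρ (.inp 0) = f
  flag_le : f ≤ 1
  mem : y ∈ E.U

namespace CenVars

variable {ρ ρ' : Var Q.d → ℕ}

theorem agree (h : CenVars E ρ y f) {m : ℕ} (hρ : Agree m ρ ρ') (hm : 3 < m) :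
    CenVars E ρ' y f :=
  ⟨(hρ (.loc 2) hm).trans h.tup, (hρ (.inp 0) (by simp [Var.rank]; omega)).trans h.flag, h.flag_le,
    h.mem⟩

theorem lt_pow (h : CenVars E ρ y f) : y < E.c.B ^ (Q.d + 1) :=
  (E.ok y h.mem).1.trans (Nat.pow_lt_pow_right E.c.one_lt_B (by omega))

theorem eval_tup (h : CenVars E ρ y f) (μ : ℕ → ℕ) : (rv Q 2).eval E.c.w ρ μ = y :=
  Prep.eval_rv h.tup h.lt_pow μ

theorem eval_comp (h : CenVars E ρ y f) (hi : i < Q.d) (μ : ℕ → ℕ) :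
    (comp Q i).eval E.c.w ρ μ = dig E.c.B i y :=
  eval_dig (h.eval_tup μ) hi.le (lt_word_of_lt h.lt_pow (by omega))

theorem eval_flag (h : CenVars E ρ y f) (μ : ℕ → ℕ) : (iv Q 0).eval E.c.w ρ μ = f :=
  eval_var _ h.flag (E.c.small_lt_word (by have := h.flag_le; omega))

theorem compKey (h : CenVars E ρ y f) (hi : i < Q.d) :
    (compKey Q i).Is E.c ρ (1, i, dig E.c.B i y) :=
  key_is (by norm_num) hi.le (h.eval_comp hi) dig_lt_pow

end CenVars

theorem run_insertCen (h : Stage E σ a) (hv : CenVars E a.ρ y f) (hi : i < Q.d)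
    (hy : y ∉ σ.cen i)
    (hreg : ∀ x ∈ σ.reg, dig σ.B i x = dig σ.B i y → σ.thr < σ.deg i (dig σ.B i y)) :
    Run E.c (insertCen Q i) a (tm (insertCen Q i)) fun b =>
      Stage E (σ.withCen i (insert y (σ.cen i))) b ∧ Agree 6 a.ρ b.ρ := by
  have hs := E.slack
  have hn := h.st.n
  have hB := h.B
  have hspec := Sem.spec_insert hi h.st.wf.reg hy hreg
  have hwf' : (σ.withCen i (insert y (σ.cen i))).Wf E.c := by
    refine h.st.wf.withCen fun z hz => ?_
    rcases Finset.mem_insert.1 hz with rfl | hz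
    · rw [hB]
      exact E.ok z hv.mem
    · exact h.st.wf.cen i hi z hz
  have hw' : (σ.withCen i (insert y (σ.cen i))).Within E :=
    h.within.withCen (Finset.insert_subset hv.mem (h.within.cen i hi))
  have hdeg := Sem.deg_withCen_insert hy i (dig σ.B i y)
  rw [if_pos ⟨rfl, rfl⟩] at hdeg
  have hlt := hwf'.deg_lt hi (dig σ.B i y)
  rw [hdeg] at hlt
  rw [hB] at hspec hlt
  refine Run.tighten (Mid := fun b => (∀ key z, z ∈ b.l key ↔
    (σ.withCen i (insert y (σ.cen i))).spec key z) ∧ Agree 6 a.ρ b.ρ ∧ b.it = a.it) ?_ ?_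
  · refine Run.seq (run_ins (Post := fun b => b = { a with
      l := insL a.l (1, i, dig E.c.B i y) y, n := a.n + 3 }) (hv.compKey hi) hv.eval_tup hv.lt_pow
      (by omega) rfl) ?_
    rintro _ rfl
    refine Run.sane fun hs1 => ?_
    simp only at hs1
    refine Run.seq (Mid := fun b => b =
      (AS.mk a.ρ (insL a.l (1, i, dig E.c.B i y) y) a.it (a.n + 3)).set (.loc 5) (σ.deg i (dig E.c.B i y) + 1))
      (run_asg (by simp only; omega) ?_) ?_
    · congr 1
      rw [ev, (hv.compKey hi).size_eq hs1]
      have hs1' := hs1 (1, i, dig E.c.B i y)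
      rw [← hB] at hs1' ⊢
      rw [← hdeg]
      refine length_eq_card hs1'.1 fun z => ?_
      rw [mem_insL, h.st.mem, Finset.mem_filter]
      simp only [Sem.spec, hi, Sem.withCen, Function.update_self, Finset.mem_insert, true_and]
      grind
    rintro _ rfl
    have hv' := hv.agree (ρ' := Function.update a.ρ (.loc 5) (σ.deg i (dig E.c.B i y) + 1))
      ((Agree.refl 6 _).update (by simp [Var.rank]) _) (by norm_num)
    refine run_ins (key := (2, i, σ.deg i (dig E.c.B i y) + 1)) (y := dig E.c.B i y)
      (key_is (by norm_num) hi.le ?_ hlt) (hv'.eval_comp hi) dig_lt_pow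
      (by simp only [AS.set]; omega) ⟨fun key z => ?_, ?_, rfl⟩
    · exact Prep.eval_rv (by simp [AS.set]) hlt
    · rw [hspec, ← h.st.mem]
      simp only [AS.set]
      rw [mem_insL, mem_insL]
    · exact (Agree.refl _ _).update (by simp [Var.rank]) _
  · rintro b ⟨b1, b2, b3⟩
    obtain ⟨h5, h6⟩ := Stage.finish (b := b) hwf' hw' b1
      ((b2 (.loc 1) (by simp [Var.rank])).trans h.st.thr) (fun x => by rw [b3, h.st.it])
    exact ⟨_, h5, h6, b2⟩

theorem run_eraseCen (h : Stage E σ a) (hv : CenVars E a.ρ y f) (hi : i < Q.d)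
    (hy : y ∈ σ.cen i)
    (hreg : ∀ x ∈ σ.reg, dig σ.B i x = dig σ.B i y → σ.thr < σ.deg i (dig σ.B i y)) :
    Run E.c (eraseCen Q i) a (tm (eraseCen Q i)) fun b =>
      Stage E (σ.withCen i ((σ.cen i).erase y)) b ∧ Agree 6 a.ρ b.ρ := by
  have hs := E.slack
  have hn := h.st.n
  have hB := h.B
  have hspec := Sem.spec_erase hi h.st.wf.reg hy hreg
  have hwf' : (σ.withCen i ((σ.cen i).erase y)).Wf E.c :=
    h.st.wf.withCen fun z hz => h.st.wf.cen i hi z (Finset.mem_of_mem_erase hz)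
  have hw' : (σ.withCen i ((σ.cen i).erase y)).Within E :=
    h.within.withCen ((Finset.erase_subset _ _).trans (h.within.cen i hi))
  have hlt := h.st.wf.deg_lt hi (dig σ.B i y)
  rw [hB] at hspec hlt
  refine Run.tighten (Mid := fun b => (∀ key z, z ∈ b.l key ↔
    (σ.withCen i ((σ.cen i).erase y)).spec key z) ∧ Agree 6 a.ρ b.ρ ∧ b.it = a.it) ?_ ?_
  · refine Run.sane fun hs1 => ?_
    refine Run.seq (Mid := fun b => b = a.set (.loc 5) (σ.deg i (dig E.c.B i y)))
      (run_asg (by omega) ?_) ?_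
    · congr 1
      rw [ev, (hv.compKey hi).size_eq hs1]
      exact (tuples_list h hs1 hi).2
    rintro _ rfl
    have hv' := hv.agree (ρ' := Function.update a.ρ (.loc 5) (σ.deg i (dig E.c.B i y)))
      ((Agree.refl 6 _).update (by simp [Var.rank]) _) (by norm_num)
    refine Run.seq (run_ers (key := (2, i, σ.deg i (dig E.c.B i y))) (y := dig E.c.B i y)
      (Post := fun b => b = { a.set (.loc 5) (σ.deg i (dig E.c.B i y)) with
        l := ersL a.l (2, i, σ.deg i (dig E.c.B i y)) (dig E.c.B i y), n := a.n + 5 })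
      (key_is (by norm_num) hi.le ?_ hlt) (hv'.eval_comp hi) dig_lt_pow
      (by simp only [AS.set]; omega) rfl) ?_
    · exact Prep.eval_rv (by simp [AS.set]) hlt
    rintro _ rfl
    refine Run.sane fun hs2 => ?_
    refine run_ers (hv'.compKey hi) hv'.eval_tup hv.lt_pow (by simp only; omega)
      ⟨fun key z => ?_, ?_, rfl⟩
    · rw [hspec, ← h.st.mem, mem_ersL (hs2 _).1]
      simp only
      rw [mem_ersL (hs1 _).1]
    · exact (Agree.refl _ _).update (by simp [Var.rank]) _
  · rintro b ⟨b1, b2, b3⟩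
    obtain ⟨h5, h6⟩ := Stage.finish (b := b) hwf' hw' b1
      ((b2 (.loc 1) (by simp [Var.rank])).trans h.st.thr) (fun x => by rw [b3, h.st.it])
    exact ⟨_, h5, h6, b2⟩

end StarMaintenance

/-! ### Updates of the center relation. -/

namespace StarMaintenance

open WordRAM Classical

variable {Q : StarQuery} {E : Env Q} {σ σ' : Sem Q} {a : AS Q.d} {y f i : ℕ}

namespace Sem

/-- The registered tuples after those tuples have been added or removed that share with `y` one of
the first components, of degree at most `m`. -/
noncomputable def phase (σ : Sem Q) (op : Finset ℕ → Finset ℕ → Finset ℕ) (m y : ℕ) :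
    ℕ → Finset ℕ
  | 0 => σ.reg
  | n + 1 => if σ.deg n (dig σ.B n y) ≤ m then
      op (phase σ op m y n) (σ.tuples n (dig σ.B n y)) else phase σ op m y n

theorem mem_phase_union {m z n : ℕ} : z ∈ σ.phase (· ∪ ·) m y n ↔
    z ∈ σ.reg ∨ ∃ i < n, σ.deg i (dig σ.B i y) ≤ m ∧ z ∈ σ.tuples i (dig σ.B i y) := by
  induction n with
  | zero => simp [phase]
  | succ n ih =>
    simp only [Nat.lt_succ_iff_lt_or_eq, or_and_right, exists_or, exists_eq_left]
    rw [← or_assoc, ← ih, phase]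
    split_ifs with h
    · rw [Finset.mem_union]
      tauto
    · tauto

theorem mem_phase_sdiff {m z n : ℕ} : z ∈ σ.phase (· \ ·) m y n ↔
    z ∈ σ.reg ∧ ∀ i < n, σ.deg i (dig σ.B i y) ≤ m → z ∉ σ.tuples i (dig σ.B i y) := by
  induction n with
  | zero => simp [phase]
  | succ n ih =>
    simp only [Nat.lt_succ_iff_lt_or_eq, or_imp, forall_and, forall_eq]
    rw [← and_assoc, ← ih, phase]
    split_ifs with h
    · rw [Finset.mem_sdiff]
      tauto
    · tauto

/-- The same logical content, with the center relation as seen by the first `n` attributes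
replaced. -/
def withCens (σ : Sem Q) (n : ℕ) (S : Finset ℕ) : Sem Q :=
  { σ with cen := fun i => if i < n then S else σ.cen i }

theorem withCens_succ (n : ℕ) (S : Finset ℕ) :
    (σ.withCens n S).withCen n S = σ.withCens (n + 1) S := by
  unfold withCens withCen
  congr 1
  funext j
  by_cases hj : j = n
  · subst hj
    simp
  · rw [Function.update_of_ne hj]
    have : j < n + 1 ↔ j < n := by omega
    simp [this]

theorem withCens_zero (S : Finset ℕ) : σ.withCens 0 S = σ := by
  simp [withCens]

/-- The same logical content, with the center relation replaced. -/
def setCen (σ : Sem Q) (S : Finset ℕ) : Sem Q := (σ.withCens Q.d S).withReg S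

theorem Full.setCen_reg (h : σ.Full) : σ.setCen σ.reg = σ := by
  have : (fun i => if i < Q.d then σ.reg else σ.cen i) = σ.cen := by
    funext i
    split_ifs with hi
    · exact (h i hi).symm
    · rfl
  unfold setCen withCens withReg
  simp only [this]

end Sem

section programs

variable (Q)

/-- The test that the component number `i` is shared by at most `m` tuples. -/
def fewE (m : Expr Q.d) (i : ℕ) : Expr Q.d := (m.lt (compKey Q i).size).not

/-- Treatment of all tuples that share with the given tuple a component of small degree. -/
def phaseProg (m : Expr Q.d) (p : Prog) : Prog :=
  seqs (fun i => cond (fewE Q m i) (forTuples i (comp Q i) p) .nop) Q.d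

/-- A factor in the time of such a phase. -/
def phaseCost (m : Expr Q.d) (p : Prog) : ℕ :=
  1 + ∑ i ∈ Finset.range Q.d, (tm ((fewE Q m i).compile 0) + 1 + (tupleCost i (comp Q i) p + 1))

/-- The change of the center relation. -/
def moveCen : Prog := seqs (fun i => cond (iv Q 0) (insertCen Q i) (eraseCen Q i)) Q.d

/-- An update of the center relation with the tuple in variable `2`. -/
def changeCenter : Prog :=
  .seq (phaseProg Q (rv Q 1) (unregister Q))
    (.seq (.seq (asg (d := Q.d) (.loc 10) (rv Q 2)) (unregister Q))
      (.seq (moveCen Q) (.seq (phaseProg Q ((rv Q 1).add (.const 1)) (register Q))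
        (cond (iv Q 0) (.seq (asg (d := Q.d) (.loc 10) (rv Q 2)) (register Q)) .nop))))

/-- The input tuple goes to variable `2`. -/
def readTuple : Prog := asg (d := Q.d) (.loc 2)
  (Expr.pack (fun i => if h : i + 2 < Q.d + 2 then iv Q ⟨i + 2, h⟩ else .const 0) Q.d)

def updateCenter : Prog :=
  .seq (readTuple Q) (cond ((iv Q 0).eq ((compKey Q 0).has (rv Q 2))) .nop (changeCenter Q))

/-- A factor in the time of a center update. -/
def updateCenterCost : ℕ :=
  tm (readTuple Q) + tm (((iv Q 0).eq ((compKey Q 0).has (rv Q 2))).compile 0) + 2 +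
    phaseCost Q (rv Q 1) (unregister Q) + (tm (asg (d := Q.d) (.loc 10) (rv Q 2)) +
    tm (unregister Q)) + tm (moveCen Q) + phaseCost Q ((rv Q 1).add (.const 1)) (register Q) +
    tm (cond (iv Q 0) (.seq (asg (d := Q.d) (.loc 10) (rv Q 2)) (register Q)) .nop)

end programs

/-- Degrees do not depend on the registered tuples, so all tests refer to the original content
although the set of registered tuples changes along the way. A component that passes the test is
shared by at most `n` tuples. -/
theorem run_phase {p : Prog} {op : Finset ℕ → Finset ℕ → Finset ℕ}
    (hp : ∀ {σ : Sem Q} {a : AS Q.d} {i v : ℕ} {u : Expr Q.d}, Stage E σ a → i < Q.d →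
      (∀ ρ, Agree 10 a.ρ ρ → (KeyE.mk 1 i u).Is E.c ρ (1, i, v)) →
      Run E.c (forTuples i u p) a ((σ.deg i v + 1) * tupleCost i u p) fun b =>
        Stage E (σ.withReg (op σ.reg (σ.tuples i v))) b ∧ Agree 10 a.ρ b.ρ ∧ Keeps a.l b.l)
    (h : Stage E σ a) (hv : CenVars E a.ρ y f) {m : Expr Q.d} {n X : ℕ} (hn : n + 1 ≤ X)
    (hm : ∀ ρ μ, ρ (.loc 1) = σ.thr → m.eval E.c.w ρ μ = n) :
    Run E.c (phaseProg Q m p) a (X * phaseCost Q m p) fun b =>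
      Stage E (σ.withReg (σ.phase op n y Q.d)) b ∧ Agree 10 a.ρ b.ρ := by
  have hB := h.B
  refine Run.mono (run_seqs (T := fun i => tm ((fewE Q m i).compile 0) + 1 +
    (X * tupleCost i (comp Q i) p + 1))
    (fun i b => Stage E (σ.withReg (σ.phase op n y i)) b ∧ Agree 10 a.ρ b.ρ) ⟨h, Agree.refl _ _⟩
    h.n_le Q.d ?_) ?_ fun b hb => hb
  · rintro i hi b ⟨h1, h2⟩
    have hvb := hv.agree h2 (by norm_num)
    refine Run.sane fun hs => ?_
    have ht : Tests E.c b.ρ (E.c.cell b.l b.it) (fewE Q m i)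
        (σ.deg i (dig σ.B i y) ≤ n) := by
      refine (Tests.lt (hm _ _ h1.st.thr) ?_).not.congr (by
        rw [not_lt])
      rw [(hvb.compKey hi).size_eq hs, ← hB]
      exact (tuples_list h1 hs hi).2
    rw [Sem.phase]
    refine run_cond h1.n_le (fun h0 => ?_) (fun h0 => ?_)
    · have hd := ht.ne_zero.1 h0
      rw [if_pos hd]
      refine (hp (v := dig σ.B i y) h1 hi fun ρ hρ => ?_).mono ?_ fun b' hb' =>
        ⟨hb'.1, h2.trans hb'.2.1⟩
      · rw [hB]
        exact (hvb.agree hρ (by norm_num)).compKey hi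
      · exact (Nat.mul_le_mul_right _ (show σ.deg i (dig σ.B i y) + 1 ≤ X by omega)).trans
          (Nat.le_succ _)
    · rw [if_neg fun hh => ht.ne_zero.2 hh h0]
      exact (run_nop h1.n_le ⟨h1, h2⟩).mono (by omega) fun b' hb' => hb'
  · unfold phaseCost
    have : ∀ i, tm ((fewE Q m i).compile 0) + 1 + (X * tupleCost i (comp Q i) p + 1) ≤
        X * (tm ((fewE Q m i).compile 0) + 1 + (tupleCost i (comp Q i) p + 1)) := by
      intro i
      simp only [Nat.mul_add]
      have h1 : ∀ k, k ≤ X * k := fun k => Nat.le_mul_of_pos_left _ (by omega)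
      have h2 := h1 1
      have h3 := h1 (tm ((fewE Q m i).compile 0))
      omega
    rw [mul_add, Finset.mul_sum]
    exact add_le_add (by omega) (Finset.sum_le_sum fun i _ => this i)

/-- The attributes are treated one after the other, which is why the logical content has a separate
copy of the center for each attribute. By `hreg`, the registered tuples that share a component with
`y` have it strictly above the threshold, so no classification changes. -/
theorem run_moveCen (h : Stage E σ a) (hv : CenVars E a.ρ y f) {D : Finset ℕ}
    (hD : ∀ i < Q.d, σ.cen i = D) (hyD : y ∈ D ↔ f = 0)
    (hreg : ∀ i < Q.d, ∀ x ∈ σ.reg, dig σ.B i x = dig σ.B i y →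
      σ.thr < σ.deg i (dig σ.B i y)) :
    Run E.c (moveCen Q) a (tm (moveCen Q)) fun b =>
      Stage E (σ.withCens Q.d (Sem.toggled D y f)) b ∧ Agree 6 a.ρ b.ρ := by
  rw [moveCen, tm_seqs]
  refine run_seqs (fun i b => Stage E (σ.withCens i (Sem.toggled D y f)) b ∧ Agree 6 a.ρ b.ρ)
    ⟨by rw [Sem.withCens_zero]; exact h, Agree.refl _ _⟩ h.n_le Q.d ?_
  rintro i hi b ⟨h1, h2⟩
  have hvb := hv.agree h2 (by norm_num)
  have hcen : (σ.withCens i (Sem.toggled D y f)).cen i = D := by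
    simp only [Sem.withCens, lt_irrefl, if_false]
    exact hD i hi
  have hdeg : ∀ u, (σ.withCens i (Sem.toggled D y f)).deg i u = σ.deg i u := by
    intro u
    unfold Sem.deg
    rw [hcen, hD i hi]
    rfl
  rw [← Sem.withCens_succ]
  have key : ∀ x ∈ (σ.withCens i (Sem.toggled D y f)).reg,
      dig (σ.withCens i (Sem.toggled D y f)).B i x = dig (σ.withCens i (Sem.toggled D y f)).B i y →
      (σ.withCens i (Sem.toggled D y f)).thr < (σ.withCens i (Sem.toggled D y f)).deg i
        (dig (σ.withCens i (Sem.toggled D y f)).B i y) := by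
    intro x hx hxy
    rw [hdeg]
    exact hreg i hi x hx hxy
  refine run_ite h1.n_le (fun h0 => ?_) (fun h0 => ?_)
  · rw [ev, hvb.eval_flag] at h0
    refine (run_insertCen h1 hvb hi (by rw [hcen, hyD]; exact h0) key).mono le_rfl ?_
    rintro b' ⟨h3, h4⟩
    rw [hcen] at h3
    have : Sem.toggled D y f = insert y D := by simp [Sem.toggled, h0]
    refine ⟨?_, h2.trans h4⟩
    rw [this] at h3 ⊢
    exact h3
  · rw [ev, hvb.eval_flag] at h0
    refine (run_eraseCen h1 hvb hi (by rw [hcen, hyD]; exact h0) key).mono le_rfl ?_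
    rintro b' ⟨h3, h4⟩
    rw [hcen] at h3
    have : Sem.toggled D y f = D.erase y := by simp [Sem.toggled, h0]
    refine ⟨?_, h2.trans h4⟩
    rw [this] at h3 ⊢
    exact h3

namespace Sem

/-- A tuple taken out in the first phase shares with `y` a component of degree at most `σ.thr`. The
update raises this degree by at most one, so the second phase, with limit `σ.thr + 1`, finds the
tuple again. That phase may also meet tuples that were never taken out, which does no harm. -/
theorem reg_after_change (hfull : σ.Full) {R : Finset ℕ} {D : Finset ℕ} (hD : σ.reg = D)
    (hyD : y ∈ D ↔ f = 0) (hR : ∀ z, z ∈ R ↔ z ∈ σ.phase (· \ ·) σ.thr y Q.d ∧ z ≠ y) (z : ℕ) :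
    (z ∈ ((σ.withReg R).withCens Q.d (toggled D y f)).phase (· ∪ ·) (σ.thr + 1) y Q.d ∨
      (f ≠ 0 ∧ z = y)) ↔ z ∈ toggled D y f := by
  rw [mem_phase_union]
  set σ2 := (σ.withReg R).withCens Q.d (toggled D y f) with hσ2
  have hreg : σ2.reg = R := rfl
  have hcen : ∀ i < Q.d, σ2.cen i = toggled D y f := by
    intro i hi
    simp [hσ2, withCens, hi]
  have hB : σ2.B = σ.B := rfl
  have hcen' : ∀ i < Q.d, σ.cen i = D := fun i hi => (hfull i hi).trans hD
  have hmem : z ∈ toggled D y f ↔ (z ∈ D ∧ z ≠ y) ∨ (f ≠ 0 ∧ z = y) := by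
    unfold toggled
    split_ifs with hf
    · simp [hf, and_comm]
    · simp only [Finset.mem_insert, ne_eq, hf, not_false_iff, true_and]
      tauto
  have hdeg : ∀ i < Q.d, ∀ u, σ2.deg i u ≤ σ.deg i u + 1 := by
    intro i hi u
    unfold deg
    rw [hcen i hi, hcen' i hi, hB]
    refine (Finset.card_le_card (t := insert y (D.filter fun x => dig σ.B i x = u)) ?_).trans
      (Finset.card_insert_le _ _)
    intro x hx
    rw [Finset.mem_filter] at hx
    rw [Finset.mem_insert, Finset.mem_filter]
    by_cases hxy : x = y
    · exact Or.inl hxy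
    · exact Or.inr ⟨(mem_toggled_of_ne hxy).1 hx.1, hx.2⟩
  rw [hreg, hR, mem_phase_sdiff, hD]
  constructor
  · rintro ((⟨⟨h1, -⟩, h2⟩ | ⟨i, hi, -, h1⟩) | h1)
    · exact hmem.2 (Or.inl ⟨h1, h2⟩)
    · rw [← hcen i hi]
      exact (mem_tuples.1 h1).1
    · exact hmem.2 (Or.inr h1)
  · intro hz
    rcases hmem.1 hz with ⟨h1, h2⟩ | h1
    · refine Or.inl ?_
      by_cases h3 : ∀ i < Q.d, σ.deg i (dig σ.B i y) ≤ σ.thr → z ∉ σ.tuples i (dig σ.B i y)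
      · exact Or.inl ⟨⟨h1, h3⟩, h2⟩
      · push Not at h3
        obtain ⟨i, hi, h4, h5⟩ := h3
        refine Or.inr ⟨i, hi, (hdeg i hi _).trans (by rw [hB]; omega), mem_tuples.2 ⟨?_, ?_⟩⟩
        · rw [hcen i hi]
          exact hz
        · exact (mem_tuples.1 h5).2
    · exact Or.inr h1

end Sem

theorem run_changeCenter (h : Stage E σ a) (hfull : σ.Full) (hv : CenVars E a.ρ y f)
    (hyD : y ∈ σ.reg ↔ f = 0) :
    Run E.c (changeCenter Q) a
      ((σ.thr + 2) * phaseCost Q (rv Q 1) (unregister Q) +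
        ((tm (asg (d := Q.d) (.loc 10) (rv Q 2)) + tm (unregister Q)) +
        (tm (moveCen Q) + ((σ.thr + 2) * phaseCost Q ((rv Q 1).add (.const 1)) (register Q) +
        tm (cond (iv Q 0) (.seq (asg (d := Q.d) (.loc 10) (rv Q 2)) (register Q)) .nop)))))
      fun b => Stage E (σ.setCen (Sem.toggled σ.reg y f)) b ∧ Agree 6 a.ρ b.ρ := by
  have hthr : σ.thr + 1 < 2 ^ E.c.w := by
    have h1 := h.st.wf.thr
    rw [h.B] at h1
    have h2 : E.c.B ^ Q.d < E.c.B ^ (Q.d + 1) := Nat.pow_lt_pow_right E.c.one_lt_B (by omega)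
    have h3 : E.c.B ^ (Q.d + 1) < 2 ^ E.c.w := E.c.lt_word le_rfl (by omega)
    omega
  have hyB : y < 2 ^ E.c.w := lt_word_of_lt hv.lt_pow (by omega)
  refine Run.seq (run_phase (op := (· \ ·)) (n := σ.thr) run_unregisterAll h hv (by omega)
    fun ρ μ hρ => eval_var _ hρ (by omega)) ?_
  rintro b1 ⟨h1, ag1⟩
  have hv1 := hv.agree ag1 (by norm_num)
  set R0 := σ.phase (· \ ·) σ.thr y Q.d with hR0
  refine Run.seq (Mid := fun b => Stage E (σ.withReg (R0.erase y)) b ∧ Agree 10 a.ρ b.ρ) ?_ ?_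
  · refine Run.seq (Mid := fun b => b = b1.set (.loc 10) y) (run_asg h1.n_le ?_) ?_
    · congr 1
      exact hv1.eval_tup _
    rintro _ rfl
    refine ((h1.set (v := .loc 10) (by simp) y).unregister hv.mem (by simp [AS.set])).mono le_rfl ?_
    rintro b ⟨g1, g2, -⟩
    exact ⟨g1, (ag1.update (by simp [Var.rank]) y).trans (g2.mono (by norm_num))⟩
  rintro b2 ⟨h2, ag2⟩
  have hv2 := hv.agree ag2 (by norm_num)
  refine Run.seq (run_moveCen (D := σ.reg) h2 hv2 hfull hyD ?_) ?_
  -- A tuple that shares a component of degree at most the threshold would have been taken out in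
  -- the first phase.
  · intro i hi x hx hxy
    by_contra hlt
    have hx1 := (Sem.mem_phase_sdiff.1 (Finset.mem_of_mem_erase hx))
    refine hx1.2 i hi (not_lt.1 hlt) (Sem.mem_tuples.2 ⟨?_, hxy⟩)
    rw [hfull i hi]
    exact hx1.1
  rintro b3 ⟨h3, ag3⟩
  have hv3 := hv2.agree ag3 (by norm_num)
  refine Run.seq (run_phase (op := (· ∪ ·)) (n := σ.thr + 1) run_registerAll h3 hv3 le_rfl
    fun ρ μ hρ => eval_add (eval_var _ (show ρ (.loc 1) = σ.thr from hρ) (by omega))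
      (eval_const (by omega)) hthr) ?_
  rintro b4 ⟨h4, ag4⟩
  have hv4 := hv3.agree ag4 (by norm_num)
  have ag : Agree 6 a.ρ b4.ρ := (ag2.mono (by norm_num)).trans (ag3.trans (ag4.mono (by norm_num)))
  have hfin := Sem.reg_after_change (R := R0.erase y) hfull rfl hyD
    (fun z => by rw [Finset.mem_erase, and_comm])
  refine run_ite h4.n_le (fun h0 => ?_) (fun h0 => ?_)
  · rw [ev, hv4.eval_flag] at h0
    refine Run.seq (Mid := fun b => b = b4.set (.loc 10) y) (run_asg h4.n_le ?_) ?_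
    · congr 1
      exact hv4.eval_tup _
    rintro _ rfl
    refine ((h4.set (v := .loc 10) (by simp) y).register hv.mem (by simp [AS.set])).mono le_rfl ?_
    rintro b ⟨g1, g2, -⟩
    refine ⟨?_, (ag.update (by simp [Var.rank]) y).trans (g2.mono (by norm_num))⟩
    convert g1 using 1
    unfold Sem.setCen Sem.addReg Sem.withReg Sem.withCens
    congr 1
    ext z
    rw [← hfin z, Finset.mem_insert, or_comm]
    simp only [h0, ne_eq, not_false_iff, true_and]
    rfl
  · rw [ev, hv4.eval_flag] at h0
    refine run_nop h4.n_le ⟨?_, ag⟩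
    convert h4 using 1
    unfold Sem.setCen Sem.withReg Sem.withCens
    congr 1
    ext z
    rw [← hfin z]
    simp only [h0, ne_eq, not_true, false_and, or_false]
    rfl

/-- The inputs of a center update. -/
structure CenInput (E : Env Q) (a : AS Q.d) (y f : ℕ) : Prop where
  flag : a.ρ (.inp 0) = f
  flag_le : f ≤ 1
  mem : y ∈ E.U
  val : ∀ i (hi : i + 2 < Q.d + 2), a.ρ (.inp ⟨i + 2, hi⟩) = dig E.c.B i y

/-- An update without effect is recognized by comparing the flag with membership in the center,
which is looked up at attribute `0`; this uses `1 ≤ Q.d`. Afterwards the update is known to change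
the center. -/
theorem run_updateCenter (hd : 1 ≤ Q.d) (h : Stage E σ a) (hfull : σ.Full)
    (hin : CenInput E a y f) :
    Run E.c (updateCenter Q) a ((σ.thr + 2) * updateCenterCost Q)
      fun b => Stage E (σ.setCen (Sem.toggled σ.reg y f)) b ∧ Agree 3 a.ρ b.ρ := by
  have hle : ∀ n, n ≤ (σ.thr + 2) * n := fun n => Nat.le_mul_of_pos_left _ (by omega)
  have hok := E.ok y hin.mem
  refine Run.mono (Run.seq (T₁ := tm (readTuple Q)) (T₂ :=
    tm (((iv Q 0).eq ((compKey Q 0).has (rv Q 2))).compile 0) + 1 + (1 +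
    ((σ.thr + 2) * phaseCost Q (rv Q 1) (unregister Q) +
        ((tm (asg (d := Q.d) (.loc 10) (rv Q 2)) + tm (unregister Q)) +
        (tm (moveCen Q) + ((σ.thr + 2) * phaseCost Q ((rv Q 1).add (.const 1)) (register Q) +
        tm (cond (iv Q 0) (.seq (asg (d := Q.d) (.loc 10) (rv Q 2)) (register Q)) .nop)))))))
    (Mid := fun b => b = a.set (.loc 2) y) (run_asg h.n_le ?_) ?_) ?_ fun b hb => hb
  · congr 1
    have : pack E.c.B (fun i => dig E.c.B i y) Q.d = y := by
      rw [pack_dig, Nat.mod_eq_of_lt hok.1]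
    rw [← this]
    refine eval_pack (by omega) (fun i hi => ?_) fun i hi => dig_lt E.c.B_pos _ _
    rw [dif_pos (by omega)]
    refine eval_var _ (hin.val i (by omega)) (lt_word_of_lt (k := Q.d + 1) dig_lt_pow (by omega))
  · rintro _ rfl
    have h' := h.set (v := .loc 2) (by simp) y
    have ag : Agree 3 a.ρ (a.set (.loc 2) y).ρ := (Agree.refl _ _).update (by simp [Var.rank]) _
    have hv : CenVars E (a.set (.loc 2) y).ρ y f := by
      refine ⟨by simp [AS.set], ?_, hin.flag_le, hin.mem⟩
      simpa [AS.set] using hin.flag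
    refine Run.sane fun hs => ?_
    have hhas := (hv.compKey (i := 0) (by omega)).has (it := a.it) hs (hv.eval_tup _)
      hv.lt_pow.le
    have hmem : y ∈ (a.set (.loc 2) y).l (1, 0, dig E.c.B 0 y) ↔ y ∈ σ.reg := by
      rw [h'.st.mem, ← hfull 0 (by omega), ← h.B]
      simp [Sem.spec, show 0 < Q.d by omega]
    rw [hmem] at hhas
    have ht := Tests.eq (hv.eval_flag (E.c.cell (a.set (.loc 2) y).l a.it)) (rfl : _ = ((compKey Q 0).has (rv Q 2)).eval
      E.c.w (a.set (.loc 2) y).ρ (E.c.cell (a.set (.loc 2) y).l a.it))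
    have hf := hin.flag_le
    refine run_cond h'.n_le (fun h0 => ?_) (fun h0 => ?_)
    · have h1 := ht.ne_zero.1 h0
      refine (run_nop h'.n_le ⟨?_, ag⟩).mono (by omega) fun b hb => hb
      have : Sem.toggled σ.reg y f = σ.reg := by
        unfold Sem.toggled
        by_cases hy : y ∈ σ.reg
        · rw [hhas.1 hy] at h1
          rw [if_neg (by omega), Finset.insert_eq_of_mem hy]
        · rw [hhas.2 hy] at h1
          rw [if_pos (by omega), Finset.erase_eq_of_notMem hy]
      rw [this, hfull.setCen_reg]
      exact h'
    · have h1 : f ≠ _ := fun hh => ht.ne_zero.2 hh h0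
      refine (run_changeCenter h' hfull hv ?_).mono (by omega) fun b hb =>
        ⟨hb.1, ag.trans (hb.2.mono (by norm_num))⟩
      by_cases hy : y ∈ σ.reg
      · rw [hhas.1 hy] at h1
        simp only [hy, true_iff]
        omega
      · rw [hhas.2 hy] at h1
        simp only [hy, false_iff]
        omega
  · unfold updateCenterCost
    simp only [Nat.mul_add]
    have h1 := hle (tm (readTuple Q))
    have h2 := hle (tm (((iv Q 0).eq ((compKey Q 0).has (rv Q 2))).compile 0))
    have h3 := hle (tm (asg (d := Q.d) (.loc 10) (rv Q 2)))
    have h4 := hle (tm (unregister Q))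
    have h5 := hle (tm (moveCen Q))
    have h6 := hle (tm (cond (iv Q 0) (.seq (asg (d := Q.d) (.loc 10) (rv Q 2)) (register Q)) .nop))
    have h7 := hle 1
    omega

end StarMaintenance

/-! ### Sweeps over all tuples with a component whose degree lies in a given interval. -/

namespace StarMaintenance

open WordRAM Classical

variable {Q : StarQuery} {E : Env Q} {σ σ' : Sem Q} {a : AS Q.d} {i : ℕ}

namespace Sem

/-- The same logical content, with another threshold. -/
def withThr (σ : Sem Q) (t : ℕ) : Sem Q := { σ with thr := t }

/-- The tuple `z` has a component whose degree is at least `lo` and less than `hi`. -/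
def Crosses (σ : Sem Q) (lo hi z : ℕ) : Prop :=
  ∃ i < Q.d, z ∈ σ.cen i ∧ lo ≤ σ.deg i (dig σ.B i z) ∧ σ.deg i (dig σ.B i z) < hi

/-- The two thresholds disagree exactly on values whose degree is in the interval from `lo` to `hi`,
and no registered tuple has such a component. -/
theorem same_withThr {t lo hi : ℕ} (h : (σ.thr = lo ∧ t = hi) ∨ (σ.thr = hi ∧ t = lo))
    (hle : lo ≤ hi) (hcen : ∀ i < Q.d, σ.reg ⊆ σ.cen i)
    (hR : ∀ z ∈ σ.reg, ¬ σ.Crosses lo hi z) : Same σ (σ.withThr t) := by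
  refine ⟨rfl, rfl, fun y hy i hi' => ?_, fun _ _ _ _ _ => Iff.rfl⟩
  have h1 : ¬ (lo ≤ σ.deg i (dig σ.B i y) ∧ σ.deg i (dig σ.B i y) < hi) :=
    fun h2 => hR y hy ⟨i, hi', hcen i hi' hy, h2⟩
  change t ≤ σ.deg i (dig σ.B i y) ↔ σ.thr ≤ σ.deg i (dig σ.B i y)
  omega

theorem Same.spec_withThr {t : ℕ} (h : Same σ (σ.withThr t)) (hok : ∀ y ∈ σ.reg, Ok Q σ.B y)
    (key : Key) (z : ℕ) : (σ.withThr t).spec key z ↔ σ.spec key z := by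
  obtain ⟨g, i, u⟩ := key
  match g with
  | 0 | n + 4 => exact h.spec_iff' hok (fun _ _ _ _ _ _ => Iff.rfl) (by simp) z
  | 1 | 2 | 3 => exact Iff.rfl

end Sem

section programs

variable (Q)

/-- The program `p` for the tuples with a component whose degree is at least the value of variable
`5` and less than the value of variable `6`. -/
def sweepBody (p : Prog) (i : ℕ) : Prog :=
  cond ((KeyE.mk 1 i (rv Q 8)).size.lt (rv Q 6)) (forTuples i (rv Q 8) p) .nop

def sweep (p : Prog) : Prog :=
  seqs (fun i => forE (.loc 7) (.loc 8) (KeyE.mk 2 i (rv Q 5)) (sweepBody Q p i)) Q.d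

def sweepCost (p : Prog) : ℕ :=
  1 + ∑ i ∈ Finset.range Q.d, (tm (((KeyE.mk 1 i (rv Q 8)).size.lt (rv Q 6)).compile 0) + 1 +
    (tupleCost i (rv Q 8) p + 1) + forCost (.loc 7) (.loc 8) (KeyE.mk 2 i (rv Q 5)))

end programs

/-- The connective `acc` is "or" for registration and "and not" for its reversal; `h1` says that
successive passes accumulate. The values of degree at least `lo` are read off from one level set,
and those of degree at least `hi` are skipped, so each of the at most `K` values costs fewer than
`hi` tuples. -/
theorem run_sweep {p : Prog} {op : Finset ℕ → Finset ℕ → Finset ℕ} {acc : Prop → Prop → Prop}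
    (hp : ∀ {σ : Sem Q} {a : AS Q.d} {i v : ℕ} {u : Expr Q.d}, Stage E σ a → i < Q.d →
      (∀ ρ, Agree 10 a.ρ ρ → (KeyE.mk 1 i u).Is E.c ρ (1, i, v)) →
      Run E.c (forTuples i u p) a ((σ.deg i v + 1) * tupleCost i u p) fun b =>
        Stage E (σ.withReg (op σ.reg (σ.tuples i v))) b ∧ Agree 10 a.ρ b.ρ ∧ Keeps a.l b.l)
    (hop : ∀ S T z, z ∈ op S T ↔ acc (z ∈ S) (z ∈ T)) (h0 : ∀ A, acc A False ↔ A)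
    (h1 : ∀ A B C, acc (acc A B) C ↔ acc A (B ∨ C)) (h : Stage E σ a) {lo hi K : ℕ} (hlo : 1 ≤ lo)
    (hlo' : a.ρ (.loc 5) = lo) (hlo2 : lo < E.c.B ^ (Q.d + 1)) (hhi : a.ρ (.loc 6) = hi)
    (hhi2 : hi < 2 ^ E.c.w) (hhi1 : 1 ≤ hi) (hK : ∀ i < Q.d, (σ.lev i lo).card ≤ K) :
    Run E.c (sweep Q p) a ((K + 1) * hi * sweepCost Q p) fun b => ∃ R,
      Stage E (σ.withReg R) b ∧ Agree 8 a.ρ b.ρ ∧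
        ∀ z, z ∈ R ↔ acc (z ∈ σ.reg) (σ.Crosses lo hi z) := by
  have hB := h.B
  set X := (K + 1) * hi with hX
  have hXK : K + 1 ≤ X := Nat.le_mul_of_pos_right _ hhi1
  have hle : ∀ n, n ≤ X * n := fun n => Nat.le_mul_of_pos_left _ (by omega)
  set cost : ℕ → ℕ := fun i => tm (((KeyE.mk 1 i (rv Q 8)).size.lt (rv Q 6)).compile 0) + 1 +
    (tupleCost i (rv Q 8) p + 1) + forCost (.loc 7) (.loc 8) (KeyE.mk 2 i (rv Q 5)) with hcost
  refine Run.mono (run_seqs (T := fun i => X * cost i)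
    (fun n b => ∃ R, Stage E (σ.withReg R) b ∧ Agree 8 a.ρ b.ρ ∧ ∀ z, z ∈ R ↔ acc (z ∈ σ.reg)
      (∃ i < n, z ∈ σ.cen i ∧ lo ≤ σ.deg i (dig σ.B i z) ∧ σ.deg i (dig σ.B i z) < hi))
    ⟨σ.reg, h, Agree.refl _ _, fun z => by simp [h0]⟩ h.n_le Q.d ?_) ?_ fun b hb => hb
  · rintro i hi' b ⟨R, g1, g2, g3⟩
    have r5 : b.ρ (.loc 5) = lo := (g2 (.loc 5) (by simp [Var.rank])).trans hlo'
    refine Run.sane fun hs => ?_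
    set L := b.l (2, i, lo) with hL
    have hmem : ∀ v, v ∈ L ↔ lo ≤ σ.deg i v := by
      intro v
      rw [hL, g1.st.mem]
      simp only [Sem.spec, hi', hlo, true_and]
      rfl
    have hlen : L.length = (σ.lev i lo).card :=
      length_eq_card (hs _).1 fun v => by rw [hmem, Sem.mem_lev hlo]
    have hLK : L.length ≤ K := hlen.trans_le (hK i hi')
    have hkey : ∀ ρ : Var Q.d → ℕ, ρ (.loc 5) = lo →
        (KeyE.mk 2 i (rv Q 5)).Is E.c ρ (2, i, lo) := fun ρ hρ =>
      key_is (by norm_num) hi'.le (Prep.eval_rv hρ hlo2) hlo2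
    refine (run_forE (key := (2, i, lo)) (L := L)
      (T := tm (((KeyE.mk 1 i (rv Q 8)).size.lt (rv Q 6)).compile 0) + 1 +
        (hi * tupleCost i (rv Q 8) p + 1)) (by simp)
      (fun n b' => ∃ R, Stage E (σ.withReg R) b' ∧ Agree 8 a.ρ b'.ρ ∧ Keeps b.l b'.l ∧
        ∀ z, z ∈ R ↔ acc (z ∈ σ.reg) ((∃ j < i, z ∈ σ.cen j ∧ lo ≤ σ.deg j (dig σ.B j z) ∧
          σ.deg j (dig σ.B j z) < hi) ∨ (z ∈ σ.cen i ∧ dig σ.B i z ∈ L.take n ∧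
            σ.deg i (dig σ.B i z) < hi)))
      ⟨R, g1, g2, Keeps.refl _, fun z => by simp [g3]⟩ ?_ ?_ ?_).mono ?_ ?_
    · rintro n b' y ⟨R', k1, k2, k3⟩
      exact ⟨⟨R', k1.set (by simp) y, k2.update (by simp [Var.rank]) y, k3⟩,
        ⟨R', k1.set (by simp) y, k2.update (by simp [Var.rank]) y, k3⟩⟩
    · rintro n b' ⟨R', k1, k2, k3, -⟩
      exact ⟨hkey _ ((k2 (.loc 5) (by simp [Var.rank])).trans hlo'),
        k3 _ _ _ (by norm_num) (by norm_num), k1.n_le⟩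
    · rintro n hn b' ⟨R', k1, k2, k3, k4⟩ hvn hvx
      have hv : L[n] < E.c.B ^ (Q.d + 1) := (hs (2, i, lo)).2 _ (List.getElem_mem hn)
      have hk1 : ∀ ρ : Var Q.d → ℕ, ρ (.loc 8) = L[n] →
          (KeyE.mk 1 i (rv Q 8)).Is E.c ρ (1, i, L[n]) := fun ρ hρ =>
        key_is (by norm_num) hi'.le (Prep.eval_rv hρ hv) hv
      refine Run.sane fun hs' => ?_
      have htest : Tests E.c b'.ρ (E.c.cell b'.l b'.it)
          ((KeyE.mk 1 i (rv Q 8)).size.lt (rv Q 6)) (σ.deg i L[n] < hi) := by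
        refine Tests.lt ?_ (eval_var _ ((k2 (.loc 6) (by simp [Var.rank])).trans hhi) hhi2)
        rw [(hk1 _ hvx).size_eq hs']
        exact (tuples_list k1 hs' hi').2
      refine run_cond k1.n_le (fun ht => ?_) (fun ht => ?_)
      · have hd := htest.ne_zero.1 ht
        refine (hp k1 hi' (v := L[n]) fun ρ hρ => hk1 ρ
          ((hρ (.loc 8) (by simp [Var.rank])).trans hvx)).mono ?_ ?_
        · exact (Nat.mul_le_mul_right _ (show σ.deg i L[n] + 1 ≤ hi by omega)).trans
            (Nat.le_succ _)
        · rintro b'' ⟨q1, q2, q3⟩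
          refine ⟨⟨_, q1, k2.trans (q2.mono (by norm_num)), k3.trans q3, fun z => ?_⟩,
            (q2 (.loc 7) (by simp [Var.rank])).trans hvn⟩
          rw [hop]
          change acc (z ∈ R') (z ∈ σ.tuples i L[n]) ↔ _
          rw [k4, h1, Sem.mem_tuples]
          refine iff_of_eq (congrArg _ (propext ?_))
          rw [or_assoc]
          refine or_congr Iff.rfl ?_
          simp only [List.take_add_one, List.getElem?_eq_getElem hn, Option.toList_some,
            List.mem_append, List.mem_singleton]
          grind
      · have hd : ¬ σ.deg i L[n] < hi := fun hh => htest.ne_zero.2 hh ht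
        refine (run_nop k1.n_le ⟨⟨R', k1, k2, k3, fun z => ?_⟩, hvn⟩).mono (by omega)
          fun _ hb => hb
        rw [k4]
        refine iff_of_eq (congrArg _ (propext (or_congr Iff.rfl ?_)))
        simp only [List.take_add_one, List.getElem?_eq_getElem hn, Option.toList_some,
          List.mem_append, List.mem_singleton]
        grind
    · simp only [hcost, Nat.mul_add]
      have e1 := Nat.mul_le_mul_right (tm (((KeyE.mk 1 i (rv Q 8)).size.lt (rv Q 6)).compile 0))
        (show L.length + 1 ≤ X by omega)
      have e2 := Nat.mul_le_mul_right (forCost (.loc 7) (.loc 8) (KeyE.mk 2 i (rv Q 5)))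
        (show L.length + 1 ≤ X by omega)
      have e3 : (L.length + 1) * (hi * tupleCost i (rv Q 8) p) ≤ X * tupleCost i (rv Q 8) p := by
        rw [hX, ← mul_assoc]
        exact Nat.mul_le_mul_right _ (Nat.mul_le_mul_right _ (by omega))
      omega
    · rintro b' ⟨R', k1, k2, -, k4⟩
      refine ⟨R', k1, k2, fun z => ?_⟩
      rw [k4]
      refine iff_of_eq (congrArg _ (propext ?_))
      simp only [List.take_length, hmem, Nat.lt_succ_iff_lt_or_eq, or_and_right, exists_or,
        exists_eq_left]
  · unfold sweepCost
    rw [mul_add, Finset.mul_sum]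
    exact add_le_add (hle 1) le_rfl

end StarMaintenance

/-! ### Scales, thresholds, and the change of the threshold. -/

namespace StarMaintenance

open WordRAM Classical

variable {Q : StarQuery} {E : Env Q} {σ σ' : Sem Q} {a : AS Q.d} {i s : ℕ}

/-- The scale number `s` of the parameter of the data structure. -/
def theta (s : ℕ) : ℕ := 2 ^ (s + 3)

/-- The degree threshold of the scale `s`. -/
def tau (d s : ℕ) : ℕ := 2 ^ ((s + 3) * (d - 1))

theorem tau_eq (d s : ℕ) : tau d s = theta s ^ (d - 1) := pow_mul _ _ _

theorem tau_pos (d s : ℕ) : 1 ≤ tau d s := Nat.one_le_two_pow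

theorem theta_pos (s : ℕ) : 1 ≤ theta s := Nat.one_le_two_pow

theorem theta_succ (s : ℕ) : theta (s + 1) = 2 * theta s := by
  unfold theta
  ring

theorem tau_succ (d s : ℕ) : tau d (s + 1) = 2 ^ (d - 1) * tau d s := by
  rw [tau_eq, tau_eq, theta_succ, mul_pow]

theorem tau_mono (d : ℕ) {s s' : ℕ} (h : s ≤ s') : tau d s ≤ tau d s' :=
  Nat.pow_le_pow_right (by norm_num) (Nat.mul_le_mul_right _ (by omega))

section programs

variable (Q)

/-- The power of two whose exponent is `d - 1` times a given number. -/
def powE (x : Expr Q.d) : Expr Q.d := (Expr.const 1).shl (x.mul (.const (Q.d - 1)))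

/-- The change to the scale in variable `4`. -/
def rescale : Prog :=
  .seq (sweep Q (unregister Q)) (.seq (asg (d := Q.d) (.loc 1) (powE Q ((rv Q 4).add (.const 3))))
    (.seq (asg (d := Q.d) (.loc 0) (rv Q 4)) (sweep Q (register Q))))

/-- The test that there are not too many heavy values. -/
def fewHeavyE : Expr Q.d := Expr.all (fun i =>
  (((Expr.const 1).shl ((rv Q 0).add (.const 5))).lt (KeyE.mk 2 i (rv Q 1)).size).not) Q.d

/-- The test that there are few values above the next lower threshold. -/
def fewDenseE : Expr Q.d := Expr.all (fun i =>
  ((Expr.const 4).mul (KeyE.mk 2 i (rv Q 5)).size).lt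
    ((Expr.const 1).shl ((rv Q 0).add (.const 3)))) Q.d

def grow : Prog :=
  .seq (asg (d := Q.d) (.loc 5) (rv Q 1)) (.seq (asg (d := Q.d) (.loc 6)
    (powE Q ((rv Q 0).add (.const 4)))) (.seq (asg (d := Q.d) (.loc 4) ((rv Q 0).add (.const 1)))
      (rescale Q)))

def shrink : Prog :=
  .seq (asg (d := Q.d) (.loc 6) (rv Q 1)) (.seq (asg (d := Q.d) (.loc 4)
    ((rv Q 0).sub (.const 1))) (rescale Q))

/-- Adaptation of the scale after an update. -/
def rebalance : Prog :=
  cond (fewHeavyE Q)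
    (cond (rv Q 0) (.seq (asg (d := Q.d) (.loc 5) (powE Q ((rv Q 0).add (.const 2))))
      (cond (fewDenseE Q) (shrink Q) .nop)) .nop)
    (grow Q)

end programs

namespace Cfg

variable {c : Cfg Q.d}

theorem exp_le (h : 2 ^ s ≤ c.B) : s ≤ c.b := (Nat.pow_le_pow_iff_right (by norm_num)).1 h

theorem mul_b_lt_word {n k : ℕ} (hn : n ≤ c.b) (hk : k ≤ Q.d) : n * k < 2 ^ c.w := by
  refine lt_of_le_of_lt ?_ c.w_lt
  have h1 : n * k ≤ c.b * Q.d := Nat.mul_le_mul hn hk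
  have h2 : c.b * (4 * Q.d + 16) ≤ c.w := by
    rw [c.b_eq]
    exact Nat.div_mul_le_self _ _
  nlinarith

end Cfg

theorem eval_pow {ρ : Var Q.d → ℕ} {μ : ℕ → ℕ} {x : Expr Q.d} {n : ℕ}
    (hx : x.eval E.c.w ρ μ = n) (hn : 2 ^ n ≤ E.c.B) :
    (powE Q x).eval E.c.w ρ μ = 2 ^ (n * (Q.d - 1)) := by
  have h1 := Cfg.exp_le hn
  have h2 := Cfg.mul_b_lt_word h1 (show Q.d - 1 ≤ Q.d by omega)
  have h3 : 2 ^ (n * (Q.d - 1)) < 2 ^ E.c.w := by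
    rw [pow_mul]
    exact E.c.lt_word (k := Q.d - 1) (Nat.pow_le_pow_left hn _) (by omega)
  rw [powE, eval_shl (eval_const (by omega)) (eval_mul hx (eval_const (by omega)) h2)
    (by rwa [one_mul]), one_mul]

theorem tau_le {c : Cfg Q.d} (hs : theta s ≤ c.B) : tau Q.d s ≤ c.B ^ Q.d := by
  rw [tau_eq]
  exact (Nat.pow_le_pow_left hs _).trans (Nat.pow_le_pow_right c.B_pos (by omega))

theorem tau_lt_pow {c : Cfg Q.d} (hs : theta s ≤ c.B) : tau Q.d s < c.B ^ (Q.d + 1) :=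
  (tau_le hs).trans_lt (Nat.pow_lt_pow_right c.one_lt_B (by omega))

/-- The tuples with a component between the thresholds are the only ones whose pattern, group or
light status may depend on the choice. They are taken out before the threshold is replaced and put
back afterwards; the same program serves both directions. -/
theorem run_rescale (h : Stage E σ a) (hfull : σ.Full) (hs4 : a.ρ (.loc 4) = s)
    (hs : theta s ≤ E.c.B) {lo hi K : ℕ}
    (hlohi : (σ.thr = lo ∧ tau Q.d s = hi) ∨ (σ.thr = hi ∧ tau Q.d s = lo)) (hle : lo ≤ hi)
    (hlo : 1 ≤ lo) (hlo5 : a.ρ (.loc 5) = lo) (hhi6 : a.ρ (.loc 6) = hi)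
    (hK : ∀ i < Q.d, (σ.lev i lo).card ≤ K) :
    Run E.c (rescale Q) a ((K + 1) * hi * sweepCost Q (unregister Q) +
      (tm (asg (d := Q.d) (.loc 1) (powE Q ((rv Q 4).add (.const 3)))) +
      (tm (asg (d := Q.d) (.loc 0) (rv Q 4)) + (K + 1) * hi * sweepCost Q (register Q)))) fun b =>
      Stage E (σ.withThr (tau Q.d s)) b ∧ b.ρ (.loc 0) = s ∧ Agree 1 a.ρ b.ρ := by
  have hB := h.B
  have hthr := h.st.wf.thr
  rw [hB] at hthr
  have htau := tau_le hs
  have hpow : E.c.B ^ Q.d < E.c.B ^ (Q.d + 1) := Nat.pow_lt_pow_right E.c.one_lt_B (by omega)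
  have hword : E.c.B ^ (Q.d + 1) < 2 ^ E.c.w := E.c.lt_word le_rfl (by omega)
  have hsb := Cfg.exp_le (c := E.c) (s := s + 3) hs
  have hbw : E.c.b ≤ E.c.w := by
    rw [E.c.b_eq]
    exact Nat.div_le_self _ _
  have hww := E.c.w_lt
  have hlo2 : lo < E.c.B ^ (Q.d + 1) := by omega
  have hhi2 : hi < 2 ^ E.c.w := by omega
  refine Run.seq (run_sweep (op := (· \ ·)) (acc := fun A B => A ∧ ¬ B) run_unregisterAll
    (fun S T z => Finset.mem_sdiff) (by simp) (by intros; tauto) h hlo hlo5 hlo2 hhi6 hhi2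
    (by omega) hK) ?_
  rintro b1 ⟨R, g1, g2, g3⟩
  -- What remains registered has no component in the critical interval, so the stored sets are
  -- correct for both thresholds.
  have hRreg : R ⊆ σ.reg := fun z hz => ((g3 z).1 hz).1
  have hsame : Sem.Same (σ.withReg R) ((σ.withReg R).withThr (tau Q.d s)) :=
    Sem.same_withThr hlohi hle (fun i hi z hz => by
      change z ∈ σ.cen i
      rw [hfull i hi]
      exact hRreg hz) fun z hz => ((g3 z).1 hz).2
  have r4 : b1.ρ (.loc 4) = s := (g2 (.loc 4) (by simp [Var.rank])).trans hs4
  refine Run.seq (Mid := fun b => b = b1.set (.loc 1) (tau Q.d s)) (run_asg g1.n_le ?_) ?_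
  · congr 1
    exact eval_pow (eval_add (eval_var _ r4 (by omega)) (eval_const (by omega)) (by omega)) hs
  rintro _ rfl
  refine Run.seq (Mid := fun b => b = (b1.set (.loc 1) (tau Q.d s)).set (.loc 0) s)
    (run_asg g1.n_le ?_) ?_
  · congr 1
    exact eval_var _ (by simp [AS.set, r4]) (by omega)
  rintro _ rfl
  set b2 := (b1.set (.loc 1) (tau Q.d s)).set (.loc 0) s with hb2
  have h2 : Stage E ((σ.withReg R).withThr (tau Q.d s)) b2 := by
    refine ⟨⟨⟨hB, g1.st.wf.reg, g1.st.wf.cen, g1.st.wf.sat, ?_⟩, fun key z => ?_, ?_, g1.st.n,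
      g1.st.it⟩, g1.within.reg, g1.within.cen, g1.within.sat⟩
    · change tau Q.d s ≤ σ.B ^ Q.d
      rw [hB]
      exact htau
    · rw [hsame.spec_withThr g1.st.wf.reg]
      exact g1.st.mem key z
    · simp [hb2, AS.set, Sem.withThr]
  have r5 : b2.ρ (.loc 5) = lo := by
    simpa [hb2, AS.set] using (g2 (.loc 5) (by simp [Var.rank])).trans hlo5
  have r6 : b2.ρ (.loc 6) = hi := by
    simpa [hb2, AS.set] using (g2 (.loc 6) (by simp [Var.rank])).trans hhi6
  refine (run_sweep (op := (· ∪ ·)) (acc := fun A B => A ∨ B) run_registerAll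
    (fun S T z => Finset.mem_union) (by simp) (by intros; tauto) h2 hlo r5 hlo2 r6 hhi2
    (by omega) hK).mono le_rfl ?_
  rintro b3 ⟨R', k1, k2, k3⟩
  refine ⟨?_, (k2 (.loc 0) (by simp [Var.rank])).trans (by simp [hb2, AS.set]), ?_⟩
  · convert k1 using 1
    have : σ.reg = R' := by
      ext z
      rw [k3]
      change _ ↔ z ∈ R ∨ σ.Crosses lo hi z
      rw [g3]
      constructor
      · intro hz
        by_cases hc : σ.Crosses lo hi z
        · exact Or.inr hc
        · exact Or.inl ⟨hz, hc⟩
      · rintro (hz | ⟨i, hi', hz, -⟩)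
        · exact hz.1
        · rwa [hfull i hi'] at hz
    unfold Sem.withThr Sem.withReg
    rw [this]
  · refine ((g2.mono (by norm_num)).trans ?_).trans (k2.mono (by norm_num))
    exact ((Agree.refl _ _).update (by simp [Var.rank]) _).update (by simp [Var.rank]) _

end StarMaintenance

/-! ### The decision whether the scale changes. -/

namespace StarMaintenance

open WordRAM Classical

variable {Q : StarQuery} {E : Env Q} {σ σ' : Sem Q} {a : AS Q.d} {i s : ℕ}

namespace Sem

/-- There are not too many heavy values. -/
def FewHeavy (σ : Sem Q) (s : ℕ) : Prop := ∀ i < Q.d, (σ.lev i (tau Q.d s)).card ≤ 4 * theta s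

/-- There are few values above the next lower threshold. -/
def FewDense (σ : Sem Q) (s : ℕ) : Prop :=
  ∀ i < Q.d, 4 * (σ.lev i (tau Q.d (s - 1))).card < theta s

/-- The scale after an update. -/
noncomputable def nextScale (σ : Sem Q) (s : ℕ) : ℕ :=
  if σ.FewHeavy s then (if s ≠ 0 ∧ σ.FewDense s then s - 1 else s) else s + 1

end Sem

section programs

variable (Q)

def sweepsCost : ℕ := sweepCost Q (unregister Q) + sweepCost Q (register Q)

/-- The time of an update of the scale apart from the change itself. -/
def rebalanceCost : ℕ :=
  tm ((fewHeavyE Q).compile 0) + tm ((rv Q 0).compile 0) + tm ((fewDenseE Q).compile 0) +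
    tm (asg (d := Q.d) (.loc 5) (powE Q ((rv Q 0).add (.const 2)))) +
    tm (asg (d := Q.d) (.loc 6) (rv Q 1)) + tm (asg (d := Q.d) (.loc 4) ((rv Q 0).sub (.const 1))) +
    tm (asg (d := Q.d) (.loc 5) (rv Q 1)) +
    tm (asg (d := Q.d) (.loc 6) (powE Q ((rv Q 0).add (.const 4)))) +
    tm (asg (d := Q.d) (.loc 4) ((rv Q 0).add (.const 1))) +
    2 * (tm (asg (d := Q.d) (.loc 1) (powE Q ((rv Q 4).add (.const 3)))) +
    tm (asg (d := Q.d) (.loc 0) (rv Q 4))) + 10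

end programs

theorem tests_few (h : Stage E σ a) (hs : Sane E.c a.l) {i δ : ℕ} {u : Expr Q.d} (hi : i < Q.d)
    (hδ : 1 ≤ δ) (hu : ∀ μ, u.eval E.c.w a.ρ μ = δ) (hδ2 : δ < E.c.B ^ (Q.d + 1)) :
    (KeyE.mk 2 i u).size.eval E.c.w a.ρ (E.c.cell a.l a.it) = (σ.lev i δ).card := by
  rw [(key_is (g := 2) (by norm_num) hi.le hu hδ2).size_eq hs]
  refine length_eq_card (hs _).1 fun v => ?_
  rw [h.st.mem, Sem.mem_lev hδ]
  simp [Sem.spec, hi, hδ]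

theorem card_lev_lt {c : Cfg Q.d} (h : σ.Wf c) (i δ : ℕ) :
    (σ.lev i δ).card ≤ c.B := by
  refine (Finset.card_filter_le _ _).trans ?_
  rw [← Finset.card_range c.B]
  refine Finset.card_le_card fun v hv => ?_
  obtain ⟨y, -, rfl⟩ := Finset.mem_image.1 hv
  rw [h.B, Finset.mem_range]
  exact dig_lt c.B_pos _ _

/-- The bound in `hK` exceeds the limit for heavy values by one because the test takes place after
one update of a balanced database. -/
theorem run_rebalance (h : Stage E σ a) (hfull : σ.Full) (hs : a.ρ (.loc 0) = s)
    (hthr : σ.thr = tau Q.d s) (hsB : 4 * theta s ≤ E.c.B)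
    (hK : ∀ i < Q.d, (σ.lev i (tau Q.d s)).card ≤ 4 * theta s + 1) :
    Run E.c (rebalance Q) a (rebalanceCost Q + (if σ.nextScale s = s then 0 else
      theta s * tau Q.d s * (6 * 2 ^ (Q.d - 1) * sweepsCost Q))) fun b =>
      Stage E (σ.withThr (tau Q.d (σ.nextScale s))) b ∧ b.ρ (.loc 0) = σ.nextScale s ∧
        Agree 1 a.ρ b.ρ := by
  have hB := h.B
  have hθ1 := theta_pos s
  have hθs : theta (s + 1) ≤ E.c.B := by rw [theta_succ]; omega
  have hsb := Cfg.exp_le (c := E.c) (s := s + 5) (by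
    refine le_trans (le_of_eq ?_) hsB
    unfold theta
    ring)
  have hbw : E.c.b ≤ E.c.w := by
    rw [E.c.b_eq]
    exact Nat.div_le_self _ _
  have hww := E.c.w_lt
  have hBw : E.c.B ^ 2 < 2 ^ E.c.w := E.c.lt_word le_rfl (by omega)
  have hB4 : 4 < E.c.B := E.c.small (by omega)
  have hB4w : 4 * E.c.B < 2 ^ E.c.w := by nlinarith
  have htau1 := tau_pos Q.d s
  have htauB : tau Q.d s < E.c.B ^ (Q.d + 1) := tau_lt_pow (by omega)
  have htauw : tau Q.d s < 2 ^ E.c.w := lt_word_of_lt htauB (by omega)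
  have hr1 : a.ρ (.loc 1) = tau Q.d s := h.st.thr.trans hthr
  have e0 : ∀ {b : AS Q.d}, b.ρ (.loc 0) = s → ∀ μ, (rv Q 0).eval E.c.w b.ρ μ = s :=
    fun hb μ => eval_var _ hb (by omega)
  refine Run.sane fun hsane => ?_
  have test1 : Tests E.c a.ρ (E.c.cell a.l a.it) (fewHeavyE Q) (σ.FewHeavy s) := by
    refine Tests.all fun i hi => ((Tests.lt ?_ (tests_few h hsane hi htau1
      (fun μ => eval_var _ hr1 htauw) htauB)).not.congr not_lt)
    have : 1 * 2 ^ (s + 5) = 4 * theta s := by unfold theta; ring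
    rw [← this]
    exact eval_shl (eval_const (by omega)) (eval_add (e0 hs _) (eval_const (by omega)) (by omega))
      (by omega)
  refine Run.mono (run_ite (T₁ := tm ((rv Q 0).compile 0) + 1 +
      (tm (asg (d := Q.d) (.loc 5) (powE Q ((rv Q 0).add (.const 2)))) +
        (tm ((fewDenseE Q).compile 0) + 1 + (tm (asg (d := Q.d) (.loc 6) (rv Q 1)) +
          (tm (asg (d := Q.d) (.loc 4) ((rv Q 0).sub (.const 1))) +
          (tm (asg (d := Q.d) (.loc 1) (powE Q ((rv Q 4).add (.const 3)))) +
            tm (asg (d := Q.d) (.loc 0) (rv Q 4)) + (if σ.FewHeavy s then (if σ.nextScale s = s then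
            0 else theta s * tau Q.d s * (6 * 2 ^ (Q.d - 1) * sweepsCost Q)) else 0))) + 1))))
    (T₂ := if σ.FewHeavy s then 0 else
      (tm (asg (d := Q.d) (.loc 5) (rv Q 1)) +
      (tm (asg (d := Q.d) (.loc 6) (powE Q ((rv Q 0).add (.const 4)))) +
      (tm (asg (d := Q.d) (.loc 4) ((rv Q 0).add (.const 1))) +
      (tm (asg (d := Q.d) (.loc 1) (powE Q ((rv Q 4).add (.const 3)))) +
            tm (asg (d := Q.d) (.loc 0) (rv Q 4)) +
            theta s * tau Q.d s * (6 * 2 ^ (Q.d - 1) * sweepsCost Q))))))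
    h.n_le (fun h1 => ?_) (fun h1 => ?_)) ?_ (fun b hb => hb)
  · replace h1 := test1.ne_zero.1 h1
    have hstay : ¬ (s ≠ 0 ∧ σ.FewDense s) → ∀ {b : AS Q.d}, Stage E σ b → b.ρ (.loc 0) = s →
        Agree 1 a.ρ b.ρ → Stage E (σ.withThr (tau Q.d (σ.nextScale s))) b ∧
        b.ρ (.loc 0) = σ.nextScale s ∧ Agree 1 a.ρ b.ρ := by
      intro hn b hb1 hb2 hb3
      have : σ.nextScale s = s := by
        unfold Sem.nextScale
        rw [if_pos h1, if_neg hn]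
      rw [this]
      refine ⟨?_, hb2, hb3⟩
      rw [← hthr]
      exact hb1
    refine run_cond h.n_le (fun h2 => ?_) (fun h2 => ?_)
    · rw [ev, e0 hs] at h2
      have hs1 : s - 1 + 1 = s := by omega
      have hθ := theta_succ (s - 1)
      rw [hs1] at hθ
      have hlo1 := tau_pos Q.d (s - 1)
      have hloB : tau Q.d (s - 1) < E.c.B ^ (Q.d + 1) := tau_lt_pow (by omega)
      have hlow : tau Q.d (s - 1) < 2 ^ E.c.w := lt_word_of_lt hloB (by omega)
      refine Run.seq (Mid := fun b => b = a.set (.loc 5) (tau Q.d (s - 1))) (run_asg h.n_le ?_) ?_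
      · congr 1
        have : tau Q.d (s - 1) = 2 ^ ((s + 2) * (Q.d - 1)) := by
          unfold tau
          congr 2
          omega
        rw [this]
        refine eval_pow (eval_add (e0 hs _) (eval_const (by omega)) (by omega)) ?_
        have : 2 ^ (s + 2) ≤ 2 ^ (s + 3) := Nat.pow_le_pow_right (by norm_num) (by omega)
        change 2 ^ (s + 2) ≤ theta s at this
        omega
      rintro _ rfl
      have hst := h.set (v := .loc 5) (by simp) (tau Q.d (s - 1))
      have r0 : (a.set (.loc 5) (tau Q.d (s - 1))).ρ (.loc 0) = s := by simp [AS.set, hs]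
      have r5 : (a.set (.loc 5) (tau Q.d (s - 1))).ρ (.loc 5) = tau Q.d (s - 1) := by simp [AS.set]
      have r1 : (a.set (.loc 5) (tau Q.d (s - 1))).ρ (.loc 1) = tau Q.d s := by simp [AS.set, hr1]
      have hag : Agree 1 a.ρ (a.set (.loc 5) (tau Q.d (s - 1))).ρ :=
        (Agree.refl _ _).update (by simp [Var.rank]) _
      set a1 := a.set (.loc 5) (tau Q.d (s - 1)) with ha1
      have test2 : Tests E.c a1.ρ (E.c.cell a1.l a1.it) (fewDenseE Q) (σ.FewDense s) := by
        refine Tests.all fun i hi => ?_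
        have hc := card_lev_lt h.st.wf i (tau Q.d (s - 1))
        refine Tests.lt (eval_mul (eval_const (by omega)) (tests_few hst hsane hi hlo1
          (fun μ => eval_var _ r5 hlow) hloB) (by omega)) ?_
        have : 1 * 2 ^ (s + 3) = theta s := by unfold theta; ring
        rw [← this]
        exact eval_shl (eval_const (by omega)) (eval_add (e0 r0 _) (eval_const (by omega))
          (by omega)) (by omega)
      refine run_cond hst.n_le (fun h3 => ?_) (fun h3 => ?_)
      · replace h3 := test2.ne_zero.1 h3
        have hnext : σ.nextScale s = s - 1 := by
          unfold Sem.nextScale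
          rw [if_pos h1, if_pos ⟨h2, h3⟩]
        refine Run.mono (Run.seq (T₁ := tm (asg (d := Q.d) (.loc 6) (rv Q 1)))
          (Mid := fun b => b = a1.set (.loc 6) (tau Q.d s)) (run_asg hst.n_le ?_)
          (T₂ := (tm (asg (d := Q.d) (.loc 4) ((rv Q 0).sub (.const 1))) +
          (tm (asg (d := Q.d) (.loc 1) (powE Q ((rv Q 4).add (.const 3)))) +
            tm (asg (d := Q.d) (.loc 0) (rv Q 4)) +
            theta s * tau Q.d s * (6 * 2 ^ (Q.d - 1) * sweepsCost Q)))) ?_) ?_ fun b hb => hb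
        · congr 1
          exact eval_var _ r1 htauw
        · rintro _ rfl
          refine Run.seq (Mid := fun b => b = (a1.set (.loc 6) (tau Q.d s)).set (.loc 4) (s - 1))
            (run_asg hst.n_le ?_) ?_
          · congr 1
            refine eval_sub (eval_var _ ?_ (by omega)) (eval_const (by omega)) (by omega) (by omega)
            simpa [AS.set] using r0
          rintro _ rfl
          -- The test has shown fewer than θ/4 values above the lower threshold, so `theta s` is a
          -- generous choice of `K`.
          refine (run_rescale (s := s - 1) (lo := tau Q.d (s - 1)) (hi := tau Q.d s)
            (K := theta s) ((hst.set (v := .loc 6) (by simp) _).set (v := .loc 4) (by simp) _) hfull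
            (by simp [AS.set]) (by omega) (Or.inr ⟨hthr, rfl⟩) (tau_mono _ (by omega)) hlo1
            (by simpa [AS.set] using r5) (by simp [AS.set]) (fun i hi => ?_)).mono ?_ ?_
          · have := h3 i hi
            omega
          · have : (theta s + 1) * tau Q.d s ≤ theta s * tau Q.d s * (6 * 2 ^ (Q.d - 1)) := by
              have e1 : theta s + 1 ≤ theta s * (6 * 2 ^ (Q.d - 1)) := by
                have := Nat.one_le_two_pow (n := Q.d - 1)
                nlinarith
              calc _ ≤ theta s * (6 * 2 ^ (Q.d - 1)) * tau Q.d s := Nat.mul_le_mul_right _ e1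
                _ = _ := by ring
            have := Nat.mul_le_mul_right (sweepsCost Q) this
            rw [sweepsCost] at this ⊢
            rw [Nat.mul_add] at this
            rw [← mul_assoc]
            omega
          · rintro b ⟨b1, b2, b3⟩
            rw [hnext]
            exact ⟨b1, b2, hag.trans ((((Agree.refl _ _).update (by simp [Var.rank]) _).update
              (by simp [Var.rank]) _).trans b3)⟩
        · rw [if_pos h1, hnext, if_neg (by omega)]
          omega
      · have h3' : ¬ σ.FewDense s := fun hh => test2.ne_zero.2 hh h3
        exact (run_nop hst.n_le (hstay (fun hh => h3' hh.2) hst r0 hag)).mono (by omega)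
          fun b hb => hb
    · rw [ev, e0 hs] at h2
      exact (run_nop h.n_le (hstay (fun hh => hh.1 h2) h hs (Agree.refl _ _))).mono (by omega)
        fun b hb => hb
  · have h1' : ¬ σ.FewHeavy s := fun hh => test1.ne_zero.2 hh h1
    have hnext : σ.nextScale s = s + 1 := by
      unfold Sem.nextScale
      rw [if_neg h1']
    rw [hnext, if_neg h1']
    refine Run.seq (Mid := fun b => b = a.set (.loc 5) (tau Q.d s)) (run_asg h.n_le ?_) ?_
    · congr 1
      exact eval_var _ hr1 htauw
    rintro _ rfl
    have h2 := h.set (v := .loc 5) (by simp) (tau Q.d s)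
    refine Run.seq (Mid := fun b => b = (a.set (.loc 5) (tau Q.d s)).set (.loc 6)
      (tau Q.d (s + 1))) (run_asg h2.n_le ?_) ?_
    · congr 1
      refine eval_pow (n := s + 4) (eval_add (eval_var _ ?_ (by omega)) (eval_const (by omega))
        (by omega)) hθs
      simpa [AS.set] using hs
    rintro _ rfl
    have h3 := h2.set (v := .loc 6) (by simp) (tau Q.d (s + 1))
    refine Run.seq (Mid := fun b => b = ((a.set (.loc 5) (tau Q.d s)).set (.loc 6)
      (tau Q.d (s + 1))).set (.loc 4) (s + 1)) (run_asg h3.n_le ?_) ?_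
    · congr 1
      refine eval_add (eval_var _ ?_ (by omega)) (eval_const (by omega)) (by omega)
      simpa [AS.set] using hs
    rintro _ rfl
    have h4 := h3.set (v := .loc 4) (by simp) (s + 1)
    refine (run_rescale (s := s + 1) (lo := tau Q.d s) (hi := tau Q.d (s + 1))
      (K := 4 * theta s + 1) h4 hfull (by simp [AS.set]) hθs (Or.inl ⟨hthr, rfl⟩)
      (tau_mono _ (by omega)) htau1 (by simp [AS.set]) (by simp [AS.set]) hK).mono ?_ ?_
    -- The constant `6 * 2 ^ (Q.d - 1)` comes from here: 4θ + 2 ≤ 6θ, and the next threshold is `2 ^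
    -- (Q.d - 1)` times the present one.
    · have : (4 * theta s + 1 + 1) * tau Q.d (s + 1) ≤
          theta s * tau Q.d s * (6 * 2 ^ (Q.d - 1)) := by
        rw [tau_succ]
        calc _ ≤ (6 * theta s) * (2 ^ (Q.d - 1) * tau Q.d s) := Nat.mul_le_mul_right _ (by omega)
          _ = _ := by ring
      have := Nat.mul_le_mul_right (sweepsCost Q) this
      rw [sweepsCost] at this ⊢
      rw [Nat.mul_add] at this
      rw [← mul_assoc]
      omega
    · rintro b ⟨b1, b2, b3⟩
      refine ⟨b1, b2, Agree.trans ?_ b3⟩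
      exact (((Agree.refl _ _).update (by simp [Var.rank]) _).update (by simp [Var.rank]) _).update
        (by simp [Var.rank]) _
  · have hnext : ¬ σ.FewHeavy s → σ.nextScale s ≠ s := by
      intro hh
      unfold Sem.nextScale
      rw [if_neg hh]
      omega
    unfold rebalanceCost
    by_cases hh : σ.FewHeavy s
    · rw [if_pos hh, if_pos hh]
      omega
    · rw [if_neg hh, if_neg hh, if_neg (hnext hh)]
      omega

end StarMaintenance

/-! ### The complete update program. -/

namespace StarMaintenance

open WordRAM Classical

variable {Q : StarQuery} {E : Env Q} {σ σ' : Sem Q} {a : AS Q.d} {i s : ℕ}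

section programs

variable (Q)

/-- The threshold of the scale in variable `0` goes to variable `1`. -/
def loadThr : Prog := asg (d := Q.d) (.loc 1) (powE Q ((rv Q 0).add (.const 3)))

/-- The update of the satellite relation whose number, plus one, is the second input. -/
def updateSats : Prog :=
  seqs (fun i => cond ((iv Q 1).eq (.const (i + 1))) (updateSat Q i) .nop) Q.k

/-- The program that processes an update. -/
def onUpdate : Prog :=
  .seq (loadThr Q) (cond (iv Q 1) (updateSats Q) (.seq (updateCenter Q) (rebalance Q)))

/-- The factor in the time of an update apart from changes of the scale. -/
def updateCost : ℕ :=
  tm (loadThr Q) + tm ((iv Q 1).compile 0) + 2 +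
    ∑ i ∈ Finset.range Q.k, (tm (((iv Q 1).eq (.const (i + 1))).compile 0) + 1 +
      ((2 + 5 ^ (Q.d - 1)) * updateSatCost Q i + 1)) + 3 * updateCenterCost Q + rebalanceCost Q

end programs

/-- Of the local variables only the scale is relied on between requests, and the threshold is
recomputed. This makes zeroed registers a valid start, since scale `0` is represented by `0` while
its threshold is positive. -/
theorem run_loadThr (hs : a.ρ (.loc 0) = s) (hsB : theta s ≤ E.c.B) (hn : a.n ≤ E.c.S) :
    Run E.c (loadThr Q) a (tm (loadThr Q)) fun b => b = a.set (.loc 1) (tau Q.d s) := by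
  refine run_asg hn ?_
  congr 1
  have hsb := Cfg.exp_le (c := E.c) (s := s + 3) hsB
  have hbw : E.c.b ≤ E.c.w := by
    rw [E.c.b_eq]
    exact Nat.div_le_self _ _
  have hww := E.c.w_lt
  exact eval_pow (n := s + 3) (eval_add (eval_var _ hs (by omega)) (eval_const (by omega))
    (by omega)) hsB

theorem run_updateSats {v f : ℕ} (h : Stage E σ a) (hfull : σ.Full) (hin : SatInput E a i v f)
    (h1 : ∀ μ, (iv Q 1).eval E.c.w a.ρ μ = i + 1) {X : ℕ}
    (hw : (σ.withSat i (Sem.toggled (σ.sat i) v f)).Within E) (ht : 1 ≤ σ.thr) {M : ℕ}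
    (hM : ∀ i < Q.d, (σ.lev i σ.thr).card ≤ M) (hX : σ.thr + (1 + M) ^ (Q.d - 1) + 1 ≤ X) :
    Run E.c (updateSats Q) a (1 + ∑ i ∈ Finset.range Q.k,
      (tm (((iv Q 1).eq (.const (i + 1))).compile 0) + 1 + (X * updateSatCost Q i + 1)))
      fun b => Stage E (σ.withSat i (Sem.toggled (σ.sat i) v f)) b ∧ Agree 10 a.ρ b.ρ := by
  have hk := Q.k_le
  have hi := hin.i_lt
  refine (run_seqs (fun n b => Stage E (if i < n then σ.withSat i (Sem.toggled (σ.sat i) v f)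
    else σ) b ∧ Agree 10 a.ρ b.ρ) ⟨by simpa using h, Agree.refl _ _⟩ h.n_le Q.k ?_).mono le_rfl
      fun b hb => by simpa [hi] using hb
  rintro j hj b ⟨g1, g2⟩
  have hinb := hin.agree g2 (by norm_num)
  have hiv : ∀ μ, (iv Q 1).eval E.c.w b.ρ μ = i + 1 := by
    intro μ
    rw [← h1 μ]
    simp only [Expr.eval]
    rw [g2 _ (by simp [Var.rank])]
  have test := Tests.eq (hiv (E.c.cell b.l b.it)) (eval_const (n := j + 1) (c := E.c) (ρ := b.ρ)
    (μ := E.c.cell b.l b.it) (by omega))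
  refine run_cond g1.n_le (fun h0 => ?_) (fun h0 => ?_)
  · have hij : i = j := by
      have := test.ne_zero.1 h0
      omega
    subst hij
    simp only [lt_irrefl, if_false] at g1
    refine (run_updateSat g1 hfull hinb hw ht hM).mono
      ((Nat.mul_le_mul_right _ hX).trans (by omega)) fun b' hb' => ?_
    simpa using ⟨hb'.1, g2.trans hb'.2⟩
  · have hij : i ≠ j := fun hh => test.ne_zero.2 (by omega) h0
    refine (run_nop g1.n_le ?_).mono (by omega) fun b hb => hb
    have : i < j + 1 ↔ i < j := by omega
    simpa only [this] using ⟨g1, g2⟩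

theorem run_onUpdate_sat {v f : ℕ} (h : Stage E σ (a.set (.loc 1) (tau Q.d s)))
    (hfull : σ.Full) (hs : a.ρ (.loc 0) = s) (hthr : σ.thr = tau Q.d s)
    (hsB : theta s ≤ E.c.B) (hin : SatInput E a i v f)
    (h1 : a.ρ (.inp 1) = i + 1)
    (hw : (σ.withSat i (Sem.toggled (σ.sat i) v f)).Within E)
    (hK : ∀ i < Q.d, (σ.lev i (tau Q.d s)).card ≤ 4 * theta s) :
    Run E.c (onUpdate Q) a (tau Q.d s * updateCost Q) fun b =>
      Stage E (σ.withSat i (Sem.toggled (σ.sat i) v f)) b ∧ b.ρ (.loc 0) = s := by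
  have hk := Q.k_le
  have hi := hin.i_lt
  have ht := tau_pos Q.d s
  -- With 1 + 4θ ≤ 5θ, the number of patterns to be visited is at most `5 ^ (Q.d - 1)` times the
  -- threshold θ^(d-1).
  have hX : σ.thr + (1 + 4 * theta s) ^ (Q.d - 1) + 1 ≤ tau Q.d s * (2 + 5 ^ (Q.d - 1)) := by
    have e1 : (1 + 4 * theta s) ^ (Q.d - 1) ≤ (5 * theta s) ^ (Q.d - 1) :=
      Nat.pow_le_pow_left (by have := theta_pos s; omega) _
    rw [mul_pow, ← tau_eq] at e1
    rw [hthr]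
    have e2 : 1 ≤ 5 ^ (Q.d - 1) := Nat.one_le_pow _ _ (by norm_num)
    nlinarith
  refine Run.mono (Run.seq (run_loadThr hs hsB h.n_le) (T₂ :=
    tm ((iv Q 1).compile 0) + 1 + (1 + ∑ i ∈ Finset.range Q.k,
      (tm (((iv Q 1).eq (.const (i + 1))).compile 0) + 1 +
        (tau Q.d s * (2 + 5 ^ (Q.d - 1)) * updateSatCost Q i + 1)))) ?_) ?_ fun b hb => hb
  · rintro _ rfl
    have hiv : ∀ μ, (iv Q 1).eval E.c.w (a.set (.loc 1) (tau Q.d s)).ρ μ = i + 1 := by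
      intro μ
      exact eval_var _ (by simpa [AS.set] using h1) (E.c.small_lt_word (by omega))
    refine run_cond h.n_le (fun _ => ?_) (fun h0 => by have := (hiv _).symm.trans h0; omega)
    refine (run_updateSats h hfull (hin.agree (m := 1) (b := a.set (.loc 1) (tau Q.d s))
      ((Agree.refl _ _).update (by simp [Var.rank]) _) (by norm_num)) hiv hw
      (hthr ▸ ht) (hthr ▸ hK) hX).mono le_rfl fun b hb => ⟨hb.1, ?_⟩
    rw [hb.2 _ (by simp [Var.rank])]
    simpa [AS.set] using hs
  · have hle : ∀ n, n ≤ tau Q.d s * n := fun n => Nat.le_mul_of_pos_left _ (by omega)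
    unfold updateCost
    simp only [Nat.mul_add, Finset.mul_sum, Finset.sum_add_distrib, ← mul_assoc]
    have e1 := hle (tm (loadThr Q))
    have e2 := hle (tm ((iv Q 1).compile 0))
    have e3 := Finset.sum_le_sum fun i (_ : i ∈ Finset.range Q.k) =>
      hle (tm (((iv Q 1).eq (.const (i + 1))).compile 0))
    have e4 := Finset.sum_le_sum fun i (_ : i ∈ Finset.range Q.k) => hle 1
    simp only [mul_one] at e4 ⊢
    omega

theorem run_onUpdate_cen {y f : ℕ} (hd : 1 ≤ Q.d)
    (h : Stage E σ (a.set (.loc 1) (tau Q.d s)))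
    (hfull : σ.Full) (hs : a.ρ (.loc 0) = s) (hthr : σ.thr = tau Q.d s)
    (hsB : 4 * theta s ≤ E.c.B) (hin : CenInput E a y f)
    (h1 : a.ρ (.inp 1) = 0) (hσ' : σ' = σ.setCen (Sem.toggled σ.reg y f))
    (hfull' : σ'.Full) (hK : ∀ i < Q.d, (σ'.lev i (tau Q.d s)).card ≤ 4 * theta s + 1) :
    Run E.c (onUpdate Q) a (tau Q.d s * updateCost Q + if σ'.nextScale s = s then 0 else
      theta s * tau Q.d s * (6 * 2 ^ (Q.d - 1) * sweepsCost Q)) fun b =>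
      Stage E (σ'.withThr (tau Q.d (σ'.nextScale s))) b ∧ b.ρ (.loc 0) = σ'.nextScale s := by
  have ht := tau_pos Q.d s
  refine Run.mono (Run.seq (run_loadThr hs (by omega) h.n_le) (T₂ :=
    tm ((iv Q 1).compile 0) + 1 + ((σ.thr + 2) * updateCenterCost Q +
      (rebalanceCost Q + if σ'.nextScale s = s then 0 else
      theta s * tau Q.d s * (6 * 2 ^ (Q.d - 1) * sweepsCost Q)))) ?_) ?_ fun b hb => hb
  · rintro _ rfl
    have hag : Agree 1 a.ρ (a.set (.loc 1) (tau Q.d s)).ρ :=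
      (Agree.refl _ _).update (by simp [Var.rank]) _
    have hiv : ∀ μ, (iv Q 1).eval E.c.w (a.set (.loc 1) (tau Q.d s)).ρ μ = 0 := by
      intro μ
      exact eval_var _ (by simpa [AS.set] using h1) (E.c.small_lt_word (by omega))
    refine run_cond h.n_le (fun h0 => absurd (hiv _) h0) (fun _ => ?_)
    refine Run.seq (run_updateCenter hd h hfull ⟨(hag _ (by simp [Var.rank])).trans hin.flag,
      hin.flag_le, hin.mem, fun i hi => (hag _ (by simp [Var.rank])).trans (hin.val i hi)⟩) ?_
    rintro b ⟨b1, b2⟩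
    rw [← hσ'] at b1
    refine (run_rebalance b1 hfull' ?_ (by rw [hσ']; exact hthr) hsB hK).mono le_rfl
      fun b hb => ⟨hb.1, hb.2.1⟩
    rw [b2 _ (by simp [Var.rank])]
    simpa [AS.set] using hs
  · have hle : ∀ n, n ≤ tau Q.d s * n := fun n => Nat.le_mul_of_pos_left _ (by omega)
    unfold updateCost
    rw [hthr]
    simp only [Nat.mul_add, ← mul_assoc]
    have e1 := hle (tm (loadThr Q))
    have e2 := hle (tm ((iv Q 1).compile 0))
    have e3 := hle (rebalanceCost Q)
    have e4 : (tau Q.d s + 2) * updateCenterCost Q ≤ tau Q.d s * 3 * updateCenterCost Q :=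
      Nat.mul_le_mul_right _ (by omega)
    omega

end StarMaintenance

/-! ### Balanced scales, their relation to the H-index, and the amortized analysis. -/

namespace StarMaintenance

open WordRAM Classical StarQuery

variable {Q : StarQuery} {D D' : Q.Database} {s : ℕ}

/-- The largest number of values of an attribute with degree at least the threshold of scale `s`. -/
noncomputable def num (D : Q.Database) (s : ℕ) : ℕ :=
  Finset.univ.sup fun i => D.numDense i (theta s)

/-- The scale `s` is appropriate for the database. -/
def Balanced (D : Q.Database) (s : ℕ) : Prop :=
  num D s ≤ 4 * theta s ∧ (s = 0 ∨ theta s ≤ 4 * num D (s - 1))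

/-- The scale after an update that leads to the database `D`. -/
noncomputable def nextScale (D : Q.Database) (s : ℕ) : ℕ :=
  if num D s ≤ 4 * theta s then (if s ≠ 0 ∧ 4 * num D (s - 1) < theta s then s - 1 else s)
  else s + 1

/-- The potential function of the amortized analysis. -/
noncomputable def potential (D : Q.Database) (s : ℕ) : ℕ :=
  tau Q.d s * ((num D s - 2 * theta s) + if s = 0 then 0 else theta s / 2 - num D (s - 1))

theorem numDense_anti (D : Q.Database) (i : Fin Q.d) {m m' : ℕ} (h : m ≤ m') :
    D.numDense i m' ≤ D.numDense i m :=
  Finset.card_le_card (Finset.monotone_filter_right _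
    fun _ _ hv => (Nat.pow_le_pow_left h _).trans hv)

theorem theta_mono {s s' : ℕ} (h : s ≤ s') : theta s ≤ theta s' :=
  Nat.pow_le_pow_right (by norm_num) (by omega)

theorem num_anti (D : Q.Database) {s s' : ℕ} (h : s ≤ s') : num D s' ≤ num D s :=
  Finset.sup_mono_fun fun i _ => numDense_anti D i (theta_mono h)

theorem num_le_card (D : Q.Database) (s : ℕ) : num D s ≤ D.center.card :=
  Finset.sup_le fun _ _ => (Finset.card_filter_le _ _).trans Finset.card_image_le

theorem num_congr (h : D'.center = D.center) (s : ℕ) : num D' s = num D s := by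
  unfold num Database.numDense Database.degree
  rw [h]

theorem le_hIndex {i : Fin Q.d} {m : ℕ} (h : m ≤ D.numDense i m) : m ≤ D.hIndex :=
  (le_csSup (D.bddAbove_hIndexAt i) h).trans
    (Finset.le_sup (f := fun i => D.hIndexAt i) (Finset.mem_univ i))

/-- At each attribute only the component of the changed tuple can change its degree, so at most one
value becomes dense. -/
theorem numDense_le_succ {t : Fin Q.d → ℕ} (h : ∀ t' ≠ t, t' ∈ D'.center ↔ t' ∈ D.center)
    (i : Fin Q.d) (m : ℕ) : D'.numDense i m ≤ D.numDense i m + 1 := by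
  refine le_trans (Finset.card_le_card ?_) (Finset.card_insert_le (t i) _)
  intro v hv
  rw [Finset.mem_insert]
  refine or_iff_not_imp_left.2 fun hne => ?_
  have hfil : (D'.center.filter fun t' => t' i = v) = D.center.filter fun t' => t' i = v := by
    ext t'
    simp only [Finset.mem_filter]
    refine and_congr_left fun hv => h t' ?_
    rintro rfl
    exact hne hv.symm
  rw [Finset.mem_filter, Finset.mem_image] at hv ⊢
  obtain ⟨⟨t', h1, h2⟩, h3⟩ := hv
  have h4 : t' ∈ D.center.filter fun t' => t' i = v := hfil ▸ Finset.mem_filter.2 ⟨h1, h2⟩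
  refine ⟨⟨t', (Finset.mem_filter.1 h4).1, h2⟩, ?_⟩
  unfold Database.degree at h3 ⊢
  rwa [← hfil]

theorem num_le_succ {t : Fin Q.d → ℕ} (h : ∀ t' ≠ t, t' ∈ D'.center ↔ t' ∈ D.center) (s : ℕ) :
    num D' s ≤ num D s + 1 :=
  Finset.sup_le fun i _ => (numDense_le_succ h i _).trans (Nat.add_le_add_right
    (Finset.le_sup (f := fun i => D.numDense i (theta s)) (Finset.mem_univ i)) _)

theorem theta_ge (s : ℕ) : 8 ≤ theta s := by
  unfold theta
  rw [pow_add]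
  have := Nat.one_le_two_pow (n := s)
  omega

/-- An appropriate scale is bounded by the H-index. -/
theorem Balanced.theta_le (h : Balanced D s) : theta s ≤ 8 * max 1 D.hIndex := by
  rcases h.2 with rfl | h2
  · have : theta 0 = 8 := rfl
    omega
  · by_cases hs : s = 0
    · subst hs
      have : theta 0 = 8 := rfl
      omega
    obtain ⟨r, rfl⟩ : ∃ r, s = r + 1 := ⟨s - 1, by omega⟩
    simp only [Nat.add_sub_cancel] at h2
    have e1 : theta (r + 1) = 4 * (4 * 2 ^ r) := by unfold theta; ring
    have e2 : theta r = 2 * (4 * 2 ^ r) := by unfold theta; ring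
    have hpos : 0 < num D r := by
      have := theta_pos (r + 1)
      omega
    obtain ⟨i, -, hi⟩ := Finset.exists_mem_eq_sup (Finset.univ : Finset (Fin Q.d)) (by
      by_contra hne
      rw [Finset.not_nonempty_iff_eq_empty] at hne
      simp [num, hne] at hpos) (fun i => D.numDense i (theta r))
    -- Balance gives at least θ/4 = `4 * 2 ^ r` values of degree at least (θ/2)^(d-1), hence of
    -- degree at least (θ/4)^(d-1); so θ/4 is a candidate for the H-index. The factor 8 in the
    -- conclusion is due to scale `0`.
    have h3 : 4 * 2 ^ r ≤ D.hIndex := by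
      refine le_hIndex (i := i) (le_trans ?_ (numDense_anti D i (show 4 * 2 ^ r ≤ theta r by omega)))
      rw [← hi]
      change 4 * 2 ^ r ≤ num D r
      omega
    omega

theorem Balanced.tau_le (h : Balanced D s) :
    tau Q.d s ≤ 8 ^ (Q.d - 1) * max 1 D.hIndex ^ (Q.d - 1) := by
  rw [tau_eq, ← mul_pow]
  exact Nat.pow_le_pow_left h.theta_le _

theorem Balanced.theta_le_card (h : Balanced D s) : theta s ≤ 8 * (D.center.card + 1) := by
  rcases h.2 with rfl | h2
  · have : theta 0 = 8 := rfl
    omega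
  · have := num_le_card D (s - 1)
    omega

theorem Balanced.nextScale_eq (h : Balanced D s) : nextScale D s = s := by
  unfold nextScale
  rw [if_pos h.1, if_neg]
  rintro ⟨h1, h2⟩
  have := h.2
  omega

section step

variable (h : Balanced D s) (h1 : ∀ r, num D' r ≤ num D r + 1) (h2 : ∀ r, num D r ≤ num D' r + 1)

include h1 h2 h

/-- One step of the scale always suffices, because an update violates a bound by at most one. The
ranges overlap: after a step the relevant numbers lie well inside the new range, up to rounding,
which is absorbed by θ ≥ 8. -/
theorem Balanced.next : Balanced D' (nextScale D' s) := by
  have hge := theta_ge s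
  have hle := h1 s
  have hle' := h2 (s - 1)
  obtain ⟨hb1, hb2⟩ := h
  unfold nextScale
  split_ifs with g1 g2
  · obtain ⟨r, rfl⟩ : ∃ r, s = r + 1 := ⟨s - 1, by omega⟩
    simp only [Nat.add_sub_cancel] at *
    have e := theta_succ r
    have hr := theta_ge r
    refine ⟨by omega, or_iff_not_imp_left.2 fun hr0 => ?_⟩
    have := num_anti D' (show r - 1 ≤ r by omega)
    omega
  · refine ⟨g1, ?_⟩
    omega
  · have e := theta_succ s
    have := num_anti D' (show s ≤ s + 1 by omega)
    refine ⟨by omega, Or.inr ?_⟩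
    rw [Nat.add_sub_cancel]
    omega

/-- Without a change of scale the potential rises by at most two thresholds, which gives the term `8
* K₂`. Before a change it is of order θτ and pays for the change, and afterwards it is at most one
threshold. The right side refers to the new scale, whose threshold is bounded by the H-index of the
new database; for a smaller scale this costs the factor `2 ^ (Q.d - 1)` at `K₁`. -/
theorem Balanced.amortized (K₁ K₂ : ℕ) :
    tau Q.d s * K₁ + (if nextScale D' s = s then 0 else theta s * tau Q.d s * K₂) +
      4 * K₂ * potential D' (nextScale D' s) ≤ 4 * K₂ * potential D s +
        (2 ^ (Q.d - 1) * K₁ + 8 * K₂) * tau Q.d (nextScale D' s) := by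
  have hge := theta_ge s
  have hle := h1 s
  have hle' := h2 s
  have hle1 := h1 (s - 1)
  have hle2 := h2 (s - 1)
  obtain ⟨hb1, hb2⟩ := h
  have h2d := Nat.one_le_two_pow (n := Q.d - 1)
  unfold nextScale
  split_ifs with g1 g2 g3 g3 g3
  · omega
  · obtain ⟨r, rfl⟩ : ∃ r, s = r + 1 := ⟨s - 1, by omega⟩
    simp only [Nat.add_sub_cancel] at *
    have e := theta_succ r
    have et := tau_succ Q.d r
    have hr := theta_ge r
    -- A smaller scale is chosen only if fewer than θ/4 values reach the lower threshold, where θ =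
    -- `theta (r + 1)`; so one update earlier there were at most θ/4.
    have p1 : theta (r + 1) / 2 - num D r ≥ theta r / 2 := by
      have : theta r = 4 * 2 ^ (r + 1) := by unfold theta; ring
      omega
    have p2 : num D' r - 2 * theta r + (if r = 0 then 0 else theta r / 2 - num D' (r - 1)) ≤ 1 := by
      have := num_anti D' (show r - 1 ≤ r by omega)
      have : theta r = 4 * 2 ^ (r + 1) := by unfold theta; ring
      split_ifs <;> omega
    unfold potential
    rw [if_neg (by omega : ¬ r + 1 = 0), Nat.add_sub_cancel]
    have q1 := Nat.mul_le_mul_left (4 * K₂ * tau Q.d (r + 1)) (p1.trans (Nat.le_add_left _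
      (num D (r + 1) - 2 * theta (r + 1))))
    have q2 := Nat.mul_le_mul_left (4 * K₂ * tau Q.d r) p2
    have q3 : theta (r + 1) * tau Q.d (r + 1) * K₂ = 4 * K₂ * tau Q.d (r + 1) * (theta r / 2) := by
      have : theta r = 2 * (theta r / 2) := by
        have : theta r = 4 * 2 ^ (r + 1) := by unfold theta; ring
        omega
      rw [e]
      generalize theta r / 2 = x at this
      rw [this]
      ring
    have q4 : tau Q.d (r + 1) * K₁ = 2 ^ (Q.d - 1) * K₁ * tau Q.d r := by
      rw [et]
      ring
    rw [q3, q4]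
    simp only [mul_assoc (4 * K₂)] at *
    nlinarith [Nat.zero_le (K₂ * tau Q.d r)]
  · unfold potential
    have p : num D' s - 2 * theta s + (if s = 0 then 0 else theta s / 2 - num D' (s - 1)) ≤
        num D s - 2 * theta s + (if s = 0 then 0 else theta s / 2 - num D (s - 1)) + 2 := by
      split_ifs <;> omega
    have q := Nat.mul_le_mul_left (4 * K₂ * tau Q.d s) p
    have := Nat.mul_le_mul_right (tau Q.d s * K₁) h2d
    simp only [mul_assoc (4 * K₂)] at *
    nlinarith
  · omega
  · omega
  · have e := theta_succ s
    have et := tau_succ Q.d s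
    -- A larger scale is chosen only if more than 4θ values are heavy, so there were at least 4θ
    -- before the update.
    have p1 : 2 * theta s ≤ num D s - 2 * theta s := by omega
    have p2 : num D' (s + 1) - 2 * theta (s + 1) + (theta (s + 1) / 2 - num D' s) ≤ 1 := by
      have := num_anti D' (show s ≤ s + 1 by omega)
      omega
    unfold potential
    rw [if_neg (by omega : s + 1 ≠ 0), Nat.add_sub_cancel]
    have q1 := Nat.mul_le_mul_left (4 * K₂ * tau Q.d s) (p1.trans (Nat.le_add_right _
      (if s = 0 then 0 else theta s / 2 - num D (s - 1))))
    have q2 := Nat.mul_le_mul_left (4 * K₂ * tau Q.d (s + 1)) p2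
    have q3 : tau Q.d s * K₁ ≤ 2 ^ (Q.d - 1) * K₁ * tau Q.d (s + 1) := by
      rw [et]
      have := Nat.mul_le_mul h2d (Nat.mul_le_mul_right (tau Q.d s * K₁) h2d)
      nlinarith
    simp only [mul_assoc (4 * K₂)] at *
    nlinarith [Nat.zero_le (theta s * tau Q.d s * K₂), Nat.zero_le (K₂ * tau Q.d (s + 1))]

end step

end StarMaintenance

/-! ### The logical content that belongs to a database. -/

namespace StarMaintenance

open WordRAM Classical StarQuery

variable {Q : StarQuery} {D D' : Q.Database} {s B : ℕ}

/-- The number that codes a tuple. -/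
def codeOf (B : ℕ) {d : ℕ} (t : Fin d → ℕ) : ℕ :=
  pack B (fun i => if h : i < d then t ⟨i, h⟩ else 0) d

/-- The components of a tuple are small enough to be digits, with room for `0`. -/
def Digits (B : ℕ) {d : ℕ} (t : Fin d → ℕ) : Prop := ∀ i, t i + 1 < B

/-- The values in the database are small. -/
structure Small (B : ℕ) (D : Q.Database) : Prop where
  center : ∀ t ∈ D.center, Digits B t
  satellite : ∀ i, ∀ v ∈ D.satellite i, v + 1 < B

section codes

variable {d : ℕ} {t t' : Fin d → ℕ}

theorem digit_lt (h : Digits B t) {i : ℕ} (hi : i < d) :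
    (if h : i < d then t ⟨i, h⟩ else 0) < B := by
  have := h ⟨i, hi⟩
  rw [dif_pos hi]
  omega

theorem dig_codeOf (h : Digits B t) {i : ℕ} (hi : i < d) : dig B i (codeOf B t) = t ⟨i, hi⟩ := by
  have := h ⟨i, hi⟩
  rw [codeOf, dig_pack (by omega) (fun j hj => digit_lt h hj) hi, dif_pos hi]

theorem codeOf_inj (h : Digits B t) (h' : Digits B t') (he : codeOf B t = codeOf B t') :
    t = t' := by
  funext i
  rw [← dig_codeOf h i.isLt, ← dig_codeOf h' i.isLt, he]

theorem ok_codeOf {t : Fin Q.d → ℕ} (h : Digits B t) : Sem.Ok Q B (codeOf B t) := by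
  refine ⟨pack_lt fun i hi => digit_lt h hi, fun i hi => ?_⟩
  rw [dig_codeOf h hi]
  exact h _

end codes

/-- The logical content of the data structure for the database `D` with the scale `s`. -/
noncomputable def semOf (B s : ℕ) (D : Q.Database) : Sem Q where
  B := B
  cen i := if i < Q.d then D.center.image (codeOf B) else ∅
  sat i := if h : i < Q.k then D.satellite ⟨i, h⟩ else ∅
  thr := tau Q.d s
  reg := D.center.image (codeOf B)

theorem full_semOf : (semOf B s D).Full := fun _ hi => if_pos hi

theorem deg_semOf (hD : Small B D) {i : ℕ} (hi : i < Q.d) (v : ℕ) :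
    (semOf B s D).deg i v = D.degree ⟨i, hi⟩ v := by
  unfold Sem.deg Database.degree
  rw [← Finset.card_image_of_injOn (s := D.center.filter _) (f := codeOf B)]
  · congr 1
    simp only [semOf, if_pos hi, Finset.filter_image]
    refine congrArg _ (Finset.filter_congr fun t ht => ?_)
    rw [dig_codeOf (hD.center t ht) hi]
  · intro t ht t' ht' he
    exact codeOf_inj (hD.center t (Finset.mem_filter.1 ht).1)
      (hD.center t' (Finset.mem_filter.1 ht').1) he

theorem card_lev_semOf (hD : Small B D) {i : ℕ} (hi : i < Q.d) (m : ℕ) :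
    ((semOf B s D).lev i (m ^ (Q.d - 1))).card = D.numDense ⟨i, hi⟩ m := by
  unfold Sem.lev Database.numDense
  simp only [deg_semOf hD hi]
  congr 2
  ext v
  simp only [semOf, if_pos hi, Finset.mem_image, exists_exists_and_eq_and]
  refine exists_congr fun t => and_congr_right fun ht => ?_
  rw [dig_codeOf (hD.center t ht) hi]

theorem card_lev_semOf_le (hD : Small B D) {n r : ℕ} : num D r ≤ n ↔
    ∀ i < Q.d, ((semOf B s D).lev i (tau Q.d r)).card ≤ n := by
  rw [num, Finset.sup_le_iff]
  constructor
  · intro h i hi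
    rw [tau_eq, card_lev_semOf hD hi]
    exact h ⟨i, hi⟩ (Finset.mem_univ _)
  · intro h i _
    rw [← card_lev_semOf (s := s) hD i.isLt, ← tau_eq]
    exact h i i.isLt

theorem nextScale_semOf (hD : Small B D) {r : ℕ} :
    (semOf B r D).nextScale s = nextScale D s := by
  have h1 : (semOf B r D).FewHeavy s ↔ num D s ≤ 4 * theta s := (card_lev_semOf_le hD).symm
  have h2 : (semOf B r D).FewDense s ↔ 4 * num D (s - 1) < theta s := by
    have hθ := theta_pos s
    -- The strict bound is put into the form to which `card_lev_semOf_le` applies; this passes from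
    -- the maximum over the attributes to each of them.
    have : 4 * num D (s - 1) < theta s ↔ num D (s - 1) ≤ (theta s - 1) / 4 := by omega
    rw [this, card_lev_semOf_le (s := r) hD]
    exact forall₂_congr fun i _ => by omega
  unfold Sem.nextScale nextScale
  simp only [h1, h2]

theorem image_toggled {S : Finset (Fin Q.d → ℕ)} (hS : ∀ t ∈ S, Digits B t) {t : Fin Q.d → ℕ}
    (ht : Digits B t) (f : Bool) :
    (if f then insert t S else S.erase t).image (codeOf B) =
      Sem.toggled (S.image (codeOf B)) (codeOf B t) f.toNat := by
  cases f
  · simp only [Bool.false_eq_true, if_false, Sem.toggled, Bool.toNat_false, if_true]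
    ext y
    simp only [Finset.mem_image, Finset.mem_erase]
    constructor
    · rintro ⟨t', ⟨h1, h2⟩, rfl⟩
      exact ⟨fun h => h1 (codeOf_inj (hS _ h2) ht h), t', h2, rfl⟩
    · rintro ⟨h1, t', h2, rfl⟩
      exact ⟨t', ⟨fun h => h1 (h ▸ rfl), h2⟩, rfl⟩
  · simp [Sem.toggled, Finset.image_insert]

theorem semOf_apply_center (hD : Small B D) {t : Fin Q.d → ℕ} (ht : Digits B t) (f : Bool) :
    semOf B s (D.apply (.center f t)) =
      (semOf B s D).setCen (Sem.toggled (semOf B s D).reg (codeOf B t) f.toNat) := by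
  have h := image_toggled hD.center ht f
  have e1 : (D.apply (.center f t)).center = if f then insert t D.center else D.center.erase t := by
    cases f <;> rfl
  have e2 : (D.apply (.center f t)).satellite = D.satellite := by cases f <;> rfl
  simp only [semOf, Sem.setCen, Sem.withCens, Sem.withReg, e1, e2, h, Sem.mk.injEq, true_and,
    and_true]
  funext i
  split_ifs <;> rfl

theorem semOf_apply_satellite (i : Fin Q.k) (v : ℕ) (f : Bool) :
    semOf B s (D.apply (.satellite f i v)) = (semOf B s D).withSat i
      (Sem.toggled ((semOf B s D).sat i) v f.toNat) := by
  have e1 : (D.apply (.satellite f i v)).center = D.center := by cases f <;> rfl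
  have e2 : (D.apply (.satellite f i v)).satellite =
      Function.update D.satellite i (Sem.toggled (D.satellite i) v f.toNat) := by
    cases f <;> simp [Database.apply, Sem.toggled]
  simp only [semOf, Sem.withSat, e1, e2, Sem.mk.injEq, true_and, and_true]
  funext j
  by_cases hj : j = i
  · subst hj
    simp
  · rw [Function.update_of_ne hj]
    split_ifs with h
    · rw [Function.update_of_ne]
      rintro rfl
      exact hj rfl
    · rfl

theorem wf_semOf {c : Cfg Q.d} (hD : Small c.B D) (hs : theta s ≤ c.B) (hB : 1 ≤ c.B) :
    (semOf c.B s D).Wf c := by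
  have hreg : ∀ y ∈ D.center.image (codeOf c.B), Sem.Ok Q c.B y := by
    intro y hy
    obtain ⟨t, ht, rfl⟩ := Finset.mem_image.1 hy
    exact ok_codeOf (hD.center t ht)
  refine ⟨rfl, hreg, fun i hi => ?_, fun i hi v hv => ?_, ?_⟩
  · simpa only [semOf, if_pos hi] using hreg
  · simp only [semOf, dif_pos hi] at hv
    exact hD.satellite _ v hv
  · change tau Q.d s ≤ c.B ^ Q.d
    rw [tau_eq]
    exact (Nat.pow_le_pow_left hs _).trans (Nat.pow_le_pow_right hB (Nat.sub_le _ _))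

theorem within_semOf {E : Env Q} (hU : D.center.image (codeOf B) ⊆ E.U) (hn : D.size ≤ E.n) :
    (semOf B s D).Within E := by
  refine ⟨hU, fun i hi => by simpa only [semOf, if_pos hi] using hU, ?_⟩
  rw [← Fin.sum_univ_eq_sum_range (fun i => ((semOf B s D).sat i).card)]
  refine le_trans (le_of_eq (Finset.sum_congr rfl fun i _ => ?_))
    ((Nat.le_add_left (∑ i, (D.satellite i).card) _).trans hn)
  simp [semOf]

end StarMaintenance

/-! ### The machine state between two requests. -/

namespace StarMaintenance

open WordRAM Classical StarQuery

variable {Q : StarQuery} {D D' : Q.Database} {s : ℕ} {c : Cfg Q.d}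

/-- The same parameters with another limit for the space. -/
def Cfg.withS {d : ℕ} (c : Cfg d) (S : ℕ) : Cfg d := { c with S := S }

/-- The limit for the space for a database with `n` tuples. -/
def limit (Q : StarQuery) (n : ℕ) : ℕ := room Q (n + 1) + 5 * (Q.k + 6)

/-- Between two requests, the machine stores the database `D` with the scale `s`. -/
def Stores (c : Cfg Q.d) (D : Q.Database) (s : ℕ) (st : State) : Prop :=
  ∃ (ρ : Var Q.d → ℕ) (l : Key → List ℕ), Rel c.w st ρ ∧ ρ (.loc 0) = s ∧ Sane c l ∧
    (∀ x, st.mem x = c.cell l (fun _ => 0) x) ∧ ∀ key z, z ∈ l key ↔ (semOf c.B s D).spec key z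

/-- Zeroed memory represents empty lists, and the zeroed register for the scale represents scale
`0`; there is no initialization to be paid for. -/
theorem stores_zero (c : Cfg Q.d) : Stores c (Database.empty Q) 0 State.zero := by
  refine ⟨fun _ => 0, fun _ => [], fun v => ⟨rfl, by positivity⟩, rfl, fun _ => by simp,
    fun x => ?_, fun key z => ?_⟩
  · simp [State.zero, Cfg.cell, pos]
  · have h1 : ∀ i, (semOf c.B 0 (Database.empty Q)).cen i = ∅ := by
      intro i
      simp [semOf, Database.empty]
    have h2 : (semOf c.B 0 (Database.empty Q)).reg = ∅ := by simp [semOf, Database.empty]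
    have h3 : ∀ i, (semOf c.B 0 (Database.empty Q)).sat i = ∅ := by
      intro i
      simp [semOf, Database.empty]
    have h4 : ∀ i v, (semOf c.B 0 (Database.empty Q)).deg i v = 0 := by
      intro i v
      simp [Sem.deg, h1]
    obtain ⟨g, i, u⟩ := key
    match g with
    | 0 | 1 | 2 | 3 | 4 | 5 | 6 | 7 | n + 8 =>
      simp only [Sem.spec, h1, h2, h3, h4]
      grind

theorem Rel.input {d w : ℕ} {st : State} {ρ : Var d → ℕ} (h : Rel w st ρ) {l : List ℕ}
    (hl : l.length ≤ d + 2) (hlt : ∀ x ∈ l, x < 2 ^ w) :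
    ∃ ρ' : Var d → ℕ, Rel w (st.input w l) ρ' ∧ (∀ n, ρ' (.loc n) = ρ (.loc n)) ∧
      ∀ (i : Fin (d + 2)) x, l[i.val]? = some x → ρ' (.inp i) = x := by
  refine ⟨fun v => (st.input w l).reg v.idx, fun v => ⟨rfl, ?_⟩, fun n => ?_, fun i x hx => ?_⟩
  · simp only [State.input]
    split_ifs
    · exact Nat.mod_lt _ (by positivity)
    · rw [(h v).1]
      exact (h v).2
  · simp only [State.input, Var.idx]
    rw [dif_neg (by omega)]
    exact (h (.loc n)).1
  · obtain ⟨hi, rfl⟩ := List.getElem?_eq_some_iff.1 hx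
    simp only [State.input, Var.idx, dif_pos hi]
    exact Nat.mod_eq_of_lt (hlt _ (List.getElem_mem hi))

/-- A request that is processed within the environment `E`. -/
theorem Stores.run (h : Stores c D s st) {l : List ℕ} (hl : l.length ≤ Q.d + 2)
    (hlt : ∀ x ∈ l, x < 2 ^ c.w) {E : Env Q} {S : ℕ} (hE : E.c = c.withS S)
    (hwf : (semOf c.B s D).Wf c) (hw : (semOf c.B s D).Within E) :
    ∃ a : AS Q.d, Good E.c a st.mem ∧ Rel c.w (st.input c.w l) a.ρ ∧ a.ρ (.loc 0) = s ∧
      Stage E (semOf c.B s D) (a.set (.loc 1) (tau Q.d s)) ∧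
      ∀ (i : Fin (Q.d + 2)) x, l[i.val]? = some x → a.ρ (.inp i) = x := by
  obtain ⟨ρ, l', h1, h2, h3, h4, h5⟩ := h
  obtain ⟨ρ', k1, k2, k3⟩ := h1.input hl hlt
  have hwfE : (semOf c.B s D).Wf E.c := by
    rw [hE]
    exact ⟨hwf.B, hwf.reg, hwf.cen, hwf.sat, hwf.thr⟩
  obtain ⟨g1, g2⟩ := Stage.finish (b := AS.set ⟨ρ', l', fun _ => 0, 0⟩ (.loc 1) (tau Q.d s)) hwfE hw
    h5 (by simp [AS.set, semOf]) (fun _ => rfl)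
  -- The exact number of cells in use serves as a first bound and is then replaced by the one that
  -- the content implies.
  have hgood : Good E.c ⟨ρ', l', fun _ => 0, st.mem.support.card⟩ st.mem := by
    rw [hE]
    exact ⟨h4, h3, fun _ => by positivity, le_rfl⟩
  exact ⟨⟨ρ', l', fun _ => 0, room Q E.n⟩, hgood.holds g1, k1,
    (k2 0).trans h2, g2, k3⟩

theorem Stage.stores {E : Env Q} {S : ℕ} (hE : E.c = c.withS S) {a : AS Q.d}
    {st : State} (h : Stage E (semOf c.B s D) a) (hs : a.ρ (.loc 0) = s) (hg : Good E.c a st.mem)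
    (hr : Rel c.w st a.ρ) : Stores c D s st := by
  rw [hE] at hg
  refine ⟨a.ρ, a.l, hr, hs, hg.sane, fun x => ?_, h.st.mem⟩
  rw [hg.mem, funext h.st.it]
  rfl

theorem Small.apply {B : ℕ} (h : Small B D) {u : Q.Update}
    (hu : ∀ v ∈ (Request.update u).values, v + 1 < B) : Small B (D.apply u) := by
  match u with
  | .center true t =>
    refine ⟨fun t' ht' => ?_, h.satellite⟩
    rcases Finset.mem_insert.1 ht' with rfl | ht'
    · exact fun i => hu _ (List.mem_ofFn.2 ⟨i, rfl⟩)
    · exact h.center t' ht'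
  | .center false t => exact ⟨fun t' ht' => h.center t' (Finset.mem_of_mem_erase ht'), h.satellite⟩
  | .satellite f i v =>
    refine ⟨by cases f <;> exact h.center, fun j x hx => ?_⟩
    have hx : x ∈ Function.update D.satellite i
        (if f then insert v (D.satellite i) else (D.satellite i).erase v) j := by
      cases f <;> exact hx
    by_cases hj : j = i
    · subst hj
      rw [Function.update_self] at hx
      by_cases hxv : x = v
      · rw [hxv]
        exact hu v (by simp [Request.values])
      · refine h.satellite j x ?_
        split_ifs at hx <;> simp_all
    · rw [Function.update_of_ne hj] at hx
      exact h.satellite j x hx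

/-- The space is measured against the database after the request, whereas the memory still
represents the one before it; a deletion can make the latter larger by one. -/
theorem size_le_apply (D : Q.Database) (u : Q.Update) :
    D.size ≤ (D.apply u).size + 1 ∧ (D.apply u).center.card ≤ (D.apply u).size := by
  refine ⟨?_, Nat.le_add_right _ _⟩
  have hsat : ∀ i (S : Finset ℕ), (D.satellite i).card ≤ S.card + 1 →
      ∑ j, (D.satellite j).card ≤ (∑ j, (Function.update D.satellite i S j).card) + 1 := by
    intro i S hS
    rw [← Finset.add_sum_erase _ _ (Finset.mem_univ i),
      ← Finset.add_sum_erase _ (fun j => (Function.update D.satellite i S j).card)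
        (Finset.mem_univ i), Function.update_self]
    have : ∑ j ∈ Finset.univ.erase i, (Function.update D.satellite i S j).card =
        ∑ j ∈ Finset.univ.erase i, (D.satellite j).card :=
      Finset.sum_congr rfl fun j hj => by rw [Function.update_of_ne (Finset.ne_of_mem_erase hj)]
    omega
  unfold Database.size
  match u with
  | .center true t =>
    have := Finset.card_le_card (Finset.subset_insert t D.center)
    simp only [Database.apply]
    omega
  | .center false t =>
    have := Finset.pred_card_le_card_erase (s := D.center) (a := t)
    simp only [Database.apply]
    omega
  | .satellite true i v =>
    have := hsat i (insert v (D.satellite i))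
      ((Finset.card_le_card (Finset.subset_insert _ _)).trans (Nat.le_succ _))
    simp only [Database.apply]
    omega
  | .satellite false i v =>
    have := hsat i ((D.satellite i).erase v) (by
      have := Finset.pred_card_le_card_erase (s := D.satellite i) (a := v)
      omega)
    simp only [Database.apply]
    omega

end StarMaintenance

/-! ### The effect of an update on machine and scale. -/

namespace StarMaintenance

open WordRAM Classical StarQuery

variable {Q : StarQuery} {D D' : Q.Database} {s : ℕ} {c : Cfg Q.d} {st : State}

/-- The conclusion about the time of an update. -/
def UpdateTime (D' : Q.Database) (s T : ℕ) : Prop :=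
  T ≤ tau Q.d s * updateCost Q + if nextScale D' s = s then 0 else
    theta s * tau Q.d s * (6 * 2 ^ (Q.d - 1) * sweepsCost Q)

theorem encode_length (hd : 1 ≤ Q.d) (u : Q.Update) :
    (Request.update u).encode.length ≤ Q.d + 2 := by
  match u with
  | .center f t => simp [Request.encode]
  | .satellite f i v =>
    simp only [Request.encode, List.length_cons, List.length_nil]
    omega

theorem encode_lt (u : Q.Update) (hu : ∀ v ∈ (Request.update u).values, v + 1 < c.B) :
    ∀ x ∈ (Request.update u).encode, x < 2 ^ c.w := by
  have hB : c.B ≤ 2 ^ c.w := (c.lt_word (k := 1) (by simp) (by omega)).le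
  have hb : ∀ f : Bool, f.toNat < 2 ^ c.w := fun f =>
    c.small_lt_word (by have := f.toNat_le; omega)
  intro x hx
  match u with
  | .center f t =>
    simp only [Request.encode, List.mem_cons] at hx
    rcases hx with rfl | rfl | hx
    · exact hb f
    · positivity
    · have := hu x hx
      omega
  | .satellite f i v =>
    simp only [Request.encode, List.mem_cons, List.not_mem_nil, or_false] at hx
    rcases hx with rfl | rfl | rfl
    · exact hb f
    · exact c.small_lt_word (by have := i.isLt; have := Q.k_le; omega)
    · have := hu x (by simp [Request.values])
      omega

/-- The environment of an update. -/
noncomputable def updateEnv (c : Cfg Q.d) (D' : Q.Database) (U : Finset (Fin Q.d → ℕ))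
    (hU : ∀ t ∈ U, Digits c.B t) (hcard : U.card ≤ D'.size + 1) : Env Q where
  c := c.withS (limit Q D'.size)
  U := U.image (codeOf c.B)
  n := D'.size + 1
  card := Finset.card_image_le.trans hcard
  ok y hy := by
    obtain ⟨t, ht, rfl⟩ := Finset.mem_image.1 hy
    exact ok_codeOf (hU t ht)
  slack := le_rfl

theorem Stores.update (hd : 1 ≤ Q.d) (h : Stores c D s st) (hbal : Balanced D s)
    (hD : Small c.B D) {u : Q.Update} (hu : ∀ v ∈ (Request.update u).values, v + 1 < c.B)
    (hsB : 4 * theta s ≤ c.B) :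
    ∃ tr st', Exec c.w (onUpdate Q) (st.input c.w (Request.update u).encode) tr st' ∧
      Stores c (D.apply u) (nextScale (D.apply u) s) st' ∧ Balanced (D.apply u)
        (nextScale (D.apply u) s) ∧ UpdateTime (D.apply u) s tr.length ∧
      Quiet (limit Q (D.apply u).size) tr ∧ ((∀ r, num (D.apply u) r ≤ num D r + 1) ∧
        ∀ r, num D r ≤ num (D.apply u) r + 1) := by
  have hD' := hD.apply hu
  obtain ⟨hsz, hcs⟩ := size_le_apply D u
  have hwf := wf_semOf hD (s := s) (by omega) c.B_pos
  have hlen := encode_length hd u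
  have hlt := encode_lt u hu
  match u with
  | .center f t =>
    have ht : Digits c.B t := fun i => hu _ (List.mem_ofFn.2 ⟨i, rfl⟩)
    have hc' : (D.apply (.center f t)).center =
        if f then insert t D.center else D.center.erase t := by cases f <;> rfl
    have hne : ∀ t' ≠ t, t' ∈ (D.apply (.center f t)).center ↔ t' ∈ D.center := by
      intro t' ht'
      rw [hc']
      split_ifs <;> simp [ht']
    have hn1 := fun r => num_le_succ hne r
    have hn2 := fun r => num_le_succ (fun t' ht' => (hne t' ht').symm) r
    set D' := D.apply (.center f t) with hDef
    -- The environment has to contain the tuples before and after the update; in the case of a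
    -- deletion the tuple itself is missing from the new center.
    have hUsub : D.center ⊆ insert t D'.center := by
      intro t' ht'
      by_cases h : t' = t
      · exact h ▸ Finset.mem_insert_self _ _
      · exact Finset.mem_insert_of_mem ((hne t' h).2 ht')
    have hU : ∀ t' ∈ insert t D'.center, Digits c.B t' := by
      intro t' ht'
      rcases Finset.mem_insert.1 ht' with rfl | h
      exacts [ht, hD'.center t' h]
    let E := updateEnv c D' (insert t D'.center) hU
      ((Finset.card_insert_le _ _).trans (Nat.add_le_add_right hcs 1))
    obtain ⟨a, a1, a2, a3, a4, a5⟩ := h.run hlen hlt (E := E) rfl hwf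
      (within_semOf (Finset.image_subset_image hUsub) hsz)
    have hfull' : (semOf c.B s D').Full := full_semOf
    have hin : CenInput E a (codeOf c.B t) f.toNat := by
      refine ⟨a5 0 _ (by simp [Request.encode]), by cases f <;> simp,
        Finset.mem_image_of_mem _ (Finset.mem_insert_self _ _), fun i hi => ?_⟩
      refine (a5 ⟨i + 2, hi⟩ (t ⟨i, by omega⟩) ?_).trans (dig_codeOf ht (by omega)).symm
      simp [Request.encode, show i < Q.d by omega]
    have hrun := run_onUpdate_cen hd a4 full_semOf a3 rfl hsB hin
      (a5 1 0 (by simp [Request.encode])) (semOf_apply_center hD ht f) hfull'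
      ((card_lev_semOf_le hD').1 ((hn1 s).trans (by have := hbal.1; omega)))
    obtain ⟨tr, st', ρ', e1, e2, ⟨l', it', n', e3, e4, e5⟩, e6, e7⟩ := hrun _ a1 _ a2 rfl
    rw [← hDef, nextScale_semOf hD'] at e4 e5 e6
    exact ⟨tr, st', e1, Stage.stores (E := E) rfl e4 e5 e3 e2, hbal.next hn1 hn2, e6, e7, hn1, hn2⟩
  | .satellite f i v =>
    have hc' : (D.apply (.satellite f i v)).center = D.center := by cases f <;> rfl
    have hnum := fun r => num_congr hc' r
    have hn1 := fun r => (hnum r).le.trans (Nat.le_succ _)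
    have hn2 := fun r => (hnum r).ge.trans (Nat.le_succ _)
    -- Degrees involve only the center, so a satellite update never changes the scale.
    have hbal' : Balanced (D.apply (.satellite f i v)) s := by
      unfold Balanced
      rw [hnum, hnum]
      exact hbal
    have hnext := hbal'.nextScale_eq
    have hv : v + 1 < c.B := hu v (by simp [Request.values])
    set D' := D.apply (.satellite f i v) with hDef
    let E := updateEnv c D' D'.center hD'.center (hcs.trans (Nat.le_succ _))
    obtain ⟨a, a1, a2, a3, a4, a5⟩ := h.run hlen hlt (E := E) rfl hwf
      (within_semOf (Finset.image_subset_image hc'.ge) hsz)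
    have h2 : ((2 : Fin (Q.d + 2)) : ℕ) = 2 := by
      rw [Fin.coe_ofNat_eq_mod]
      exact Nat.mod_eq_of_lt (by omega)
    have hin : SatInput E a i v f.toNat := by
      refine ⟨i.isLt, hv, a5 0 _ (by simp [Request.encode]), by cases f <;> simp, a5 2 _ ?_⟩
      rw [h2]
      simp [Request.encode]
    have hw : ((semOf c.B s D).withSat i (Sem.toggled ((semOf c.B s D).sat i) v f.toNat)).Within
        E := by
      rw [← semOf_apply_satellite]
      exact within_semOf (Finset.Subset.refl _) (Nat.le_succ _)
    have hrun := run_onUpdate_sat a4 full_semOf a3 rfl (le_trans (by omega) hsB) hin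
      (a5 1 _ (by simp [Request.encode])) hw ((card_lev_semOf_le hD).1 hbal.1)
    obtain ⟨tr, st', ρ', e1, e2, ⟨l', it', n', e3, e4, e5⟩, e6, e7⟩ := hrun _ a1 _ a2 rfl
    rw [← semOf_apply_satellite, ← hDef] at e4
    rw [hnext]
    refine ⟨tr, st', e1, Stage.stores (E := E) rfl e4 e5 e3 e2, hbal', ?_, e7, hn1, hn2⟩
    unfold UpdateTime
    omega

end StarMaintenance

/-! ### Enumeration of a union of sets without repetition. -/

namespace StarMaintenance

open WordRAM Classical

section union

/-- The elements output so far by the first `n` stages of the enumeration of a union of the sets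
`A 0, A 1, …`, where the stage number `r` has output the elements `dn r` of `A r`. -/
noncomputable def emitted (A dn : ℕ → List ℕ) : ℕ → Finset ℕ
  | 0 => ∅
  | n + 1 => (emitted A dn n \ (A n).toFinset) ∪ (dn n).toFinset

/-- The union of the first `n` sets. -/
noncomputable def unionUpTo (A : ℕ → List ℕ) : ℕ → Finset ℕ
  | 0 => ∅
  | n + 1 => unionUpTo A n ∪ (A n).toFinset

/-- The invariant of the stage number `r`. -/
structure StageOk (A dn : ℕ → List ℕ) (r : ℕ) : Prop where
  pre : dn r <+: A r
  le : (emitted A dn r ∩ (A r).toFinset).card ≤ (dn r).length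
  eq : (emitted A dn r ∩ (A r).toFinset).card = (dn r).length ∨ emitted A dn r = unionUpTo A r

/-- The element, plus one, that is passed on after a step, if `F` was emitted before it and `F'`
after it, out of the set `U`; `0` means that there is none. -/
structure Passes (U F F' : Finset ℕ) (a : ℕ) : Prop where
  none : a = 0 → F = U ∧ F' = F
  some : ∀ x, a = x + 1 → x ∈ U ∧ x ∉ F ∧ F' = insert x F

/-- The situation in a round of the enumeration after `n` stages. -/
structure InRound (A dn dn' : ℕ → List ℕ) (n a : ℕ) : Prop where
  old : ∀ r, StageOk A dn r
  new : ∀ r < n, StageOk A dn' r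
  rest : ∀ r, n ≤ r → dn' r = dn r
  pass : Passes (unionUpTo A n) (emitted A dn n) (emitted A dn' n) a

variable {A dn dn' : ℕ → List ℕ} {n a x : ℕ}

theorem mem_unionUpTo : x ∈ unionUpTo A n ↔ ∃ r < n, x ∈ A r := by
  induction n with
  | zero => simp [unionUpTo]
  | succ n ih =>
    rw [unionUpTo, Finset.mem_union, ih, List.mem_toFinset]
    constructor
    · rintro (⟨r, h1, h2⟩ | h)
      exacts [⟨r, by omega, h2⟩, ⟨n, by omega, h⟩]
    · rintro ⟨r, h1, h2⟩
      rcases Nat.lt_succ_iff_lt_or_eq.1 h1 with h | rfl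
      exacts [Or.inl ⟨r, h, h2⟩, Or.inr h2]

theorem emitted_congr (h : ∀ r < n, dn' r = dn r) : emitted A dn' n = emitted A dn n := by
  induction n with
  | zero => rfl
  | succ n ih => rw [emitted, emitted, ih fun r hr => h r (by omega), h n (by omega)]

theorem emitted_nil : emitted A (fun _ => []) n = ∅ := by
  induction n with
  | zero => rfl
  | succ n ih => simp [emitted, ih]

theorem stageOk_nil (r : ℕ) : StageOk A (fun _ => []) r := by
  refine ⟨List.nil_prefix, ?_, Or.inl ?_⟩ <;> simp [emitted_nil]

theorem StageOk.congr {r : ℕ} (h : StageOk A dn r) (hd : ∀ r' ≤ r, dn' r' = dn r') :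
    StageOk A dn' r := by
  have h1 := emitted_congr (A := A) (n := r) fun r' hr => hd r' (by omega)
  refine ⟨?_, ?_, ?_⟩
  · rw [hd r le_rfl]
    exact h.pre
  · rw [hd r le_rfl, h1]
    exact h.le
  · rw [hd r le_rfl, h1]
    exact h.eq

theorem InRound.start (h : ∀ r, StageOk A dn r) : InRound A dn dn 0 0 :=
  ⟨h, fun _ hr => absurd hr (Nat.not_lt_zero _), fun _ _ => rfl,
    ⟨fun _ => ⟨rfl, rfl⟩, fun _ hx => by omega⟩⟩

/-- Beyond the actual stages all sets are empty, so the invariant holds there for trivial reasons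
and is available for every stage at the start of the next round. -/
theorem InRound.stageOk (h : InRound A dn dn' n a) (hA : ∀ r, n ≤ r → A r = []) (r : ℕ) :
    StageOk A dn' r := by
  by_cases hr : r < n
  · exact h.new r hr
  · have h1 := (h.old r).pre
    rw [hA r (by omega), List.prefix_nil] at h1
    have h2 := h.rest r (by omega)
    refine ⟨by rw [h2, h1]; exact List.nil_prefix, ?_, Or.inl ?_⟩ <;>
      simp [hA r (by omega), h2, h1]

/-- A stage that lets its input pass. -/
theorem InRound.skip (h : InRound A dn dn' n a) (ha : ∀ x, a = x + 1 → x ∉ A n)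
    (hnil : a = 0 → dn n = A n) : InRound A dn dn' (n + 1) a := by
  have hn := h.rest n le_rfl
  have hpre := (h.old n).pre.subset
  have hlen : (emitted A dn' n ∩ (A n).toFinset).card = (emitted A dn n ∩ (A n).toFinset).card := by
    rcases Nat.eq_zero_or_pos a with h0 | h0
    · rw [(h.pass.none h0).2]
    · obtain ⟨x, rfl⟩ : ∃ x, a = x + 1 := ⟨a - 1, by omega⟩
      rw [(h.pass.some x rfl).2.2, Finset.insert_inter_of_notMem (by simpa using ha x rfl)]
  refine ⟨h.old, fun r hr => ?_, fun r hr => h.rest r (by omega), fun h0 => ?_, fun x hx => ?_⟩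
  · rcases Nat.lt_succ_iff_lt_or_eq.1 hr with hr | rfl
    · exact h.new r hr
    refine ⟨hn ▸ (h.old r).pre, by rw [hlen, hn]; exact (h.old r).le, ?_⟩
    rw [hlen, hn]
    refine (h.old r).eq.imp id fun h1 => ?_
    rcases Nat.eq_zero_or_pos a with h0 | h0
    · rw [(h.pass.none h0).2, h1]
    · obtain ⟨x, rfl⟩ : ∃ x, a = x + 1 := ⟨a - 1, by omega⟩
      exact absurd (h1 ▸ (h.pass.some x rfl).1) (h.pass.some x rfl).2.1
  · obtain ⟨h1, h2⟩ := h.pass.none h0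
    simp only [emitted, unionUpTo, h2, hn, hnil h0, h1, and_true]
    ext z
    simp only [Finset.mem_union, Finset.mem_sdiff]
    tauto
  · obtain ⟨h1, h2, h3⟩ := h.pass.some x hx
    simp only [emitted, unionUpTo, h3, hn, Finset.mem_union, Finset.mem_sdiff, List.mem_toFinset]
    have h4 := ha x hx
    refine ⟨Or.inl h1, fun hh => hh.elim (fun hh => h2 hh.1) (fun hh => h4 (hpre hh)), ?_⟩
    ext z
    simp only [Finset.mem_union, Finset.mem_sdiff, Finset.mem_insert, List.mem_toFinset]
    constructor
    · tauto
    · rintro (rfl | hz)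
      · exact Or.inl ⟨Or.inl rfl, h4⟩
      · tauto

/-- There is an element left if the input is an element of the stage. -/
theorem InRound.eq_zero (h : InRound A dn dn' n a) (hnd : (A n).Nodup) (hA : dn n = A n)
    (ha : ∀ x, a = x + 1 → x ∈ A n) : a = 0 := by
  by_contra h0
  obtain ⟨x, rfl⟩ : ∃ x, a = x + 1 := ⟨a - 1, by omega⟩
  obtain ⟨h1, h2, -⟩ := h.pass.some x rfl
  rcases (h.old n).eq with h3 | h3
  · rw [hA, ← List.toFinset_card_of_nodup hnd] at h3
    have h4 := Finset.eq_of_subset_of_card_le Finset.inter_subset_right h3.ge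
    have h5 : x ∈ emitted A dn n ∩ (A n).toFinset := by
      rw [h4]
      simpa using ha x rfl
    exact h2 (Finset.mem_inter.1 h5).1
  · exact h2 (h3 ▸ h1)

/-- A stage that outputs an element of its own. -/
theorem InRound.take (h : InRound A dn dn' n a) {rem : List ℕ} (hnd : (A n).Nodup)
    (hA : A n = dn n ++ x :: rem) (ha : ∀ z, a = z + 1 → z ∈ A n) :
    InRound A dn (Function.update dn' n (dn n ++ [x])) (n + 1) (x + 1) := by
  have hcon : emitted A (Function.update dn' n (dn n ++ [x])) n = emitted A dn' n :=
    emitted_congr fun r hr => Function.update_of_ne (by omega) _ _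
  have hx : x ∉ dn n := by
    rw [hA, List.nodup_append] at hnd
    exact fun hh => hnd.2.2 x hh x (List.mem_cons_self) rfl
  have hxA : x ∈ A n := by rw [hA]; simp
  -- The input, if any, is an element of this set and is swallowed; what counts of the earlier
  -- output is only the part outside the set.
  have hdiff : emitted A dn' n \ (A n).toFinset = emitted A dn n \ (A n).toFinset := by
    rcases Nat.eq_zero_or_pos a with h0 | h0
    · rw [(h.pass.none h0).2]
    · obtain ⟨z, rfl⟩ : ∃ z, a = z + 1 := ⟨a - 1, by omega⟩
      rw [(h.pass.some z rfl).2.2, Finset.insert_sdiff_of_mem _ (by simpa using ha z rfl)]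
  refine ⟨h.old, fun r hr => ?_, fun r hr => ?_, fun h0 => by omega, fun z hz => ?_⟩
  · rcases Nat.lt_succ_iff_lt_or_eq.1 hr with hr | rfl
    · exact (h.new r hr).congr fun r' hr' => Function.update_of_ne (by omega) _ _
    have hle := (h.old r).le
    refine ⟨?_, ?_, ?_⟩
    · rw [Function.update_self, hA]
      exact ⟨rem, by simp⟩
    all_goals rw [hcon, Function.update_self, List.length_append, List.length_singleton]
    · rcases Nat.eq_zero_or_pos a with h0 | h0
      · rw [(h.pass.none h0).2]
        omega
      · obtain ⟨z, rfl⟩ : ∃ z, a = z + 1 := ⟨a - 1, by omega⟩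
        rw [(h.pass.some z rfl).2.2, Finset.insert_inter_of_mem (by simpa using ha z rfl)]
        exact (Finset.card_insert_le _ _).trans (by omega)
    · rcases Nat.eq_zero_or_pos a with h0 | h0
      · rw [(h.pass.none h0).2]
        exact Or.inr (h.pass.none h0).1
      · obtain ⟨z, rfl⟩ : ∃ z, a = z + 1 := ⟨a - 1, by omega⟩
        obtain ⟨h1, h2, h3⟩ := h.pass.some z rfl
        rw [h3, Finset.insert_inter_of_mem (by simpa using ha z rfl),
          Finset.card_insert_of_notMem (by simp [h2])]
        refine Or.inl (congrArg (· + 1) ((h.old r).eq.resolve_right fun h4 => ?_))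
        exact h2 (h4 ▸ h1)
  · rw [Function.update_of_ne (by omega)]
    exact h.rest r (by omega)
  · obtain rfl : z = x := by omega
    simp only [emitted, unionUpTo, hcon, hdiff, Function.update_self]
    refine ⟨by simp [hxA], by simp [hxA, hx], ?_⟩
    ext y
    simp only [Finset.mem_union, Finset.mem_insert, List.toFinset_append, List.toFinset_cons,
      List.toFinset_nil, Finset.notMem_empty, or_false]
    tauto

end union

/-! ### Traversal of a concatenation of lists. -/

/-- In the concatenation of the lists `Ls`, the list `rem` follows the position `i₂` of the list
number `i₁`. -/
structure Cursor (Ls : List (List ℕ)) (i₁ i₂ : ℕ) (rem : List ℕ) : Prop where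
  eq : rem = (Ls.drop i₁).flatten.drop i₂
  lt : ∀ h : i₁ < Ls.length, i₂ < Ls[i₁].length
  le : i₁ ≤ Ls.length

namespace Cursor

variable {Ls : List (List ℕ)} {i₁ i₂ : ℕ} {rem : List ℕ}

theorem start (h : ∀ L ∈ Ls, L ≠ []) : Cursor Ls 0 0 Ls.flatten :=
  ⟨by simp, fun hlt => List.length_pos_iff.2 (h _ (List.getElem_mem hlt)), Nat.zero_le _⟩

theorem nil (h : Cursor Ls i₁ i₂ rem) (hi : ¬ i₁ < Ls.length) : rem = [] := by
  rw [h.eq, List.drop_eq_nil_of_le (as := Ls) (by omega)]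
  simp

/-- Since no list is empty, the position moves directly to the head of the next list, and an advance
takes constant time. -/
theorem next (h : Cursor Ls i₁ i₂ rem) (hne : ∀ L ∈ Ls, L ≠ []) (hi : i₁ < Ls.length) :
    ∃ rem', rem = Ls[i₁][i₂]'(h.lt hi) :: rem' ∧
      (i₂ + 1 < Ls[i₁].length → Cursor Ls i₁ (i₂ + 1) rem') ∧
      (¬ i₂ + 1 < Ls[i₁].length → Cursor Ls (i₁ + 1) 0 rem') := by
  have h2 := h.lt hi
  have e := h.eq
  rw [List.drop_eq_getElem_cons hi, List.flatten_cons, List.drop_append_of_le_length h2.le,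
    List.drop_eq_getElem_cons h2, List.cons_append] at e
  refine ⟨_, e, fun h3 => ⟨?_, fun _ => h3, h.le⟩, fun h3 => ⟨?_, fun hlt => ?_, hi⟩⟩
  · rw [List.drop_eq_getElem_cons hi, List.flatten_cons, List.drop_append_of_le_length h3.le]
  · rw [List.drop_eq_nil_of_le (as := Ls[i₁]) (by omega), List.nil_append, List.drop_zero]
  · exact List.length_pos_iff.2 (hne _ (List.getElem_mem hlt))

end Cursor

end StarMaintenance

/-! ### The result as a union over the bound parts of patterns. -/

namespace StarMaintenance

open WordRAM Classical

variable {Q : StarQuery} {c : Cfg Q.d} {σ : Sem Q} {l : Key → List ℕ} {x y β : ℕ}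

namespace Sem

/-- The values of bound attributes in the pattern `β` belong to the satellites. -/
def BoundAlive (σ : Sem Q) (β : ℕ) : Prop :=
  ∀ i < Q.e, dig σ.B i β = 0 ∨ (1 ≤ dig σ.B i β ∧ dig σ.B i β - 1 ∈ σ.sat i)

/-- The components of the tuple belong to the satellites. -/
def Alive (σ : Sem Q) (y : ℕ) : Prop := ∀ i < Q.k, dig σ.B i y ∈ σ.sat i

/-- The output part of a tuple. -/
noncomputable def outPart (σ : Sem Q) (y : ℕ) : ℕ := σ.G y / σ.B ^ Q.e

theorem G_mod (h : Ok Q σ.B y) : σ.G y % σ.B ^ Q.e = σ.P y % σ.B ^ Q.e := by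
  rw [G, P, pack_mod (fun i hi => gdig_lt h hi) e_le, pack_mod (fun i hi => pdig_lt h hi) e_le]
  exact pack_congr fun i hi => if_pos hi

theorem G_eq (h : Ok Q σ.B y) : σ.G y = σ.P y % σ.B ^ Q.e + σ.outPart y * σ.B ^ Q.e := by
  rw [← G_mod h, outPart, mul_comm, Nat.mod_add_div]

theorem dig_outPart (h : Ok Q σ.B y) {i : ℕ} (hi : i < Q.j) :
    dig σ.B i (σ.outPart y) = dig σ.B (Q.e + i) y + 1 := by
  have := Q.j_le
  have he : Q.e = Q.d - Q.j := rfl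
  rw [outPart, dig_div, dig_G h (by omega), if_neg (by omega)]

theorem outPart_lt (h : Ok Q σ.B y) : σ.outPart y < σ.B ^ Q.j := by
  have := Q.j_le
  have hB : 0 < σ.B ^ Q.e ∨ Q.e = 0 := by
    by_cases h0 : Q.e = 0
    · exact Or.inr h0
    · have := h.2 0 (by have := e_le (Q := Q); omega)
      exact Or.inl (pow_pos (by omega) _)
  have he : Q.e = Q.d - Q.j := rfl
  refine Nat.div_lt_of_lt_mul ?_
  rw [← pow_add, show Q.e + Q.j = Q.d by omega]
  exact G_lt h

/-- Every component with a satellite is either light, or heavy at an output attribute, or heavy at a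
bound attribute, and is checked in exactly one of the three conditions. -/
theorem alive_iff (h : Ok Q σ.B y) :
    σ.Alive y ↔ σ.LightAlive y ∧ σ.OutAlive (σ.P y) ∧ σ.BoundAlive (σ.P y % σ.B ^ Q.e) := by
  have hk := Q.k_le
  have he : Q.e ≤ Q.k := Q.sub_le
  have hP : ∀ i < Q.k, dig σ.B i (σ.P y) = σ.pdig y i := fun i hi => dig_P h (by omega)
  have hb : ∀ i < Q.e, dig σ.B i (σ.P y % σ.B ^ Q.e) = σ.pdig y i := by
    intro i hi
    have := h.2 i (by omega)
    rw [dig_mod (by omega) hi, hP i (by omega)]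
  unfold Alive LightAlive OutAlive BoundAlive
  constructor
  · intro ha
    have hp : ∀ i < Q.k, σ.pdig y i = 0 ∨ 1 ≤ σ.pdig y i ∧ σ.pdig y i - 1 ∈ σ.sat i := by
      intro i hi
      unfold pdig
      split_ifs
      · exact Or.inr ⟨by omega, ha i hi⟩
      · exact Or.inl rfl
    refine ⟨fun i hi => Or.inr (ha i hi), fun i hi _ => ?_, fun i hi => ?_⟩
    · rw [hP i hi]
      exact hp i hi
    · rw [hb i hi]
      exact hp i (by omega)
  · rintro ⟨h1, h2, h3⟩ i hi
    rcases h1 i hi with hh | hh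
    · have : σ.pdig y i = 0 ∨ 1 ≤ σ.pdig y i ∧ σ.pdig y i - 1 ∈ σ.sat i := by
        by_cases hie : i < Q.e
        · rw [← hb i hie]
          exact h3 i hie
        · rw [← hP i hi]
          exact h2 i hi (by omega)
      unfold pdig at this
      rw [if_pos hh] at this
      simpa using this
    · exact hh

end Sem

/-- The lists `l` store the sets of `σ`. -/
structure Lists (c : Cfg Q.d) (σ : Sem Q) (l : Key → List ℕ) : Prop where
  wf : σ.Wf c
  sane : Sane c l
  mem : ∀ key z, z ∈ l key ↔ σ.spec key z

/-- The lists of bound parts of patterns. -/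
abbrev roots (l : Key → List ℕ) : List ℕ := l (0, 0, 0)

/-- The output parts of the groups of the patterns with the bound part `β`. -/
def walks (σ : Sem Q) (l : Key → List ℕ) (β : ℕ) : List (List ℕ) :=
  (l (7, 0, β)).map fun p => (l (5, 0, p)).map (· / σ.B ^ Q.e)

/-- The output tuples, as numbers, that belong to the bound part number `r`. -/
noncomputable def parts (σ : Sem Q) (l : Key → List ℕ) (r : ℕ) : List ℕ :=
  if r < (roots l).length ∧ σ.BoundAlive ((roots l).getD r 0) then
    (walks σ l ((roots l).getD r 0)).flatten else []

namespace Lists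

theorem ok (h : Lists c σ l) (hy : y ∈ σ.reg) : Sem.Ok Q σ.B y := h.wf.reg y hy

theorem root_lt (h : Lists c σ l) (hβ : β ∈ roots l) : β < c.B ^ Q.e := by
  obtain ⟨-, -, y, -, -, -, rfl⟩ := (h.mem _ _).1 hβ
  rw [h.wf.B]
  exact Nat.mod_lt _ (pow_pos c.B_pos _)

theorem mem_walks (h : Lists c σ l) : x ∈ (walks σ l β).flatten ↔ ∃ y ∈ σ.reg, σ.LightAlive y ∧
    σ.OutAlive (σ.P y) ∧ σ.P y % σ.B ^ Q.e = β ∧ σ.outPart y = x := by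
  simp only [walks, List.mem_flatten, List.mem_map, exists_exists_and_eq_and, h.mem, Sem.spec,
    true_and]
  constructor
  · rintro ⟨p, ⟨h1, h2, -⟩, q, ⟨y, h5, h6, rfl, rfl⟩, rfl⟩
    exact ⟨y, h5, h6, h2, h1, rfl⟩
  · rintro ⟨y, h1, h2, h3, h4, rfl⟩
    exact ⟨σ.P y, ⟨h4, h3, y, h1, h2, rfl⟩, σ.G y, ⟨y, h1, h2, rfl, rfl⟩, rfl⟩

/-- A linked pattern is the pattern of some registered live tuple, whose group is in the list of
that pattern; so the traversal meets no empty list. -/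
theorem walks_ne_nil (h : Lists c σ l) : ∀ L ∈ walks σ l β, L ≠ [] := by
  intro L hL
  obtain ⟨p, hp, rfl⟩ := List.mem_map.1 hL
  obtain ⟨-, -, -, y, h1, h2, rfl⟩ := (h.mem _ _).1 hp
  exact List.ne_nil_of_mem (List.mem_map_of_mem ((h.mem (5, 0, σ.P y) (σ.G y)).2
    ⟨rfl, y, h1, h2, rfl, rfl⟩))

/-- Given the bound part, the output part determines the group, and the group determines the
pattern. So an output part occurs only once under a given bound part, although it may occur under
several of them. -/
theorem nodup_walks (h : Lists c σ l) : (walks σ l β).flatten.Nodup := by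
  have key : ∀ p ∈ l (7, 0, β), ∀ q ∈ l (5, 0, p), ∃ y ∈ σ.reg, σ.P y = p ∧ σ.G y = q ∧
      q = β + q / σ.B ^ Q.e * σ.B ^ Q.e := by
    intro p hp q hq
    obtain ⟨-, h1, -⟩ := (h.mem _ _).1 hp
    obtain ⟨-, y, h2, -, rfl, rfl⟩ := (h.mem _ _).1 hq
    refine ⟨y, h2, rfl, rfl, ?_⟩
    conv_lhs => rw [Sem.G_eq (h.ok h2)]
    rw [h1, Sem.outPart]
  rw [List.nodup_flatten]
  constructor
  · intro L hL
    obtain ⟨p, hp, rfl⟩ := List.mem_map.1 hL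
    refine List.Nodup.map_on (fun q hq q' hq' he => ?_) (h.sane _).1
    obtain ⟨-, -, -, -, h1⟩ := key p hp q hq
    obtain ⟨-, -, -, -, h2⟩ := key p hp q' hq'
    rw [h1, h2, he]
  · rw [walks, List.pairwise_map]
    refine (h.sane (7, 0, β)).1.imp_of_mem fun hp hp' hne => ?_
    intro x hx hx'
    obtain ⟨q, hq, rfl⟩ := List.mem_map.1 hx
    obtain ⟨q', hq', he⟩ := List.mem_map.1 hx'
    obtain ⟨y, h1, h2, h3, h4⟩ := key _ hp q hq
    obtain ⟨y', h1', h2', h3', h4'⟩ := key _ hp' q' hq'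
    refine hne (h2 ▸ h2' ▸ Sem.P_eq_of_G_eq (h.ok h1) (h.ok h1') ?_)
    rw [h3, h3', h4, h4', he]

theorem nodup_parts (h : Lists c σ l) (r : ℕ) : (parts σ l r).Nodup := by
  unfold parts
  split_ifs
  exacts [h.nodup_walks, List.nodup_nil]

theorem mem_parts (h : Lists c σ l) {r : ℕ} (hr : r < (roots l).length) :
    x ∈ parts σ l r ↔ ∃ y ∈ σ.reg, σ.Alive y ∧ σ.P y % σ.B ^ Q.e = (roots l)[r] ∧
      σ.outPart y = x := by
  unfold parts
  rw [List.getD_eq_getElem _ _ hr]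
  split_ifs with hb
  · rw [h.mem_walks]
    refine exists_congr fun y => and_congr_right fun hy => ?_
    rw [Sem.alive_iff (h.ok hy)]
    constructor
    · rintro ⟨h1, h2, h3, h4⟩
      exact ⟨⟨h1, h2, h3 ▸ hb.2⟩, h3, h4⟩
    · rintro ⟨⟨h1, h2, -⟩, h3, h4⟩
      exact ⟨h1, h2, h3, h4⟩
  · simp only [List.not_mem_nil, false_iff, not_exists, not_and]
    intro y hy ha h3
    exact absurd ⟨hr, h3 ▸ ((Sem.alive_iff (h.ok hy)).1 ha).2.2⟩ hb

theorem mem_union (h : Lists c σ l) : x ∈ unionUpTo (parts σ l) (roots l).length ↔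
    ∃ y ∈ σ.reg, σ.Alive y ∧ σ.outPart y = x := by
  rw [mem_unionUpTo]
  constructor
  · rintro ⟨r, hr, hx⟩
    obtain ⟨y, h1, h2, -, h3⟩ := (h.mem_parts hr).1 hx
    exact ⟨y, h1, h2, h3⟩
  · rintro ⟨y, h1, h2, h3⟩
    obtain ⟨h4, h5, -⟩ := (Sem.alive_iff (h.ok h1)).1 h2
    have : σ.P y % σ.B ^ Q.e ∈ roots l := (h.mem _ _).2 ⟨rfl, rfl, y, h1, h4, h5, rfl⟩
    obtain ⟨r, hr, he⟩ := List.getElem_of_mem this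
    exact ⟨r, hr, (h.mem_parts hr).2 ⟨y, h1, h2, he.symm, h3⟩⟩

/-- The list of a group guarantees live light values, and `hb` live bound values. Heavy output
values need no test: `x` already belongs to the union, so a live tuple has the same output values.
Hence nonemptiness of one group decides membership, in constant time. -/
theorem mem_parts_iff (h : Lists c σ l) {r n : ℕ} (hn : n ≤ (roots l).length)
    (hr : r < (roots l).length) (hb : σ.BoundAlive (roots l)[r])
    (hx : x ∈ unionUpTo (parts σ l) n) :
    x ∈ parts σ l r ↔ l (4, 0, (roots l)[r] + x * c.B ^ Q.e) ≠ [] := by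
  have hk := Q.k_le
  have hroot := h.root_lt (List.getElem_mem hr)
  have hBe : 0 < c.B ^ Q.e := pow_pos c.B_pos _
  rw [h.mem_parts hr]
  constructor
  · rintro ⟨y, h1, h2, h3, h4⟩
    refine List.ne_nil_of_mem ((h.mem _ y).2 ⟨rfl, h1, ((Sem.alive_iff (h.ok h1)).1 h2).1, ?_⟩)
    rw [Sem.G_eq (h.ok h1), h3, h4, h.wf.B]
  · intro hne
    obtain ⟨y, hy⟩ := List.exists_mem_of_ne_nil _ hne
    obtain ⟨-, h1, h2, h3⟩ := (h.mem _ _).1 hy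
    have hm : σ.P y % σ.B ^ Q.e = (roots l)[r] := by
      rw [← Sem.G_mod (h.ok h1), h3, h.wf.B, Nat.add_mul_mod_self_right, Nat.mod_eq_of_lt hroot]
    have ho : σ.outPart y = x := by
      rw [Sem.outPart, h3, h.wf.B, Nat.add_mul_div_right _ _ hBe, Nat.div_eq_of_lt hroot, zero_add]
    refine ⟨y, h1, (Sem.alive_iff (h.ok h1)).2 ⟨h2, fun i hi he => ?_, hm ▸ hb⟩, hm, ho⟩
    obtain ⟨r', hr', hx'⟩ := mem_unionUpTo.1 hx
    obtain ⟨y', g1, g2, -, g3⟩ := (h.mem_parts (by omega)).1 hx'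
    have hj : i - Q.e < Q.j := by
      have := Q.j_le
      have : Q.e = Q.d - Q.j := rfl
      omega
    have h5 := Sem.dig_outPart (h.ok h1) hj
    have h6 := Sem.dig_outPart (h.ok g1) hj
    rw [ho, Nat.add_sub_cancel' he] at h5
    rw [g3, Nat.add_sub_cancel' he] at h6
    have h7 : dig σ.B i y = dig σ.B i y' := by omega
    rw [Sem.dig_P (h.ok h1) (by omega), Sem.pdig]
    split_ifs
    · refine Or.inr ⟨by omega, ?_⟩
      rw [Nat.add_sub_cancel, h7]
      exact g2 i hi
    · exact Or.inl rfl

end Lists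

end StarMaintenance

/-! ### Enumeration programs, and the step to the next element of a stage. -/

namespace StarMaintenance

open WordRAM Classical

variable {Q : StarQuery} {c : Cfg Q.d} {σ : Sem Q} {l : Key → List ℕ} {a b : AS Q.d} {s : ℕ}

section programs

variable (Q)

/-- The address of the cells with the position in the lists of the bound part in variable `10`. -/
def itAddr (k : ℕ) : Expr Q.d :=
  ((((rv Q 10).mul (.const 2)).add (.const k)).mul (.const 4)).add (.const 3)

def itE (k : ℕ) : Expr Q.d := .load (itAddr Q k)

def patsKey : KeyE Q.d := ⟨7, 0, rv Q 10⟩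

/-- The group with the bound part in variable `10` and the output part, plus one, in `4`. -/
def partKey : KeyE Q.d := ⟨4, 0, (rv Q 10).add (((rv Q 4).sub (.const 1)).shl
  (Expr.digitBits.mul (.const Q.e)))⟩

/-- The next output part, plus one, goes to variable `4`, or `0` if there is none. -/
def advance : Prog :=
  cond ((itE Q 0).lt (patsKey Q).size)
    (.seq (asg (d := Q.d) (.loc 11) ((patsKey Q).get (itE Q 0)))
      (.seq (asg (d := Q.d) (.loc 4) (((((grpKey Q).get (itE Q 1))).shr
          (Expr.digitBits.mul (.const Q.e))).add (.const 1)))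
        (cond (((itE Q 1).add (.const 1)).lt (grpKey Q).size)
          (store (itAddr Q 1) ((itE Q 1).add (.const 1)))
          (.seq (store (itAddr Q 1) (.const 0)) (store (itAddr Q 0) ((itE Q 0).add (.const 1)))))))
    (asg (d := Q.d) (.loc 4) (.const 0))

def boundAliveE : Expr Q.d := Expr.all (fun i => ((Expr.dig i (rv Q 10)).eq (.const 0)).or
  ((KeyE.mk 3 i (.const 0)).has (Expr.dig i (rv Q 10)))) Q.e

/-- A stage of the enumeration. -/
def stage : Prog :=
  cond (boundAliveE Q) (cond (rv Q 4) (cond (partKey Q).size (advance Q) .nop) (advance Q)) .nop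

/-- A round of the enumeration. -/
def round : Prog :=
  .seq (asg (d := Q.d) (.loc 4) (.const 0)) (forE (.loc 9) (.loc 10) (rootKey Q) (stage Q))

/-- The components of the output go to the variables from number `20` on. -/
def digits : Prog := seqs (fun i => asg (d := Q.d) (.loc (20 + i))
  ((Expr.dig i ((rv Q 4).sub (.const 1))).sub (.const 1))) Q.j

/-- The cells with the positions are erased. -/
def cleanup : Prog := forE (.loc 9) (.loc 10) (rootKey Q)
  (.seq (store (itAddr Q 0) (.const 0)) (store (itAddr Q 1) (.const 0)))

end programs

/-- The lists `l` store the sets of `σ`, and there is enough room for the enumeration. -/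
structure Tour (c : Cfg Q.d) (σ : Sem Q) (l : Key → List ℕ) : Prop extends Lists c σ l where
  space : 3 * σ.weight + 2 * (roots l).length + 5 ≤ c.S

/-- The state of an enumeration whose stages have output the elements `dn`. -/
structure Walk (c : Cfg Q.d) (σ : Sem Q) (l : Key → List ℕ) (s : ℕ) (dn : ℕ → List ℕ)
    (b : AS Q.d) : Prop where
  lists : b.l = l
  scale : b.ρ (.loc 0) = s
  n : b.n + 5 ≤ c.S
  it : ∀ x, b.it x ≠ 0 → x / 2 ∈ roots l
  cur : ∀ r (hr : r < (roots l).length), σ.BoundAlive (roots l)[r] → ∃ rem,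
    parts σ l r = dn r ++ rem ∧ Cursor (walks σ l (roots l)[r]) (b.it (2 * (roots l)[r]))
      (b.it (2 * (roots l)[r] + 1)) rem

theorem Walk.set {dn : ℕ → List ℕ} (h : Walk c σ l s dn b) (v : Var Q.d) (x : ℕ)
    (hv : v ≠ .loc 0 := by simp) : Walk c σ l s dn (b.set v x) :=
  ⟨h.lists, (Function.update_of_ne hv.symm _ _).trans h.scale, h.n, h.it, h.cur⟩

/-- During an enumeration each bound part has two auxiliary cells: the index of the current pattern
and the index of the current group. -/
theorem Tour.holds (h : Tour c σ l) {it : ℕ → ℕ} (hit : ∀ x, it x ≠ 0 → x / 2 ∈ roots l) :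
    Holds l it (3 * σ.weight + 2 * (roots l).length) := by
  refine holds_of_spec (E' := (roots l).toFinset.image (2 * ·) ∪
    (roots l).toFinset.image (2 * · + 1)) (fun key z hz => (h.mem key z).1 hz) (fun x hx => ?_) ?_
  · rw [Finset.mem_union, Finset.mem_image, Finset.mem_image]
    have := List.mem_toFinset.2 (hit x hx)
    rcases Nat.even_or_odd' x with ⟨y, rfl | rfl⟩
    · exact Or.inl ⟨_, this, by omega⟩
    · exact Or.inr ⟨_, this, by omega⟩
  · have h1 := List.toFinset_card_le (roots l)
    have h2 := Finset.card_union_le ((roots l).toFinset.image (2 * ·))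
      ((roots l).toFinset.image (2 * · + 1))
    have h3 := Finset.card_image_le (s := (roots l).toFinset) (f := (2 * ·))
    have h4 := Finset.card_image_le (s := (roots l).toFinset) (f := (2 * · + 1))
    omega

/-- A write to a cell with a position. -/
theorem run_storeIt {ax ex : Expr Q.d} {x v : ℕ} {Post : AS Q.d → Prop}
    (hax : ev c a ax = x * 4 + 3) (hex : ev c a ex = v) (hn : a.n + 1 ≤ c.S)
    (hP : Post { a with it := Function.update a.it x v, n := a.n + 1 }) :
    Run c (store ax ex) a (tm (store ax ex)) Post := by
  intro m hm
  have hv : v < 2 ^ c.w := hex ▸ Expr.eval_lt _ _ _ _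
  refine Does.store ((Nat.add_le_add_right hm.card 1).trans hn) ?_
  rw [hm.eval, hm.eval, hax, hex]
  refine ⟨a.l, Function.update a.it x v, a.n + 1, ⟨fun z => ?_, hm.sane, fun z => ?_,
    (card_support_update_le _ _ _).trans (Nat.add_le_add_right hm.card 1)⟩, hP⟩
  · rw [Finsupp.coe_update]
    by_cases hz : z = x * 4 + 3
    · subst hz
      rw [Function.update_self, c.cell_it]
      exact (Function.update_self x v a.it).symm
    · rw [Function.update_of_ne hz, hm.mem]
      unfold Cfg.cell
      split_ifs <;> try rfl
      exact (Function.update_of_ne (show z / 4 ≠ x by omega) v a.it).symm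
  · simp only
    by_cases hz : z = x
    · rw [hz, Function.update_self]
      exact hv
    · rw [Function.update_of_ne hz]
      exact hm.it_lt z

section eval

variable {β : ℕ}

theorem root_lt_pow (h : Lists c σ l) (hβ : β ∈ roots l) : β < c.B ^ (Q.d + 1) :=
  (h.root_lt hβ).trans_le (Nat.pow_le_pow_right c.B_pos (by have := Sem.e_le (Q := Q); omega))

theorem ev_itAddr (hβ : β < c.B ^ (Q.d + 1)) (hX : a.ρ (.loc 10) = β) {k : ℕ} (hk : k < 2) :
    ev c a (itAddr Q k) = (2 * β + k) * 4 + 3 := by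
  have h64 : 64 < c.B := c.small (by omega)
  have h1 : (β * 2 + k) * 4 + 3 < 2 ^ c.w := by
    refine c.lt_word (k := Q.d + 2) ?_ (by omega)
    rw [pow_succ]
    nlinarith
  rw [mul_comm 2 β]
  refine eval_add (eval_mul (eval_add (eval_mul (eval_var _ hX (by omega)) (eval_const (by omega))
    (by omega)) (eval_const (by omega)) (by omega)) (eval_const (by omega)) (by omega))
    (eval_const (by omega)) (by omega)

theorem ev_itE (hβ : β < c.B ^ (Q.d + 1)) (hX : a.ρ (.loc 10) = β) {k : ℕ} (hk : k < 2)
    (hlt : a.it (2 * β + k) ≤ c.B ^ (Q.d + 1)) : ev c a (itE Q k) = a.it (2 * β + k) := by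
  have := ev_itAddr (a := a) hβ hX hk
  unfold ev itE at *
  rw [Expr.eval, this, c.cell_it, Nat.mod_eq_of_lt (c.lt_word hlt (by omega))]

theorem tests_boundAlive (h : Lists c σ l) (hl : a.l = l) (hβ : β ∈ roots l)
    (hX : a.ρ (.loc 10) = β) :
    Tests c a.ρ (c.cell a.l a.it) (boundAliveE Q) (σ.BoundAlive β) := by
  subst hl
  have hk := Q.k_le
  have he : Q.e ≤ Q.k := Q.sub_le
  have hβ' := lt_word_of_lt (root_lt_pow h hβ) (by omega)
  refine Tests.all fun i hi => ?_
  have hd : ∀ μ, (Expr.dig i (rv Q 10)).eval c.w a.ρ μ = dig c.B i β := fun μ =>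
    eval_dig (eval_var _ hX hβ') (by omega) hβ'
  have h1 := (key_is (c := c) (ρ := a.ρ) (g := 3) (i := i) (by norm_num) (by omega)
    (fun μ => eval_const (Nat.zero_le _)) (pow_pos c.B_pos _)).has (it := a.it) h.sane (hd _)
      (dig_lt_pow (Q := Q)).le
  rw [h.wf.B]
  refine ((Tests.eq (hd _) (eval_const (by omega))).or h1).congr (or_congr Iff.rfl ?_)
  rw [h.mem (3, i, 0)]
  simp [Sem.spec, show i < Q.k by omega]

end eval

variable {dn dn' : ℕ → List ℕ} {n : ℕ}

/-- The outcome of a stage. -/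
def StageDone (c : Cfg Q.d) (σ : Sem Q) (l : Key → List ℕ) (s : ℕ) (dn : ℕ → List ℕ) (n : ℕ)
    (x : ℕ) (b : AS Q.d) : Prop :=
  ∃ dn', Walk c σ l s dn' b ∧ InRound (parts σ l) dn dn' (n + 1) (b.ρ (.loc 4)) ∧ b.ρ (.loc 9) = x

/-- The stage is called upon to act, since its input is absent or an element of its own set (`ha`).
If its list has an element left, this is `InRound.take`; otherwise `InRound.eq_zero` shows that
there was no input. -/
theorem run_advance (h : Tour c σ l) (hw : Walk c σ l s dn' b)
    (hr : InRound (parts σ l) dn dn' n (b.ρ (.loc 4))) (hn : n < (roots l).length)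
    (hX : b.ρ (.loc 10) = (roots l)[n]) (hb : σ.BoundAlive (roots l)[n])
    (ha : ∀ z, b.ρ (.loc 4) = z + 1 → z ∈ parts σ l n) :
    Run c (advance Q) b (tm (advance Q)) (StageDone c σ l s dn n (b.ρ (.loc 9))) := by
  have hS := h.space
  have hbS := hw.n
  obtain ⟨rem, h1, h2⟩ := hw.cur n hn hb
  have hl := hw.lists
  subst hl
  set β := (roots b.l)[n] with hβ
  have hβm : β ∈ roots b.l := List.getElem_mem hn
  have hβ' := root_lt_pow h.toLists hβm
  -- This stage has not acted yet in the present round.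
  rw [hr.rest n le_rfl] at h1
  have hwl : (walks σ b.l β).length = (b.l (7, 0, β)).length := List.length_map _
  have hlen := h.sane.length_le (7, 0, β)
  have hi1 : b.it (2 * β) ≤ c.B ^ (Q.d + 1) := h2.le.trans (hwl ▸ hlen)
  have hkey : ∀ {ρ : Var Q.d → ℕ}, ρ (.loc 10) = β → (patsKey Q).Is c ρ (7, 0, β) := fun hρ =>
    key_is (by norm_num) (Nat.zero_le _) (Prep.eval_rv hρ hβ') hβ'
  have hB1 : c.B ^ (Q.d + 1) + 1 < 2 ^ c.w := by
    have : c.B ^ (Q.d + 1) < c.B ^ (Q.d + 2) := Nat.pow_lt_pow_right c.one_lt_B (by omega)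
    exact c.lt_word (k := Q.d + 2) (by omega) (by omega)
  have htest := Tests.lt (ev_itE (k := 0) hβ' hX (by omega) hi1)
    ((hkey hX).size_eq (it := b.it) h.sane)
  have htm : tm (advance Q) = tm (((itE Q 0).lt (patsKey Q).size).compile 0) + (1 +
    tm (.seq (asg (d := Q.d) (.loc 11) ((patsKey Q).get (itE Q 0)))
      (.seq (asg (d := Q.d) (.loc 4) (((((grpKey Q).get (itE Q 1))).shr
          (Expr.digitBits.mul (.const Q.e))).add (.const 1)))
        (cond (((itE Q 1).add (.const 1)).lt (grpKey Q).size)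
          (store (itAddr Q 1) ((itE Q 1).add (.const 1)))
          (.seq (store (itAddr Q 1) (.const 0)) (store (itAddr Q 0) ((itE Q 0).add (.const 1)))))))
    + tm (asg (d := Q.d) (.loc 4) (.const 0))) := rfl
  rw [htm]
  refine run_ite (by omega) (fun h0 => ?_) (fun h0 => ?_)
  · have hlt : b.it (2 * β) < (b.l (7, 0, β)).length := htest.ne_zero.1 h0
    obtain ⟨rem', e1, e2, e3⟩ := h2.next h.toLists.walks_ne_nil (hwl ▸ hlt)
    have hi2 := h2.lt (hwl ▸ hlt)
    set i₁ := b.it (2 * β) with hi₁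
    set i₂ := b.it (2 * β + 1) with hi₂
    set p := (b.l (7, 0, β))[i₁] with hp
    have hL : (walks σ b.l β)[i₁]'(hwl ▸ hlt) = (b.l (5, 0, p)).map (· / σ.B ^ Q.e) :=
      List.getElem_map _
    have hll : ((walks σ b.l β)[i₁]'(hwl ▸ hlt)).length = (b.l (5, 0, p)).length := by
      rw [hL, List.length_map]
    rw [hll] at hi2 e2 e3
    have hLq : ((walks σ b.l β)[i₁]'(hwl ▸ hlt))[i₂]'(hll ▸ hi2) =
        (b.l (5, 0, p))[i₂] / σ.B ^ Q.e := by
      simp only [hL, List.getElem_map]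
    rw [hLq] at e1
    have hlen5 := h.sane.length_le (5, 0, p)
    set q := (b.l (5, 0, p))[i₂] with hq
    have hp' : p < c.B ^ (Q.d + 1) := (h.sane _).2 _ (List.getElem_mem hlt)
    have hq' : q < c.B ^ (Q.d + 1) := (h.sane _).2 _ (List.getElem_mem hi2)
    have hqd := Nat.div_le_self q (c.B ^ Q.e)
    refine Run.seq (Mid := fun b' => b' = b.set (.loc 11) p) (run_asg (by omega) ?_) ?_
    · congr 1
      refine ((hkey hX).get_eq h.sane (ev_itE (k := 0) hβ' hX (by omega) hi1) hi1).trans ?_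
      exact List.getD_eq_getElem _ _ hlt
    rintro _ rfl
    have hX1 : (b.set (.loc 11) p).ρ (.loc 10) = β := by simp [AS.set, hX]
    have hg : ∀ {ρ : Var Q.d → ℕ}, ρ (.loc 11) = p → (grpKey Q).Is c ρ (5, 0, p) := fun hρ =>
      key_is (by norm_num) (Nat.zero_le _) (Prep.eval_rv hρ hp') hp'
    have hg1 : (grpKey Q).Is c (b.set (.loc 11) p).ρ (5, 0, p) := hg (by simp [AS.set])
    refine Run.seq (Mid := fun b' => b' = (b.set (.loc 11) p).set (.loc 4) (q / σ.B ^ Q.e + 1))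
      (run_asg (by simp only [AS.set]; omega) ?_) ?_
    · congr 1
      rw [h.wf.B]
      refine eval_add (eval_shr_bits ?_ (by have := Sem.e_le (Q := Q); omega) (by omega))
        (eval_const (by omega)) (by omega)
      exact (hg1.get_eq h.sane (ev_itE (k := 1) hβ' hX1 (by omega) (by simp only [AS.set]; omega))
        (by simp only [AS.set]; omega)).trans (List.getD_eq_getElem _ _ hi2)
    rintro _ rfl
    set b2 := (b.set (.loc 11) p).set (.loc 4) (q / σ.B ^ Q.e + 1) with hb2
    have hX2 : b2.ρ (.loc 10) = β := by simp [hb2, AS.set, hX]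
    have hg2 : (grpKey Q).Is c b2.ρ (5, 0, p) := hg (by simp [hb2, AS.set])
    have hround : InRound (parts σ b.l) dn
        (Function.update dn' n (dn n ++ [q / σ.B ^ Q.e])) (n + 1) (q / σ.B ^ Q.e + 1) :=
      hr.take (h.toLists.nodup_parts n) (by rw [h1, e1]) ha
    -- Only the two cells of this bound part change. Bound parts are listed without repetition, so
    -- the positions of all other stages are untouched.
    have hfin : ∀ it' : ℕ → ℕ, (∀ x, x / 2 ≠ β → it' x = b.it x) →
        Cursor (walks σ b.l β) (it' (2 * β)) (it' (2 * β + 1)) rem' →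
        ∃ N, Holds b.l it' N ∧ StageDone c σ b.l s dn n (b.ρ (.loc 9)) ⟨b2.ρ, b.l, it', N⟩ := by
      intro it' hit hcur
      have hit' : ∀ x, it' x ≠ 0 → x / 2 ∈ roots b.l := by
        intro x hx
        by_cases hxβ : x / 2 = β
        · rw [hxβ]
          exact hβm
        · exact hw.it x (hit x hxβ ▸ hx)
      refine ⟨_, h.holds hit', Function.update dn' n (dn n ++ [q / σ.B ^ Q.e]),
        ⟨rfl, by simpa [hb2, AS.set] using hw.scale, by simp only; omega, hit', fun r hr' hbr => ?_⟩,
        ?_, by simp [hb2, AS.set]⟩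
      · by_cases hrn : r = n
        · subst hrn
          refine ⟨rem', ?_, hcur⟩
          rw [Function.update_self, h1, e1]
          simp
        · rw [Function.update_of_ne hrn]
          have hne : (roots b.l)[r] ≠ β := fun hh =>
            hrn ((List.Nodup.getElem_inj_iff (h.sane (0, 0, 0)).1).1 hh)
          obtain ⟨rem2, g1, g2⟩ := hw.cur r hr' hbr
          refine ⟨rem2, g1, ?_⟩
          simp only
          rw [hit _ (by omega), hit _ (by omega)]
          exact g2
      · have : b2.ρ (.loc 4) = q / σ.B ^ Q.e + 1 := by simp [hb2, AS.set]
        rw [← this] at hround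
        exact hround
    have hi2' : ∀ {b' : AS Q.d}, b'.it = b.it → b'.ρ (.loc 10) = β → ev c b' (itE Q 1) = i₂ := by
      intro b' hb' hXb
      rw [ev_itE (k := 1) hβ' hXb (by omega) (by rw [hb']; omega), hb']
    have htest2 := Tests.lt (eval_add (hi2' (b' := b2) rfl hX2) (eval_const (n := 1) (c := c)
      (ρ := b2.ρ) (by omega)) (by omega)) (hg2.size_eq (it := b2.it) h.sane)
    have hbn : b2.n = b.n := rfl
    refine Run.tighten (Mid := fun b' => b'.ρ = b2.ρ ∧ b'.l = b.l ∧ (∀ x, x / 2 ≠ β → b'.it x = b.it x)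
      ∧ Cursor (walks σ b.l β) (b'.it (2 * β)) (b'.it (2 * β + 1)) rem') ?_ ?_
    · have htm2 : tm (cond (((itE Q 1).add (.const 1)).lt (grpKey Q).size)
          (store (itAddr Q 1) ((itE Q 1).add (.const 1)))
          (.seq (store (itAddr Q 1) (.const 0)) (store (itAddr Q 0) ((itE Q 0).add (.const 1))))) =
        tm ((((itE Q 1).add (.const 1)).lt (grpKey Q).size).compile 0) + (1 +
          tm (store (itAddr Q 1) ((itE Q 1).add (.const 1))) + tm (.seq (store (itAddr Q 1)
          (.const 0)) (store (itAddr Q 0) ((itE Q 0).add (.const 1))))) := rfl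
      rw [htm2]
      refine run_ite (by omega) (fun h3 => ?_) (fun h3 => ?_)
      · replace h3 : i₂ + 1 < (b.l (5, 0, p)).length := htest2.ne_zero.1 h3
        refine run_storeIt (ev_itAddr hβ' hX2 (by omega)) (eval_add (hi2' rfl hX2)
          (eval_const (by omega)) (by omega)) (by omega) ⟨rfl, rfl, fun x hx => ?_, ?_⟩
        · exact Function.update_of_ne (by omega) _ _
        · simp only
          rw [Function.update_of_ne (by omega), Function.update_self]
          exact e2 h3
      · replace h3 : ¬ i₂ + 1 < (b.l (5, 0, p)).length := fun hh => htest2.ne_zero.2 hh h3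
        -- At the end of the groups of a pattern, the inner index returns to zero and the outer one
        -- moves on.
        refine Run.seq (run_storeIt (Post := fun b' => b' = { b2 with
          it := Function.update b2.it (2 * β + 1) 0, n := b2.n + 1 }) (ev_itAddr hβ' hX2 (by omega))
          (eval_const (by omega)) (by omega) rfl) ?_
        rintro _ rfl
        have hi : Function.update b2.it (2 * β + 1) 0 (2 * β) = i₁ :=
          Function.update_of_ne (by omega) _ _
        refine run_storeIt (ev_itAddr (k := 0) hβ' hX2 (by omega)) (eval_add (ev_itE (k := 0)
          (a := { b2 with it := Function.update b2.it (2 * β + 1) 0, n := b2.n + 1 }) hβ'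
          hX2 (by omega) (hi.trans_le hi1)) (eval_const (by omega)) ?_) (by simp only; omega)
          ⟨rfl, rfl, fun x hx => ?_, ?_⟩
        · simp only [add_zero]
          omega
        · simp only [add_zero]
          rw [Function.update_of_ne (by omega), Function.update_of_ne (by omega)]
          rfl
        · simp only [add_zero]
          rw [Function.update_self, hi, Function.update_of_ne (by omega), Function.update_self]
          exact e3 h3
    · rintro ⟨ρ', l', it', n'⟩ ⟨g1, g2, g3, g4⟩
      simp only at g1 g2
      subst g1 g2
      exact hfin it' g3 g4
  · have hlt : ¬ b.it (2 * β) < (b.l (7, 0, β)).length := fun hh => htest.ne_zero.2 hh h0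
    have hrem := h2.nil (by rw [hwl]; exact hlt)
    rw [hrem, List.append_nil] at h1
    -- The list is exhausted. Variable `4` is then `0` already, so that writing `0` to it merely
    -- lets the absent input pass.
    have h4 := hr.eq_zero (h.toLists.nodup_parts n) h1.symm ha
    refine run_asg (by omega) ⟨dn', hw.set _ _, ?_, by simp [AS.set]⟩
    have : ev c b (.const 0) = b.ρ (.loc 4) := (eval_const (by omega)).trans h4.symm
    rw [this]
    simp only [AS.set, Function.update_self]
    exact hr.skip (fun x hx => by omega) fun _ => h1.symm

end StarMaintenance

/-! ### Stages, rounds, the output of digits, and the cleanup after an enumeration. -/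

namespace StarMaintenance

open WordRAM Classical

variable {Q : StarQuery} {c : Cfg Q.d} {σ : Sem Q} {l : Key → List ℕ} {a b : AS Q.d}
  {dn dn' : ℕ → List ℕ} {n s : ℕ}

theorem partKey_is (h : Lists c σ l) {β x : ℕ} (hβ : β ∈ roots l) (hX : b.ρ (.loc 10) = β)
    (hx : b.ρ (.loc 4) = x + 1) (hxj : x < c.B ^ Q.j) :
    (partKey Q).Is c b.ρ (4, 0, β + x * c.B ^ Q.e) := by
  have hj := Q.j_le
  have he : Q.e = Q.d - Q.j := rfl
  have hβe := h.root_lt hβ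
  have h1 : β + x * c.B ^ Q.e < c.B ^ Q.d := by
    have h2 : (x + 1) * c.B ^ Q.e ≤ c.B ^ Q.j * c.B ^ Q.e := Nat.mul_le_mul_right _ hxj
    rw [← pow_add, show Q.j + Q.e = Q.d by omega, add_one_mul] at h2
    omega
  have h2 := c.B_pos
  have hd : c.B ^ Q.d < c.B ^ (Q.d + 1) := Nat.pow_lt_pow_right c.one_lt_B (by omega)
  have hj' : c.B ^ Q.j ≤ c.B ^ Q.d := Nat.pow_le_pow_right h2 (by omega)
  refine key_is (by norm_num) (Nat.zero_le _) (fun μ => ?_) (by omega)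
  refine eval_add (Prep.eval_rv hX (root_lt_pow h hβ) μ) (eval_shl_bits (eval_sub
    (Prep.eval_rv hx (by omega) μ) (eval_const (by omega)) (by omega)
    (lt_word_of_lt (k := Q.d + 1) (by omega) (by omega))) (by omega) ?_) ?_
  · exact lt_word_of_lt (k := Q.d + 1) (by omega) (by omega)
  · exact lt_word_of_lt (k := Q.d + 1) (by omega) (by omega)

theorem union_lt (h : Lists c σ l) {x : ℕ} (hn : n ≤ (roots l).length)
    (hx : x ∈ unionUpTo (parts σ l) n) : x < c.B ^ Q.j := by
  obtain ⟨r, h1, h2⟩ := mem_unionUpTo.1 hx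
  obtain ⟨y, h3, -, -, rfl⟩ := (h.mem_parts (h1.trans_le hn)).1 h2
  rw [← h.wf.B]
  exact Sem.outPart_lt (h.ok h3)

/-- If the bound part is dead its set is empty, and the input passes. An input outside the set
passes as well. In the remaining cases the stage supplies an element of its own. -/
theorem run_stage (h : Tour c σ l) (hw : Walk c σ l s dn' b)
    (hr : InRound (parts σ l) dn dn' n (b.ρ (.loc 4))) (hn : n < (roots l).length)
    (hX : b.ρ (.loc 10) = (roots l)[n]) :
    Run c (stage Q) b (tm (stage Q)) (StageDone c σ l s dn n (b.ρ (.loc 9))) := by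
  have hbS := hw.n
  have hl := hw.lists
  subst hl
  have hmem : (roots b.l)[n] ∈ roots b.l := List.getElem_mem hn
  have htest := tests_boundAlive h.toLists rfl hmem hX
  have skip : (∀ x, b.ρ (.loc 4) = x + 1 → x ∉ parts σ b.l n) →
      (b.ρ (.loc 4) = 0 → dn n = parts σ b.l n) →
      Run c .nop b (tm .nop) (StageDone c σ b.l s dn n (b.ρ (.loc 9))) := fun h1 h2 =>
    run_nop (by omega) ⟨dn', hw, hr.skip h1 h2, rfl⟩
  have htm : tm (stage Q) = tm ((boundAliveE Q).compile 0) + (1 + (tm ((rv Q 4).compile 0) + (1 +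
    (tm ((partKey Q).size.compile 0) + (1 + tm (advance Q) + tm .nop)) + tm (advance Q))) +
    tm .nop) := rfl
  rw [htm]
  refine run_ite (by omega) (fun h1 => ?_) (fun h1 => ?_)
  · have hb : σ.BoundAlive (roots b.l)[n] := htest.ne_zero.1 h1
    have hlt : b.ρ (.loc 4) < 2 ^ c.w := by
      by_cases h0 : b.ρ (.loc 4) = 0
      · rw [h0]
        positivity
      · obtain ⟨x, hx⟩ : ∃ x, b.ρ (.loc 4) = x + 1 := ⟨b.ρ (.loc 4) - 1, by omega⟩
        have h2 := union_lt h.toLists hn.le (hr.pass.some x hx).1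
        rw [hx]
        exact c.lt_word (k := Q.j) h2 (by have := Q.j_le; omega)
    have hev : ev c b (rv Q 4) = b.ρ (.loc 4) := eval_var _ rfl hlt
    refine run_ite (by omega) (fun h2 => ?_) (fun h2 => ?_)
    · rw [hev] at h2
      obtain ⟨x, hx⟩ : ∃ x, b.ρ (.loc 4) = x + 1 := ⟨b.ρ (.loc 4) - 1, by omega⟩
      have hxu := (hr.pass.some x hx).1
      have hiff := h.toLists.mem_parts_iff hn.le hn hb hxu
      have hsz := (partKey_is h.toLists hmem hX hx (union_lt h.toLists hn.le hxu)).size_eq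
        (it := b.it) h.sane
      refine run_ite (by omega) (fun h3 => run_advance h hw hr hn hX hb fun z hz => ?_)
        (fun h3 => skip (fun z hz => ?_) fun h0 => by omega)
      · obtain rfl : z = x := by omega
        refine hiff.2 fun h4 => h3 ?_
        rw [ev, hsz]
        exact congrArg List.length h4
      · obtain rfl : z = x := by omega
        refine fun h4 => hiff.1 h4 (List.length_eq_zero_iff.1 ?_)
        rw [← hsz]
        exact h3
    · rw [hev] at h2
      exact run_advance h hw hr hn hX hb fun z hz => by omega
  · have hb : ¬ σ.BoundAlive (roots b.l)[n] := fun hh => htest.ne_zero.2 hh h1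
    have hnil : parts σ b.l n = [] := by
      unfold parts
      rw [List.getD_eq_getElem _ _ hn, if_neg fun hh => hb hh.2]
    refine skip (fun x _ => by simp [hnil]) fun _ => ?_
    have := (hr.old n).pre
    rw [hnil, List.prefix_nil] at this
    rw [this, hnil]

/-- The time for a loop over all bound parts with the given body. -/
def sweepTime (Q : StarQuery) (p : Prog) : ℕ :=
  tm p + forCost (.loc 9) (.loc 10) (rootKey Q)

theorem rootKey_is' {ρ : Var Q.d → ℕ} : (rootKey Q).Is c ρ (0, 0, 0) :=
  key_is (by norm_num) (Nat.zero_le _) (fun _ => eval_const (Nat.zero_le _)) (pow_pos c.B_pos _)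

theorem run_round (h : Tour c σ l) (hw : Walk c σ l s dn b) (hok : ∀ r, StageOk (parts σ l) dn r) :
    Run c (round Q) b (tm (asg (d := Q.d) (.loc 4) (.const 0)) +
      ((roots l).length + 1) * sweepTime Q (stage Q)) fun b' => ∃ dn', Walk c σ l s dn' b' ∧
      InRound (parts σ l) dn dn' (roots l).length (b'.ρ (.loc 4)) := by
  have hn := hw.n
  have e : ev c b (.const 0) = 0 := eval_const (Nat.zero_le _)
  refine Run.seq (run_asg (Post := fun b' => b' = b.set (.loc 4) 0) (by omega) (by rw [e])) ?_
  rintro _ rfl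
  refine run_forE (key := (0, 0, 0)) (L := roots l) (by simp) (fun n b' => ∃ dn', Walk c σ l s dn' b' ∧
    InRound (parts σ l) dn dn' n (b'.ρ (.loc 4))) ⟨dn, hw.set _ _, ?_⟩ ?_ ?_ ?_
  · simp only [AS.set, Function.update_self]
    exact InRound.start hok
  · rintro n b' y ⟨dn', h1, h2⟩
    refine ⟨⟨dn', h1.set _ _, ?_⟩, ⟨dn', h1.set _ _, ?_⟩⟩ <;> simpa [AS.set] using h2
  · rintro n b' ⟨dn', h1, h2⟩
    have := h1.n
    exact ⟨rootKey_is', by rw [h1.lists], by omega⟩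
  · rintro n hn b' ⟨dn', h1, h2⟩ h3 h4
    refine (run_stage h h1 h2 hn h4).mono le_rfl ?_
    rintro b'' ⟨dn'', k1, k2, k3⟩
    exact ⟨⟨dn'', k1, k2⟩, k3.trans h3⟩

theorem run_digits (hw : Walk c σ l s dn b) {x : ℕ} (hx : b.ρ (.loc 4) = x + 1)
    (hlt : x < c.B ^ Q.j) (hpos : ∀ i < Q.j, 1 ≤ dig c.B i x) :
    Run c (digits Q) b (tm (digits Q)) fun b' => Walk c σ l s dn b' ∧
      ∀ i < Q.j, b'.ρ (.loc (20 + i)) = dig c.B i x - 1 := by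
  have hn := hw.n
  have hj := Q.j_le
  have hB := c.B_pos
  have hd : c.B ^ Q.d < c.B ^ (Q.d + 1) := Nat.pow_lt_pow_right c.one_lt_B (by omega)
  have hj' : c.B ^ Q.j ≤ c.B ^ Q.d := Nat.pow_le_pow_right hB (by omega)
  refine (run_seqs (T := fun i => tm (asg (d := Q.d) (.loc (20 + i))
    ((Expr.dig i ((rv Q 4).sub (.const 1))).sub (.const 1)))) (fun n b' => Walk c σ l s dn b' ∧
      b'.ρ (.loc 4) = x + 1 ∧ ∀ i < n, b'.ρ (.loc (20 + i)) = dig c.B i x - 1)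
    ⟨hw, hx, fun i hi => absurd hi (Nat.not_lt_zero _)⟩ (by omega) Q.j ?_).mono ?_
    fun b' hb => ⟨hb.1, hb.2.2⟩
  · rintro i hi b' ⟨h1, h2, h3⟩
    have := h1.n
    have e : ev c b' ((Expr.dig i ((rv Q 4).sub (.const 1))).sub (.const 1)) = dig c.B i x - 1 := by
      have hxw : x < 2 ^ c.w := lt_word_of_lt (k := Q.d + 1) (by omega) (by omega)
      refine eval_sub (eval_dig (m := x) (eval_sub (Prep.eval_rv h2 (by omega) _)
        (eval_const (by omega)) (by omega) (lt_word_of_lt (k := Q.d + 1) (by omega) (by omega)))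
        (by omega) hxw) (eval_const (by omega)) (hpos i hi) ?_
      exact lt_word_of_lt (dig_lt_pow (Q := Q)) (by omega)
    refine run_asg (by omega) ?_
    rw [e]
    refine ⟨h1.set _ _, (Function.update_of_ne (by simp; omega) _ _).trans h2, fun i' hi' => ?_⟩
    by_cases hii : i' = i
    · subst hii
      simp [AS.set]
    · simp only [AS.set]
      rw [Function.update_of_ne (by simpa using hii)]
      exact h3 i' (by omega)
  · unfold digits
    generalize Q.j = j
    induction j with
    | zero => simp [seqs, tm]
    | succ j ih =>
      rw [Finset.sum_range_succ]
      simp only [seqs, tm] at ih ⊢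
      omega

/-- The positions are erased so that the next enumeration starts from the beginning and the cells
are released. Only cells of bound parts can be nonzero, so one pass over the bound parts suffices.
-/
theorem run_cleanup (h : Tour c σ l) (hw : Walk c σ l s dn b) :
    Run c (cleanup Q) b (((roots l).length + 1) * sweepTime Q (.seq (store (itAddr Q 0) (.const 0))
      (store (itAddr Q 1) (.const 0)))) fun b' => b'.l = l ∧ b'.ρ (.loc 0) = s ∧ ∀ x, b'.it x = 0 := by
  have hS := h.space
  refine (run_forE (key := (0, 0, 0)) (L := roots l) (by simp) (fun n b' => b'.l = l ∧
    b'.ρ (.loc 0) = s ∧ b'.n + 2 ≤ c.S ∧ ∀ x, b'.it x ≠ 0 → x / 2 ∈ (roots l).drop n)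
    ⟨hw.lists, hw.scale, by have := hw.n; omega, by simpa using hw.it⟩ ?_ ?_ ?_).mono le_rfl ?_
  · rintro n b' y ⟨h1, h2, h3, h4⟩
    exact ⟨⟨h1, by simpa [AS.set] using h2, h3, h4⟩, ⟨h1, by simpa [AS.set] using h2, h3, h4⟩⟩
  · rintro n b' ⟨h1, -, h3, -⟩
    exact ⟨rootKey_is', by rw [h1], by omega⟩
  · rintro n hn b' ⟨h1, h2, h3, h4⟩ h5 h6
    have hβ' := root_lt_pow h.toLists (List.getElem_mem hn)
    have e : ∀ b'' : AS Q.d, ev c b'' (.const 0) = 0 := fun _ => eval_const (Nat.zero_le _)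
    refine Run.tighten (Run.seq (run_storeIt (Post := fun b'' => b'' = { b' with
      it := Function.update b'.it (2 * (roots l)[n] + 0) 0, n := b'.n + 1 })
      (ev_itAddr (k := 0) hβ' h6 (by omega)) (e _) (by omega) rfl) (Post := fun b'' => b''.l = b'.l ∧
      b''.ρ = b'.ρ ∧ ∀ x, b''.it x ≠ 0 → b'.it x ≠ 0 ∧ x / 2 ≠ (roots l)[n]) ?_) ?_
    · rintro _ rfl
      refine run_storeIt (ev_itAddr (k := 1) hβ' h6 (by omega)) (e _) (by simp only; omega)
        ⟨rfl, rfl, fun x hx => ?_⟩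
      have hx1 : x ≠ 2 * (roots l)[n] + 1 := by
        rintro rfl
        simp at hx
      dsimp only at hx
      rw [Function.update_of_ne hx1] at hx
      have hx0 : x ≠ 2 * (roots l)[n] + 0 := by
        rintro rfl
        simp at hx
      rw [Function.update_of_ne hx0] at hx
      exact ⟨hx, by omega⟩
    · rintro b'' ⟨k1, k2, k3⟩
      rw [h1] at k1
      refine ⟨3 * σ.weight + 2 * (roots l).length, by
        rw [k1]
        exact h.holds fun x hx => List.mem_of_mem_drop (h4 x (k3 x hx).1),
        ⟨k1, k2 ▸ h2, by simp only; omega, fun x hx => ?_⟩, k2 ▸ h5⟩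
      obtain ⟨g1, g2⟩ := k3 x hx
      have g3 := h4 x g1
      rw [List.drop_eq_getElem_cons hn] at g3
      exact (List.mem_cons.1 g3).resolve_left g2
  · rintro b' ⟨h1, h2, -, h4⟩
    exact ⟨h1, h2, fun x => by_contra fun hx => by simpa using h4 x hx⟩

end StarMaintenance

/-! ### The main loop of the enumeration and its delay. -/

namespace StarMaintenance

open WordRAM Classical

section delay

/-- A stretch without output cannot contain the event `e`, so it lies entirely on one side of it. -/
theorem DelayAtMost.append_cons {D : ℕ} {t t' : List Event} {e : Event} (h : DelayAtMost D t)
    (h' : DelayAtMost D t') (he : e.out ≠ none) : DelayAtMost D (t ++ e :: t') := by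
  rintro l ⟨u, v, huv⟩ hl
  have hel : e ∉ l := fun hh => he (hl e hh)
  rw [List.append_assoc, List.append_eq_append_iff] at huv
  rcases huv with ⟨a, rfl, h2⟩ | ⟨a, rfl, h2⟩
  · rw [List.append_eq_append_iff] at h2
    rcases h2 with ⟨a', rfl, -⟩ | ⟨a', rfl, h3⟩
    · exact h l ⟨u, a', by simp⟩ hl
    · rcases List.cons_eq_append_iff.1 h3 with ⟨rfl, -⟩ | ⟨a'', rfl, -⟩
      · exact h _ ⟨u, [], by simp⟩ hl
      · simp at hel
  · rcases List.cons_eq_append_iff.1 h2 with ⟨rfl, h3⟩ | ⟨a', rfl, h3⟩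
    · rcases List.append_eq_cons_iff.1 h3 with ⟨rfl, -⟩ | ⟨a'', rfl, -⟩
      · exact Nat.zero_le _
      · simp at hel
    · exact h' l ⟨a', v, by rw [h3]; simp⟩ hl

theorem DelayAtMost.of_length {D : ℕ} {t : List Event} (h : t.length ≤ D) : DelayAtMost D t :=
  fun _ hl _ => hl.length_le.trans h

theorem outputs_quiet {S : ℕ} {t : List Event} (h : Quiet S t) : outputs t = [] :=
  List.filterMap_eq_nil_iff.2 fun e he => (h e he).1

end delay

variable {Q : StarQuery} {c : Cfg Q.d} {σ : Sem Q} {l : Key → List ℕ} {a b : AS Q.d}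
  {dn dn' : ℕ → List ℕ} {n s : ℕ} {st : State}

/-- The machine state `st` is described by the abstract state `b`. -/
def At (c : Cfg Q.d) (st : State) (b : AS Q.d) : Prop := Rel c.w st b.ρ ∧ Good c b st.mem

theorem Run.exec {p : Prog} {T : ℕ} {Post : AS Q.d → Prop} (h : Run c p b T Post)
    (hb : At c st b) : ∃ tr st' b', Exec c.w p st tr st' ∧ At c st' b' ∧ Post b' ∧ tr.length ≤ T ∧
      Quiet c.S tr := by
  obtain ⟨tr, st', ρ', h1, h2, ⟨l', it', n', h3, h4⟩, h5, h6⟩ := h _ hb.2 st hb.1 rfl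
  exact ⟨tr, st', ⟨ρ', l', it', n'⟩, h1, ⟨h2, h3⟩, h4, h5, h6⟩

section programs

variable (Q)

def emitOut : Prog := .emit ((List.range Q.j).map fun i => .reg (Var.idx (d := Q.d) (.loc (20 + i))))

/-- The main loop of the enumeration. -/
def produce : Prog := .loop (.reg (Var.idx (d := Q.d) (.loc 4)))
  (.seq (digits Q) (.seq (emitOut Q) (round Q)))

/-- The program for an enumeration. -/
def onEnumerate : Prog := .seq (round Q) (.seq (produce Q) (cleanup Q))

/-- The time of a round when there are `n` bound parts. -/
def roundTime (n : ℕ) : ℕ :=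
  tm (asg (d := Q.d) (.loc 4) (.const 0)) + (n + 1) * sweepTime Q (stage Q)

def cleanupTime (n : ℕ) : ℕ := (n + 1) * sweepTime Q (.seq (store (itAddr Q 0) (.const 0))
  (store (itAddr Q 1) (.const 0)))

end programs

/-- The output with the given number. -/
def outOf (B j x : ℕ) : List ℕ := (List.range j).map fun i => dig B i x - 1

/-- Induction on the number of elements not yet output. The delay is stated with arbitrary short
pieces before and after the loop: in the induction step the round after an output is the piece
before the remaining loop, and the cleanup is the piece after it. -/
theorem exec_produce (h : Tour c σ l) {T : ℕ} (hb : At c st b) (hw : Walk c σ l s dn' b)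
    (hr : InRound (parts σ l) dn dn' (roots l).length (b.ρ (.loc 4))) :
    ∃ tr st' b' dn'', Exec c.w (produce Q) st tr st' ∧ At c st' b' ∧ Walk c σ l s dn'' b' ∧
      (∀ e ∈ tr, e.space ≤ c.S) ∧
      (∃ xs : List ℕ, outputs tr = xs.map (outOf c.B Q.j) ∧ xs.Nodup ∧ ∀ x, x ∈ xs ↔
        x ∈ unionUpTo (parts σ l) (roots l).length \ emitted (parts σ l) dn (roots l).length) ∧
      ∀ pre post, pre.length ≤ roundTime Q (roots l).length → post.length ≤ T →
        DelayAtMost (roundTime Q (roots l).length + 1 + tm (digits Q) + T)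
          (pre ++ (tr ++ post)) := by
  have hsp : ∀ {st : State} {b : AS Q.d} {dn : ℕ → List ℕ}, At c st b → Walk c σ l s dn b →
      st.space ≤ c.S := fun h1 h2 => h1.2.card.trans (by have := h2.n; omega)
  have hA : ∀ r, (roots l).length ≤ r → parts σ l r = [] := fun r hr => if_neg (by omega)
  generalize hk : (unionUpTo (parts σ l) (roots l).length \
    emitted (parts σ l) dn (roots l).length).card = k
  induction k generalizing st b dn dn' with
  | zero =>
    have hU : unionUpTo (parts σ l) (roots l).length \ emitted (parts σ l) dn (roots l).length = ∅ :=
      Finset.card_eq_zero.1 hk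
    have h0 : b.ρ (.loc 4) = 0 := by
      by_contra h0
      obtain ⟨x, hx⟩ : ∃ x, b.ρ (.loc 4) = x + 1 := ⟨b.ρ (.loc 4) - 1, by omega⟩
      obtain ⟨h1, h2, -⟩ := hr.pass.some x hx
      simpa [hU] using Finset.mem_sdiff.2 ⟨h1, h2⟩
    refine ⟨_, st, b, dn', Exec.loop_stop (((hb.1 (.loc 4)).1).trans h0), hb, hw, ?_,
      ⟨[], rfl, List.nodup_nil, by simp [hU]⟩, fun pre post h1 h2 => DelayAtMost.of_length ?_⟩
    · intro e he
      rw [List.mem_singleton.1 he]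
      exact hsp hb hw
    · simp
      omega
  | succ k ih =>
    have h0 : b.ρ (.loc 4) ≠ 0 := by
      intro h0
      rw [(hr.pass.none h0).1, Finset.sdiff_self] at hk
      simp at hk
    obtain ⟨x, hx⟩ : ∃ x, b.ρ (.loc 4) = x + 1 := ⟨b.ρ (.loc 4) - 1, by omega⟩
    obtain ⟨hxU, hxF, hF⟩ := hr.pass.some x hx
    have hpos : ∀ i < Q.j, 1 ≤ dig c.B i x := by
      intro i hi
      obtain ⟨y, hy, -, rfl⟩ := h.toLists.mem_union.1 hxU
      rw [← h.wf.B, Sem.dig_outPart (h.toLists.ok hy) hi]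
      omega
    obtain ⟨tr1, st1, b1, e1, hb1, ⟨hw1, hd1⟩, hl1, hq1⟩ :=
      (run_digits hw hx (union_lt h.toLists le_rfl hxU) hpos).exec hb
    obtain ⟨tr2, st2, b2, e2, hb2, ⟨dn2, hw2, hr2⟩, hl2, hq2⟩ :=
      (run_round h hw1 (hr.stageOk hA)).exec hb1
    have hset : ∀ z, z ∈ unionUpTo (parts σ l) (roots l).length \
        emitted (parts σ l) dn (roots l).length ↔ z = x ∨ z ∈ unionUpTo (parts σ l) (roots l).length \
        emitted (parts σ l) dn' (roots l).length := by
      intro z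
      rw [hF]
      simp only [Finset.mem_sdiff, Finset.mem_insert]
      by_cases hz : z = x
      · subst hz
        simp [hxU, hxF]
      · simp [hz]
    have hk' : (unionUpTo (parts σ l) (roots l).length \
        emitted (parts σ l) dn' (roots l).length).card = k := by
      have : unionUpTo (parts σ l) (roots l).length \ emitted (parts σ l) dn (roots l).length =
          insert x (unionUpTo (parts σ l) (roots l).length \
            emitted (parts σ l) dn' (roots l).length) := by
        ext z
        rw [hset, Finset.mem_insert]
      rw [this, Finset.card_insert_of_notMem (by simp [hF])] at hk
      omega
    obtain ⟨tr3, st3, b3, dn3, e3, hb3, hw3, hs3, ⟨xs, ho3, hn3, hm3⟩, hdl3⟩ := ih hb2 hw2 hr2 hk'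
    have hout : ((List.range Q.j).map fun i => Operand.reg (Var.idx (d := Q.d) (.loc (20 + i)))).map
        (Operand.val c.w st1) = outOf c.B Q.j x := by
      rw [List.map_map]
      refine List.map_congr_left fun i hi => ?_
      exact (hb1.1 _).1.trans (hd1 i (List.mem_range.1 hi))
    have hemit := Exec.emit (w := c.w) st1
      ((List.range Q.j).map fun i => Operand.reg (Var.idx (d := Q.d) (.loc (20 + i))))
    rw [hout] at hemit
    refine ⟨_, st3, b3, dn3, Exec.loop_step (fun hh => h0 ((hb.1 (.loc 4)).1.symm.trans hh))
      (Exec.seq e1 (Exec.seq hemit e2)) e3, hb3, hw3, ?_, ⟨x :: xs, ?_, ?_, ?_⟩, ?_⟩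
    · intro e he
      simp only [List.mem_cons, List.mem_append, List.not_mem_nil, or_false] at he
      rcases he with rfl | (he | rfl | he) | he
      · exact hsp hb hw
      · exact (hq1 e he).2
      · exact hsp hb1 hw1
      · exact (hq2 e he).2
      · exact hs3 e he
    · have e1 := outputs_quiet hq1
      have e2 := outputs_quiet hq2
      simp only [outputs] at e1 e2 ho3
      simp [outputs, State.silent, List.filterMap_append, e1, e2, ho3]
    · exact List.nodup_cons.2 ⟨fun hh => by simpa [hF] using (hm3 x).1 hh, hn3⟩
    · intro z
      rw [List.mem_cons, hm3, hset]
    -- The trace is cut at the output. To the left are the preceding round, one test and the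
    -- computation of the digits; to the right the induction hypothesis applies with the new round
    -- as prefix.
    · intro pre post h1 h2
      have := DelayAtMost.append_cons (e := ⟨some (outOf c.B Q.j x), st1.space⟩)
        (t := pre ++ st.silent :: tr1) (DelayAtMost.of_length (D := roundTime Q (roots l).length + 1 +
          tm (digits Q) + T) (by simp; omega)) (hdl3 tr2 post hl2 h2) (by simp)
      simpa using this

theorem exec_onEnumerate (h : Tour c σ l) (hb : At c st b) (hl : b.l = l) (hn : b.n + 5 ≤ c.S)
    (hit : ∀ x, b.it x = 0) : ∃ tr st' b', Exec c.w (onEnumerate Q) st tr st' ∧ At c st' b' ∧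
      b'.l = l ∧ b'.ρ (.loc 0) = b.ρ (.loc 0) ∧ (∀ x, b'.it x = 0) ∧ (∀ e ∈ tr, e.space ≤ c.S) ∧
      (∃ xs : List ℕ, outputs tr = xs.map (outOf c.B Q.j) ∧ xs.Nodup ∧ ∀ x, x ∈ xs ↔
        ∃ y ∈ σ.reg, σ.Alive y ∧ σ.outPart y = x) ∧
      DelayAtMost (roundTime Q (roots l).length + 1 + tm (digits Q) +
        cleanupTime Q (roots l).length) tr := by
  have hw : Walk c σ l (b.ρ (.loc 0)) (fun _ => []) b := by
    refine ⟨hl, rfl, hn, fun x hx => absurd (hit x) hx, fun r hr hbr => ⟨parts σ l r, rfl, ?_⟩⟩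
    rw [hit, hit, parts, List.getD_eq_getElem _ _ hr, if_pos ⟨hr, hbr⟩]
    exact Cursor.start h.toLists.walks_ne_nil
  obtain ⟨tr1, st1, b1, e1, hb1, ⟨dn1, hw1, hr1⟩, hl1, hq1⟩ :=
    (run_round h hw fun r => stageOk_nil r).exec hb
  obtain ⟨tr2, st2, b2, dn2, e2, hb2, hw2, hs2, ⟨xs, ho2, hn2, hm2⟩, hdl2⟩ :=
    exec_produce h (T := cleanupTime Q (roots l).length) hb1 hw1 hr1
  obtain ⟨tr3, st3, b3, e3, hb3, ⟨k1, k2, k3⟩, hl3, hq3⟩ := (run_cleanup h hw2).exec hb2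
  refine ⟨_, st3, b3, Exec.seq e1 (Exec.seq e2 e3), hb3, k1, k2, k3, ?_, ⟨xs, ?_, hn2, ?_⟩,
    hdl2 tr1 tr3 hl1 hl3⟩
  · intro e he
    rcases List.mem_append.1 he with he | he
    · exact (hq1 e he).2
    rcases List.mem_append.1 he with he | he
    exacts [hs2 e he, (hq3 e he).2]
  · have e1 := outputs_quiet hq1
    have e3 := outputs_quiet hq3
    simp only [outputs] at e1 e3 ho2
    simp [outputs, List.filterMap_append, e1, e3, ho2]
  · intro x
    rw [hm2, emitted_nil, Finset.sdiff_empty, h.toLists.mem_union]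

end StarMaintenance

/-! ### The enumeration of the result of a database. -/

namespace StarMaintenance

open WordRAM Classical StarQuery

variable {Q : StarQuery} {D : Q.Database} {s : ℕ} {c : Cfg Q.d} {st : State}

theorem alive_semOf (hD : Small c.B D) {t : Fin Q.d → ℕ} (ht : t ∈ D.center) :
    (semOf c.B s D).Alive (codeOf c.B t) ↔ ∀ i : Fin Q.k, t (i.castLE Q.k_le) ∈ D.satellite i := by
  have hk := Q.k_le
  refine ⟨fun h i => ?_, fun h i hi => ?_⟩
  · have := h i i.isLt
    simp only [semOf, dif_pos i.isLt] at this
    rwa [dig_codeOf (hD.center t ht) (i.isLt.trans_le hk)] at this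
  · simp only [semOf, dif_pos hi]
    rw [dig_codeOf (hD.center t ht) (hi.trans_le hk)]
    exact h ⟨i, hi⟩

theorem outOf_semOf (hD : Small c.B D) {t : Fin Q.d → ℕ} (ht : t ∈ D.center) :
    outOf c.B Q.j ((semOf c.B s D).outPart (codeOf c.B t)) =
      List.ofFn fun a : Fin Q.j => t ⟨Q.d - Q.j + a, by have := Q.j_le; have := a.isLt; omega⟩ := by
  have hj := Q.j_le
  refine List.ext_getElem (by simp [outOf]) fun i h1 h2 => ?_
  have hi : i < Q.j := by simpa [outOf] using h1
  simp only [outOf, List.getElem_map, List.getElem_range, List.getElem_ofFn]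
  have := Sem.dig_outPart (σ := semOf c.B s D) (ok_codeOf (hD.center t ht)) hi
  rw [show (semOf c.B s D).B = c.B from rfl] at this
  rw [this, Nat.add_sub_cancel, dig_codeOf (hD.center t ht) (by unfold StarQuery.e; omega)]

theorem outOf_injOn {B j x y : ℕ} (hx : x < B ^ j) (hy : y < B ^ j)
    (hx1 : ∀ i < j, 1 ≤ dig B i x) (hy1 : ∀ i < j, 1 ≤ dig B i y)
    (h : outOf B j x = outOf B j y) : x = y := by
  refine eq_of_dig_eq hx hy fun i hi => ?_
  have := List.map_inj_left.1 h i (List.mem_range.2 hi)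
  have := hx1 i hi
  have := hy1 i hi
  omega

/-- The limit for the space of an enumeration for a database with `n` tuples. -/
def tourLimit (Q : StarQuery) (n : ℕ) : ℕ := room Q n + 2 * n + 5 * (Q.k + 6)

/-- The factor in the delay of an enumeration. -/
def delayCost (Q : StarQuery) : ℕ := tm (asg (d := Q.d) (.loc 4) (.const 0)) +
  sweepTime Q (stage Q) + 1 + tm (digits Q) + sweepTime Q (.seq (store (itAddr Q 0) (.const 0))
    (store (itAddr Q 1) (.const 0)))

theorem time_le (n : ℕ) : roundTime Q n + 1 + tm (digits Q) + cleanupTime Q n ≤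
    (n + 1) * delayCost Q := by
  unfold roundTime cleanupTime delayCost
  have h1 := Nat.le_mul_of_pos_left (tm (asg (d := Q.d) (.loc 4) (.const 0)) + 1 + tm (digits Q))
    (show 0 < n + 1 by omega)
  have h2 : (n + 1) * (tm (asg (d := Q.d) (.loc 4) (.const 0)) + sweepTime Q (stage Q) + 1 +
      tm (digits Q) + sweepTime Q (.seq (store (itAddr Q 0) (.const 0))
      (store (itAddr Q 1) (.const 0)))) = (n + 1) * (tm (asg (d := Q.d) (.loc 4) (.const 0)) + 1 +
      tm (digits Q)) + (n + 1) * sweepTime Q (stage Q) + (n + 1) * sweepTime Q (.seq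
      (store (itAddr Q 0) (.const 0)) (store (itAddr Q 1) (.const 0))) := by ring
  rw [h2]
  omega

theorem Stores.enumerate (h : Stores c D s st) (hbal : Balanced D s) (hD : Small c.B D)
    (hsB : 4 * theta s ≤ c.B) :
    ∃ tr st', Exec c.w (onEnumerate Q) st tr st' ∧ Stores c D s st' ∧ (outputs tr).Nodup ∧
      (∀ x, x ∈ outputs tr ↔ ∃ o ∈ D.result, x = List.ofFn o) ∧
      DelayAtMost (2 * 40 ^ Q.e * delayCost Q * max 1 D.hIndex ^ Q.e) tr ∧
      ∀ e ∈ tr, e.space ≤ tourLimit Q D.size := by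
  set σ := semOf c.B s D with hσ
  let c' := c.withS (tourLimit Q D.size)
  let E : Env Q := ⟨c', D.center.image (codeOf c.B), D.size,
    Finset.card_image_le.trans (Nat.le_add_right _ _), fun y hy => by
      obtain ⟨t, ht, rfl⟩ := Finset.mem_image.1 hy
      exact ok_codeOf (hD.center t ht), by
      simp only [c', Cfg.withS, tourLimit]
      omega⟩
  have hwE : σ.Within E := within_semOf (Finset.Subset.refl _) le_rfl
  have hwf : σ.Wf c' := wf_semOf (c := c') hD (show theta s ≤ c.B by omega) c.B_pos
  have hwt : 3 * σ.weight ≤ room Q D.size := hwE.weight_le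
  obtain ⟨ρ, l, h1, h2, h3, h4, h5⟩ := h
  have hroots : ∀ z ∈ (roots l).toFinset, ∃ y ∈ σ.reg, σ.P y % σ.B ^ Q.e = z := by
    intro z hz
    obtain ⟨-, -, y, hy, -, -, rfl⟩ := (h5 _ _).1 (List.mem_toFinset.1 hz)
    exact ⟨y, hy, rfl⟩
  have hlen : (roots l).length = (roots l).toFinset.card :=
    (List.toFinset_card_of_nodup (h3 (0, 0, 0)).1).symm
  -- A tuple yields at most one bound part, so the auxiliary cells also stay linear in the database.
  have hlen1 : (roots l).length ≤ D.size := by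
    rw [hlen]
    refine le_trans (Finset.card_le_card fun z hz => ?_) ((Finset.card_image_le
      (s := σ.reg) (f := fun y => σ.P y % σ.B ^ Q.e)).trans
      (Finset.card_image_le.trans (Nat.le_add_right _ _)))
    obtain ⟨y, hy, rfl⟩ := hroots z hz
    exact Finset.mem_image_of_mem _ hy
  -- By balance, 1 + 4θ ≤ 1 + 32·max(1, h) ≤ 40·max(1, h), and the additional 1 is absorbed by
  -- doubling.
  have hlen2 : (roots l).length + 1 ≤ 2 * (40 ^ Q.e * max 1 D.hIndex ^ Q.e) := by
    have g1 : (roots l).length ≤ (1 + 4 * theta s) ^ Q.e := by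
      rw [hlen]
      exact Sem.card_roots_le hwf.reg (tau_pos Q.d s)
        ((card_lev_semOf_le hD).1 hbal.1) hroots
    have g2 : (1 + 4 * theta s) ^ Q.e ≤ 40 ^ Q.e * max 1 D.hIndex ^ Q.e := by
      rw [← mul_pow]
      refine Nat.pow_le_pow_left ?_ _
      have := hbal.theta_le
      have := theta_ge s
      omega
    have g3 : 1 ≤ (1 + 4 * theta s) ^ Q.e := Nat.one_le_pow _ _ (by omega)
    omega
  have hgood : Good c' ⟨ρ, l, fun _ => 0, st.mem.support.card⟩ st.mem :=
    ⟨h4, h3, fun _ => by positivity, le_rfl⟩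
  have htour : Tour c' σ l := by
    refine ⟨⟨hwf, h3, h5⟩, ?_⟩
    simp only [c', Cfg.withS, tourLimit]
    omega
  obtain ⟨tr, st', b', e1, ⟨e2, e3⟩, e4, e5, e6, e7, ⟨xs, e8, e9, e10⟩, e11⟩ := exec_onEnumerate
    htour (st := st) (b := ⟨ρ, l, fun _ => 0, 3 * σ.weight + 2 * (roots l).length⟩) ⟨h1, hgood.holds (htour.holds fun x hx => absurd rfl hx)⟩ rfl htour.space
    fun _ => rfl
  have hB : c'.B = c.B := rfl
  have hout : ∀ x ∈ xs, x < c.B ^ Q.j ∧ ∀ i < Q.j, 1 ≤ dig c.B i x := by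
    intro x hx
    obtain ⟨y, hy, -, rfl⟩ := (e10 x).1 hx
    refine ⟨Sem.outPart_lt (hwf.reg y hy), fun i hi => ?_⟩
    have := Sem.dig_outPart (hwf.reg y hy) hi
    change dig c.B i _ = _ at this
    omega
  refine ⟨tr, st', e1, ⟨b'.ρ, l, e2, e5.trans h2, h3, fun x => ?_, h5⟩, ?_, fun x => ?_, ?_, e7⟩
  · rw [e3.mem, e4, funext e6]
    rfl
  · rw [e8]
    refine (List.nodup_map_iff_inj_on e9).2 fun x hx y hy hxy => ?_
    exact outOf_injOn (hout x hx).1 (hout y hy).1 (hout x hx).2 (hout y hy).2 hxy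
  · rw [e8, List.mem_map]
    constructor
    · rintro ⟨z, hz, rfl⟩
      obtain ⟨y, hy, hal, rfl⟩ := (e10 z).1 hz
      obtain ⟨t, ht, rfl⟩ := Finset.mem_image.1 hy
      exact ⟨_, ⟨t, ht, (alive_semOf hD ht).1 hal, fun _ => rfl⟩, outOf_semOf hD ht⟩
    · rintro ⟨o, ⟨t, ht, hal, ho⟩, rfl⟩
      refine ⟨σ.outPart (codeOf c.B t), (e10 _).2 ⟨_, Finset.mem_image_of_mem _ ht,
        (alive_semOf hD ht).2 hal, rfl⟩, (outOf_semOf hD ht).trans ?_⟩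
      rw [funext ho]
  · intro t ht hsil
    refine (e11 t ht hsil).trans ((time_le _).trans ((Nat.mul_le_mul_right _ hlen2).trans
      (le_of_eq ?_)))
    ring

end StarMaintenance

/-! ### Sequences of requests, and the choice of the constants. -/

namespace StarMaintenance

open WordRAM Classical StarQuery DynamicAlgorithm

variable {Q : StarQuery} {c : Cfg Q.d} {reqs : List Q.Request}

/-- The dynamic algorithm. -/
def algorithm (Q : StarQuery) : DynamicAlgorithm := ⟨onUpdate Q, onEnumerate Q⟩

theorem dbAfter_succ {i : ℕ} {r : Q.Request} (h : reqs[i]? = some r) :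
    dbAfter reqs (i + 1) = (dbAfter reqs i).serve r := by
  unfold dbAfter
  rw [List.take_add_one, h, List.foldl_append]
  rfl

theorem small_dbAfter {B : ℕ} (h : ∀ r ∈ reqs, ∀ v ∈ r.values, v + 1 < B) {i : ℕ}
    (hi : i ≤ reqs.length) : Small B (dbAfter reqs i) ∧ (dbAfter reqs i).center.card ≤ i := by
  induction i with
  | zero => exact ⟨⟨by simp [dbAfter, Database.empty], by simp [dbAfter, Database.empty]⟩,
      by simp [dbAfter, Database.empty]⟩
  | succ i ih =>
    obtain ⟨h1, h2⟩ := ih (by omega)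
    have hr : reqs[i]? = some reqs[i] := List.getElem?_eq_getElem (by omega)
    rw [dbAfter_succ hr]
    have hv := h _ (List.getElem_mem (show i < reqs.length by omega))
    generalize reqs[i] = r at hv
    match r with
    | .enumerate => exact ⟨h1, h2.trans (Nat.le_succ _)⟩
    | .update u =>
      refine ⟨h1.apply hv, ?_⟩
      match u with
      | .center true t => exact (Finset.card_insert_le _ _).trans (Nat.succ_le_succ h2)
      | .center false t => exact (Finset.card_erase_le).trans (h2.trans (Nat.le_succ _))
      | .satellite true j v => exact h2.trans (Nat.le_succ _)
      | .satellite false j v => exact h2.trans (Nat.le_succ _)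

/-- What is known about a request that leads from the scale and the machine state in `x` to those
in `y`, with the steps `tr`. -/
structure Served (c : Cfg Q.d) (D : Q.Database) (r : Q.Request) (x y : ℕ × State)
    (tr : List Event) : Prop where
  exec : Exec c.w ((algorithm Q).code r) (x.2.input c.w r.encode) tr y.2
  update : ∀ u, r = .update u → y.1 = nextScale (D.apply u) x.1 ∧
    UpdateTime (D.apply u) x.1 tr.length ∧ (∀ r, num (D.apply u) r ≤ num D r + 1) ∧
    (∀ r, num D r ≤ num (D.apply u) r + 1) ∧ Quiet (limit Q (D.apply u).size) tr
  enumerate : r = .enumerate → y.1 = x.1 ∧ (outputs tr).Nodup ∧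
    (∀ x, x ∈ outputs tr ↔ ∃ o ∈ D.result, x = List.ofFn o) ∧
    DelayAtMost (2 * 40 ^ Q.e * delayCost Q * max 1 D.hIndex ^ Q.e) tr ∧
    ∀ e ∈ tr, e.space ≤ tourLimit Q D.size

theorem exists_served (hd : 1 ≤ Q.d) {D : Q.Database} {r : Q.Request} {x : ℕ × State}
    (hs : Stores c D x.1 x.2) (hbal : Balanced D x.1) (hD : Small c.B D)
    (hr : ∀ v ∈ r.values, v + 1 < c.B) (hsB : 4 * theta x.1 ≤ c.B) :
    ∃ y tr, Stores c (D.serve r) y.1 y.2 ∧ Balanced (D.serve r) y.1 ∧ Served c D r x y tr := by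
  match r with
  | .update u =>
    obtain ⟨tr, st', h1, h2, h3, h4, h5, h6, h7⟩ := hs.update hd hbal hD hr hsB
    refine ⟨(_, st'), tr, h2, h3, h1, fun u' hu => ?_, fun h => by cases h⟩
    cases hu
    exact ⟨rfl, h4, h6, h7, h5⟩
  | .enumerate =>
    obtain ⟨tr, st', h1, h2, h3, h4, h5, h6⟩ := hs.enumerate hbal hD hsB
    refine ⟨(x.1, st'), tr, h2, hbal, ?_, fun u' hu => (by cases hu), fun _ => ⟨rfl, h3, h4, h5, h6⟩⟩
    have : x.2.input c.w (Request.enumerate : Q.Request).encode = x.2 := by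
      simp [State.input, Request.encode]
    rw [this]
    exact h1

/-- All requests can be served. -/
theorem exists_run (hd : 1 ≤ Q.d) (hreq : ∀ r ∈ reqs, ∀ v ∈ r.values, v + 1 < c.B)
    (hlen : 32 * (reqs.length + 1) ≤ c.B) :
    ∃ (x : ℕ → ℕ × State) (tr : ℕ → List Event), x 0 = (0, State.zero) ∧
      (∀ i ≤ reqs.length, Balanced (dbAfter reqs i) (x i).1) ∧
      ∀ i r, reqs[i]? = some r → Served c (dbAfter reqs i) r (x i) (x (i + 1)) (tr i) := by
  -- The property is void beyond the last request, so that the states can be chosen as an infinite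
  -- sequence.
  let P : ℕ → ℕ × State → Prop := fun i x => i ≤ reqs.length →
    Stores c (dbAfter reqs i) x.1 x.2 ∧ Balanced (dbAfter reqs i) x.1
  have hstep : ∀ i (x : {x // P i x}), ∃ (y : {y // P (i + 1) y}) (tr : List Event),
      ∀ r, reqs[i]? = some r → Served c (dbAfter reqs i) r x.1 y.1 tr := by
    rintro i ⟨x, hx⟩
    by_cases hi : i < reqs.length
    · have hr : reqs[i]? = some reqs[i] := List.getElem?_eq_getElem hi
      obtain ⟨h1, h2⟩ := hx hi.le
      obtain ⟨h3, h4⟩ := small_dbAfter hreq hi.le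
      -- Since θ ≤ 8·(|center| + 1), and the center has at most as many tuples as there are
      -- requests, `hlen` gives 4θ ≤ B; this is the origin of the factor 32.
      have h5 := h2.theta_le_card
      obtain ⟨y, tr, g1, g2, g3⟩ := exists_served hd h1 h2 h3
        (hreq _ (List.getElem_mem hi)) (by omega)
      rw [← dbAfter_succ hr] at g1 g2
      refine ⟨⟨y, fun _ => ⟨g1, g2⟩⟩, tr, fun r h => ?_⟩
      rw [hr] at h
      cases h
      exact g3
    · refine ⟨⟨x, fun h => by omega⟩, [], fun r h => ?_⟩
      rw [List.getElem?_eq_none (by omega)] at h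
      cases h
  choose f g hfg using hstep
  have h0 : P 0 (0, State.zero) := by
    refine fun _ => ⟨stores_zero c, ?_, Or.inl rfl⟩
    exact (num_le_card _ _).trans (by simp [dbAfter, Database.empty])
  let xs : ∀ i, {x // P i x} := fun i => Nat.rec ⟨_, h0⟩ (fun i x => f i x) i
  exact ⟨fun i => (xs i).1, fun i => g i (xs i), rfl, fun i hi => ((xs i).2 hi).2,
    fun i r hr => hfg i (xs i) r hr⟩

/-- The factor in the amortized update time. -/
def amortizedCost (Q : StarQuery) : ℕ :=
  (2 ^ (Q.d - 1) * updateCost Q + 8 * (6 * 2 ^ (Q.d - 1) * sweepsCost Q)) * 8 ^ (Q.d - 1)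

/-- The factor in the space. -/
def spaceCost (Q : StarQuery) : ℕ := 3 * (2 * Q.d + Q.k + 5) + 5 * (Q.k + 6) + 2

theorem limit_le (n : ℕ) : limit Q n ≤ spaceCost Q * (n + 1) := by
  unfold limit room spaceCost
  nlinarith [Nat.zero_le (5 * (Q.k + 6) * n)]

theorem tourLimit_le (n : ℕ) : tourLimit Q n ≤ spaceCost Q * (n + 1) := by
  unfold tourLimit room spaceCost
  nlinarith [Nat.zero_le (5 * (Q.k + 6) * n)]

/-- The inequality of `Balanced.amortized` telescopes. The potential is zero for the empty database,
and enumerations change neither the database nor the scale. -/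
theorem sum_updates_le {x : ℕ → ℕ × State} {tr : ℕ → List Event} (hx : x 0 = (0, State.zero))
    (hbal : ∀ i ≤ reqs.length, Balanced (dbAfter reqs i) (x i).1)
    (h : ∀ i r, reqs[i]? = some r → Served c (dbAfter reqs i) r (x i) (x (i + 1)) (tr i))
    {n : ℕ} (hn : n ≤ reqs.length) : ∑ i ∈ updatesAmong reqs n, (tr i).length +
      4 * (6 * 2 ^ (Q.d - 1) * sweepsCost Q) * potential (dbAfter reqs n) (x n).1 ≤
      amortizedCost Q * ∑ i ∈ updatesAmong reqs n,
        max 1 (dbAfter reqs (i + 1)).hIndex ^ (Q.d - 1) := by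
  unfold updatesAmong
  simp only [Finset.sum_filter]
  induction n with
  | zero =>
    have h1 : num (dbAfter reqs 0) 0 = 0 :=
      Nat.le_zero.1 ((num_le_card _ _).trans (by simp [dbAfter, Database.empty]))
    simp [hx, potential, h1]
  | succ n ih =>
    have ih := ih (by omega)
    have hr : reqs[n]? = some reqs[n] := List.getElem?_eq_getElem (by omega)
    have hs := h n _ hr
    have hD := dbAfter_succ hr
    rw [Finset.sum_range_succ, Finset.sum_range_succ]
    generalize reqs[n] = r at hr hs hD
    match r with
    | .update u =>
      have hu : ∃ u, reqs[n]? = some (Request.update u) := ⟨u, hr⟩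
      rw [if_pos hu, if_pos hu]
      obtain ⟨h1, h2, h3, h4, -⟩ := hs.update u rfl
      change dbAfter reqs (n + 1) = (dbAfter reqs n).apply u at hD
      have hb' := hbal (n + 1) hn
      have ht := hb'.tau_le
      rw [← hD] at h1 h2 h3 h4
      have ham := (hbal n (by omega)).amortized h3 h4 (updateCost Q)
        (6 * 2 ^ (Q.d - 1) * sweepsCost Q)
      rw [← h1] at ham
      unfold UpdateTime at h2
      rw [← h1] at h2
      have ht2 := Nat.mul_le_mul_left (2 ^ (Q.d - 1) * updateCost Q +
        8 * (6 * 2 ^ (Q.d - 1) * sweepsCost Q)) ht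
      rw [← mul_assoc (_ + _) (8 ^ _)] at ht2
      change _ ≤ amortizedCost Q * _ at ht2
      rw [mul_add]
      omega
    | .enumerate =>
      have hu : ¬ ∃ u, reqs[n]? = some (Request.update u) := by
        rintro ⟨u, hu⟩
        rw [hr] at hu
        cases hu
      change dbAfter reqs (n + 1) = dbAfter reqs n at hD
      rw [if_neg hu, if_neg hu, hD, (hs.enumerate rfl).1]
      exact ih

/-- The word length leaves at least `64 * (Q.d + 4) * Nat.clog 2 N` bits per digit, more than the `7
* Nat.clog 2 N` that make the base at least `N ^ 7`, which exceeds `32 * (N + 1)` for `2 ≤ N`. -/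
theorem exists_cfg {N w : ℕ} (hN : 2 ≤ N)
    (hw : (4 * Q.d + 16) * (64 * (Q.d + 4)) * Nat.clog 2 N ≤ w) :
    ∃ c : Cfg Q.d, c.w = w ∧ 32 * (N + 1) ≤ c.B := by
  have hc : 1 ≤ Nat.clog 2 N := Nat.clog_pos (by norm_num) hN
  have hb : 64 * (Q.d + 4) * Nat.clog 2 N ≤ w / (4 * Q.d + 16) := by
    rw [Nat.le_div_iff_mul_le (by omega)]
    refine le_trans (le_of_eq ?_) hw
    ring
  refine ⟨⟨w, w / (4 * Q.d + 16), 0, rfl, (Nat.le_mul_of_pos_right _ hc).trans hb⟩, rfl, ?_⟩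
  have h1 : 32 * (N + 1) ≤ N ^ 7 := by
    have h2 : 32 ≤ N ^ 5 := (show 32 = 2 ^ 5 by norm_num).le.trans (Nat.pow_le_pow_left hN 5)
    have h3 : N + 1 ≤ N ^ 2 := by nlinarith
    calc 32 * (N + 1) ≤ N ^ 5 * N ^ 2 := Nat.mul_le_mul h2 h3
      _ = N ^ 7 := (pow_add _ _ _).symm
  refine h1.trans ((Nat.pow_le_pow_left (Nat.le_pow_clog Nat.one_lt_two N) 7).trans ?_)
  rw [← pow_mul, Cfg.B]
  refine Nat.pow_le_pow_right (by norm_num) (le_trans ?_ hb)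
  rw [mul_comm]
  exact Nat.mul_le_mul_right _ (by omega)

end StarMaintenance

open StarMaintenance in
theorem theorem1p3 (Q : StarQuery) (hd : 1 ≤ Q.d) :
    ∃ (A : DynamicAlgorithm) (c C : ℕ),
      ∀ N w : ℕ, 2 ≤ N → c * Nat.clog 2 N ≤ w →
      ∀ reqs : List Q.Request, reqs.length ≤ N → (∀ r ∈ reqs, ∀ v ∈ r.values, v < N) →
      ∃ (σ : ℕ → WordRAM.State) (tr : ℕ → List WordRAM.Event),
        A.IsRun w reqs σ tr ∧
        -- amortized update time `O(h(D)^(d-1))`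
        (∀ n ≤ reqs.length,
          ∑ i ∈ DynamicAlgorithm.updatesAmong reqs n, (tr i).length ≤
            C * ∑ i ∈ DynamicAlgorithm.updatesAmong reqs n,
              max 1 (StarQuery.dbAfter reqs (i + 1)).hIndex ^ (Q.d - 1)) ∧
        -- each enumeration lists the result without repetition, with delay `O(h(D)^(d-j))`
        (∀ i, reqs[i]? = some StarQuery.Request.enumerate →
          (WordRAM.outputs (tr i)).Nodup ∧
          (∀ x : List ℕ, x ∈ WordRAM.outputs (tr i) ↔
            ∃ o ∈ (StarQuery.dbAfter reqs i).result, x = List.ofFn o) ∧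
          WordRAM.DelayAtMost
            (C * max 1 (StarQuery.dbAfter reqs i).hIndex ^ (Q.d - Q.j)) (tr i)) ∧
        -- linear space `O(|D|)`, at every moment
        (∀ i < reqs.length, ∀ e ∈ tr i,
          e.space ≤ C * ((StarQuery.dbAfter reqs (i + 1)).size + 1)) := by
  refine ⟨algorithm Q, (4 * Q.d + 16) * (64 * (Q.d + 4)),
    amortizedCost Q + 2 * 40 ^ Q.e * delayCost Q + spaceCost Q,
    fun N w hN hw reqs hlen hreq => ?_⟩
  obtain ⟨c, rfl, hB⟩ := exists_cfg hN hw
  obtain ⟨x, tr, h0, h1, h2⟩ := exists_run (c := c) hd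
    (fun r hr v hv => (by have := hreq r hr v hv; omega)) (by omega)
  refine ⟨fun i => (x i).2, tr, ⟨congrArg Prod.snd h0, fun i r hr => (h2 i r hr).exec⟩,
    fun n hn => ?_, fun i hi => ?_, fun i hi e he => ?_⟩
  · exact (Nat.le_add_right _ _).trans ((sum_updates_le h0 h1 h2 hn).trans
      (Nat.mul_le_mul_right _ (by omega)))
  · obtain ⟨-, g1, g2, g3, -⟩ := (h2 i _ hi).enumerate rfl
    exact ⟨g1, g2, fun l hl hs => (g3 l hl hs).trans (Nat.mul_le_mul_right _ (by omega))⟩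
  · have hr : reqs[i]? = some reqs[i] := List.getElem?_eq_getElem hi
    have hs := h2 i _ hr
    rw [StarMaintenance.dbAfter_succ hr]
    refine le_trans ?_ (Nat.mul_le_mul_right _ (show spaceCost Q ≤ _ by omega))
    generalize reqs[i] = r at hs
    match r with
    | .update u =>
      obtain ⟨-, -, -, -, g⟩ := hs.update u rfl
      exact (g e he).2.trans (limit_le _)
    | .enumerate =>
      obtain ⟨-, -, -, -, g⟩ := hs.enumerate rfl
      exact (g e he).trans (tourLimit_le _)
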